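/- **Setting.** Let $\Omega=(-1,1)$, and fix constants $\mu_f,\mu_g,\kappa_f>0$, $\gamma_f>1$ and the fluid pressure law $\mathrm p_f(s)=\kappa_f s^{\gamma_f}$. For $N\ge 1$ bubbles $B_k=(x_k^-,x_k^+)$, $x_k^\pm=c_k\pm R_k$, $k=1,\dots,N$, put $x_0^+=-1$, $x_{N+1}^-=1$, $\mathcal F_k=(x_k^+,x_{k+1}^-)$ for $k=0,\dots,N$ and $\mathcal F=\Omega\setminus\bigcup_k\overline{B_k}$. With constants $m_k,\kappa_k>0$ (bubble mass, and coefficient of the sum $\kappa_k/R_k$ of gas pressure and surface tension), the microscopic system on $(0,T)$ is $$\partial_t\rho_f+\partial_x(\rho_fu_f)=0,\quad \partial_t(\rho_fu_f)+\partial_x(\rho_fu_f^2)=\partial_x\Sigma_f,\quad \Sigma_f=\mu_f\partial_xu_f-\mathrm p_f(\rho_f)\quad\text{in }\mathcal F(t),$$ $$u_f(t,\pm1)=0,\qquad u_f(t,x_k^\pm)=\dot c_k\pm\dot R_k,$$ $$m_k\ddot c_k=\Sigma_f(x_k^+)-\Sigma_f(x_k^-),\quad \tfrac{m_k}{3}\ddot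 R_k=\Sigma_f(x_k^-)+\Sigma_f(x_k^+)-2\Sigma_k,\quad \Sigma_k=\mu_g\frac{\dot R_k}{R_k}-\frac{\kappa_k}{R_k}.$$ A classical solution on $(0,T)$ has $c_k,R_k\in H^2(0,T)$, $u_f\in H^1_tL^2_x\cap L^2_tH^2_x$ and $\rho_f\in H^1_{t,x}$, $\rho_f>0$, in the moving fluid domain, and on $[0,T]$ all $R_k$ and all $|\mathcal F_k|=x_{k+1}^--x_k^+$, $k=0,\dots,N$, are positive. The representatives used are $u_f\in C_tH^1_x$ and $\rho_f\in C_tL^2_x$. **Data.** Let $M_\infty,d_\infty,\underline\rho_\infty,\overline\rho_\infty>0$. The initial data are given by $(\rho_f^0,u_f^0)\in H^1(\Omega)\times H^1_0(\Omega)$ with $2\underline\rho_\infty\le\rho_f^0\le\overline\rho_\infty/2$ on $\Omega$ and by $(c_k^0,R_k^0)_{k}$ such that $$M_\infty\le Nm_k\le M_\infty^{-1},\quad M_\infty\le N\kappa_k\le M_\infty^{-1},\quad 2d_\infty\le NR_k^0\le(2d_\infty)^{-1}\quad(1\le k\le N),$$ $$2d_\infty\le N|\mathcal F_k^0|\le(2d_\infty)^{-1}\quad(0\le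 k\le N),$$ and at $t=0$: $c_k=c_k^0$, $R_k=R_k^0$, $(\rho_f,u_f)=(\rho_f^0,u_f^0)$ on $\mathcal F^0$, $\dot c_k=\frac12(u_f^0(c_k^0+R_k^0)+u_f^0(c_k^0-R_k^0))$, $\dot R_k=\frac12(u_f^0(c_k^0+R_k^0)-u_f^0(c_k^0-R_k^0))$. **Extended stresses.** $\tilde\Sigma_f=\Sigma_f$ in $\mathcal F$, and $\tilde\Sigma_f(x)=\frac{\Sigma_f(x_k^-)+\Sigma_f(x_k^+)}2-\frac{\Sigma_f(x_k^-)-\Sigma_f(x_k^+)}{2R_k}(x-c_k)$ in $B_k$. $\tilde\Sigma_g=\Sigma_k$ in $B_k$, $\tilde\Sigma_g=\Sigma_1$ in $\mathcal F_0$, $\tilde\Sigma_g=\Sigma_N$ in $\mathcal F_N$, and $\tilde\Sigma_g(x)=\Sigma_k+\frac{\Sigma_{k+1}-\Sigma_k}{x_{k+1}^--x_k^+}(x-x_k^+)$ in $\mathcal F_k$, $1\le k\le N-1$. **Bounds.** For $K>0$ consider the following bounds at time $t$: * (Q1) $d_\infty\le NR_k\le d_\infty^{-1}$, $k=1,\dots,N$;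 * (Q2) $d_\infty\le N|\mathcal F_k|\le d_\infty^{-1}$, $k=1,\dots,N$; * (Q3) $\underline\rho_\infty\le\rho_f\le\overline\rho_\infty$ a.e. on $\mathcal F(t)$; * (Q4) $\int_{\mathcal F}\mu_f\frac{|\partial_xu_f|^2}2\,dx+\mu_g\sum_{k=1}^N\frac{|\dot R_k|^2}{R_k}\le K$; * (Q5) $\int_0^t\big[\|\tilde\Sigma_f\|_{H^1(\Omega)}^2+\|\tilde\Sigma_g\|_{H^1(\Omega)}^2+\sum_{k=1}^Nm_k(|\ddot R_k|^2+|\ddot c_k|^2)\big]ds\le K$. **Proposition.** Given the physical constants $\mu_f,\mu_g,\kappa_f,\gamma_f$, given $M_\infty,d_\infty,\underline\rho_\infty,\overline\rho_\infty>0$ and $A,B\ge0$, there is $K_\infty>0$ such that for every $K>K_\infty$ there is $T_\infty[K]>0$ with the following property. For all $N$, all parameters $(m_k,\kappa_k)$ and all data as above with $\|u_f^0\|_{H^1(\Omega)}\le A$ and $\|\rho_f^0\|_{H^1(\Omega)}\le B$, every classical solution on $(0,T)$, $0<T\le T_\infty[K]$, with these data that satisfies (Q1)–(Q5) for all $t\in(0,T)$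 satisfies, for all $t\in[0,T]$, the versions of (Q1)–(Q5) with strict inequalities, (Q2) moreover for $k=0$. In (Q3) the strict version means that there is $\varepsilon>0$ with $\underline\rho_\infty+\varepsilon\le\rho_f\le\overline\rho_\infty-\varepsilon$ a.e. on $\mathcal F(t)$ for all $t\in[0,T]$. In particular $K_\infty$ and $T_\infty[K]$ do not depend on $N$. -/

import Mathlib

open Set Filter Topology MeasureTheory
open scoped ENNReal NNReal ContDiff

noncomputable section

namespace BubblyFlow

/-! ### Sobolev spaces -/

/-- `f` is the continuous representative of an element of `H¹(a,b)` and `g` is its weak derivative: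
`g ∈ L²(a,b)` and `f` is a primitive of `g` on `[a,b]`. -/
def HasH1Deriv (a b : ℝ) (f g : ℝ → ℝ) : Prop :=
  MemLp g 2 (volume.restrict (Ioo a b)) ∧ ∀ x ∈ Icc a b, f x = f a + ∫ y in a..x, g y

/-- `f ∈ H¹(a,b)` (continuous representative). -/
def MemH1 (a b : ℝ) (f : ℝ → ℝ) : Prop := ∃ g, HasH1Deriv a b f g

/-- The norm `(∫ |f|² + |f'|²)^{1/2}` of `H¹(a,b)`, with the value `∞` outside `H¹(a,b)`.
As weak derivatives are a.e. unique, the infimum is over a single value. -/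
def h1Norm (a b : ℝ) (f : ℝ → ℝ) : ℝ≥0∞ :=
  (⨅ (g : ℝ → ℝ) (_ : HasH1Deriv a b f g),
    ∫⁻ x in Ioo a b, ENNReal.ofReal (f x ^ 2 + g x ^ 2)) ^ (1 / 2 : ℝ)

/-- `g` is the weak derivative of `f` with respect to the first variable (time) on the open set
`Q ⊆ ℝ × ℝ`, tested against `C_c^∞(Q)`. -/
def HasWeakTimeDeriv (Q : Set (ℝ × ℝ)) (f g : ℝ × ℝ → ℝ) : Prop :=
  ∀ φ : ℝ × ℝ → ℝ, ContDiff ℝ ∞ φ → HasCompactSupport φ → tsupport φ ⊆ Q →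
    ∫ p in Q, f p * fderiv ℝ φ p (1, 0) = - ∫ p in Q, g p * φ p

/-! ### Physical parameters -/

/-- Fluid and gas viscosities, and the constants of the fluid pressure law. -/
structure Params where
  muF : ℝ
  muG : ℝ
  kapF : ℝ
  gamF : ℝ
  muF_pos : 0 < muF
  muG_pos : 0 < muG
  kapF_pos : 0 < kapF
  one_lt_gamF : 1 < gamF

/-- The fluid pressure law `p_f(s) = κ_f s^{γ_f}`. -/
def Params.pF (P : Params) (s : ℝ) : ℝ := P.kapF * s ^ P.gamF

/-! ### Geometry: `N` bubbles, indexed by `k = 1, …, N`, in `Ω = (-1,1)` -/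

/-- `x_k^+ = c_k + R_k`, with the convention `x_0^+ = -1`. -/
def xPlus (c R : ℕ → ℝ) (k : ℕ) : ℝ := if k = 0 then -1 else c k + R k

/-- `x_k^- = c_k - R_k`, with the convention `x_{N+1}^- = 1`. -/
def xMinus (N : ℕ) (c R : ℕ → ℝ) (k : ℕ) : ℝ := if k = N + 1 then 1 else c k - R k

/-- The length `x_{k+1}^- - x_k^+` of the fluid interval `F_k = (x_k^+, x_{k+1}^-)`,
`k = 0, …, N`. -/
def gap (N : ℕ) (c R : ℕ → ℝ) (k : ℕ) : ℝ := xMinus N c R (k + 1) - xPlus c R k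

/-- The fluid domain: `Ω` without the closed bubbles. -/
def fluidDomain (N : ℕ) (c R : ℕ → ℝ) : Set ℝ :=
  Ioo (-1) 1 \ ⋃ k ∈ Finset.Icc 1 N, Icc (c k - R k) (c k + R k)

/-! ### The unknowns -/

/-- The unknowns `(c_k, R_k)`, `(ρ, u)` of the microscopic system, together with the names of
their derivatives. That the latter are the derivatives of the former (which determines them
almost everywhere) is part of `IsClassicalSolution`. Bubbles are indexed by `k = 1, …, N`, the
values at other `k` are irrelevant. Fluid quantities are functions of `t` and `x`. -/
structure Flow where
  c : ℕ → ℝ → ℝ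
  dc : ℕ → ℝ → ℝ
  ddc : ℕ → ℝ → ℝ
  R : ℕ → ℝ → ℝ
  dR : ℕ → ℝ → ℝ
  ddR : ℕ → ℝ → ℝ
  rho : ℝ → ℝ → ℝ
  rho_t : ℝ → ℝ → ℝ
  rho_x : ℝ → ℝ → ℝ
  u : ℝ → ℝ → ℝ
  u_t : ℝ → ℝ → ℝ
  u_x : ℝ → ℝ → ℝ
  u_xx : ℝ → ℝ → ℝ

namespace Flow

/-- `x_k^+(t)`. -/
def xp (z : Flow) (k : ℕ) (t : ℝ) : ℝ := xPlus (fun j => z.c j t) (fun j => z.R j t) k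

/-- `x_k^-(t)`. -/
def xm (z : Flow) (N k : ℕ) (t : ℝ) : ℝ := xMinus N (fun j => z.c j t) (fun j => z.R j t) k

/-- `|F_k(t)|`. -/
def gap (z : Flow) (N k : ℕ) (t : ℝ) : ℝ :=
  BubblyFlow.gap N (fun j => z.c j t) (fun j => z.R j t) k

/-- The fluid domain `F(t)`. -/
def fluid (z : Flow) (N : ℕ) (t : ℝ) : Set ℝ :=
  fluidDomain N (fun j => z.c j t) (fun j => z.R j t)

/-- The space-time fluid domain `{(t,x) : 0 < t < T, x ∈ F(t)}`. -/
def tube (z : Flow) (N : ℕ) (T : ℝ) : Set (ℝ × ℝ) := {p | p.1 ∈ Ioo 0 T ∧ p.2 ∈ z.fluid N p.1}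

/-- The fluid stress `Σ_f = μ_f ∂_x u - p_f(ρ)`. -/
def sigF (z : Flow) (P : Params) (t x : ℝ) : ℝ := P.muF * z.u_x t x - P.pF (z.rho t x)

/-- The bubble stress `Σ_k = μ_g R_k' / R_k - π_k` with `π_k = κ_k / R_k`, the sum of the
gas pressure and of the surface tension. -/
def sigB (z : Flow) (P : Params) (κ : ℕ → ℝ) (k : ℕ) (t : ℝ) : ℝ :=
  P.muG * (z.dR k t / z.R k t) - κ k / z.R k t

/-- The extension of `Σ_f` to `Ω` that is affine in each bubble. -/
def sigFExt (z : Flow) (P : Params) (N : ℕ) (t x : ℝ) : ℝ :=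
  (⋃ k ∈ Finset.Icc 1 N, Ioo (z.xm N k t) (z.xp k t))ᶜ.indicator (z.sigF P t) x +
    ∑ k ∈ Finset.Icc 1 N, (Ioo (z.xm N k t) (z.xp k t)).indicator
      (fun y => (z.sigF P t (z.xm N k t) + z.sigF P t (z.xp k t)) / 2 -
        (z.sigF P t (z.xm N k t) - z.sigF P t (z.xp k t)) / (2 * z.R k t) * (y - z.c k t)) x

/-- The extension of the bubble stresses to `Ω`: `Σ_k` in the bubble `B_k`, affine in the fluid
intervals `F_1, …, F_{N-1}`, and constant (equal to `Σ_1`, respectively `Σ_N`) in the intervals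
`F_0` and `F_N` next to the boundary. -/
def sigGExt (z : Flow) (P : Params) (N : ℕ) (κ : ℕ → ℝ) (t x : ℝ) : ℝ :=
  ∑ k ∈ Finset.Icc 1 N,
      (Icc (z.xm N k t) (z.xp k t)).indicator (fun _ => z.sigB P κ k t) x +
    (Iio (z.xm N 1 t)).indicator (fun _ => z.sigB P κ 1 t) x +
    (Ioi (z.xp N t)).indicator (fun _ => z.sigB P κ N t) x +
    ∑ k ∈ Finset.Ico 1 N, (Ioo (z.xp k t) (z.xm N (k + 1) t)).indicator
      (fun y => z.sigB P κ k t +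
        (z.sigB P κ (k + 1) t - z.sigB P κ k t) / (z.xm N (k + 1) t - z.xp k t) *
          (y - z.xp k t)) x

end Flow

/-- Classical solutions on `(0,T)` of the microscopic system: `(c_k, R_k) ∈ H²(0,T)`,
`u ∈ H¹_t L²_x ∩ L²_t H²_x` and `ρ ∈ H¹_{t,x}` in the moving fluid domain, no overlap.

Representatives are the usual ones: `u` is continuous up to the boundary of each moving fluid
interval with `u(t) ∈ H¹(F_k(t))` for every `t` (the space `H¹_t L²_x ∩ L²_t H²_x` embeds into
`C_t H¹_x`), `ρ` is continuous in time with values in `L²` (`H¹_{t,x}` embeds into `C_t L²_x`),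
and for almost every `t` the functions `∂_x u(t)`, `ρ(t) ∈ H¹(F_k(t))` are continuous up to the
end points of `F_k(t)`, so that `Σ_f(t, x_k^±(t))` is the value of `Σ_f(t, ·)` there. -/
structure IsClassicalSolution (P : Params) (N : ℕ) (m κ : ℕ → ℝ) (T : ℝ) (z : Flow) :
    Prop where
  /-- Bubble motion in `H²(0,T)`. -/
  c_h1 : ∀ k ∈ Finset.Icc 1 N, HasH1Deriv 0 T (z.c k) (z.dc k)
  dc_h1 : ∀ k ∈ Finset.Icc 1 N, HasH1Deriv 0 T (z.dc k) (z.ddc k)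
  R_h1 : ∀ k ∈ Finset.Icc 1 N, HasH1Deriv 0 T (z.R k) (z.dR k)
  dR_h1 : ∀ k ∈ Finset.Icc 1 N, HasH1Deriv 0 T (z.dR k) (z.ddR k)
  /-- Nondegenerate bubbles that overlap neither each other nor the boundary. -/
  R_pos : ∀ k ∈ Finset.Icc 1 N, ∀ t ∈ Icc 0 T, 0 < z.R k t
  gap_pos : ∀ k ≤ N, ∀ t ∈ Icc 0 T, 0 < z.gap N k t
  /-- Regularity of the velocity. -/
  u_cont : ∀ k ≤ N, ContinuousOn (fun p : ℝ × ℝ => z.u p.1 p.2)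
    {p | p.1 ∈ Icc 0 T ∧ p.2 ∈ Icc (z.xp k p.1) (z.xm N (k + 1) p.1)}
  u_h1 : ∀ k ≤ N, ∀ t ∈ Icc 0 T,
    HasH1Deriv (z.xp k t) (z.xm N (k + 1) t) (z.u t) (z.u_x t)
  u_x_h1 : ∀ k ≤ N, ∀ᵐ t ∂(volume.restrict (Ioo 0 T)),
    HasH1Deriv (z.xp k t) (z.xm N (k + 1) t) (z.u_x t) (z.u_xx t)
  u_weak : HasWeakTimeDeriv (z.tube N T) (fun p => z.u p.1 p.2) (fun p => z.u_t p.1 p.2)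
  u_t_L2 : MemLp (fun p : ℝ × ℝ => z.u_t p.1 p.2) 2 (volume.restrict (z.tube N T))
  u_x_L2 : MemLp (fun p : ℝ × ℝ => z.u_x p.1 p.2) 2 (volume.restrict (z.tube N T))
  u_xx_L2 : MemLp (fun p : ℝ × ℝ => z.u_xx p.1 p.2) 2 (volume.restrict (z.tube N T))
  /-- Regularity and positivity of the density. -/
  rho_h1 : ∀ k ≤ N, ∀ᵐ t ∂(volume.restrict (Ioo 0 T)),
    HasH1Deriv (z.xp k t) (z.xm N (k + 1) t) (z.rho t) (z.rho_x t)
  rho_weak : HasWeakTimeDeriv (z.tube N T) (fun p => z.rho p.1 p.2) (fun p => z.rho_t p.1 p.2)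
  rho_L2 : MemLp (fun p : ℝ × ℝ => z.rho p.1 p.2) 2 (volume.restrict (z.tube N T))
  rho_t_L2 : MemLp (fun p : ℝ × ℝ => z.rho_t p.1 p.2) 2 (volume.restrict (z.tube N T))
  rho_x_L2 : MemLp (fun p : ℝ × ℝ => z.rho_x p.1 p.2) 2 (volume.restrict (z.tube N T))
  rho_slice_L2 : ∀ t ∈ Icc 0 T, MemLp (z.rho t) 2 (volume.restrict (z.fluid N t))
  rho_cont : ∀ s ∈ Icc 0 T,
    Tendsto (fun t => eLpNorm (fun x => z.rho t x - z.rho s x) 2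
      (volume.restrict (z.fluid N t ∩ z.fluid N s))) (𝓝[Icc 0 T] s) (𝓝 0)
  rho_pos : ∀ᵐ p ∂(volume.restrict (z.tube N T)), 0 < z.rho p.1 p.2
  /-- `∂_t ρ + ∂_x (ρ u) = 0` in the fluid. -/
  mass : ∀ᵐ p ∂(volume.restrict (z.tube N T)),
    z.rho_t p.1 p.2 + (z.rho_x p.1 p.2 * z.u p.1 p.2 + z.rho p.1 p.2 * z.u_x p.1 p.2) = 0
  /-- `∂_t (ρ u) + ∂_x (ρ u²) = ∂_x Σ_f` in the fluid, the derivatives being expanded. -/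
  momentum : ∀ᵐ p ∂(volume.restrict (z.tube N T)),
    (z.rho_t p.1 p.2 * z.u p.1 p.2 + z.rho p.1 p.2 * z.u_t p.1 p.2) +
      (z.rho_x p.1 p.2 * z.u p.1 p.2 ^ 2 +
        2 * z.rho p.1 p.2 * z.u p.1 p.2 * z.u_x p.1 p.2) =
    P.muF * z.u_xx p.1 p.2 - deriv P.pF (z.rho p.1 p.2) * z.rho_x p.1 p.2
  /-- No slip at the boundary of `Ω`. -/
  no_slip_left : ∀ t ∈ Icc 0 T, z.u t (-1) = 0
  no_slip_right : ∀ t ∈ Icc 0 T, z.u t 1 = 0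
  /-- Continuity of the velocity at the interfaces. -/
  u_plus : ∀ k ∈ Finset.Icc 1 N, ∀ t ∈ Icc 0 T, z.u t (z.xp k t) = z.dc k t + z.dR k t
  u_minus : ∀ k ∈ Finset.Icc 1 N, ∀ t ∈ Icc 0 T, z.u t (z.xm N k t) = z.dc k t - z.dR k t
  /-- Dynamics of the bubbles. -/
  newton_c : ∀ k ∈ Finset.Icc 1 N, ∀ᵐ t ∂(volume.restrict (Ioo 0 T)),
    m k * z.ddc k t = z.sigF P t (z.xp k t) - z.sigF P t (z.xm N k t)
  newton_R : ∀ k ∈ Finset.Icc 1 N, ∀ᵐ t ∂(volume.restrict (Ioo 0 T)),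
    m k / 3 * z.ddR k t =
      z.sigF P t (z.xm N k t) + z.sigF P t (z.xp k t) - 2 * z.sigB P κ k t

/-! ### Initial data -/

/-- Initial data and bubble parameters in the scaling regime: the global fluid data
`(ρ⁰, u⁰) ∈ H¹(Ω) × H¹_0(Ω)` with `2 ρlo ≤ ρ⁰ ≤ ρhi / 2`, the initial centers and radii, and the
parameters `(m_k, κ_k)`. -/
structure IsAdmissibleData (M d ρlo ρhi : ℝ) (N : ℕ) (m κ c0 R0 : ℕ → ℝ) (ρ0 u0 : ℝ → ℝ) :
    Prop where
  m_scaling : ∀ k ∈ Finset.Icc 1 N, M ≤ N * m k ∧ N * m k ≤ M⁻¹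
  kappa_scaling : ∀ k ∈ Finset.Icc 1 N, M ≤ N * κ k ∧ N * κ k ≤ M⁻¹
  R_scaling : ∀ k ∈ Finset.Icc 1 N, 2 * d ≤ N * R0 k ∧ N * R0 k ≤ (2 * d)⁻¹
  gap_scaling : ∀ k ≤ N, 2 * d ≤ N * gap N c0 R0 k ∧ N * gap N c0 R0 k ≤ (2 * d)⁻¹
  rho_h1 : MemH1 (-1) 1 ρ0
  u_h1 : MemH1 (-1) 1 u0
  u_left : u0 (-1) = 0
  u_right : u0 1 = 0
  rho_bound : ∀ x ∈ Icc (-1 : ℝ) 1, 2 * ρlo ≤ ρ0 x ∧ ρ0 x ≤ ρhi / 2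

/-- The flow `z` starts from the fluid data restricted to the initial fluid domain, the given
centers and radii, and bubble velocities that match `u⁰` at the interfaces. -/
structure HasInitialData (N : ℕ) (c0 R0 : ℕ → ℝ) (ρ0 u0 : ℝ → ℝ) (z : Flow) : Prop where
  c_init : ∀ k ∈ Finset.Icc 1 N, z.c k 0 = c0 k
  R_init : ∀ k ∈ Finset.Icc 1 N, z.R k 0 = R0 k
  rho_init : ∀ x ∈ fluidDomain N c0 R0, z.rho 0 x = ρ0 x
  u_init : ∀ x ∈ fluidDomain N c0 R0, z.u 0 x = u0 x
  dc_init : ∀ k ∈ Finset.Icc 1 N, z.dc k 0 = (u0 (c0 k + R0 k) + u0 (c0 k - R0 k)) / 2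
  dR_init : ∀ k ∈ Finset.Icc 1 N, z.dR k 0 = (u0 (c0 k + R0 k) - u0 (c0 k - R0 k)) / 2

/-! ### The bounds -/

/-- `∫_{F(t)} μ_f |∂_x u|²/2 dx + μ_g ∑_k |R_k'|² / R_k`. -/
def h1Energy (P : Params) (N : ℕ) (z : Flow) (t : ℝ) : ℝ :=
  (∫ x in z.fluid N t, P.muF * (z.u_x t x ^ 2 / 2)) +
    P.muG * ∑ k ∈ Finset.Icc 1 N, z.dR k t ^ 2 / z.R k t

/-- The integral over `(0,t)` of the squared `H¹(Ω)` norms of the two extended stresses and of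
`∑_k m_k (|R_k''|² + |c_k''|²)`. -/
def stressIntegral (P : Params) (N : ℕ) (m κ : ℕ → ℝ) (z : Flow) (t : ℝ) : ℝ≥0∞ :=
  ∫⁻ s in Ioo 0 t, (h1Norm (-1) 1 (z.sigFExt P N s) ^ 2 +
    h1Norm (-1) 1 (z.sigGExt P N κ s) ^ 2 +
    ENNReal.ofReal (∑ k ∈ Finset.Icc 1 N, m k * (z.ddR k s ^ 2 + z.ddc k s ^ 2)))

/-- The large inequalities for the radii, the fluid gaps, the density, the `H¹` energy and the
time-integrated stresses, at all times `t ∈ S`. -/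
structure Bounds (P : Params) (N : ℕ) (m κ : ℕ → ℝ) (d ρlo ρhi K : ℝ) (S : Set ℝ) (z : Flow) :
    Prop where
  q1 : ∀ t ∈ S, ∀ k ∈ Finset.Icc 1 N, d ≤ N * z.R k t ∧ N * z.R k t ≤ d⁻¹
  q2 : ∀ t ∈ S, ∀ k ∈ Finset.Icc 1 N, d ≤ N * z.gap N k t ∧ N * z.gap N k t ≤ d⁻¹
  q3 : ∀ t ∈ S, ∀ᵐ x ∂(volume.restrict (z.fluid N t)), ρlo ≤ z.rho t x ∧ z.rho t x ≤ ρhi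
  q4 : ∀ t ∈ S, h1Energy P N z t ≤ K
  q5 : ∀ t ∈ S, stressIntegral P N m κ z t ≤ ENNReal.ofReal K

/-- The strict versions of these inequalities at all times `t ∈ S`. For the gaps the interval `F_0`
is included in addition. As the density is defined up to null sets, strictness in `q3` is that of
the essential bounds, uniformly in `t`; this is stronger than strict inequalities almost everywhere
and gives strict inequalities everywhere if the density is continuous. -/
structure StrictBounds (P : Params) (N : ℕ) (m κ : ℕ → ℝ) (d ρlo ρhi K : ℝ) (S : Set ℝ)
    (z : Flow) : Prop where
  q1 : ∀ t ∈ S, ∀ k ∈ Finset.Icc 1 N, d < N * z.R k t ∧ N * z.R k t < d⁻¹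
  q2 : ∀ t ∈ S, ∀ k ≤ N, d < N * z.gap N k t ∧ N * z.gap N k t < d⁻¹
  q3 : ∃ ε > 0, ∀ t ∈ S, ∀ᵐ x ∂(volume.restrict (z.fluid N t)),
    ρlo + ε ≤ z.rho t x ∧ z.rho t x ≤ ρhi - ε
  q4 : ∀ t ∈ S, h1Energy P N z t < K
  q5 : ∀ t ∈ S, stressIntegral P N m κ z t < ENNReal.ofReal K

end BubblyFlow

end

noncomputable section

namespace BubblyFlow

/-! ### One-dimensional Sobolev calculus -/

/-! The argument is a bootstrap in which a short time supplies the smallness. Let D(t) be the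
`dissipation`, the sum of ∫|∂ₓΣ_f|² over the gaps and of m_k(|R_k''|² + |c_k''|²) over the bubbles.
By (Q5) its integral over (0,T) is at most K.

Uniformity in N comes from a fixed-time estimate. By Newton's law the affine extension of Σ_f has
slope m_k c_k''/(2R_k) in B_k. Since m_k and R_k are both of order 1/N, the squared slope integrates
over B_k to at most a constant times m_k|c_k''|². So the derivative of the extension is bounded in
L²(Ω) by a multiple of D, with a constant depending only on M and d. The gaps have length at least
d/N, so together they fill a fixed part of Ω, and the L² norm of Σ_f in the fluid controls the
extension at one point. Hence Σ_f and all Σ_k are at most a constant times √(1 + E + D), where E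
bounds the squared L² norm of Σ_f (`StressProfile.sup_le`). Solving the constitutive laws for ∂ₓu
and R_k'/R_k bounds both by one rate w(t) (`BoundedFlow.rates_le`), and ∫w ≤ √T · C(K)
(`BoundedFlow.integral_rate_le`). Radii and gaps therefore change by a small relative amount. The
density changes little by a maximum principle for the mass equation (`nonpos_of_transport`). The
factor 2 left between the data and the bounds gives strict (Q1)–(Q3).

For (Q4) and (Q5) the momentum equation is tested with the acceleration. In a gap this gives the
growth of μ_f/2 ∫|∂ₓu|², the dissipation ∫|∂ₓΣ_f|²/ρ, the power of Σ_f at the two end points, and a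
pressure term that is integrated by parts in time (`GapFlow.gap_energy`). Summed over the gaps, the
boundary powers regroup by bubbles. There Newton's laws turn them into -m_k|c_k''|² -
(m_k/3)|R_k''|² - 2Σ_k R_k'', and the last product is an exact derivative of -μ_g R_k'²/R_k + 2κ_k
R_k'/R_k up to a remainder (`bubble_work_eq`). All remainders are at most (w + const) times the
energy. The energy is at most K by (Q4), so they contribute at most K(2∫w + const · T), which is at
most 1 for short T. What is left is a bound of energy and dissipation by a constant free of K
(`BoundedFlow.energy_le`). Taking K above a multiple of this constant gives strict (Q4) and (Q5).

The regularity allows neither a direct differentiation of the energy nor pointwise values in time.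
Each gap is mapped to (0,1), where the weak time derivatives become, by du Bois-Reymond, genuine
primitives in time for almost every point (`MovingInterval.exists_primitive`). The energy inequality
is proved for backward difference quotients, using convexity, and passes to the limit by continuity
of translations in L² (`VelRect.energy_le_final`). Results at almost every time reach every t in
[0,T] by lower semicontinuity of the energy and L² continuity of the density. -/

theorem absolutelyContinuousOnInterval_of_dist_le {f h : ℝ → ℝ} {a b C : ℝ}
    (hf : AbsolutelyContinuousOnInterval f a b)
    (hC : ∀ x ∈ uIcc a b, ∀ y ∈ uIcc a b, dist (h x) (h y) ≤ C * dist (f x) (f y)) :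
    AbsolutelyContinuousOnInterval h a b := by
  rw [absolutelyContinuousOnInterval_iff] at hf ⊢
  intro ε hε
  have hC' : 0 < |C| + 1 := by positivity
  obtain ⟨δ, hδ, H⟩ := hf (ε / (|C| + 1)) (by positivity)
  refine ⟨δ, hδ, fun E hE hs => ?_⟩
  have h1 := H E hE hs
  rw [lt_div_iff₀ hC'] at h1
  refine lt_of_le_of_lt ?_ h1
  rw [Finset.sum_mul]
  refine Finset.sum_le_sum fun i hi => ?_
  have hm := hE.1 i hi
  refine (hC _ hm.1 _ hm.2).trans ?_
  rw [mul_comm]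
  exact mul_le_mul_of_nonneg_left (by linarith [le_abs_self C]) dist_nonneg

theorem map_affine_restrict (a : ℝ) {r : ℝ} (hr : 0 < r) :
    Measure.map (fun y => a + r * y) (volume.restrict (Ioo 0 1)) =
      ENNReal.ofReal |r⁻¹| • volume.restrict (Ioo a (a + r)) := by
  have e : MeasurableEmbedding (fun y : ℝ => a + r * y) :=
    ((Homeomorph.mulLeft₀ r hr.ne').trans (Homeomorph.addLeft a)).measurableEmbedding
  have h2 : Measure.map (fun y => a + r * y) volume = ENNReal.ofReal |r⁻¹| • volume := by
    have : (fun y : ℝ => a + r * y) = (fun z => a + z) ∘ (fun y => r * y) := rfl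
    rw [this, ← Measure.map_map (measurable_const_add a) (measurable_const_mul r),
      Real.map_volume_mul_left hr.ne', Measure.map_smul]
    simp [MeasureTheory.map_add_left_eq_self]
  have h3 : Ioo (0 : ℝ) 1 = (fun y => a + r * y) ⁻¹' (Ioo a (a + r)) := by
    ext y
    simp only [mem_Ioo, mem_preimage, lt_add_iff_pos_right, add_lt_add_iff_left]
    constructor
    · rintro ⟨h1, h2⟩; exact ⟨by positivity, by nlinarith⟩
    · rintro ⟨h1, h2⟩; exact ⟨by exact pos_of_mul_pos_right h1 hr.le, by nlinarith⟩
  rw [h3, ← e.restrict_map, h2, Measure.restrict_smul]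

namespace HasH1Deriv

variable {a b c d : ℝ} {f g h k f' g' : ℝ → ℝ}

theorem intervalIntegrable (H : HasH1Deriv a b f g) (hab : a ≤ b) :
    IntervalIntegrable g volume a b :=
  (intervalIntegrable_iff_integrableOn_Ioo_of_le hab).2 (H.1.integrable one_le_two)

theorem intervalIntegrable_sub (H : HasH1Deriv a b f g) (hc : c ∈ Icc a b) (hd : d ∈ Icc a b) :
    IntervalIntegrable g volume c d :=
  (H.intervalIntegrable (hc.1.trans hc.2)).mono_set (by
    rw [uIcc_of_le (hc.1.trans hc.2)]
    exact uIcc_subset_Icc hc hd)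

theorem sub_eq (H : HasH1Deriv a b f g) (hc : c ∈ Icc a b) (hd : d ∈ Icc a b) :
    f d - f c = ∫ y in c..d, g y := by
  have ha : a ∈ Icc a b := ⟨le_rfl, hc.1.trans hc.2⟩
  rw [H.2 d hd, H.2 c hc, ← intervalIntegral.integral_interval_sub_left
    (H.intervalIntegrable_sub ha hd) (H.intervalIntegrable_sub ha hc)]
  ring

theorem mono (H : HasH1Deriv a b f g) (hc : c ∈ Icc a b) (hd : d ∈ Icc a b) :
    HasH1Deriv c d f g := by
  refine ⟨H.1.mono_measure (Measure.restrict_mono (Ioo_subset_Ioo hc.1 hd.2) le_rfl), ?_⟩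
  intro x hx
  have := H.sub_eq hc (d := x) ⟨hc.1.trans hx.1, hx.2.trans hd.2⟩
  linarith

theorem ac (H : HasH1Deriv a b f g) (hab : a ≤ b) : AbsolutelyContinuousOnInterval f a b := by
  refine absolutelyContinuousOnInterval_of_dist_le (C := 1)
    ((H.intervalIntegrable hab).absolutelyContinuousOnInterval_intervalIntegral
      (c := a) (by simp)) ?_
  intro x hx y hy
  rw [uIcc_of_le hab] at hx hy
  rw [H.2 x hx, H.2 y hy]
  simp

theorem continuousOn (H : HasH1Deriv a b f g) : ContinuousOn f (Icc a b) := by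
  rcases le_or_gt a b with hab | hab
  · have := (H.ac hab).continuousOn
    rwa [uIcc_of_le hab] at this
  · simp [hab]

theorem ae_hasDerivAt (H : HasH1Deriv a b f g) :
    ∀ᵐ x, x ∈ Ioo a b → HasDerivAt f (g x) x := by
  rcases le_or_gt a b with hab | hab
  · filter_upwards [(H.intervalIntegrable hab).ae_hasDerivAt_integral] with x hx hx'
    have h1 := (hx (by rw [uIcc_of_le hab]; exact Ioo_subset_Icc_self hx') a (by simp)).const_add
      (f a)
    refine h1.congr_of_eventuallyEq ?_
    filter_upwards [Ioo_mem_nhds hx'.1 hx'.2] with y hy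
    exact H.2 y (Ioo_subset_Icc_self hy)
  · exact Eventually.of_forall fun x hx => absurd (hx.1.trans hx.2) (not_lt.2 hab.le)

/-- The Lebesgue form of the fundamental theorem of calculus. It reduces the product rule, the chain
rule and the rule for inverses to absolute continuity and a pointwise derivative almost everywhere.
-/
theorem of_ac (hab : a ≤ b) (hf : AbsolutelyContinuousOnInterval f a b)
    (hg : MemLp g 2 (volume.restrict (Ioo a b)))
    (hd : ∀ᵐ x, x ∈ Ioo a b → HasDerivAt f (g x) x) : HasH1Deriv a b f g := by
  refine ⟨hg, fun x hx => ?_⟩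
  have h1 : AbsolutelyContinuousOnInterval f a x := hf.mono (by
    rw [uIcc_of_le hab, uIcc_of_le hx.1]
    exact Icc_subset_Icc_right hx.2)
  have h2 := h1.integral_deriv_eq_sub
  have h3 : ∫ y in a..x, g y = ∫ y in a..x, deriv f y := by
    refine intervalIntegral.integral_congr_ae ?_
    filter_upwards [hd, Measure.ae_ne volume x] with y hy hyx hy'
    rw [uIoc_of_le hx.1] at hy'
    exact ((hy ⟨hy'.1, (lt_of_le_of_ne hy'.2 hyx).trans_le hx.2⟩).deriv).symm
  rw [h3, h2]
  ring

theorem ae_eq (H : HasH1Deriv a b f g) (H' : HasH1Deriv a b f g') :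
    ∀ᵐ x ∂(volume.restrict (Ioo a b)), g x = g' x := by
  rw [ae_restrict_iff' measurableSet_Ioo]
  filter_upwards [H.ae_hasDerivAt, H'.ae_hasDerivAt] with x h1 h2 hx
  exact (h1 hx).unique (h2 hx)

theorem congr (H : HasH1Deriv a b f g) (hf : ∀ x ∈ Icc a b, f' x = f x)
    (hg : ∀ᵐ x ∂(volume.restrict (Ioo a b)), g' x = g x) : HasH1Deriv a b f' g' := by
  refine ⟨(memLp_congr_ae hg).2 H.1, fun x hx => ?_⟩
  have ha : a ∈ Icc a b := ⟨le_rfl, hx.1.trans hx.2⟩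
  rw [hf x hx, hf a ha, H.2 x hx]
  congr 1
  refine intervalIntegral.integral_congr_ae ?_
  rw [ae_restrict_iff' measurableSet_Ioo] at hg
  filter_upwards [hg, Measure.ae_ne volume x] with y hy hyx hy'
  rw [uIoc_of_le hx.1] at hy'
  exact (hy ⟨hy'.1, (lt_of_le_of_ne hy'.2 hyx).trans_le hx.2⟩).symm

theorem exists_bound (H : HasH1Deriv a b f g) : ∃ C, ∀ x ∈ Icc a b, |f x| ≤ C := by
  obtain ⟨C, hC⟩ := isCompact_Icc.exists_bound_of_continuousOn H.continuousOn
  exact ⟨C, fun x hx => by simpa using hC x hx⟩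

theorem _root_.BubblyFlow.memLp_mul_of_continuousOn {f g : ℝ → ℝ} {a b : ℝ}
    (hf : ContinuousOn f (Icc a b)) (hg : MemLp g 2 (volume.restrict (Ioo a b))) :
    MemLp (fun x => f x * g x) 2 (volume.restrict (Ioo a b)) := by
  obtain ⟨C, hC⟩ := isCompact_Icc.exists_bound_of_continuousOn hf
  refine MemLp.of_le_mul (c := C) hg ?_ ?_
  · exact ((hf.mono Ioo_subset_Icc_self).aestronglyMeasurable measurableSet_Ioo).mul
      hg.aestronglyMeasurable
  · rw [ae_restrict_iff' measurableSet_Ioo]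
    refine Eventually.of_forall fun x hx => ?_
    rw [norm_mul]
    exact mul_le_mul_of_nonneg_right (hC x (Ioo_subset_Icc_self hx)) (norm_nonneg _)

theorem mul (H : HasH1Deriv a b f f') (H' : HasH1Deriv a b h k) (hab : a ≤ b) :
    HasH1Deriv a b (fun x => f x * h x) (fun x => f' x * h x + f x * k x) := by
  refine of_ac hab ((H.ac hab).fun_mul (H'.ac hab)) ?_ ?_
  · refine MemLp.add ?_ (memLp_mul_of_continuousOn H.continuousOn H'.1)
    simpa [mul_comm] using memLp_mul_of_continuousOn H'.continuousOn H.1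
  · filter_upwards [H.ae_hasDerivAt, H'.ae_hasDerivAt] with x h1 h2 hx
    exact (h1 hx).mul (h2 hx)

theorem comp {φ : ℝ → ℝ} (hφ : ContDiff ℝ 1 φ) (H : HasH1Deriv a b f g) (hab : a ≤ b) :
    HasH1Deriv a b (fun x => φ (f x)) (fun x => deriv φ (f x) * g x) := by
  obtain ⟨C, hC⟩ := H.exists_bound
  -- Only a local Lipschitz bound is available for φ. It suffices because f is bounded on the
  -- compact interval.
  obtain ⟨K, hK⟩ := (hφ.contDiffOn (s := Icc (-C) C)).exists_lipschitzOnWith (by decide)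
    (convex_Icc _ _) isCompact_Icc
  have hm : ∀ x ∈ Icc a b, f x ∈ Icc (-C) C := fun x hx => abs_le.1 (hC x hx)
  refine of_ac hab (absolutelyContinuousOnInterval_of_dist_le (C := K) (H.ac hab) ?_) ?_ ?_
  · intro x hx y hy
    rw [uIcc_of_le hab] at hx hy
    exact hK.dist_le_mul _ (hm x hx) _ (hm y hy)
  · exact memLp_mul_of_continuousOn
      ((hφ.continuous_deriv le_rfl).comp_continuousOn H.continuousOn) H.1
  · filter_upwards [H.ae_hasDerivAt] with x h1 hx
    exact ((hφ.differentiable (by decide) (f x)).hasDerivAt).comp x (h1 hx)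

theorem const_mul (r : ℝ) (H : HasH1Deriv a b f g) :
    HasH1Deriv a b (fun x => r * f x) (fun x => r * g x) := by
  refine ⟨H.1.const_mul r, fun x hx => ?_⟩
  beta_reduce
  rw [H.2 x hx, intervalIntegral.integral_const_mul]
  ring

theorem add (H : HasH1Deriv a b f f') (H' : HasH1Deriv a b h k) :
    HasH1Deriv a b (fun x => f x + h x) (fun x => f' x + k x) := by
  refine ⟨H.1.add H'.1, fun x hx => ?_⟩
  have ha : a ∈ Icc a b := ⟨le_rfl, hx.1.trans hx.2⟩
  beta_reduce
  rw [H.2 x hx, H'.2 x hx, intervalIntegral.integral_add (H.intervalIntegrable_sub ha hx)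
    (H'.intervalIntegrable_sub ha hx)]
  ring

theorem sub (H : HasH1Deriv a b f f') (H' : HasH1Deriv a b h k) :
    HasH1Deriv a b (fun x => f x - h x) (fun x => f' x - k x) := by
  have := H.add (H'.const_mul (-1))
  refine this.congr (fun x _ => by ring) (Eventually.of_forall fun x => by ring)

theorem const (r : ℝ) : HasH1Deriv a b (fun _ => r) (fun _ => 0) := by
  refine ⟨MemLp.zero, fun x _ => by simp⟩

theorem linear (q x₀ : ℝ) : HasH1Deriv a b (fun x => q * (x - x₀)) (fun _ => q) := by
  refine ⟨memLp_const q, fun x _ => ?_⟩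
  simp only [intervalIntegral.integral_const, smul_eq_mul]
  ring

theorem integral_deriv_mul (H : HasH1Deriv a b f f') (H' : HasH1Deriv a b h k) (hab : a ≤ b) :
    ∫ x in a..b, f x * k x = f b * h b - f a * h a - ∫ x in a..b, f' x * h x := by
  have h1 := (H.mul H' hab).2 b ⟨hab, le_rfl⟩
  have i1 : IntervalIntegrable (fun x => f' x * h x) volume a b :=
    (H.intervalIntegrable hab).mul_continuousOn (by rw [uIcc_of_le hab]; exact H'.continuousOn)
  have i2 : IntervalIntegrable (fun x => f x * k x) volume a b :=
    (H'.intervalIntegrable hab).continuousOn_mul (by rw [uIcc_of_le hab]; exact H.continuousOn)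
  rw [intervalIntegral.integral_add i1 i2] at h1
  linarith

theorem sq_intervalIntegrable (H : HasH1Deriv a b f g) (hab : a ≤ b) :
    IntervalIntegrable (fun x => g x ^ 2) volume a b :=
  (intervalIntegrable_iff_integrableOn_Ioo_of_le hab).2 H.1.integrable_sq

theorem fun_sq_intervalIntegrable (H : HasH1Deriv a b f g) (hab : a ≤ b) :
    IntervalIntegrable (fun x => f x ^ 2) volume a b :=
  ContinuousOn.intervalIntegrable (by rw [uIcc_of_le hab]; exact H.continuousOn.pow 2)

theorem glue (H : HasH1Deriv a b f f') (H' : HasH1Deriv b c f g') (hab : a ≤ b) (hbc : b ≤ c) :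
    HasH1Deriv a c f (fun x => if x < b then f' x else g' x) := by
  have e1 : ∀ᵐ x ∂(volume.restrict (Ioo a b)), (if x < b then f' x else g' x) = f' x := by
    rw [ae_restrict_iff' measurableSet_Ioo]
    exact Eventually.of_forall fun x hx => if_pos hx.2
  have e2 : ∀ᵐ x ∂(volume.restrict (Ioo b c)), (if x < b then f' x else g' x) = g' x := by
    rw [ae_restrict_iff' measurableSet_Ioo]
    exact Eventually.of_forall fun x hx => if_neg (not_lt.2 hx.1.le)
  have H1 : HasH1Deriv a b f (fun x => if x < b then f' x else g' x) :=
    H.congr (fun _ _ => rfl) e1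
  have H2 : HasH1Deriv b c f (fun x => if x < b then f' x else g' x) :=
    H'.congr (fun _ _ => rfl) e2
  refine ⟨?_, fun x hx => ?_⟩
  · have h3 : MemLp (fun x => if x < b then f' x else g' x) 2
        (volume.restrict (Ioo a b) + volume.restrict (Ioo b c)) := by
      constructor
      · exact H1.1.1.add_measure H2.1.1
      · have := H1.1.2
        have := H2.1.2
        rw [eLpNorm_lt_top_iff_lintegral_rpow_enorm_lt_top (by simp) (by simp)] at *
        rw [lintegral_add_measure]
        exact ENNReal.add_lt_top.2 ⟨by assumption, by assumption⟩
    refine h3.mono_measure ?_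
    have hs : volume.restrict (Ioo a c) = volume.restrict (Ioo a b ∪ Ioo b c) := by
      refine Measure.restrict_congr_set ?_
      filter_upwards [Measure.ae_ne volume b] with x hx
      refine propext ⟨fun h => ?_, fun h => ?_⟩
      · rcases lt_or_gt_of_ne hx with h' | h'
        · exact Or.inl ⟨h.1, h'⟩
        · exact Or.inr ⟨h', h.2⟩
      · rcases h with h | h
        · exact ⟨h.1, h.2.trans_le hbc⟩
        · exact ⟨hab.trans_lt h.1, h.2⟩
    rw [hs]
    exact Measure.restrict_union_le _ _
  · rcases le_total x b with h | h
    · exact H1.2 x ⟨hx.1, h⟩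
    · have h4 := H1.2 b ⟨hab, le_rfl⟩
      have h5 := H2.2 x ⟨h, hx.2⟩
      rw [h5, h4, add_assoc, intervalIntegral.integral_add_adjacent_intervals
        (H1.intervalIntegrable hab) (H2.intervalIntegrable_sub ⟨le_rfl, hbc⟩ ⟨h, hx.2⟩)]

theorem comp_affine {r : ℝ} (hr : 0 < r) (H : HasH1Deriv a (a + r) f g) :
    HasH1Deriv 0 1 (fun y => f (a + r * y)) (fun y => r * g (a + r * y)) := by
  have hint : ∀ x, ∫ y in (0 : ℝ)..x, r * g (a + r * y) = ∫ z in a..(a + r * x), g z := by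
    intro x
    rw [intervalIntegral.integral_const_mul]
    have := intervalIntegral.integral_comp_add_mul (a := 0) (b := x) (c := r) g hr.ne' a
    rw [this]
    simp [hr.ne']
  refine ⟨?_, fun x hx => ?_⟩
  · have h1 := map_affine_restrict a hr
    have h2 : MemLp g 2 (Measure.map (fun y => a + r * y) (volume.restrict (Ioo 0 1))) := by
      rw [h1]
      exact H.1.smul_measure (by simp)
    exact ((memLp_map_measure_iff h2.aestronglyMeasurable (by fun_prop)).1 h2).const_mul r
  · rw [hint]
    have := H.sub_eq (c := a) (d := a + r * x) ⟨le_rfl, by linarith⟩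
      ⟨by nlinarith [hx.1], by nlinarith [hx.2]⟩
    simp only [mul_zero, add_zero]
    linarith

/-- The one-dimensional Sobolev embedding, by Cauchy–Schwarz. A bound `s` of the integral is carried
so that the estimate is monotone in it. -/
theorem abs_sub_le (H : HasH1Deriv a b f g) {s : ℝ} (hs : ∫ x in a..b, g x ^ 2 ≤ s)
    (hc : c ∈ Icc a b) (hd : d ∈ Icc a b) : |f d - f c| ≤ √((b - a) * s) := by
  have hab := hc.1.trans hc.2
  wlog hcd : c ≤ d generalizing c d
  · rw [abs_sub_comm]
    exact this hd hc (le_of_not_ge hcd)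
  rw [H.sub_eq hc hd]
  refine Real.abs_le_sqrt ?_
  have h1 : (∫ y in c..d, g y) ^ 2 ≤ (d - c) * ∫ y in c..d, g y ^ 2 := by
    have i1 := H.intervalIntegrable_sub hc hd
    have i2 := ((H.mono hc hd)).sq_intervalIntegrable hcd
    rcases hcd.eq_or_lt with rfl | hlt
    · simp
    -- The mean of g: Cauchy–Schwarz is read off from ∫ (g - m)² ≥ 0.
    set m := (d - c)⁻¹ * ∫ y in c..d, g y with hm
    have h0 : 0 ≤ ∫ y in c..d, (g y - m) ^ 2 :=
      intervalIntegral.integral_nonneg hcd fun _ _ => sq_nonneg _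
    have h2 : ∫ y in c..d, (g y - m) ^ 2 =
        (∫ y in c..d, g y ^ 2) - 2 * m * (∫ y in c..d, g y) + m ^ 2 * (d - c) := by
      have : ∀ y, (g y - m) ^ 2 = (g y ^ 2 - 2 * m * g y) + m ^ 2 := fun y => by ring
      simp only [this]
      rw [intervalIntegral.integral_add (i2.sub (i1.const_mul _)) (by simp),
        intervalIntegral.integral_sub i2 (i1.const_mul _), intervalIntegral.integral_const_mul]
      simp [mul_comm]
    rw [h2] at h0
    have hpos : 0 < d - c := by linarith
    have h3 : (∫ y in c..d, g y) = (d - c) * m := by rw [hm]; field_simp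
    rw [h3] at h0 ⊢
    nlinarith
  refine h1.trans ?_
  have h2 : ∫ y in c..d, g y ^ 2 ≤ ∫ y in a..b, g y ^ 2 := by
    refine intervalIntegral.integral_mono_interval hc.1 hcd hd.2
      (Eventually.of_forall fun y => sq_nonneg _) (H.sq_intervalIntegrable hab)
  have h3 : 0 ≤ ∫ y in c..d, g y ^ 2 :=
    intervalIntegral.integral_nonneg hcd fun _ _ => sq_nonneg _
  have : d - c ≤ b - a := by linarith [hc.1, hd.2]
  nlinarith

end HasH1Deriv

/-! ### Steklov averages -/

/-- Translation of the first variable. -/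
def shift (τ : ℝ) (p : ℝ × ℝ) : ℝ × ℝ := (p.1 + τ, p.2)

theorem measurePreserving_shift (τ : ℝ) :
    MeasurePreserving (shift τ) (volume : Measure (ℝ × ℝ)) volume := by
  have h := measurePreserving_add_right (volume : Measure (ℝ × ℝ)) (τ, 0)
  have e : shift τ = fun p : ℝ × ℝ => p + (τ, 0) := by
    funext p; simp [shift, Prod.ext_iff]
  rwa [e]

theorem memLp_shift {f : ℝ × ℝ → ℝ} (hf : MemLp f 2 volume) (τ : ℝ) :
    MemLp (fun p => f (shift τ p)) 2 volume :=
  hf.comp_measurePreserving (measurePreserving_shift τ)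

theorem integral_mul_shift_eq_inner {Φ f : ℝ × ℝ → ℝ} (hΦ : MemLp Φ 2 volume)
    (hf : MemLp f 2 volume) (τ : ℝ) :
    ∫ p, Φ p * f (shift τ p) = inner ℝ (hΦ.toLp Φ) ((memLp_shift hf τ).toLp _) := by
  rw [L2.inner_def]
  refine integral_congr_ae ?_
  filter_upwards [hΦ.coeFn_toLp, (memLp_shift hf τ).coeFn_toLp] with p h1 h2
  rw [h1, h2]
  simp [mul_comm]

/-- Translations act continuously on L²; this replaces any pointwise differentiation theorem in the
limits of difference quotients. -/
theorem continuous_integral_mul_shift {Φ f : ℝ × ℝ → ℝ} (hΦ : MemLp Φ 2 volume)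
    (hf : MemLp f 2 volume) : Continuous fun τ => ∫ p, Φ p * f (shift τ p) := by
  have h1 : Continuous fun τ : ℝ => (⟨shift τ, by unfold shift; fun_prop⟩ : C(ℝ × ℝ, ℝ × ℝ)) := by
    refine ContinuousMap.continuous_of_continuous_uncurry _ ?_
    simp only [Function.uncurry_def, ContinuousMap.coe_mk]
    unfold shift
    fun_prop
  have h2 := Continuous.compMeasurePreservingLp (μ := (volume : Measure (ℝ × ℝ)))
    (ν := volume) (f := fun _ : ℝ => hf.toLp f) continuous_const h1
    (fun τ => measurePreserving_shift τ) (by simp)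
  have h3 : (fun τ => ∫ p, Φ p * f (shift τ p)) = fun τ => inner ℝ (hΦ.toLp Φ)
      (Lp.compMeasurePreserving (shift τ) (measurePreserving_shift τ) (hf.toLp f)) := by
    funext τ
    rw [integral_mul_shift_eq_inner hΦ hf, Lp.toLp_compMeasurePreserving]
    rfl
  rw [h3]
  exact continuous_const.inner h2

theorem integral_abs_mul_shift_le {Φ f : ℝ × ℝ → ℝ} (hΦ : MemLp Φ 2 volume)
    (hf : MemLp f 2 volume) (τ : ℝ) :
    ∫ p, |Φ p * f (shift τ p)| ≤ ‖hΦ.abs.toLp _‖ * ‖hf.abs.toLp _‖ := by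
  have h1 := integral_mul_shift_eq_inner hΦ.abs hf.abs τ
  simp only [Pi.abs_apply] at h1
  simp only [abs_mul]
  rw [h1]
  refine (real_inner_le_norm _ _).trans (le_of_eq ?_)
  have hn : ‖(memLp_shift hf.abs τ).toLp _‖ = ‖hf.abs.toLp _‖ := by
    have h2 := eLpNorm_comp_measurePreserving (p := 2) hf.abs.aestronglyMeasurable
      (measurePreserving_shift τ)
    simp only [Function.comp_def] at h2
    rw [Lp.norm_toLp, Lp.norm_toLp, h2]
  exact congrArg _ hn

/-- Fubini: testing an average over a time window is averaging the tested translates. Strong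
measurability of f is needed for joint measurability in the point and the shift. -/
theorem integral_mul_average {Φ f : ℝ × ℝ → ℝ} (hΦ : MemLp Φ 2 volume)
    (hf : MemLp f 2 volume) (hfm : StronglyMeasurable f) (h : ℝ) :
    ∫ p, Φ p * ∫ s in p.1..p.1 + h, f (s, p.2) =
      ∫ τ in (0 : ℝ)..h, ∫ p, Φ p * f (shift τ p) := by
  have e1 : ∀ p : ℝ × ℝ, Φ p * ∫ s in p.1..p.1 + h, f (s, p.2) =
      ∫ τ in (0 : ℝ)..h, Φ p * f (shift τ p) := by
    intro p
    rw [intervalIntegral.integral_const_mul]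
    have := intervalIntegral.integral_comp_add_left (a := 0) (b := h) (fun s => f (s, p.2)) p.1
    simp only [shift]
    rw [this, add_zero]
  simp only [e1]
  have hint : Integrable (Function.uncurry fun (p : ℝ × ℝ) (τ : ℝ) => Φ p * f (shift τ p))
      ((volume : Measure (ℝ × ℝ)).prod (volume.restrict (uIoc 0 h))) := by
    have hmeas : AEStronglyMeasurable
        (Function.uncurry fun (p : ℝ × ℝ) (τ : ℝ) => Φ p * f (shift τ p))
        ((volume : Measure (ℝ × ℝ)).prod (volume.restrict (uIoc 0 h))) := by
      refine (hΦ.aestronglyMeasurable.comp_fst).mul ?_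
      refine (hfm.comp_measurable ?_).aestronglyMeasurable
      unfold shift
      fun_prop
    rw [integrable_prod_iff' hmeas]
    refine ⟨Eventually.of_forall fun τ => hΦ.integrable_mul (memLp_shift hf τ), ?_⟩
    have : IsFiniteMeasure (volume.restrict (uIoc 0 h)) := by
      rw [uIoc]; infer_instance
    refine Integrable.mono' (integrable_const (‖hΦ.abs.toLp _‖ * ‖hf.abs.toLp _‖))
      hmeas.norm.prod_swap.integral_prod_right' ?_
    refine Eventually.of_forall fun τ => ?_
    simp only [Function.uncurry_apply_pair]
    rw [Real.norm_of_nonneg (integral_nonneg fun _ => norm_nonneg _)]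
    simpa only [Real.norm_eq_abs] using integral_abs_mul_shift_le hΦ hf τ
  simp only [intervalIntegral.intervalIntegral_eq_integral_uIoc, integral_smul]
  rw [integral_integral_swap hint]

/-- The left side is the mean over (0,h) of a continuous function of the shift, so the limit is its
value at shift 0, for h of either sign. -/
theorem tendsto_integral_mul_average {Φ f : ℝ × ℝ → ℝ} (hΦ : MemLp Φ 2 volume)
    (hf : MemLp f 2 volume) :
    Tendsto (fun h => ∫ p, Φ p * (h⁻¹ * ∫ s in p.1..p.1 + h, f (s, p.2))) (𝓝[≠] 0)
      (𝓝 (∫ p, Φ p * f p)) := by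
  -- Averages use whole time slices, so the null set where the representative differs must be null
  -- on almost every slice.
  obtain ⟨f', hf', hff'⟩ := hf.aestronglyMeasurable
  have hf2 : MemLp f' 2 volume := (memLp_congr_ae hff').1 hf
  have e0 : ∀ᵐ y : ℝ, ∀ᵐ s : ℝ, f (s, y) = f' (s, y) := by
    have := Measure.ae_ae_of_ae_prod (μ := (volume : Measure ℝ)) (ν := (volume : Measure ℝ))
      (p := fun q => f q.swap = f' q.swap)
      ((Measure.measurePreserving_swap).quasiMeasurePreserving.ae hff')
    exact this
  have e1 : ∀ h, ∫ p, Φ p * (h⁻¹ * ∫ s in p.1..p.1 + h, f (s, p.2)) =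
      h⁻¹ * ∫ τ in (0 : ℝ)..h, ∫ p, Φ p * f' (shift τ p) := by
    intro h
    rw [← integral_mul_average hΦ hf2 hf', ← integral_const_mul]
    refine integral_congr_ae ?_
    have e2 : ∀ᵐ p : ℝ × ℝ, ∀ᵐ s : ℝ, f (s, p.2) = f' (s, p.2) :=
      Measure.quasiMeasurePreserving_snd.ae e0
    filter_upwards [e2] with p hp
    have : ∫ s in p.1..p.1 + h, f (s, p.2) = ∫ s in p.1..p.1 + h, f' (s, p.2) :=
      intervalIntegral.integral_congr_ae (hp.mono fun s hs _ => hs)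
    rw [this]
    ring
  have e3 : ∫ p, Φ p * f p = ∫ p, Φ p * f' (shift 0 p) := by
    refine integral_congr_ae ?_
    filter_upwards [hff'] with p hp
    simp [shift, hp]
  simp only [e1, e3]
  have hc := continuous_integral_mul_shift hΦ hf2
  have hd := intervalIntegral.integral_hasDerivAt_right (f := fun τ => ∫ p, Φ p * f' (shift τ p))
    (a := 0) (b := 0) (by simp) (hc.stronglyMeasurableAtFilter _ _) hc.continuousAt
  have := hd.tendsto_slope_zero
  simpa using this

/-- The product of Lebesgue measure on `(0,T)` and on `(0,1)`. -/
abbrev rect (T : ℝ) : Measure (ℝ × ℝ) :=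
  (volume.restrict (Ioo 0 T)).prod (volume.restrict (Ioo 0 1))

theorem rect_eq (T : ℝ) : rect T = volume.restrict (Ioo 0 T ×ˢ Ioo 0 1) := by
  rw [rect, Measure.prod_restrict, Measure.volume_eq_prod]

theorem rect_mono {t T : ℝ} (h : t ≤ T) : rect t ≤ rect T := by
  rw [rect_eq, rect_eq]
  exact Measure.restrict_mono (prod_mono_left (Ioo_subset_Ioo_right h)) le_rfl

/-- Extension of D by zero outside the rectangle cuts the averaging window at time 0, which is the
origin of the maximum. -/
theorem tendsto_rect_average_left {t : ℝ} {Φ D : ℝ × ℝ → ℝ} (hΦ : MemLp Φ 2 (rect t))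
    (hD : MemLp D 2 (rect t)) :
    Tendsto (fun h => ∫ p, Φ p * (h⁻¹ * ∫ s in max (p.1 - h) 0..p.1, D (s, p.2)) ∂(rect t))
      (𝓝[>] 0) (𝓝 (∫ p, Φ p * D p ∂(rect t))) := by
  have hm : MeasurableSet (Ioo 0 t ×ˢ Ioo (0 : ℝ) 1) := measurableSet_Ioo.prod measurableSet_Ioo
  rw [rect_eq] at hΦ hD ⊢
  have h1 := tendsto_integral_mul_average ((memLp_indicator_iff_restrict hm).2 hΦ)
    ((memLp_indicator_iff_restrict hm).2 hD)
  -- A negative increment turns the forward average of the general result into a backward one.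
  have h2 : Tendsto (fun h : ℝ => -h) (𝓝[>] 0) (𝓝[≠] 0) := by
    refine tendsto_nhdsWithin_iff.2 ⟨?_, ?_⟩
    · have : Tendsto (fun h : ℝ => -h) (𝓝 0) (𝓝 (-0)) := (continuous_neg).tendsto 0
      rw [neg_zero] at this
      exact this.mono_left nhdsWithin_le_nhds
    · filter_upwards [self_mem_nhdsWithin] with h hh
      simpa using (ne_of_gt hh)
  have h3 := h1.comp h2
  have e : ∀ (F : ℝ × ℝ → ℝ), ∫ p, (Ioo 0 t ×ˢ Ioo (0 : ℝ) 1).indicator Φ p * F p =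
      ∫ p in (Ioo 0 t ×ˢ Ioo (0 : ℝ) 1), Φ p * F p := by
    intro F
    rw [← integral_indicator hm]
    refine integral_congr_ae (Eventually.of_forall fun p => ?_)
    by_cases hp : p ∈ Ioo 0 t ×ˢ Ioo (0 : ℝ) 1 <;> simp [hp]
  rw [e] at h3
  have e4 : ∫ p in (Ioo 0 t ×ˢ Ioo (0 : ℝ) 1), Φ p * (Ioo 0 t ×ˢ Ioo (0 : ℝ) 1).indicator D p =
      ∫ p in (Ioo 0 t ×ˢ Ioo (0 : ℝ) 1), Φ p * D p := by
    refine setIntegral_congr_fun hm fun p hp => ?_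
    simp [hp]
  rw [e4] at h3
  refine h3.congr' ?_
  filter_upwards [self_mem_nhdsWithin] with h hh
  have hh : 0 < h := hh
  simp only [Function.comp_apply]
  rw [e]
  refine setIntegral_congr_fun hm fun p hp => ?_
  obtain ⟨⟨hp1, hp2⟩, hp3⟩ := hp
  have hle : p.1 + -h ≤ p.1 := by linarith
  have hle2 : max (p.1 - h) 0 ≤ p.1 := max_le (by linarith) hp1.le
  rw [intervalIntegral.integral_of_ge hle, intervalIntegral.integral_of_le hle2,
    integral_Ioc_eq_integral_Ioo, integral_Ioc_eq_integral_Ioo]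
  have e5 : ∀ s, (Ioo 0 t ×ˢ Ioo (0 : ℝ) 1).indicator D (s, p.2) =
      (Ioo 0 t).indicator (fun s => D (s, p.2)) s := by
    intro s
    by_cases hs : s ∈ Ioo 0 t
    · rw [indicator_of_mem hs, indicator_of_mem (by exact ⟨hs, hp3⟩)]
    · rw [indicator_of_notMem hs, indicator_of_notMem (by simp [hs])]
  simp only [e5]
  rw [setIntegral_indicator measurableSet_Ioo]
  have e6 : Ioo (p.1 + -h) p.1 ∩ Ioo 0 t = Ioo (max (p.1 - h) 0) p.1 := by
    ext s
    simp only [mem_inter_iff, mem_Ioo, max_lt_iff]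
    constructor
    · rintro ⟨⟨a1, a2⟩, a3, a4⟩; exact ⟨⟨by linarith, a3⟩, a2⟩
    · rintro ⟨⟨a1, a2⟩, a3⟩; exact ⟨⟨by linarith, a3⟩, a2, by linarith⟩
  rw [e6]
  rw [inv_neg]
  ring

theorem tendsto_rect_average_right {t : ℝ} {Φ D : ℝ × ℝ → ℝ} (hΦ : MemLp Φ 2 (rect t))
    (hD : MemLp D 2 (rect t)) :
    Tendsto (fun h => ∫ p, Φ p * (h⁻¹ * ∫ s in p.1..min (p.1 + h) t, D (s, p.2)) ∂(rect t))
      (𝓝[>] 0) (𝓝 (∫ p, Φ p * D p ∂(rect t))) := by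
  have hm : MeasurableSet (Ioo 0 t ×ˢ Ioo (0 : ℝ) 1) := measurableSet_Ioo.prod measurableSet_Ioo
  rw [rect_eq] at hΦ hD ⊢
  have h1 := tendsto_integral_mul_average ((memLp_indicator_iff_restrict hm).2 hΦ)
    ((memLp_indicator_iff_restrict hm).2 hD)
  have h3 := h1.mono_left (nhdsWithin_mono (0 : ℝ) (fun x (hx : 0 < x) => hx.ne'))
  have e : ∀ (F : ℝ × ℝ → ℝ), ∫ p, (Ioo 0 t ×ˢ Ioo (0 : ℝ) 1).indicator Φ p * F p =
      ∫ p in (Ioo 0 t ×ˢ Ioo (0 : ℝ) 1), Φ p * F p := by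
    intro F
    rw [← integral_indicator hm]
    refine integral_congr_ae (Eventually.of_forall fun p => ?_)
    by_cases hp : p ∈ Ioo 0 t ×ˢ Ioo (0 : ℝ) 1 <;> simp [hp]
  rw [e] at h3
  have e4 : ∫ p in (Ioo 0 t ×ˢ Ioo (0 : ℝ) 1), Φ p * (Ioo 0 t ×ˢ Ioo (0 : ℝ) 1).indicator D p =
      ∫ p in (Ioo 0 t ×ˢ Ioo (0 : ℝ) 1), Φ p * D p := by
    refine setIntegral_congr_fun hm fun p hp => ?_
    simp [hp]
  rw [e4] at h3
  refine h3.congr' ?_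
  filter_upwards [self_mem_nhdsWithin] with h hh
  have hh : 0 < h := hh
  rw [e]
  refine setIntegral_congr_fun hm fun p hp => ?_
  obtain ⟨⟨hp1, hp2⟩, hp3⟩ := hp
  have hle : p.1 ≤ p.1 + h := by linarith
  have hle2 : p.1 ≤ min (p.1 + h) t := le_min hle hp2.le
  rw [intervalIntegral.integral_of_le hle, intervalIntegral.integral_of_le hle2,
    integral_Ioc_eq_integral_Ioo, integral_Ioc_eq_integral_Ioo]
  have e5 : ∀ s, (Ioo 0 t ×ˢ Ioo (0 : ℝ) 1).indicator D (s, p.2) =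
      (Ioo 0 t).indicator (fun s => D (s, p.2)) s := by
    intro s
    by_cases hs : s ∈ Ioo 0 t
    · rw [indicator_of_mem hs, indicator_of_mem (by exact ⟨hs, hp3⟩)]
    · rw [indicator_of_notMem hs, indicator_of_notMem (by simp [hs])]
  simp only [e5]
  rw [setIntegral_indicator measurableSet_Ioo]
  have e6 : Ioo p.1 (p.1 + h) ∩ Ioo 0 t = Ioo p.1 (min (p.1 + h) t) := by
    ext s
    simp only [mem_inter_iff, mem_Ioo, lt_min_iff]
    constructor
    · rintro ⟨⟨a1, a2⟩, a3, a4⟩; exact ⟨a1, a2, a4⟩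
    · rintro ⟨a1, a2, a3⟩; exact ⟨⟨a1, a2⟩, by linarith, a3⟩
  rw [e6]

/-! ### Functions on the rectangle -/

theorem ae_rect_right {T : ℝ} {P : ℝ → Prop}
    (h : ∀ᵐ y ∂(volume.restrict (Ioo (0 : ℝ) 1)), P y) : ∀ᵐ p ∂(rect T), P p.2 :=
  Measure.quasiMeasurePreserving_snd.ae h

theorem ae_slice_left {T : ℝ} {P : ℝ × ℝ → Prop} (h : ∀ᵐ p ∂(rect T), P p) :
    ∀ᵐ t ∂(volume.restrict (Ioo 0 T)), ∀ᵐ y ∂(volume.restrict (Ioo (0 : ℝ) 1)), P (t, y) :=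
  Measure.ae_ae_of_ae_prod h

theorem ae_slice_right {T : ℝ} {P : ℝ × ℝ → Prop} (h : ∀ᵐ p ∂(rect T), P p) :
    ∀ᵐ y ∂(volume.restrict (Ioo (0 : ℝ) 1)), ∀ᵐ t ∂(volume.restrict (Ioo 0 T)), P (t, y) := by
  have h1 : ∀ᵐ q ∂((volume.restrict (Ioo (0 : ℝ) 1)).prod (volume.restrict (Ioo 0 T))),
      P q.swap := (Measure.measurePreserving_swap).quasiMeasurePreserving.ae h
  exact Measure.ae_ae_of_ae_prod h1

theorem memLp_slice_left {T : ℝ} {F : ℝ × ℝ → ℝ} (hF : MemLp F 2 (rect T)) :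
    ∀ᵐ t ∂(volume.restrict (Ioo 0 T)),
      MemLp (fun y => F (t, y)) 2 (volume.restrict (Ioo (0 : ℝ) 1)) := by
  filter_upwards [hF.aestronglyMeasurable.prodMk_left, hF.integrable_sq.prod_right_ae] with t h1 h2
  exact (memLp_two_iff_integrable_sq h1).2 h2

theorem memLp_slice_right {T : ℝ} {F : ℝ × ℝ → ℝ} (hF : MemLp F 2 (rect T)) :
    ∀ᵐ y ∂(volume.restrict (Ioo (0 : ℝ) 1)),
      MemLp (fun t => F (t, y)) 2 (volume.restrict (Ioo 0 T)) := by
  filter_upwards [hF.aestronglyMeasurable.prod_swap.prodMk_left, hF.integrable_sq.prod_left_ae]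
    with y h1 h2
  exact (memLp_two_iff_integrable_sq h1).2 h2

theorem sq_integral_le {F : ℝ → ℝ} (hF : MemLp F 2 (volume.restrict (Ioo (0 : ℝ) 1))) :
    (∫ y in (0 : ℝ)..1, F y) ^ 2 ≤ ∫ y in (0 : ℝ)..1, F y ^ 2 := by
  have H : HasH1Deriv 0 1 (fun x => ∫ y in (0 : ℝ)..x, F y) F := ⟨hF, fun x _ => by simp⟩
  have h1 := H.abs_sub_le (c := 0) (d := 1) le_rfl (by simp) (by simp)
  have h0 : 0 ≤ ∫ y in (0 : ℝ)..1, F y ^ 2 :=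
    intervalIntegral.integral_nonneg zero_le_one fun _ _ => sq_nonneg _
  simp only [intervalIntegral.integral_same, sub_zero, one_mul] at h1
  have h2 := Real.sq_sqrt h0
  rw [← sq_abs]
  rw [← h2]
  exact pow_le_pow_left₀ (abs_nonneg _) h1 2

theorem integral_unit (F : ℝ → ℝ) :
    ∫ y in (0 : ℝ)..1, F y = ∫ y in Ioo (0 : ℝ) 1, F y := by
  rw [intervalIntegral.integral_of_le zero_le_one, integral_Ioc_eq_integral_Ioo]

theorem memLp_integral_slice {T : ℝ} {F : ℝ × ℝ → ℝ} (hF : MemLp F 2 (rect T)) :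
    MemLp (fun t => ∫ y in (0 : ℝ)..1, F (t, y)) 2 (volume.restrict (Ioo 0 T)) := by
  have hm : AEStronglyMeasurable (fun t => ∫ y in (0 : ℝ)..1, F (t, y))
      (volume.restrict (Ioo 0 T)) := by
    simp only [integral_unit]
    exact hF.aestronglyMeasurable.integral_prod_right'
  rw [memLp_two_iff_integrable_sq hm]
  refine Integrable.mono' hF.integrable_sq.integral_prod_left (hm.pow 2) ?_
  filter_upwards [memLp_slice_left hF] with t ht
  rw [Real.norm_of_nonneg (sq_nonneg _), ← integral_unit]
  exact sq_integral_le ht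

/-- The trace at 1 is ∫ ∂_y(yF) = ∫ F + ∫ y ∂_yF. Written through integrals over slices, it is
visibly measurable in time and square integrable; the trace at 0 differs from it by ∫ ∂_yF. -/
theorem memLp_trace {T : ℝ} {F Fy : ℝ → ℝ → ℝ}
    (h : ∀ᵐ t ∂(volume.restrict (Ioo 0 T)), HasH1Deriv 0 1 (F t) (Fy t))
    (hF : MemLp (fun p => F p.1 p.2) 2 (rect T)) (hFy : MemLp (fun p => Fy p.1 p.2) 2 (rect T)) :
    MemLp (fun t => F t 0) 2 (volume.restrict (Ioo 0 T)) ∧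
      MemLp (fun t => F t 1) 2 (volume.restrict (Ioo 0 T)) := by
  have hy : MemLp (fun p : ℝ × ℝ => p.2 * Fy p.1 p.2) 2 (rect T) := by
    refine MemLp.of_le_mul (c := 1) hFy ?_ ?_
    · exact (measurable_snd.aestronglyMeasurable).mul hFy.aestronglyMeasurable
    · have := ae_rect_right (T := T) (ae_restrict_mem (μ := volume) measurableSet_Ioo
        (s := Ioo (0 : ℝ) 1))
      filter_upwards [this] with p hp
      rw [norm_mul]
      refine mul_le_mul_of_nonneg_right ?_ (norm_nonneg _)
      rw [Real.norm_eq_abs, abs_of_pos hp.1]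
      exact hp.2.le
  have e1 : ∀ᵐ t ∂(volume.restrict (Ioo 0 T)),
      F t 1 = (∫ y in (0 : ℝ)..1, F t y) + ∫ y in (0 : ℝ)..1, y * Fy t y := by
    filter_upwards [h] with t ht
    have h1 := (HasH1Deriv.linear (a := 0) (b := 1) 1 0).integral_deriv_mul ht zero_le_one
    simp only [one_mul, sub_zero, mul_one] at h1
    rw [h1]
    ring
  have e0 : ∀ᵐ t ∂(volume.restrict (Ioo 0 T)),
      F t 0 = F t 1 - ∫ y in (0 : ℝ)..1, Fy t y := by
    filter_upwards [h] with t ht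
    rw [ht.2 1 (by simp)]
    ring
  have m1 : MemLp (fun t => F t 1) 2 (volume.restrict (Ioo 0 T)) :=
    (memLp_congr_ae e1).2 ((memLp_integral_slice hF).add (memLp_integral_slice hy))
  exact ⟨(memLp_congr_ae e0).2 (m1.sub (memLp_integral_slice hFy)), m1⟩

theorem aestronglyMeasurable_rect {T : ℝ} {w : ℝ × ℝ → ℝ}
    (hw : ContinuousOn w (Icc 0 T ×ˢ Icc 0 1)) : AEStronglyMeasurable w (rect T) := by
  rw [rect_eq]
  exact (hw.mono (prod_mono Ioo_subset_Icc_self Ioo_subset_Icc_self)).aestronglyMeasurable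
    (measurableSet_Ioo.prod measurableSet_Ioo)

theorem ae_mem_rect (T : ℝ) : ∀ᵐ p ∂(rect T), p ∈ Icc 0 T ×ˢ Icc (0 : ℝ) 1 := by
  rw [rect_eq]
  filter_upwards [ae_restrict_mem (measurableSet_Ioo.prod measurableSet_Ioo)] with p hp
  exact ⟨Ioo_subset_Icc_self hp.1, Ioo_subset_Icc_self hp.2⟩

theorem memLp_top_rect {T : ℝ} {w : ℝ × ℝ → ℝ} (hw : ContinuousOn w (Icc 0 T ×ˢ Icc 0 1)) :
    MemLp w ∞ (rect T) := by
  obtain ⟨C, hC⟩ := (isCompact_Icc.prod isCompact_Icc).exists_bound_of_continuousOn hw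
  exact memLp_top_of_bound (aestronglyMeasurable_rect hw) C ((ae_mem_rect T).mono fun p hp => hC p hp)

/-- As w is a primitive of D in time, its backward difference quotient is a Steklov average of D.
Negative times are frozen at 0, where w stays defined and the difference is still the integral of D
over the truncated window. -/
theorem average_left {t : ℝ} {Φ : ℝ × ℝ → ℝ} {w D : ℝ → ℝ → ℝ} (hΦ : MemLp Φ 2 (rect t))
    (hw : ContinuousOn (fun p : ℝ × ℝ => w p.1 p.2) (Icc 0 t ×ˢ Icc 0 1))
    (hD : MemLp (fun p => D p.1 p.2) 2 (rect t))
    (h : ∀ᵐ y ∂(volume.restrict (Ioo (0 : ℝ) 1)),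
      HasH1Deriv 0 t (fun s => w s y) (fun s => D s y)) :
    (∀ h > 0, Integrable (fun p => Φ p * (w p.1 p.2 - w (max (p.1 - h) 0) p.2)) (rect t)) ∧
    Tendsto (fun h => h⁻¹ * ∫ p, Φ p * (w p.1 p.2 - w (max (p.1 - h) 0) p.2) ∂(rect t)) (𝓝[>] 0)
      (𝓝 (∫ p, Φ p * D p.1 p.2 ∂(rect t))) := by
  constructor
  · intro h hh
    have c2 : ContinuousOn (fun p : ℝ × ℝ => w (max (p.1 - h) 0) p.2) (Icc 0 t ×ˢ Icc 0 1) := by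
      refine hw.comp (f := fun p : ℝ × ℝ => (max (p.1 - h) 0, p.2)) (by fun_prop) ?_
      rintro p ⟨⟨h1, h2⟩, h3⟩
      exact ⟨⟨le_max_right _ _, max_le (by linarith) (h1.trans h2)⟩, h3⟩
    have h1 : MemLp (fun p : ℝ × ℝ => w p.1 p.2 - w (max (p.1 - h) 0) p.2) 2 (rect t) :=
      (memLp_top_rect (hw.sub c2)).mono_exponent le_top
    exact hΦ.integrable_mul h1
  · refine (tendsto_rect_average_left hΦ hD).congr' ?_
    filter_upwards [self_mem_nhdsWithin] with h' hh'
    have hh' : 0 < h' := hh'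
    rw [← integral_const_mul]
    refine integral_congr_ae ?_
    filter_upwards [ae_rect_right (T := t) h, ae_mem_rect t] with p h1 h2
    obtain ⟨⟨h3, h4⟩, h5⟩ := h2
    have := h1.sub_eq (c := max (p.1 - h') 0) (d := p.1)
      ⟨le_max_right _ _, max_le (by linarith) (h3.trans h4)⟩ ⟨h3, h4⟩
    rw [this]
    ring

theorem continuousOn_integral_mul {T : ℝ} {w : ℝ → ℝ → ℝ} {k : ℝ → ℝ}
    (hw : ContinuousOn (fun p : ℝ × ℝ => w p.1 p.2) (Icc 0 T ×ˢ Icc 0 1))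
    (hk : IntervalIntegrable k volume 0 1) :
    ContinuousOn (fun s => ∫ y in (0 : ℝ)..1, k y * w s y) (Icc 0 T) := by
  obtain ⟨C, hC⟩ := (isCompact_Icc.prod isCompact_Icc).exists_bound_of_continuousOn hw
  intro t ht
  refine intervalIntegral.continuousWithinAt_of_dominated_interval
    (bound := fun y => ‖k y‖ * C) ?_ ?_ (hk.norm.mul_const C) ?_
  · filter_upwards [self_mem_nhdsWithin] with s hs
    refine (intervalIntegrable_iff.1 hk).aestronglyMeasurable.mul ?_
    refine ContinuousOn.aestronglyMeasurable ?_ measurableSet_uIoc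
    refine hw.comp (f := fun y => (s, y)) (by fun_prop) fun y hy => ⟨hs, ?_⟩
    rw [uIoc_of_le zero_le_one] at hy
    exact Ioc_subset_Icc_self hy
  · filter_upwards [self_mem_nhdsWithin] with s hs
    refine Eventually.of_forall fun y hy => ?_
    rw [uIoc_of_le zero_le_one] at hy
    rw [norm_mul]
    exact mul_le_mul_of_nonneg_left (hC (s, y) ⟨hs, Ioc_subset_Icc_self hy⟩) (norm_nonneg _)
  · refine Eventually.of_forall fun y hy => ?_
    rw [uIoc_of_le zero_le_one] at hy
    refine ContinuousWithinAt.mul continuousWithinAt_const ?_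
    exact (hw.comp (f := fun s => (s, y)) (by fun_prop)
      fun s hs => ⟨hs, Ioc_subset_Icc_self hy⟩) t ht

/-- The velocity in a fluid interval of length `g`, parametrised affinely by `(0,1)`:
`vx`, `vxx` are the first two derivatives in space, `vt` is the derivative in time, `al`, `be` are
the accelerations of the end points. -/
structure VelRect (T : ℝ) (g : ℝ → ℝ) (v vx vxx vt : ℝ → ℝ → ℝ) (al be : ℝ → ℝ) : Prop where
  v_cont : ContinuousOn (fun p : ℝ × ℝ => v p.1 p.2) (Icc 0 T ×ˢ Icc 0 1)
  g_pos : ∀ t ∈ Icc 0 T, 0 < g t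
  g_h1 : HasH1Deriv 0 T g (fun t => v t 1 - v t 0)
  v_y : ∀ t ∈ Icc 0 T, HasH1Deriv 0 1 (v t) (fun y => g t * vx t y)
  vx_y : ∀ᵐ t ∂(volume.restrict (Ioo 0 T)), HasH1Deriv 0 1 (vx t) (fun y => g t * vxx t y)
  v_t : ∀ᵐ y ∂(volume.restrict (Ioo (0 : ℝ) 1)),
    HasH1Deriv 0 T (fun t => v t y) (fun t => vt t y)
  vx_L2 : MemLp (fun p => vx p.1 p.2) 2 (rect T)
  vxx_L2 : MemLp (fun p => vxx p.1 p.2) 2 (rect T)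
  vt_L2 : MemLp (fun p => vt p.1 p.2) 2 (rect T)
  left : HasH1Deriv 0 T (fun t => v t 0) al
  right : HasH1Deriv 0 T (fun t => v t 1) be
  vx_bdd : ∃ C, ∀ t ∈ Ioo 0 T, ∫ y in (0 : ℝ)..1, vx t y ^ 2 ≤ C

namespace VelRect

variable {T : ℝ} {g : ℝ → ℝ} {v vx vxx vt : ℝ → ℝ → ℝ} {al be : ℝ → ℝ}

theorem vx_mem (H : VelRect T g v vx vxx vt al be) {t : ℝ} (ht : t ∈ Icc 0 T) :
    MemLp (vx t) 2 (volume.restrict (Ioo (0 : ℝ) 1)) := by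
  have h1 := ((H.v_y t ht).1).const_mul (g t)⁻¹
  refine (memLp_congr_ae (Eventually.of_forall fun y => ?_)).1 h1
  have := (H.g_pos t ht).ne'
  field_simp

theorem vx_sq_int (H : VelRect T g v vx vxx vt al be) {t : ℝ} (ht : t ∈ Icc 0 T) :
    IntervalIntegrable (fun y => vx t y ^ 2) volume 0 1 :=
  (intervalIntegrable_iff_integrableOn_Ioo_of_le zero_le_one).2 (H.vx_mem ht).integrable_sq

theorem intervalIntegrable_mul {f h : ℝ → ℝ} (hf : MemLp f 2 (volume.restrict (Ioo (0 : ℝ) 1)))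
    (hh : MemLp h 2 (volume.restrict (Ioo (0 : ℝ) 1))) :
    IntervalIntegrable (fun y => f y * h y) volume 0 1 :=
  (intervalIntegrable_iff_integrableOn_Ioo_of_le zero_le_one).2 (hf.integrable_mul hh)

/-- Lower semicontinuity of the energy. -/
theorem lsc (H : VelRect T g v vx vxx vt al be) {t η : ℝ} (ht : t ∈ Icc 0 T) (hη : 0 < η) :
    ∀ᶠ s in 𝓝[Icc 0 T] t, g t * (∫ y in (0 : ℝ)..1, vx t y ^ 2) ≤
      g s * (∫ y in (0 : ℝ)..1, vx s y ^ 2) + η := by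
  have hg := H.g_pos t ht
  -- The approximation error is multiplied by the length, and `g t * ε` is η/2. The other half of η
  -- pays for the change of the continuous lower bound.
  set ε : ℝ := η / (2 * g t) with hε
  have hε0 : 0 < ε := by positivity
  -- By duality g∫|vx|² is the supremum over q of 2∫q g vx - g∫q². For smooth q an integration by
  -- parts leaves only v, which is continuous in time. A smooth q close to vx(t) almost attains the
  -- supremum at time t.
  obtain ⟨q, -, hq, hqn⟩ := (H.vx_mem ht).exist_eLpNorm_sub_le (by simp) (by norm_num)
    (Real.sqrt_pos.2 hε0)
  have hqm : MemLp q 2 (volume.restrict (Ioo (0 : ℝ) 1)) := by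
    have := (hq.continuous.continuousOn (s := Icc (0 : ℝ) 1))
    simpa using memLp_mul_of_continuousOn this (memLp_const (1 : ℝ))
  have hd : ∫ y in (0 : ℝ)..1, (vx t y - q y) ^ 2 ≤ ε := by
    have hm := (H.vx_mem ht).sub hqm
    rw [integral_unit]
    have h1 := hm.eLpNorm_eq_integral_rpow_norm (by simp) (by simp)
    rw [h1] at hqn
    have h2 := (ENNReal.ofReal_le_ofReal_iff (Real.sqrt_nonneg _)).1 hqn
    have h3 : ∀ y, ‖(vx t - q) y‖ ^ ENNReal.toReal 2 = (vx t y - q y) ^ 2 := by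
      intro y
      simp
    simp only [h3] at h2
    have h0 : 0 ≤ ∫ y in Ioo (0 : ℝ) 1, (vx t y - q y) ^ 2 := integral_nonneg fun _ => sq_nonneg _
    have h4 : √(∫ y in Ioo (0 : ℝ) 1, (vx t y - q y) ^ 2) ≤ √ε := by
      rw [Real.sqrt_eq_rpow]
      simpa using h2
    exact (Real.sqrt_le_sqrt_iff hε0.le).1 h4
  have qH : HasH1Deriv 0 1 q (deriv q) := by
    refine ⟨?_, fun x hx => ?_⟩
    · have := ((hq.continuous_deriv (by simp)).continuousOn (s := Icc (0 : ℝ) 1))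
      simpa using memLp_mul_of_continuousOn this (memLp_const (1 : ℝ))
    · rw [intervalIntegral.integral_deriv_eq_sub
        (fun y _ => hq.differentiable (by simp) y)
        ((hq.continuous_deriv (by simp)).intervalIntegrable _ _)]
      ring
  -- the affine lower bound
  set Q := ∫ y in (0 : ℝ)..1, q y ^ 2 with hQ
  set ψ : ℝ → ℝ := fun s => 2 * (q 1 * v s 1 - q 0 * v s 0 -
    ∫ y in (0 : ℝ)..1, deriv q y * v s y) - g s * Q with hψ
  have hq2 : IntervalIntegrable (fun y => q y ^ 2) volume 0 1 :=
    (hq.continuous.pow 2).intervalIntegrable _ _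
  have key : ∀ s ∈ Icc 0 T, ∫ y in (0 : ℝ)..1, (2 * (q y * (g s * vx s y)) - g s * q y ^ 2) =
      ψ s := by
    intro s hs
    have i1 := intervalIntegrable_mul hqm (H.v_y s hs).1
    rw [intervalIntegral.integral_sub (i1.const_mul 2) (hq2.const_mul _),
      intervalIntegral.integral_const_mul, intervalIntegral.integral_const_mul,
      qH.integral_deriv_mul (H.v_y s hs) zero_le_one]
  have hlow : ∀ s ∈ Icc 0 T, ψ s ≤ g s * ∫ y in (0 : ℝ)..1, vx s y ^ 2 := by
    intro s hs
    rw [← key s hs, ← intervalIntegral.integral_const_mul]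
    refine intervalIntegral.integral_mono_on zero_le_one
      (((intervalIntegrable_mul hqm (H.v_y s hs).1).const_mul 2).sub (hq2.const_mul _))
      ((H.vx_sq_int hs).const_mul _) fun y _ => ?_
    nlinarith [H.g_pos s hs, mul_nonneg (H.g_pos s hs).le (sq_nonneg (vx s y - q y))]
  have hup : g t * (∫ y in (0 : ℝ)..1, vx t y ^ 2) = ψ t + g t *
      ∫ y in (0 : ℝ)..1, (vx t y - q y) ^ 2 := by
    have i1 := intervalIntegrable_mul hqm (H.v_y t ht).1
    have i3 : IntervalIntegrable (fun y => (vx t y - q y) ^ 2) volume 0 1 :=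
      (intervalIntegrable_iff_integrableOn_Ioo_of_le zero_le_one).2
        ((H.vx_mem ht).sub hqm).integrable_sq
    rw [← key t ht, ← intervalIntegral.integral_const_mul, ← intervalIntegral.integral_const_mul,
      ← intervalIntegral.integral_add ((i1.const_mul 2).sub (hq2.const_mul _)) (i3.const_mul _)]
    congr 1
    funext y
    ring
  have hcont : ContinuousOn ψ (Icc 0 T) := by
    have c1 : ContinuousOn (fun s => v s 1) (Icc 0 T) := H.right.continuousOn
    have c0 : ContinuousOn (fun s => v s 0) (Icc 0 T) := H.left.continuousOn
    have c2 := continuousOn_integral_mul H.v_cont (qH.intervalIntegrable zero_le_one)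
    exact (((c1.const_smul (q 1)).sub (c0.const_smul (q 0))).sub c2).const_smul (2 : ℝ) |>.sub
      (H.g_h1.continuousOn.mul continuousOn_const)
  have hev : ∀ᶠ s in 𝓝[Icc 0 T] t, ψ t - η / 2 < ψ s :=
    (hcont t ht).eventually (lt_mem_nhds (by linarith))
  filter_upwards [hev, self_mem_nhdsWithin] with s h1 hs
  have h2 := hlow s hs
  have h3 : g t * (∫ y in (0 : ℝ)..1, (vx t y - q y) ^ 2) ≤ η / 2 := by
    calc _ ≤ g t * ε := mul_le_mul_of_nonneg_left hd hg.le
      _ = η / 2 := by rw [hε]; field_simp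
  linarith

end VelRect

/-! ### The energy inequality for the velocity on the rectangle. -/

theorem integral_add_four {α : Type*} [MeasurableSpace α] {μ : Measure α} {f₁ f₂ f₃ f₄ : α → ℝ}
    (h₁ : Integrable f₁ μ) (h₂ : Integrable f₂ μ) (h₃ : Integrable f₃ μ) (h₄ : Integrable f₄ μ) :
    Integrable (fun a => f₁ a + f₂ a + f₃ a + f₄ a) μ ∧
      (∫ a, f₁ a ∂μ) + (∫ a, f₂ a ∂μ) + (∫ a, f₃ a ∂μ) + (∫ a, f₄ a ∂μ) =
        ∫ a, f₁ a + f₂ a + f₃ a + f₄ a ∂μ := by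
  refine ⟨((h₁.add h₂).add h₃).add h₄, ?_⟩
  have e₂ := integral_add (h₁.add h₂) h₃
  have e₃ := integral_add ((h₁.add h₂).add h₃) h₄
  simp only [Pi.add_apply] at e₂ e₃
  rw [e₃, e₂, integral_add h₁ h₂]

/-- During the first h units of time the clamped argument is 0. The resulting term h G(0), divided
by h, is the exact initial energy, so no continuity at time 0 is needed. -/
theorem integral_clamp_left {T h : ℝ} {G : ℝ → ℝ} (hh : 0 < h) (hT : h < T)
    (hG : IntervalIntegrable G volume 0 T) :
    IntervalIntegrable (fun s => G (max (s - h) 0)) volume 0 T ∧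
      ∫ s in (0 : ℝ)..T, G (max (s - h) 0) = h * G 0 + ∫ s in (0 : ℝ)..T - h, G s := by
  have i1 : IntervalIntegrable (fun s => G (max (s - h) 0)) volume 0 h := by
    refine (intervalIntegrable_const (c := G 0)).congr fun s hs => ?_
    rw [uIoc_of_le hh.le] at hs
    simp [max_eq_right (sub_nonpos.2 hs.2)]
  have hG' : IntervalIntegrable G volume 0 (T - h) := hG.mono_set (by
    rw [uIcc_of_le (by linarith), uIcc_of_le (by linarith)]
    exact Icc_subset_Icc_right (by linarith))
  have e2 : ∀ s ∈ uIoc h T, G (s - h) = G (max (s - h) 0) := by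
    intro s hs
    rw [uIoc_of_le hT.le] at hs
    rw [max_eq_left (sub_nonneg.2 hs.1.le)]
  have i2 : IntervalIntegrable (fun s => G (max (s - h) 0)) volume h T := by
    have := hG'.comp_sub_right h
    rw [zero_add, sub_add_cancel] at this
    exact this.congr e2
  refine ⟨i1.trans i2, ?_⟩
  rw [← intervalIntegral.integral_add_adjacent_intervals i1 i2]
  congr 1
  · rw [intervalIntegral.integral_congr_ae (g := fun _ => G 0)]
    · simp
    · refine Eventually.of_forall fun s hs => ?_
      rw [uIoc_of_le hh.le] at hs
      simp [max_eq_right (sub_nonpos.2 hs.2)]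
  · rw [← intervalIntegral.integral_congr_ae (Eventually.of_forall e2),
      intervalIntegral.integral_comp_sub_right G h, sub_self]

namespace VelRect

variable {T : ℝ} {g : ℝ → ℝ} {v vx vxx vt : ℝ → ℝ → ℝ} {al be : ℝ → ℝ}

theorem mono (H : VelRect T g v vx vxx vt al be) {t : ℝ} (ht : t ∈ Icc 0 T) :
    VelRect t g v vx vxx vt al be where
  v_cont := H.v_cont.mono (prod_mono_left (Icc_subset_Icc_right ht.2))
  g_pos s hs := H.g_pos s ⟨hs.1, hs.2.trans ht.2⟩
  g_h1 := H.g_h1.mono ⟨le_rfl, ht.1.trans ht.2⟩ ht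
  v_y s hs := H.v_y s ⟨hs.1, hs.2.trans ht.2⟩
  vx_y := ae_restrict_of_ae_restrict_of_subset (Ioo_subset_Ioo_right ht.2) H.vx_y
  v_t := H.v_t.mono fun _ hy => hy.mono ⟨le_rfl, ht.1.trans ht.2⟩ ht
  vx_L2 := H.vx_L2.mono_measure (rect_mono ht.2)
  vxx_L2 := H.vxx_L2.mono_measure (rect_mono ht.2)
  vt_L2 := H.vt_L2.mono_measure (rect_mono ht.2)
  left := H.left.mono ⟨le_rfl, ht.1.trans ht.2⟩ ht
  right := H.right.mono ⟨le_rfl, ht.1.trans ht.2⟩ ht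
  vx_bdd := H.vx_bdd.imp fun _ hC s hs => hC s ⟨hs.1, hs.2.trans_le ht.2⟩

theorem g_mul_memLp (H : VelRect T g v vx vxx vt al be) {F : ℝ → ℝ → ℝ}
    (hF : MemLp (fun p => F p.1 p.2) 2 (rect T)) :
    MemLp (fun p : ℝ × ℝ => g p.1 * F p.1 p.2) 2 (rect T) := by
  have h1 : MemLp (fun p : ℝ × ℝ => g p.1) ∞ (rect T) := by
    refine memLp_top_rect (H.g_h1.continuousOn.comp continuousOn_fst fun p hp => hp.1)
  exact hF.mul h1

theorem traces (H : VelRect T g v vx vxx vt al be) :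
    MemLp (fun t => vx t 0) 2 (volume.restrict (Ioo 0 T)) ∧
      MemLp (fun t => vx t 1) 2 (volume.restrict (Ioo 0 T)) :=
  memLp_trace H.vx_y H.vx_L2 (H.g_mul_memLp H.vxx_L2)

theorem energy_aesm (H : VelRect T g v vx vxx vt al be) :
    AEStronglyMeasurable (fun s => ∫ y in (0 : ℝ)..1, vx s y ^ 2) (volume.restrict (Ioo 0 T)) := by
  simp only [integral_unit]
  exact (H.vx_L2.aestronglyMeasurable.pow 2).integral_prod_right'

theorem energy_memLp (H : VelRect T g v vx vxx vt al be) :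
    MemLp (fun s => ∫ y in (0 : ℝ)..1, vx s y ^ 2) 2 (volume.restrict (Ioo 0 T)) := by
  obtain ⟨C, hC⟩ := H.vx_bdd
  refine MemLp.of_bound H.energy_aesm C ?_
  filter_upwards [ae_restrict_mem measurableSet_Ioo] with s hs
  rw [Real.norm_of_nonneg (intervalIntegral.integral_nonneg zero_le_one fun _ _ => sq_nonneg _)]
  exact hC s hs

/-- Convexity: with a = vx(s), b = vx(s'), the bound 2a(g(s)a - g(s')b) - (g(s) - g(s'))a² exceeds
g(s)a² - g(s')b² by g(s')(a - b)². The first product is then integrated by parts, which requires a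
second derivative at the time s only. -/
theorem energy_difference (H : VelRect T g v vx vxx vt al be) {s s' : ℝ} (hs : s ∈ Icc 0 T)
    (hs' : s' ∈ Icc 0 T) (h : HasH1Deriv 0 1 (vx s) (fun y => g s * vxx s y)) :
    g s * (∫ y in (0 : ℝ)..1, vx s y ^ 2) - g s' * (∫ y in (0 : ℝ)..1, vx s' y ^ 2) ≤
      2 * vx s 1 * (v s 1 - v s' 1) + -2 * vx s 0 * (v s 0 - v s' 0) +
        (∫ y in (0 : ℝ)..1, -2 * (g s * vxx s y) * (v s y - v s' y)) +
        -(∫ y in (0 : ℝ)..1, vx s y ^ 2) * (g s - g s') := by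
  have h1 := h.integral_deriv_mul ((H.v_y s hs).sub (H.v_y s' hs')) zero_le_one
  have e1 : ∫ y in (0 : ℝ)..1, -2 * (g s * vxx s y) * (v s y - v s' y) =
      -2 * ∫ y in (0 : ℝ)..1, g s * vxx s y * (v s y - v s' y) := by
    rw [← intervalIntegral.integral_const_mul]
    congr 1; funext y; ring
  have i1 := intervalIntegrable_mul (H.vx_mem hs) ((H.v_y s hs).1.sub (H.v_y s' hs').1)
  simp only [Pi.sub_apply] at i1
  have h2 : (∫ y in (0 : ℝ)..1, (g s * vx s y ^ 2 - g s' * vx s' y ^ 2)) ≤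
      ∫ y in (0 : ℝ)..1, (2 * (vx s y * (g s * vx s y - g s' * vx s' y)) -
        (g s - g s') * vx s y ^ 2) := by
    refine intervalIntegral.integral_mono_on zero_le_one
      (((H.vx_sq_int hs).const_mul _).sub ((H.vx_sq_int hs').const_mul _))
      ((i1.const_mul 2).sub ((H.vx_sq_int hs).const_mul _)) fun y _ => ?_
    nlinarith [mul_nonneg (H.g_pos s' hs').le (sq_nonneg (vx s y - vx s' y))]
  rw [intervalIntegral.integral_sub ((H.vx_sq_int hs).const_mul _)
    ((H.vx_sq_int hs').const_mul _), intervalIntegral.integral_const_mul,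
    intervalIntegral.integral_const_mul, intervalIntegral.integral_sub (i1.const_mul 2)
    ((H.vx_sq_int hs).const_mul _), intervalIntegral.integral_const_mul,
    intervalIntegral.integral_const_mul, h1] at h2
  rw [e1]
  linarith

/-- The energy inequality on a fluid interval. -/
theorem energy_le_final (H : VelRect T g v vx vxx vt al be) (hT : 0 < T) :
    g T * (∫ y in (0 : ℝ)..1, vx T y ^ 2) ≤ g 0 * (∫ y in (0 : ℝ)..1, vx 0 y ^ 2) +
      ((∫ p, 2 * vx p.1 1 * be p.1 ∂(rect T)) + (∫ p, -2 * vx p.1 0 * al p.1 ∂(rect T)) +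
      (∫ p, -2 * (g p.1 * vxx p.1 p.2) * vt p.1 p.2 ∂(rect T)) +
      ∫ p, -(∫ y in (0 : ℝ)..1, vx p.1 y ^ 2) * (v p.1 1 - v p.1 0) ∂(rect T)) := by
  have hT' : T ∈ Icc 0 T := ⟨hT.le, le_rfl⟩
  set I : ℝ → ℝ := fun s => ∫ y in (0 : ℝ)..1, vx s y ^ 2 with hI
  obtain ⟨i1, l1⟩ := average_left (Φ := fun p => 2 * vx p.1 1) (w := fun s _ => v s 1)
    (D := fun s _ => be s) ((H.traces.2.const_mul 2).comp_fst _)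
    (H.right.continuousOn.comp continuousOn_fst fun p hp => hp.1) (H.right.1.comp_fst _)
    (Eventually.of_forall fun _ => H.right)
  obtain ⟨i2, l2⟩ := average_left (Φ := fun p => -2 * vx p.1 0) (w := fun s _ => v s 0)
    (D := fun s _ => al s) ((H.traces.1.const_mul (-2)).comp_fst _)
    (H.left.continuousOn.comp continuousOn_fst fun p hp => hp.1) (H.left.1.comp_fst _)
    (Eventually.of_forall fun _ => H.left)
  obtain ⟨i3, l3⟩ := average_left (Φ := fun p => -2 * (g p.1 * vxx p.1 p.2)) (w := v)
    (D := vt) ((H.g_mul_memLp H.vxx_L2).const_mul (-2)) H.v_cont H.vt_L2 H.v_t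
  obtain ⟨i4, l4⟩ := average_left (Φ := fun p => -I p.1) (w := fun s _ => g s)
    (D := fun s _ => v s 1 - v s 0) (H.energy_memLp.neg.comp_fst _)
    (H.g_h1.continuousOn.comp continuousOn_fst fun p hp => hp.1) (H.g_h1.1.comp_fst _)
    (Eventually.of_forall fun _ => H.g_h1)
  have lim := ((l1.add l2).add l3).add l4
  refine le_of_forall_pos_le_add fun η hη => ?_
  rw [add_right_comm, ← sub_le_iff_le_add']
  refine ge_of_tendsto lim ?_
  have hGi : IntervalIntegrable (fun s => g s * I s) volume 0 T :=
    ((intervalIntegrable_iff_integrableOn_Ioo_of_le hT.le).2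
      (H.energy_memLp.integrable one_le_two)).continuousOn_mul
      (by rw [uIcc_of_le hT.le]; exact H.g_h1.continuousOn)
  -- The integrated differences telescope to the integral of the energy over (T - h, T) minus h
  -- times the initial energy. Near T only lower semicontinuity is known, and it bounds that
  -- integral below at the cost of η.
  obtain ⟨δ, hδ, hl⟩ := Metric.mem_nhdsWithin_iff.1 (H.lsc hT' hη)
  filter_upwards [Ioo_mem_nhdsGT (show 0 < min δ T by positivity)] with h hh
  have hh0 : 0 < h := hh.1
  have hhT : h < T := hh.2.trans_le (min_le_right _ _)
  have hhδ : h < δ := hh.2.trans_le (min_le_left _ _)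
  obtain ⟨hint, hsum⟩ := integral_add_four (i1 h hh0) (i2 h hh0) (i3 h hh0) (i4 h hh0)
  rw [← mul_add, ← mul_add, ← mul_add, hsum]
  obtain ⟨j1, e1⟩ := integral_clamp_left hh0 hhT hGi
  have step : ∫ s in (0 : ℝ)..T, (g s * I s - g (max (s - h) 0) * I (max (s - h) 0)) ≤
      ∫ p, (2 * vx p.1 1 * (v p.1 1 - v (max (p.1 - h) 0) 1) +
        -2 * vx p.1 0 * (v p.1 0 - v (max (p.1 - h) 0) 0) +
        -2 * (g p.1 * vxx p.1 p.2) * (v p.1 p.2 - v (max (p.1 - h) 0) p.2) +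
        -I p.1 * (g p.1 - g (max (p.1 - h) 0))) ∂(rect T) := by
    rw [intervalIntegral.integral_of_le hT.le, integral_Ioc_eq_integral_Ioo]
    rw [integral_prod _ hint]
    refine integral_mono_ae ?_ hint.integral_prod_left ?_
    · exact (intervalIntegrable_iff_integrableOn_Ioo_of_le hT.le).1 (hGi.sub j1)
    · filter_upwards [H.vx_y, ae_restrict_mem measurableSet_Ioo, (i3 h hh0).prod_right_ae]
        with s h1 hs h3
      have hs1 : s ∈ Icc 0 T := Ioo_subset_Icc_self hs
      have hs2 : max (s - h) 0 ∈ Icc 0 T :=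
        ⟨le_max_right _ _, max_le (by linarith [hs.2]) hT.le⟩
      refine (H.energy_difference hs1 hs2 h1).trans (le_of_eq ?_)
      rw [← integral_unit, intervalIntegral.integral_add, intervalIntegral.integral_add]
      · simp [hI]
      · simp
      · exact (intervalIntegrable_iff_integrableOn_Ioo_of_le zero_le_one).2 h3
      · exact IntervalIntegrable.add (by simp)
          ((intervalIntegrable_iff_integrableOn_Ioo_of_le zero_le_one).2 h3)
      · simp
  refine le_trans ?_ (mul_le_mul_of_nonneg_left step (inv_pos.2 hh0).le)
  rw [intervalIntegral.integral_sub hGi j1, e1]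
  have hGT : IntervalIntegrable (fun s => g s * I s) volume (T - h) T := hGi.mono_set (by
    rw [uIcc_of_le hT.le, uIcc_of_le (by linarith)]
    exact Icc_subset_Icc_left (by linarith))
  have hG0 : IntervalIntegrable (fun s => g s * I s) volume 0 (T - h) := hGi.mono_set (by
    rw [uIcc_of_le hT.le, uIcc_of_le (by linarith)]
    exact Icc_subset_Icc_right (by linarith))
  rw [← intervalIntegral.integral_add_adjacent_intervals hG0 hGT]
  have hlow : h * (g T * I T - η) ≤ ∫ s in (T - h)..T, g s * I s := by
    have : ∫ s in (T - h)..T, (g T * I T - η) ≤ ∫ s in (T - h)..T, g s * I s := by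
      refine intervalIntegral.integral_mono_on (by linarith) (by simp) hGT fun s hs => ?_
      have := hl (show s ∈ Metric.ball T δ ∩ Icc 0 T from
        ⟨by rw [Metric.mem_ball, Real.dist_eq, abs_lt]; constructor <;> linarith [hs.1, hs.2],
          by linarith [hs.1], hs.2⟩)
      simp only [mem_ofPred_eq] at this
      linarith
    rw [intervalIntegral.integral_const, smul_eq_mul, sub_sub_cancel] at this
    exact this
  rw [inv_mul_eq_div, le_div_iff₀ hh0]
  nlinarith

theorem energy_le (H : VelRect T g v vx vxx vt al be) {t : ℝ} (ht : t ∈ Ioc 0 T) :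
    g t * (∫ y in (0 : ℝ)..1, vx t y ^ 2) ≤ g 0 * (∫ y in (0 : ℝ)..1, vx 0 y ^ 2) +
      ((∫ p, 2 * vx p.1 1 * be p.1 ∂(rect t)) + (∫ p, -2 * vx p.1 0 * al p.1 ∂(rect t)) +
      (∫ p, -2 * (g p.1 * vxx p.1 p.2) * vt p.1 p.2 ∂(rect t)) +
      ∫ p, -(∫ y in (0 : ℝ)..1, vx p.1 y ^ 2) * (v p.1 1 - v p.1 0) ∂(rect t)) :=
  (H.mono ⟨ht.1.le, ht.2⟩).energy_le_final ht.1

end VelRect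

/-! ### Summation by parts in time: the work of a scalar field against the acceleration. -/

theorem integral_rect {T : ℝ} (hT : 0 ≤ T) {G : ℝ × ℝ → ℝ} (hG : Integrable G (rect T)) :
    IntervalIntegrable (fun s => ∫ y in (0 : ℝ)..1, G (s, y)) volume 0 T ∧
      ∫ p, G p ∂(rect T) = ∫ s in (0 : ℝ)..T, ∫ y in (0 : ℝ)..1, G (s, y) := by
  constructor
  · rw [intervalIntegrable_iff_integrableOn_Ioo_of_le hT]
    simp only [integral_unit]
    exact hG.integral_prod_left
  · rw [integral_prod _ hG, intervalIntegral.integral_of_le hT, integral_Ioc_eq_integral_Ioo]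
    simp only [integral_unit]

theorem tendsto_average_end {T : ℝ} (hT : 0 < T) {G : ℝ → ℝ}
    (hi : IntervalIntegrable G volume 0 T) (hG : ContinuousWithinAt G (Icc 0 T) T) :
    Tendsto (fun h => h⁻¹ * ∫ s in (T - h)..T, G s) (𝓝[>] 0) (𝓝 (G T)) := by
  rw [Metric.tendsto_nhds]
  intro ε hε
  obtain ⟨δ, hδ, hl⟩ := Metric.continuousWithinAt_iff.1 hG (ε / 2) (by positivity)
  filter_upwards [Ioo_mem_nhdsGT (show 0 < min δ T by positivity)] with h hh
  have hh0 : 0 < h := hh.1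
  have hhT : h < T := hh.2.trans_le (min_le_right _ _)
  have hhδ : h < δ := hh.2.trans_le (min_le_left _ _)
  have i1 : IntervalIntegrable G volume (T - h) T := hi.mono_set (by
    rw [uIcc_of_le hT.le, uIcc_of_le (by linarith)]
    exact Icc_subset_Icc_left (by linarith))
  have h1 : ‖∫ s in (T - h)..T, (G s - G T)‖ ≤ ε / 2 * |T - (T - h)| := by
    refine intervalIntegral.norm_integral_le_of_norm_le_const fun s hs => ?_
    rw [uIoc_of_le (by linarith)] at hs
    refine (hl (x := s) ⟨by linarith [hs.1], hs.2⟩ ?_).le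
    rw [Real.dist_eq, abs_lt]
    constructor <;> linarith [hs.1, hs.2]
  rw [intervalIntegral.integral_sub i1 (by simp), intervalIntegral.integral_const, sub_sub_cancel,
    abs_of_pos hh0, smul_eq_mul] at h1
  rw [Real.dist_eq]
  have e : h⁻¹ * (∫ s in (T - h)..T, G s) - G T =
      h⁻¹ * ((∫ s in (T - h)..T, G s) - h * G T) := by field_simp
  rw [e, abs_mul, abs_of_pos (inv_pos.2 hh0), inv_mul_eq_div, div_lt_iff₀ hh0]
  rw [Real.norm_eq_abs] at h1
  nlinarith

theorem tendsto_average_start {T : ℝ} (hT : 0 < T) {G : ℝ → ℝ}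
    (hi : IntervalIntegrable G volume 0 T) (hG : ContinuousWithinAt G (Icc 0 T) 0) :
    Tendsto (fun h => h⁻¹ * ∫ s in (0 : ℝ)..h, G s) (𝓝[>] 0) (𝓝 (G 0)) := by
  have h1 : ContinuousWithinAt (fun s => G (T - s)) (Icc 0 T) T := by
    refine ContinuousWithinAt.comp (t := Icc 0 T) (by rwa [sub_self])
      (by fun_prop) fun s hs => ⟨by linarith [hs.2], by linarith [hs.1]⟩
  have h2 := tendsto_average_end hT (by
    have := (hi.comp_sub_left T).symm
    simpa using this) h1
  rw [sub_self] at h2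
  refine h2.congr fun h => ?_
  rw [intervalIntegral.integral_comp_sub_left G T]
  simp

/-- Discrete integration by parts: a shift of time turns backward differences in the second argument
of a two-time kernel into forward differences in the first. The strips at both ends that the shift
leaves over become the boundary terms. -/
theorem integral_diagonal {T h : ℝ} (hh : 0 < h) (hT : h < T) {K : ℝ → ℝ → ℝ}
    (k1 : IntervalIntegrable (fun s => K s s) volume 0 T)
    (k2 : IntervalIntegrable (fun s => K (min (s + h) T) s) volume 0 T)
    (k3 : IntervalIntegrable (fun s => K s 0) volume 0 T) :
    ∫ s in (0 : ℝ)..T, (K s s - K s (max (s - h) 0)) =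
      -(∫ s in (0 : ℝ)..T, (K (min (s + h) T) s - K s s)) + (∫ s in (T - h)..T, K T s) -
        ∫ s in (0 : ℝ)..h, K s 0 := by
  have e1 : ∀ s ∈ uIoc 0 h, K s 0 = K s (max (s - h) 0) := by
    intro s hs
    rw [uIoc_of_le hh.le] at hs
    rw [max_eq_right (sub_nonpos.2 hs.2)]
  have e2 : ∀ s ∈ uIoc h T, K (min (s - h + h) T) (s - h) = K s (max (s - h) 0) := by
    intro s hs
    rw [uIoc_of_le hT.le] at hs
    rw [max_eq_left (sub_nonneg.2 hs.1.le), sub_add_cancel, min_eq_left hs.2]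
  have e3 : ∀ s ∈ uIoc (T - h) T, K (min (s + h) T) s = K T s := by
    intro s hs
    rw [uIoc_of_le (by linarith)] at hs
    rw [min_eq_right (by linarith [hs.1])]
  have k2' : IntervalIntegrable (fun s => K (min (s + h) T) s) volume 0 (T - h) :=
    k2.mono_set (by
      rw [uIcc_of_le (by linarith), uIcc_of_le (by linarith)]
      exact Icc_subset_Icc_right (by linarith))
  have k2'' : IntervalIntegrable (fun s => K (min (s + h) T) s) volume (T - h) T :=
    k2.mono_set (by
      rw [uIcc_of_le (by linarith), uIcc_of_le (by linarith)]
      exact Icc_subset_Icc_left (by linarith))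
  have k3' : IntervalIntegrable (fun s => K s 0) volume 0 h := k3.mono_set (by
    rw [uIcc_of_le (by linarith), uIcc_of_le (by linarith)]
    exact Icc_subset_Icc_right (by linarith))
  have i1 : IntervalIntegrable (fun s => K s (max (s - h) 0)) volume 0 h := k3'.congr e1
  have i2 : IntervalIntegrable (fun s => K s (max (s - h) 0)) volume h T := by
    have := k2'.comp_sub_right h
    rw [zero_add, sub_add_cancel] at this
    exact this.congr e2
  rw [intervalIntegral.integral_sub k1 (i1.trans i2), intervalIntegral.integral_sub k2 k1,
    ← intervalIntegral.integral_add_adjacent_intervals i1 i2,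
    ← intervalIntegral.integral_add_adjacent_intervals k2' k2'',
    ← intervalIntegral.integral_congr_ae (Eventually.of_forall e1),
    ← intervalIntegral.integral_congr_ae (Eventually.of_forall e2),
    intervalIntegral.integral_congr_ae (Eventually.of_forall e3),
    intervalIntegral.integral_comp_sub_right (fun s => K (min (s + h) T) s) h, sub_self]
  ring

/-- A bounded scalar field on the rectangle with square integrable derivatives: `f` is its
representative that is absolutely continuous in time, `F` the one that is so in space. -/
structure FieldRect (T C : ℝ) (g : ℝ → ℝ) (f F fx ft : ℝ → ℝ → ℝ) : Prop where
  meas : Measurable (fun p : ℝ × ℝ => f p.1 p.2)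
  bdd : ∀ᵐ y ∂(volume.restrict (Ioo (0 : ℝ) 1)), ∀ t ∈ Icc 0 T, |f t y| ≤ C
  f_t : ∀ᵐ y ∂(volume.restrict (Ioo (0 : ℝ) 1)),
    HasH1Deriv 0 T (fun t => f t y) (fun t => ft t y)
  ft_L2 : MemLp (fun p => ft p.1 p.2) 2 (rect T)
  f_x : ∀ᵐ t ∂(volume.restrict (Ioo 0 T)), HasH1Deriv 0 1 (F t) (fun y => g t * fx t y)
  ae_eq : ∀ᵐ t ∂(volume.restrict (Ioo 0 T)), ∀ᵐ y ∂(volume.restrict (Ioo (0 : ℝ) 1)), F t y = f t y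
  fx_L2 : MemLp (fun p => fx p.1 p.2) 2 (rect T)

namespace FieldRect

variable {T C : ℝ} {g : ℝ → ℝ} {f F fx ft : ℝ → ℝ → ℝ}

theorem mono (H : FieldRect T C g f F fx ft) {t : ℝ} (ht : t ∈ Icc 0 T) :
    FieldRect t C g f F fx ft where
  meas := H.meas
  bdd := H.bdd.mono fun _ hy s hs => hy s ⟨hs.1, hs.2.trans ht.2⟩
  f_t := H.f_t.mono fun _ hy => hy.mono ⟨le_rfl, ht.1.trans ht.2⟩ ht
  ft_L2 := H.ft_L2.mono_measure (rect_mono ht.2)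
  f_x := ae_restrict_of_ae_restrict_of_subset (Ioo_subset_Ioo_right ht.2) H.f_x
  ae_eq := ae_restrict_of_ae_restrict_of_subset (Ioo_subset_Ioo_right ht.2) H.ae_eq
  fx_L2 := H.fx_L2.mono_measure (rect_mono ht.2)

theorem f_slice (H : FieldRect T C g f F fx ft) {t : ℝ} (ht : t ∈ Icc 0 T) :
    MemLp (f t) ∞ (volume.restrict (Ioo (0 : ℝ) 1)) := by
  refine memLp_top_of_bound (H.meas.comp measurable_prodMk_left).aestronglyMeasurable C ?_
  filter_upwards [H.bdd] with y hy using hy t ht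

theorem f_comp (H : FieldRect T C g f F fx ft) {θ : ℝ → ℝ} (hθ : Measurable θ)
    (h : ∀ s ∈ Icc 0 T, θ s ∈ Icc 0 T) :
    MemLp (fun p : ℝ × ℝ => f (θ p.1) p.2) ∞ (rect T) := by
  refine memLp_top_of_bound (H.meas.comp ((hθ.comp measurable_fst).prodMk
    measurable_snd)).aestronglyMeasurable C ?_
  filter_upwards [ae_rect_right (T := T) H.bdd, ae_mem_rect T] with p hp hp' using hp _ (h _ hp'.1)

theorem F_traces (H : FieldRect T C g f F fx ft) (hg : ContinuousOn g (Icc 0 T)) :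
    MemLp (fun t => F t 0) 2 (volume.restrict (Ioo 0 T)) ∧
      MemLp (fun t => F t 1) 2 (volume.restrict (Ioo 0 T)) := by
  have h1 : MemLp (fun p : ℝ × ℝ => g p.1) ∞ (rect T) :=
    memLp_top_rect (hg.comp continuousOn_fst fun p hp => hp.1)
  have hint : ∀ᵐ t ∂(volume.restrict (Ioo 0 T)), (∫ y in (0 : ℝ)..1, F t y) =
      ∫ y in (0 : ℝ)..1, f t y := by
    filter_upwards [H.ae_eq] with t ht
    rw [integral_unit, integral_unit]
    exact integral_congr_ae ht
  have hx : MemLp (fun p : ℝ × ℝ => g p.1 * fx p.1 p.2) 2 (rect T) := H.fx_L2.mul h1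
  have hy : MemLp (fun p : ℝ × ℝ => p.2 * (g p.1 * fx p.1 p.2)) 2 (rect T) := by
    have : MemLp (fun p : ℝ × ℝ => p.2) ∞ (rect T) := memLp_top_rect continuousOn_snd
    exact hx.mul this
  have hf : MemLp (fun p : ℝ × ℝ => f p.1 p.2) 2 (rect T) :=
    (H.f_comp measurable_id fun _ hs => hs).mono_exponent le_top
  have e1 : ∀ᵐ t ∂(volume.restrict (Ioo 0 T)),
      F t 1 = (∫ y in (0 : ℝ)..1, f t y) + ∫ y in (0 : ℝ)..1, y * (g t * fx t y) := by
    filter_upwards [H.f_x, hint] with t ht ht'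
    have h1 := (HasH1Deriv.linear (a := 0) (b := 1) 1 0).integral_deriv_mul ht zero_le_one
    simp only [one_mul, sub_zero, mul_one] at h1
    rw [h1, ← ht']
    ring
  have e0 : ∀ᵐ t ∂(volume.restrict (Ioo 0 T)),
      F t 0 = F t 1 - ∫ y in (0 : ℝ)..1, g t * fx t y := by
    filter_upwards [H.f_x] with t ht
    rw [ht.2 1 (by simp)]
    ring
  have m1 : MemLp (fun t => F t 1) 2 (volume.restrict (Ioo 0 T)) :=
    (memLp_congr_ae e1).2 ((memLp_integral_slice hf).add (memLp_integral_slice hy))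
  exact ⟨(memLp_congr_ae e0).2 (m1.sub (memLp_integral_slice hx)), m1⟩

variable {v vx vxx vt : ℝ → ℝ → ℝ} {al be : ℝ → ℝ}

/-- The left side is formally ∫∫ f ∂_t(g vx), but g vx has no time derivative. It is therefore
realised as a limit of backward differences of g vx tested with f, and `integral_diagonal` moves the
difference onto f, which has a derivative in time. -/
theorem work_final (H : FieldRect T C g f F fx ft) (V : VelRect T g v vx vxx vt al be)
    (hT : 0 < T) (hFT : HasH1Deriv 0 1 (F T) (fun y => g T * fx T y))
    (hFf : ∀ᵐ y ∂(volume.restrict (Ioo (0 : ℝ) 1)), F T y = f T y) :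
    (∫ p, F p.1 1 * be p.1 ∂(rect T)) + (∫ p, -F p.1 0 * al p.1 ∂(rect T)) +
      (∫ p, -(g p.1 * fx p.1 p.2) * vt p.1 p.2 ∂(rect T)) =
    -(∫ p, (g p.1 * vx p.1 p.2) * ft p.1 p.2 ∂(rect T)) +
      (∫ y in (0 : ℝ)..1, f T y * (g T * vx T y)) - ∫ y in (0 : ℝ)..1, f 0 y * (g 0 * vx 0 y) := by
  have hT' : T ∈ Icc 0 T := ⟨hT.le, le_rfl⟩
  have h0' : (0 : ℝ) ∈ Icc 0 T := ⟨le_rfl, hT.le⟩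
  have tr := H.F_traces V.g_h1.continuousOn
  obtain ⟨i1, l1⟩ := average_left (Φ := fun p => F p.1 1) (w := fun s _ => v s 1)
    (D := fun s _ => be s) (tr.2.comp_fst _)
    (V.right.continuousOn.comp continuousOn_fst fun p hp => hp.1) (V.right.1.comp_fst _)
    (Eventually.of_forall fun _ => V.right)
  obtain ⟨i2, l2⟩ := average_left (Φ := fun p => -F p.1 0) (w := fun s _ => v s 0)
    (D := fun s _ => al s) (tr.1.neg.comp_fst _)
    (V.left.continuousOn.comp continuousOn_fst fun p hp => hp.1) (V.left.1.comp_fst _)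
    (Eventually.of_forall fun _ => V.left)
  obtain ⟨i3, l3⟩ := average_left (Φ := fun p => -(g p.1 * fx p.1 p.2)) (w := v)
    (D := vt) ((V.g_mul_memLp H.fx_L2).neg) V.v_cont V.vt_L2 V.v_t
  have hvy : MemLp (fun p : ℝ × ℝ => g p.1 * vx p.1 p.2) 2 (rect T) := V.g_mul_memLp V.vx_L2
  have l4 := tendsto_rect_average_right hvy H.ft_L2
  -- The field at one time paired with the velocity gradient at another.
  set K : ℝ → ℝ → ℝ := fun s σ => ∫ y in (0 : ℝ)..1, f s y * (g σ * vx σ y) with hK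
  have hvy0 : ∀ σ ∈ Icc 0 T, IntervalIntegrable (fun y => g σ * vx σ y) volume 0 1 :=
    fun σ hσ => (V.v_y σ hσ).intervalIntegrable zero_le_one
  -- the two end point averages
  have kT : ContinuousOn (fun s => K T s) (Icc 0 T) := by
    -- The gradient of v is not known to be continuous in time, but v is. The spatial derivative is
    -- moved to the field, which must thus be in H¹ at the final time.
    have c2 := continuousOn_integral_mul V.v_cont (hFT.intervalIntegrable zero_le_one)
    have c3 : ContinuousOn (fun s => F T 1 * v s 1 - F T 0 * v s 0 -
        ∫ y in (0 : ℝ)..1, g T * fx T y * v s y) (Icc 0 T) :=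
      ((V.right.continuousOn.const_smul (F T 1)).sub (V.left.continuousOn.const_smul (F T 0))).sub c2
    -- The space-regular representative F(T) and the time-regular f(T) agree almost everywhere, so
    -- they give the same pairing.
    refine c3.congr fun s hs => ?_
    have h1 := hFT.integral_deriv_mul (V.v_y s hs) zero_le_one
    beta_reduce
    rw [← h1, hK]
    simp only [integral_unit]
    refine integral_congr_ae ?_
    filter_upwards [hFf] with y hy
    rw [hy]
  have k0 : ContinuousOn (fun s => K s 0) (Icc 0 T) := by
    intro t ht
    refine intervalIntegral.continuousWithinAt_of_dominated_interval
      (bound := fun y => C * ‖g 0 * vx 0 y‖) ?_ ?_ ((hvy0 0 h0').norm.const_mul C) ?_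
    · filter_upwards [] with s
      exact (H.meas.comp measurable_prodMk_left).aestronglyMeasurable.mul
        (intervalIntegrable_iff.1 (hvy0 0 h0')).aestronglyMeasurable
    · filter_upwards [self_mem_nhdsWithin] with s hs
      have := (ae_restrict_iff' measurableSet_Ioo).1 H.bdd
      filter_upwards [this, Measure.ae_ne volume (1 : ℝ)] with y hy hy1 hy'
      rw [uIoc_of_le zero_le_one] at hy'
      rw [norm_mul]
      exact mul_le_mul_of_nonneg_right (hy ⟨hy'.1, lt_of_le_of_ne hy'.2 hy1⟩ s hs) (norm_nonneg _)
    · have := (ae_restrict_iff' measurableSet_Ioo).1 H.f_t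
      filter_upwards [this, Measure.ae_ne volume (1 : ℝ)] with y hy hy1 hy'
      rw [uIoc_of_le zero_le_one] at hy'
      exact ((hy ⟨hy'.1, lt_of_le_of_ne hy'.2 hy1⟩).continuousOn t ht).mul
        continuousWithinAt_const
  have kTi : IntervalIntegrable (fun s => K T s) volume 0 T :=
    ContinuousOn.intervalIntegrable (by rwa [uIcc_of_le hT.le])
  have k0i : IntervalIntegrable (fun s => K s 0) volume 0 T :=
    ContinuousOn.intervalIntegrable (by rwa [uIcc_of_le hT.le])
  have l5 := tendsto_average_end hT kTi (kT T hT')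
  have l6 := tendsto_average_start hT k0i (k0 0 h0')
  refine tendsto_nhds_unique ((l1.add l2).add l3) (((l4.neg.add l5).sub l6).congr' ?_)
  filter_upwards [Ioo_mem_nhdsGT hT] with h hh
  have hh0 : 0 < h := hh.1
  have z : Integrable (fun _ : ℝ × ℝ => (0 : ℝ)) (rect T) := integrable_zero _ _ _
  obtain ⟨hint, hsum⟩ := integral_add_four (i1 h hh0) (i2 h hh0) (i3 h hh0) z
  simp only [integral_zero, add_zero] at hsum hint
  rw [← mul_add, ← mul_add, hsum, (integral_rect hT.le hint).2]
  have e7 : ∫ s in (0 : ℝ)..T, ∫ y in (0 : ℝ)..1, (F s 1 * (v s 1 - v (max (s - h) 0) 1) +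
      -F s 0 * (v s 0 - v (max (s - h) 0) 0) +
      -(g s * fx s y) * (v s y - v (max (s - h) 0) y)) =
      ∫ s in (0 : ℝ)..T, (K s s - K s (max (s - h) 0)) := by
    rw [intervalIntegral.integral_of_le hT.le, intervalIntegral.integral_of_le hT.le,
      integral_Ioc_eq_integral_Ioo, integral_Ioc_eq_integral_Ioo]
    refine integral_congr_ae ?_
    filter_upwards [H.f_x, H.ae_eq, ae_restrict_mem measurableSet_Ioo, (i3 h hh0).prod_right_ae]
      with s h1 h2 hs h3
    have hs1 : s ∈ Icc 0 T := Ioo_subset_Icc_self hs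
    have hs2 : max (s - h) 0 ∈ Icc 0 T :=
      ⟨le_max_right _ _, max_le (by linarith [hs.2]) hT.le⟩
    have h4 := h1.integral_deriv_mul ((V.v_y s hs1).sub (V.v_y _ hs2)) zero_le_one
    have e8 : K s s - K s (max (s - h) 0) =
        ∫ y in (0 : ℝ)..1, F s y * (g s * vx s y - g (max (s - h) 0) * vx (max (s - h) 0) y) := by
      have m : ∀ σ ∈ Icc 0 T, IntervalIntegrable (fun y => f s y * (g σ * vx σ y)) volume 0 1 :=
        fun σ hσ => VelRect.intervalIntegrable_mul ((H.f_slice hs1).mono_exponent le_top)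
          (V.v_y σ hσ).1
      rw [hK]
      beta_reduce
      rw [← intervalIntegral.integral_sub (m s hs1) (m _ hs2), integral_unit, integral_unit]
      refine integral_congr_ae ?_
      filter_upwards [h2] with y hy
      rw [hy]
      ring
    rw [e8, h4, intervalIntegral.integral_add (by simp)
      ((intervalIntegrable_iff_integrableOn_Ioo_of_le zero_le_one).2 h3)]
    simp only [intervalIntegral.integral_const, sub_zero, one_smul, neg_mul,
      intervalIntegral.integral_neg]
    ring
  rw [e7]
  -- the time averages of the field
  have m1 : Integrable (fun p : ℝ × ℝ => f p.1 p.2 * (g p.1 * vx p.1 p.2)) (rect T) :=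
    ((H.f_comp measurable_id fun _ hs => hs).mono_exponent (p := 2) le_top).integrable_mul
      hvy
  have m2 : Integrable (fun p : ℝ × ℝ => f (min (p.1 + h) T) p.2 * (g p.1 * vx p.1 p.2)) (rect T) :=
    ((H.f_comp (θ := fun s => min (s + h) T) (by fun_prop) fun s hs =>
      ⟨le_min (by linarith [hs.1]) hT.le, min_le_right _ _⟩).mono_exponent (p := 2) le_top).integrable_mul
      hvy
  have e9 := integral_diagonal hh0 hh.2 (K := K) (integral_rect hT.le m1).1 (integral_rect hT.le m2).1
    k0i
  rw [e9]
  have e10 : ∫ s in (0 : ℝ)..T, (K (min (s + h) T) s - K s s) =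
      ∫ p, (f (min (p.1 + h) T) p.2 - f p.1 p.2) * (g p.1 * vx p.1 p.2) ∂(rect T) := by
    rw [intervalIntegral.integral_sub (integral_rect hT.le m2).1 (integral_rect hT.le m1).1,
      ← (integral_rect hT.le m2).2, ← (integral_rect hT.le m1).2, ← integral_sub m2 m1]
    refine integral_congr_ae (Eventually.of_forall fun p => ?_)
    beta_reduce
    ring
  have e11 : ∫ p, (g p.1 * vx p.1 p.2) * (h⁻¹ * ∫ s in p.1..min (p.1 + h) T, ft s p.2) ∂(rect T) =
      h⁻¹ * ∫ p, (f (min (p.1 + h) T) p.2 - f p.1 p.2) * (g p.1 * vx p.1 p.2) ∂(rect T) := by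
    rw [← integral_const_mul]
    refine integral_congr_ae ?_
    filter_upwards [ae_rect_right (T := T) H.f_t, ae_mem_rect T] with p h1 h2
    rw [h1.sub_eq h2.1 (d := min (p.1 + h) T)
      ⟨le_min (by linarith [h2.1.1]) hT.le, min_le_right _ _⟩]
    ring
  rw [e10, e11]
  ring

/-- The work of a scalar field against the acceleration. -/
theorem work (H : FieldRect T C g f F fx ft) (V : VelRect T g v vx vxx vt al be) :
    ∀ᵐ t ∂(volume.restrict (Ioo 0 T)),
    (∫ p, F p.1 1 * be p.1 ∂(rect t)) + (∫ p, -F p.1 0 * al p.1 ∂(rect t)) +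
      (∫ p, -(g p.1 * fx p.1 p.2) * vt p.1 p.2 ∂(rect t)) =
    -(∫ p, (g p.1 * vx p.1 p.2) * ft p.1 p.2 ∂(rect t)) +
      (∫ y in (0 : ℝ)..1, f t y * (g t * vx t y)) - ∫ y in (0 : ℝ)..1, f 0 y * (g 0 * vx 0 y) := by
  filter_upwards [H.f_x, H.ae_eq, ae_restrict_mem measurableSet_Ioo] with t h1 h2 ht
  exact (H.mono (Ioo_subset_Icc_self ht)).work_final (V.mono (Ioo_subset_Icc_self ht)) ht.1 h1 h2

end FieldRect

/-! ### Test functions of class `C¹` -/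

open Convolution in
-- Mollification. The time derivative commutes with the convolution, so both estimates follow from
-- uniform continuity.
theorem exists_smooth_approx {Q : Set (ℝ × ℝ)} (hQ : IsOpen Q) {φ : ℝ × ℝ → ℝ}
    (hφ : ContDiff ℝ 1 φ) (hc : HasCompactSupport φ) (hs : tsupport φ ⊆ Q) {ε : ℝ} (hε : 0 < ε) :
    ∃ ψ : ℝ × ℝ → ℝ, ContDiff ℝ ∞ ψ ∧ HasCompactSupport ψ ∧ tsupport ψ ⊆ Q ∧
      (∀ p, |ψ p - φ p| ≤ ε) ∧ ∀ p, |fderiv ℝ ψ p (1, 0) - fderiv ℝ φ p (1, 0)| ≤ ε := by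
  obtain ⟨δ, hδ, hδQ⟩ := hc.isCompact.exists_cthickening_subset_open hQ hs
  have hc' : HasCompactSupport (fun p => fderiv ℝ φ p (1, 0)) :=
    (hc.fderiv (𝕜 := ℝ)).comp_left (g := fun l : (ℝ × ℝ) →L[ℝ] ℝ => l (1, 0)) rfl
  have hd : Continuous (fun p => fderiv ℝ φ p (1, 0)) :=
    (hφ.continuous_fderiv one_ne_zero).clm_apply continuous_const
  obtain ⟨δ₁, hδ₁, h₁⟩ := Metric.uniformContinuous_iff.1
    (hc.uniformContinuous_of_continuous hφ.continuous) ε hε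
  obtain ⟨δ₂, hδ₂, h₂⟩ := Metric.uniformContinuous_iff.1
    (hc'.uniformContinuous_of_continuous hd) ε hε
  -- The radius must keep the support inside Q and lie below the moduli of continuity of φ and of
  -- its time derivative.
  set η := min δ (min δ₁ δ₂)
  have hη : 0 < η := lt_min hδ (lt_min hδ₁ hδ₂)
  let χ : ContDiffBump (0 : ℝ × ℝ) := ⟨η / 2, η, by positivity, by linarith⟩
  have hχ : LocallyIntegrable (χ.normed volume) volume :=
    (χ.contDiff_normed (n := 0)).continuous.locallyIntegrable
  have hsub : Function.support (χ.normed volume ⋆[ContinuousLinearMap.lsmul ℝ ℝ, volume] φ) ⊆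
      Metric.cthickening δ (tsupport φ) := by
    refine (support_convolution_subset _).trans ?_
    rintro _ ⟨p, hp, q, hq, rfl⟩
    refine Metric.mem_cthickening_of_dist_le _ q _ _ (subset_tsupport _ hq) ?_
    rw [χ.support_normed_eq] at hp
    have : dist p 0 < η := hp
    simp only [dist_eq_norm, sub_zero] at this
    rw [dist_eq_norm]; simp only [add_sub_cancel_right]
    exact this.le.trans (min_le_left _ _)
  have hsupp : tsupport (χ.normed volume ⋆[ContinuousLinearMap.lsmul ℝ ℝ, volume] φ) ⊆
      Metric.cthickening δ (tsupport φ) := closure_minimal hsub Metric.isClosed_cthickening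
  refine ⟨χ.normed volume ⋆[ContinuousLinearMap.lsmul ℝ ℝ, volume] φ, ?_, ?_, ?_, ?_, ?_⟩
  · exact χ.hasCompactSupport_normed.contDiff_convolution_left _ χ.contDiff_normed
      hφ.continuous.locallyIntegrable
  · exact HasCompactSupport.intro (hc.isCompact.cthickening) fun p hp => by
      by_contra h; exact hp (hsub h)
  · exact hsupp.trans hδQ
  · intro p
    refine χ.dist_normed_convolution_le hφ.continuous.aestronglyMeasurable fun q hq => ?_
    exact (h₁ (lt_of_lt_of_le hq ((min_le_right _ _).trans (min_le_left _ _)))).le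
  · intro p
    rw [(hc.hasFDerivAt_convolution_right (ContinuousLinearMap.lsmul ℝ ℝ) hχ hφ p).fderiv,
      convolution_precompR_apply _ hχ (hc.fderiv (𝕜 := ℝ)) (hφ.continuous_fderiv one_ne_zero)]
    refine χ.dist_normed_convolution_le hd.aestronglyMeasurable fun q hq => ?_
    exact (h₂ (lt_of_lt_of_le hq ((min_le_right _ _).trans (min_le_right _ _)))).le

/-- The interfaces move along C¹ curves only, so test functions transported from the fixed frame are
no better than C¹. -/
theorem HasWeakTimeDeriv.of_contDiff_one {Q : Set (ℝ × ℝ)} (hQ : IsOpen Q) {f g φ : ℝ × ℝ → ℝ}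
    (H : HasWeakTimeDeriv Q f g) (hf : IntegrableOn f Q) (hg : IntegrableOn g Q)
    (hφ : ContDiff ℝ 1 φ) (hc : HasCompactSupport φ) (hs : tsupport φ ⊆ Q) :
    ∫ p in Q, f p * fderiv ℝ φ p (1, 0) = - ∫ p in Q, g p * φ p := by
  have hc' : HasCompactSupport (fun p => fderiv ℝ φ p (1, 0)) :=
    (hc.fderiv (𝕜 := ℝ)).comp_left (g := fun l : (ℝ × ℝ) →L[ℝ] ℝ => l (1, 0)) rfl
  have hd : Continuous (fun p => fderiv ℝ φ p (1, 0)) :=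
    (hφ.continuous_fderiv one_ne_zero).clm_apply continuous_const
  have key : ∀ {w θ : ℝ × ℝ → ℝ}, IntegrableOn w Q → Continuous θ → HasCompactSupport θ →
      IntegrableOn (fun p => w p * θ p) Q := by
    intro w θ hw hθ hθc
    obtain ⟨C, hC⟩ := hθ.bounded_above_of_compact_support hθc
    exact Integrable.mul_bdd (c := C) hw hθ.aestronglyMeasurable (ae_of_all _ hC)
  rw [← sub_eq_zero, sub_neg_eq_add]
  set If := ∫ p in Q, |f p|
  set Ig := ∫ p in Q, |g p|
  have hIf : 0 ≤ If := integral_nonneg fun _ => abs_nonneg _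
  have hIg : 0 ≤ Ig := integral_nonneg fun _ => abs_nonneg _
  have small : ∀ {w θ θ' : ℝ × ℝ → ℝ} {ε : ℝ}, IntegrableOn w Q →
      IntegrableOn (fun p => w p * θ p) Q → IntegrableOn (fun p => w p * θ' p) Q →
      (∀ p, |θ p - θ' p| ≤ ε) →
      |(∫ p in Q, w p * θ p) - ∫ p in Q, w p * θ' p| ≤ (∫ p in Q, |w p|) * ε := by
    intro w θ θ' ε hw h h' hle
    rw [← integral_sub h h', ← integral_mul_const]
    refine (abs_integral_le_integral_abs).trans (integral_mono (h.sub h').abs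
      (hw.abs.mul_const _) fun p => ?_)
    simp only [← mul_sub, abs_mul]
    exact mul_le_mul_of_nonneg_left (hle p) (abs_nonneg _)
  by_contra hne
  set X := (∫ p in Q, f p * fderiv ℝ φ p (1, 0)) + ∫ p in Q, g p * φ p
  have hX : 0 < |X| := abs_pos.2 hne
  obtain ⟨ψ, hψ, hψc, hψs, h0, h1⟩ := exists_smooth_approx hQ hφ hc hs
    (ε := |X| / (2 * (If + Ig + 1))) (by positivity)
  have e := H ψ hψ hψc hψs
  have hψc' : HasCompactSupport (fun p => fderiv ℝ ψ p (1, 0)) :=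
    (hψc.fderiv (𝕜 := ℝ)).comp_left (g := fun l : (ℝ × ℝ) →L[ℝ] ℝ => l (1, 0)) rfl
  have hψd : Continuous (fun p => fderiv ℝ ψ p (1, 0)) :=
    (hψ.continuous_fderiv (by simp)).clm_apply continuous_const
  have b1 := small hf (key hf hψd hψc') (key hf hd hc') h1
  have b0 := small hg (key hg hψ.continuous hψc) (key hg hφ.continuous hc) h0
  have : |X| ≤ (If + Ig) * (|X| / (2 * (If + Ig + 1))) := by
    have : X = -((∫ p in Q, f p * fderiv ℝ ψ p (1, 0)) - ∫ p in Q, f p * fderiv ℝ φ p (1, 0))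
        - ((∫ p in Q, g p * ψ p) - ∫ p in Q, g p * φ p) := by
      simp only [X]; linarith
    calc |X| ≤ _ + _ := by rw [this]; exact abs_sub _ _
      _ ≤ If * (|X| / (2 * (If + Ig + 1))) + Ig * (|X| / (2 * (If + Ig + 1))) := by
        rw [abs_neg]; exact add_le_add b1 b0
      _ = _ := by ring
  have h2 : (If + Ig) * (|X| / (2 * (If + Ig + 1))) < |X| := by
    rw [mul_div_assoc', div_lt_iff₀ (by positivity)]
    nlinarith
  linarith

/-! ### The moving frame -/

/-- The space-time strip `{0 < t < T, a(t) < x < a(t) + g(t)}`. -/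
def strip (T : ℝ) (a g : ℝ → ℝ) : Set (ℝ × ℝ) :=
  {p | p.1 ∈ Ioo 0 T ∧ p.2 ∈ Ioo (a p.1) (a p.1 + g p.1)}

/-- The parametrization of the strip by a rectangle. -/
def frame (a g : ℝ → ℝ) (p : ℝ × ℝ) : ℝ × ℝ := (p.1, a p.1 + g p.1 * p.2)

section Frame

variable {T : ℝ} {a g : ℝ → ℝ}

theorem continuous_frame (ha : Continuous a) (hg : Continuous g) : Continuous (frame a g) := by
  unfold frame; fun_prop

theorem isOpen_strip (ha : Continuous a) (hg : Continuous g) : IsOpen (strip T a g) := by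
  have : strip T a g = {p | 0 < p.1} ∩ {p | p.1 < T} ∩ {p | a p.1 < p.2} ∩
      {p | p.2 < a p.1 + g p.1} := by
    ext p; simp [strip, and_assoc]
  rw [this]
  refine (((isOpen_lt ?_ ?_).inter (isOpen_lt ?_ ?_)).inter (isOpen_lt ?_ ?_)).inter
    (isOpen_lt ?_ ?_) <;> fun_prop

/-- Change of variables slice by slice; the Jacobian is the length g(t). No differentiability in
time is involved. -/
theorem map_frame (ha : Continuous a) (hg : Continuous g) (hpos : ∀ t, 0 < g t) :
    Measure.map (frame a g) ((rect T).withDensity fun p => ENNReal.ofReal (g p.1)) =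
      volume.restrict (strip T a g) := by
  have hm := (continuous_frame ha hg).measurable
  have hgm : Measurable fun p : ℝ × ℝ => ENNReal.ofReal (g p.1) := by fun_prop
  refine Measure.ext_of_lintegral _ fun H hH => ?_
  rw [lintegral_map hH hm]
  refine (lintegral_withDensity_eq_lintegral_mul _ hgm (hH.comp hm)).trans ?_
  have hS : MeasurableSet (strip T a g) := (isOpen_strip ha hg).measurableSet
  rw [← lintegral_indicator hS, Measure.volume_eq_prod,
    lintegral_prod _ (hH.indicator hS).aemeasurable, rect,
    lintegral_prod _ (by exact (hgm.mul (hH.comp hm)).aemeasurable),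
    ← lintegral_indicator measurableSet_Ioo]
  refine lintegral_congr fun t => ?_
  by_cases ht : t ∈ Ioo 0 T
  · rw [indicator_of_mem ht]
    have e1 : ∀ x, (strip T a g).indicator H (t, x) =
        (Ioo (a t) (a t + g t)).indicator (fun x => H (t, x)) x := by
      intro x
      by_cases hx : x ∈ Ioo (a t) (a t + g t)
      · rw [indicator_of_mem hx, indicator_of_mem]; exact ⟨ht, hx⟩
      · rw [indicator_of_notMem hx, indicator_of_notMem]; exact fun h => hx h.2
    simp only [e1, lintegral_indicator measurableSet_Ioo, Pi.mul_apply]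
    have hHt : Measurable fun x => H (t, x) := hH.comp measurable_prodMk_left
    have e2 := lintegral_map (μ := volume.restrict (Ioo 0 1)) hHt
      (show Measurable fun y => a t + g t * y by fun_prop)
    rw [map_affine_restrict (a t) (hpos t), lintegral_smul_measure] at e2
    rw [lintegral_const_mul _ (by exact (hH.comp hm).comp measurable_prodMk_left)]
    change _ * ∫⁻ y in Ioo 0 1, H (t, a t + g t * y) = _
    rw [← e2, smul_eq_mul, ← mul_assoc, abs_of_pos (inv_pos.2 (hpos t)),
      ← ENNReal.ofReal_mul (hpos t).le, mul_inv_cancel₀ (hpos t).ne']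
    simp
  · rw [indicator_of_notMem ht]
    symm
    rw [← lintegral_zero (μ := (volume : Measure ℝ))]
    refine lintegral_congr fun x => ?_
    rw [indicator_of_notMem]; exact fun h => ht h.1

/-- The Jacobian is bounded below on [0,T], so null sets and square integrability on the strip pass
to the rectangle. -/
theorem rect_le (hg : Continuous g) (hpos : ∀ t, 0 < g t) :
    ∃ C : ℝ≥0, rect T ≤ C • (rect T).withDensity fun p => ENNReal.ofReal (g p.1) := by
  obtain ⟨C, hC⟩ := (isCompact_Icc (a := (0 : ℝ)) (b := T)).exists_bound_of_continuousOn
    (f := fun t => (g t)⁻¹) (hg.inv₀ fun t => (hpos t).ne').continuousOn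
  refine ⟨C.toNNReal, ?_⟩
  have hgm : Measurable fun p : ℝ × ℝ => ENNReal.ofReal (g p.1) := by fun_prop
  have : rect T ≤ (rect T).withDensity
      (fun p => (C.toNNReal : ℝ≥0∞) * ENNReal.ofReal (g p.1)) := by
    conv_lhs => rw [← withDensity_one (μ := rect T)]
    refine withDensity_mono ?_
    filter_upwards [ae_mem_rect T] with p hp
    have h1 := hC p.1 hp.1
    rw [Real.norm_of_nonneg (inv_nonneg.2 (hpos _).le)] at h1
    have h0 : 0 ≤ C := (inv_nonneg.2 (hpos p.1).le).trans h1
    change 1 ≤ _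
    rw [show (C.toNNReal : ℝ≥0∞) = ENNReal.ofReal C from rfl, ← ENNReal.ofReal_mul h0]
    refine ENNReal.one_le_ofReal.2 ?_
    have := hpos p.1
    calc 1 = (g p.1)⁻¹ * g p.1 := (inv_mul_cancel₀ this.ne').symm
      _ ≤ C * g p.1 := by gcongr
  refine this.trans (le_of_eq ?_)
  rw [show (fun p : ℝ × ℝ => (C.toNNReal : ℝ≥0∞) * ENNReal.ofReal (g p.1)) =
    (C.toNNReal : ℝ≥0∞) • fun p : ℝ × ℝ => ENNReal.ofReal (g p.1) from rfl,
    withDensity_smul _ hgm]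
  rfl

theorem memLp_frame (ha : Continuous a) (hg : Continuous g) (hpos : ∀ t, 0 < g t)
    {H : ℝ × ℝ → ℝ} (hH : MemLp H 2 (volume.restrict (strip T a g))) :
    MemLp (fun p => H (frame a g p)) 2 (rect T) := by
  obtain ⟨C, hC⟩ := rect_le (T := T) hg hpos
  rw [← map_frame ha hg hpos] at hH
  have := hH.comp_of_map (continuous_frame ha hg).measurable.aemeasurable
  exact this.of_measure_le_smul (c := C) (by simp) hC

theorem ae_frame (ha : Continuous a) (hg : Continuous g) (hpos : ∀ t, 0 < g t)
    {P : ℝ × ℝ → Prop} (h : ∀ᵐ p ∂(volume.restrict (strip T a g)), P p) :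
    ∀ᵐ p ∂(rect T), P (frame a g p) := by
  obtain ⟨C, hC⟩ := rect_le (T := T) hg hpos
  rw [← map_frame ha hg hpos] at h
  have h2 := ae_of_ae_map (continuous_frame ha hg).measurable.aemeasurable h
  exact (Measure.absolutelyContinuous_of_le_smul hC).ae_le h2

theorem integral_strip (ha : Continuous a) (hg : Continuous g) (hpos : ∀ t, 0 < g t)
    {H : ℝ × ℝ → ℝ} (hH : AEStronglyMeasurable H (volume.restrict (strip T a g))) :
    ∫ p in strip T a g, H p = ∫ p, g p.1 * H (frame a g p) ∂(rect T) := by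
  rw [← map_frame ha hg hpos] at hH ⊢
  rw [integral_map (continuous_frame ha hg).measurable.aemeasurable hH]
  have := integral_withDensity_eq_integral_smul (μ := rect T)
    (f := fun p : ℝ × ℝ => (g p.1).toNNReal) (by fun_prop) (fun p => H (frame a g p))
  refine (this.trans ?_)
  refine integral_congr_ae (ae_of_all _ fun p => ?_)
  simp only [NNReal.smul_def, Real.coe_toNNReal _ (hpos p.1).le, smul_eq_mul]

end Frame

theorem HasH1Deriv.of_contDiff {φ : ℝ → ℝ} {a b : ℝ} (hφ : ContDiff ℝ 1 φ) (hab : a ≤ b) :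
    HasH1Deriv a b φ (deriv φ) := by
  refine ((HasH1Deriv.linear (a := a) (b := b) 1 0).comp hφ hab).congr (fun x _ => by simp)
    (ae_of_all _ fun x => by simp)

section Frame

variable {T : ℝ} {a g : ℝ → ℝ}

theorem strip_subset (hpos : ∀ t, 0 < g t) :
    strip T a g ⊆ frame a g '' (Icc 0 T ×ˢ Icc 0 1) := by
  rintro ⟨t, x⟩ ⟨ht, hx⟩
  have := hpos t
  refine ⟨(t, (x - a t) / g t), ⟨Ioo_subset_Icc_self ht, ?_, ?_⟩, ?_⟩
  · exact div_nonneg (by linarith [hx.1]) this.le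
  · exact (div_le_one this).2 (by linarith [hx.2])
  · simp only [frame, Prod.mk.injEq, true_and]
    field_simp
    ring

theorem isFiniteMeasure_strip (ha : Continuous a) (hg : Continuous g) (hpos : ∀ t, 0 < g t) :
    IsFiniteMeasure (volume.restrict (strip T a g)) := by
  refine isFiniteMeasure_restrict.2 (ne_of_lt ?_)
  exact (measure_mono (strip_subset hpos)).trans_lt (((isCompact_Icc.prod isCompact_Icc).image
    (continuous_frame ha hg)).measure_lt_top)

set_option maxHeartbeats 1000000 in
/-- The weak time derivative in a moving frame, tested with a product. -/
theorem integral_frame_deriv (ha : ContDiff ℝ 1 a) (hg : ContDiff ℝ 1 g)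
    (hpos : ∀ t, 0 < g t) {f ft fx : ℝ × ℝ → ℝ} (H : HasWeakTimeDeriv (strip T a g) f ft)
    (hf : MemLp f 2 (volume.restrict (strip T a g)))
    (hft : MemLp ft 2 (volume.restrict (strip T a g)))
    (hfx : MemLp fx 2 (volume.restrict (strip T a g)))
    (hx : ∀ᵐ t ∂(volume.restrict (Ioo 0 T)),
      HasH1Deriv 0 1 (fun y => f (frame a g (t, y))) (fun y => g t * fx (frame a g (t, y))))
    {α β : ℝ → ℝ} (hα : ContDiff ℝ 1 α) (hαc : HasCompactSupport α) (hαs : tsupport α ⊆ Ioo 0 T)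
    (hβ : ContDiff ℝ 1 β) (hβc : HasCompactSupport β) (hβs : tsupport β ⊆ Ioo 0 1) :
    ∫ p, f (frame a g p) * (deriv α p.1 * β p.2) ∂(rect T) =
      -∫ p, (ft (frame a g p) + (deriv a p.1 + deriv g p.1 * p.2) * fx (frame a g p)) *
        (α p.1 * β p.2) ∂(rect T) := by
  have hac := ha.continuous
  have hgc := hg.continuous
  have hg0 : ∀ t, g t ≠ 0 := fun t => (hpos t).ne'
  -- The product α(t)β(y) in physical coordinates. The division by g compensates the Jacobian of the
  -- frame.
  set φ : ℝ × ℝ → ℝ := fun p => α p.1 * β ((p.2 - a p.1) / g p.1) / g p.1 with hφdef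
  have hφ : ContDiff ℝ 1 φ := by
    have h1 : ContDiff ℝ 1 fun p : ℝ × ℝ => g p.1 := hg.comp contDiff_fst
    have h2 : ContDiff ℝ 1 fun p : ℝ × ℝ => a p.1 := ha.comp contDiff_fst
    exact ((hα.comp contDiff_fst).mul
      (hβ.comp ((contDiff_snd.sub h2).div h1 fun p => hg0 _))).div h1 fun p => hg0 _
  have hK : IsCompact (frame a g '' (tsupport α ×ˢ tsupport β)) :=
    (hαc.isCompact.prod hβc.isCompact).image (continuous_frame hac hgc)
  have hsub : Function.support φ ⊆ frame a g '' (tsupport α ×ˢ tsupport β) := by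
    rintro ⟨t, x⟩ hp
    have hp' : α t * β ((x - a t) / g t) / g t ≠ 0 := hp
    refine ⟨(t, (x - a t) / g t), ⟨subset_tsupport _ ?_, subset_tsupport _ ?_⟩, ?_⟩
    · intro h0; rw [h0] at hp'; simp at hp'
    · intro h0; rw [h0] at hp'; simp at hp'
    · have := hg0 t
      simp only [frame, Prod.mk.injEq, true_and]
      field_simp
      ring
  have hts : tsupport φ ⊆ frame a g '' (tsupport α ×ˢ tsupport β) :=
    closure_minimal hsub hK.isClosed
  have hstrip : tsupport φ ⊆ strip T a g := by
    refine hts.trans ?_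
    rintro _ ⟨⟨t, y⟩, ⟨h1, h2⟩, rfl⟩
    have hy := hβs h2
    have := hpos t
    simp only at hy
    exact ⟨hαs h1, by simp only [frame]; nlinarith [hy.1], by simp only [frame]; nlinarith [hy.2]⟩
  have hφc : HasCompactSupport φ := HasCompactSupport.intro hK fun p hp => by
    by_contra h; exact hp (hsub h)
  have := isFiniteMeasure_strip (T := T) hac hgc hpos
  have key := H.of_contDiff_one (isOpen_strip hac hgc) (hf.integrable (by norm_num))
    (hft.integrable (by norm_num)) hφ hφc hstrip
  have hd : Continuous (fun p => fderiv ℝ φ p (1, 0)) :=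
    (hφ.continuous_fderiv one_ne_zero).clm_apply continuous_const
  have s1 := integral_strip hac hgc hpos (hf.aestronglyMeasurable.mul hd.aestronglyMeasurable)
  have s2 := integral_strip hac hgc hpos
    (hft.aestronglyMeasurable.mul hφ.continuous.aestronglyMeasurable)
  simp only [Pi.mul_apply] at s1 s2
  rw [s1, s2] at key
  have hφt : ∀ t y, fderiv ℝ φ (frame a g (t, y)) (1, 0) =
      (deriv α t * β y - α t * (deriv β y * (deriv a t + deriv g t * y) / g t
        + β y * deriv g t / g t)) / g t := by
    intro t y
    have h1 : HasDerivAt (fun s => φ (s, a t + g t * y))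
        (fderiv ℝ φ (frame a g (t, y)) (1, 0)) t :=
      ((hφ.differentiable one_ne_zero _).hasFDerivAt).comp_hasDerivAt t
        ((hasDerivAt_id t).prodMk (hasDerivAt_const t (a t + g t * y)))
    have e0 : (a t + g t * y - a t) / g t = y := by
      have := hg0 t
      field_simp
      ring
    have dg := (hg.differentiable one_ne_zero t).hasDerivAt
    have da := (ha.differentiable one_ne_zero t).hasDerivAt
    have dq := (((hasDerivAt_const t (a t + g t * y)).sub da).div dg (hg0 t))
    have db : HasDerivAt β (deriv β y) ((a t + g t * y - a t) / g t) := by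
      rw [e0]; exact (hβ.differentiable one_ne_zero y).hasDerivAt
    have h2 := (((hα.differentiable one_ne_zero t).hasDerivAt).mul (db.comp t dq)).div dg (hg0 t)
    have := h1.unique h2
    rw [this]
    simp only [Pi.sub_apply, Function.comp_apply, Pi.mul_apply, Pi.div_apply, e0]
    have := hg0 t
    field_simp
    ring
  have mF : MemLp (fun p => f (frame a g p)) 2 (rect T) := memLp_frame hac hgc hpos hf
  have mFt : MemLp (fun p => ft (frame a g p)) 2 (rect T) := memLp_frame hac hgc hpos hft
  have mFx : MemLp (fun p => fx (frame a g p)) 2 (rect T) := memLp_frame hac hgc hpos hfx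
  have da := ha.continuous_deriv le_rfl
  have dg := hg.continuous_deriv le_rfl
  have dα := hα.continuous_deriv le_rfl
  have dβ := hβ.continuous_deriv le_rfl
  have mk : ∀ {G w : ℝ × ℝ → ℝ}, MemLp G 2 (rect T) → Continuous w →
      Integrable (fun p => G p * w p) (rect T) := fun hG hw =>
    (hG.mul (memLp_top_rect hw.continuousOn) (r := 2)).integrable (by norm_num) |>.congr
      (ae_of_all _ fun p => by simp [mul_comm])
  have hw : Continuous fun p : ℝ × ℝ => α p.1 * (deriv β p.2 * (deriv a p.1 + deriv g p.1 * p.2)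
      / g p.1 + β p.2 * deriv g p.1 / g p.1) := by
    have hinv : Continuous fun p : ℝ × ℝ => (g p.1)⁻¹ :=
      (hgc.comp continuous_fst).inv₀ fun p => hg0 _
    have h1 : Continuous fun p : ℝ × ℝ => deriv β p.2 * (deriv a p.1 + deriv g p.1 * p.2) := by
      fun_prop
    have h2 : Continuous fun p : ℝ × ℝ => β p.2 * deriv g p.1 := by fun_prop
    exact (hα.continuous.comp continuous_fst).mul ((h1.mul hinv).add (h2.mul hinv))
  -- The terms created by the motion of the frame are the y-derivative of β(y)(a' + g'y)/g. An
  -- integration by parts in space converts them to the frame velocity times ∂ₓf.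
  have aux : ∫ p, f (frame a g p) * (α p.1 * (deriv β p.2 * (deriv a p.1 + deriv g p.1 * p.2)
      / g p.1 + β p.2 * deriv g p.1 / g p.1)) ∂(rect T) =
      -∫ p, fx (frame a g p) *
        ((deriv a p.1 + deriv g p.1 * p.2) * (α p.1 * β p.2)) ∂(rect T) := by
    have i1 : Integrable (fun p : ℝ × ℝ => f (frame a g p) *
        (α p.1 * (deriv β p.2 * (deriv a p.1 + deriv g p.1 * p.2)
        / g p.1 + β p.2 * deriv g p.1 / g p.1))) (rect T) :=
      mk mF hw
    have i2 : Integrable (fun p : ℝ × ℝ => fx (frame a g p) *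
        ((deriv a p.1 + deriv g p.1 * p.2) * (α p.1 * β p.2))) (rect T) := mk mFx (by fun_prop)
    rw [integral_prod _ i1, integral_prod _ i2, ← integral_neg]
    refine integral_congr_ae ?_
    filter_upwards [hx] with t ht
    simp only [← integral_unit]
    have cd : ContDiff ℝ 1 fun y => β y * ((deriv a t + deriv g t * y) / g t) := by fun_prop
    have h := ht.integral_deriv_mul (HasH1Deriv.of_contDiff cd zero_le_one) zero_le_one
    have b0 : β 0 = 0 := image_eq_zero_of_notMem_tsupport fun h => by simpa using hβs h
    have b1 : β 1 = 0 := image_eq_zero_of_notMem_tsupport fun h => by simpa using hβs h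
    simp only [b0, b1, zero_mul, mul_zero, sub_zero, zero_sub] at h
    rw [← intervalIntegral.integral_neg] at h ⊢
    have h' := congrArg (α t * ·) h
    simp only [← intervalIntegral.integral_const_mul] at h'
    refine Eq.trans (Eq.trans ?_ h') ?_
    · refine intervalIntegral.integral_congr fun y _ => ?_
      have d1 : HasDerivAt (fun y => β y * ((deriv a t + deriv g t * y) / g t))
          (deriv β y * ((deriv a t + deriv g t * y) / g t) + β y * (deriv g t / g t)) y := by
        refine ((hβ.differentiable one_ne_zero y).hasDerivAt).mul ?_
        simpa using (((hasDerivAt_id y).const_mul (deriv g t)).const_add (deriv a t)).div_const (g t)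
      simp only [d1.deriv]
      ring
    · refine intervalIntegral.integral_congr fun y _ => ?_
      have := hg0 t
      field_simp
  have e1 : ∫ p, g p.1 * (f (frame a g p) * fderiv ℝ φ (frame a g p) (1, 0)) ∂(rect T) =
      (∫ p, f (frame a g p) * (deriv α p.1 * β p.2) ∂(rect T)) -
      ∫ p, f (frame a g p) * (α p.1 * (deriv β p.2 * (deriv a p.1 + deriv g p.1 * p.2)
      / g p.1 + β p.2 * deriv g p.1 / g p.1)) ∂(rect T) := by
    rw [← integral_sub (mk mF (by fun_prop)) (mk mF hw)]
    refine integral_congr_ae (ae_of_all _ fun p => ?_)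
    have := hg0 p.1
    beta_reduce
    rw [show p = (p.1, p.2) from rfl, hφt]
    field_simp
  have e2 : ∫ p, g p.1 * (ft (frame a g p) * φ (frame a g p)) ∂(rect T) =
      ∫ p, ft (frame a g p) * (α p.1 * β p.2) ∂(rect T) := by
    refine integral_congr_ae (ae_of_all _ fun p => ?_)
    have := hg0 p.1
    have e0 : (a p.1 + g p.1 * p.2 - a p.1) / g p.1 = p.2 := by
      field_simp
      ring
    simp only [hφdef, frame, e0]
    field_simp
  have e3 : ∫ p, (ft (frame a g p) + (deriv a p.1 + deriv g p.1 * p.2) * fx (frame a g p)) *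
        (α p.1 * β p.2) ∂(rect T) = (∫ p, ft (frame a g p) * (α p.1 * β p.2) ∂(rect T)) +
      ∫ p, fx (frame a g p) *
        ((deriv a p.1 + deriv g p.1 * p.2) * (α p.1 * β p.2)) ∂(rect T) := by
    rw [← integral_add (mk mFt (by fun_prop)) (mk mFx (by fun_prop))]
    refine integral_congr_ae (ae_of_all _ fun p => ?_)
    ring
  rw [e1, e2, aux] at key
  rw [e3]
  linarith

end Frame

/-! ### The lemma of du Bois-Reymond -/

theorem exists_Icc_of_isCompact {K : Set ℝ} {a b : ℝ} (hab : a < b) (hK : IsCompact K)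
    (h : K ⊆ Ioo a b) : ∃ p q, a < p ∧ p ≤ q ∧ q < b ∧ K ⊆ Icc p q := by
  rcases K.eq_empty_or_nonempty with rfl | hne
  · exact ⟨(a + b) / 2, (a + b) / 2, by linarith, le_rfl, by linarith, empty_subset _⟩
  · obtain ⟨p, hp⟩ := hK.exists_isLeast hne
    obtain ⟨q, hq⟩ := hK.exists_isGreatest hne
    exact ⟨p, q, (h hp.1).1, hp.2 hq.1, (h hq.1).2, fun x hx => ⟨hp.2 hx, hq.2 hx⟩⟩

/-- The vanishing mean is exactly what makes the primitive vanish again to the right of the support.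
-/
theorem exists_primitive_compact {κ : ℝ → ℝ} {T : ℝ} (hT : 0 < T) (hκ : Continuous κ)
    (hc : HasCompactSupport κ) (hs : tsupport κ ⊆ Ioo 0 T) (h0 : ∫ t in (0 : ℝ)..T, κ t = 0) :
    ∃ θ : ℝ → ℝ, ContDiff ℝ 1 θ ∧ HasCompactSupport θ ∧ tsupport θ ⊆ Ioo 0 T ∧ deriv θ = κ := by
  obtain ⟨p, q, hp, hpq, hq, hsub⟩ := exists_Icc_of_isCompact hT hc.isCompact hs
  have hd : ∀ t, HasDerivAt (fun t => ∫ s in (0 : ℝ)..t, κ s) (κ t) t := fun t =>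
    intervalIntegral.integral_hasDerivAt_right (hκ.intervalIntegrable _ _)
      hκ.stronglyMeasurable.stronglyMeasurableAtFilter hκ.continuousAt
  have hder : deriv (fun t => ∫ s in (0 : ℝ)..t, κ s) = κ := funext fun t => (hd t).deriv
  have zero : ∀ s, s ∉ Icc p q → κ s = 0 := fun s hs =>
    image_eq_zero_of_notMem_tsupport fun h => hs (hsub h)
  have hsupp : ∀ t, t ∉ Icc p q → ∫ s in (0 : ℝ)..t, κ s = 0 := by
    intro t ht
    rw [mem_Icc, not_and_or, not_le, not_le] at ht
    rcases ht with ht | ht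
    · refine intervalIntegral.integral_zero_ae (ae_of_all _ fun s hs => zero s fun h => ?_)
      rcases le_total 0 t with h0t | h0t
      · rw [uIoc_of_le h0t] at hs; linarith [hs.2, h.1]
      · rw [uIoc_of_ge h0t] at hs; linarith [hs.2, h.1]
    · have e : ∫ s in t..T, κ s = 0 := by
        refine intervalIntegral.integral_zero_ae (ae_of_all _ fun s hs => zero s fun h => ?_)
        rcases le_total t T with h0t | h0t
        · rw [uIoc_of_le h0t] at hs; linarith [hs.1, h.2]
        · rw [uIoc_of_ge h0t] at hs; linarith [hs.1, h.2]
      have := intervalIntegral.integral_add_adjacent_intervals (hκ.intervalIntegrable 0 t)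
        (hκ.intervalIntegrable (μ := volume) t T)
      linarith
  refine ⟨fun t => ∫ s in (0 : ℝ)..t, κ s, ?_, ?_, ?_, hder⟩
  · exact contDiff_one_iff_deriv.2 ⟨fun t => (hd t).differentiableAt, by rw [hder]; exact hκ⟩
  · exact HasCompactSupport.intro isCompact_Icc hsupp
  · refine (closure_minimal (fun t ht => ?_) isClosed_Icc).trans
      (fun t ht => ⟨hp.trans_le ht.1, ht.2.trans_lt hq⟩ : Icc p q ⊆ Ioo 0 T)
    by_contra h; exact ht (hsupp t h)

/-- An integrable function on a rectangle that vanishes against all products of test functions. -/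
theorem ae_eq_zero_of_integral_tensor {T : ℝ} {Z : ℝ × ℝ → ℝ} (hZ : Integrable Z (rect T))
    (h : ∀ α β : ℝ → ℝ, ContDiff ℝ ∞ α → HasCompactSupport α → tsupport α ⊆ Ioo 0 T →
      ContDiff ℝ ∞ β → HasCompactSupport β → tsupport β ⊆ Ioo 0 1 →
      ∫ p, Z p * (α p.1 * β p.2) ∂(rect T) = 0) : Z =ᵐ[rect T] 0 := by
  have bd : ∀ {f : ℝ → ℝ}, ContDiff ℝ ∞ f → HasCompactSupport f → ∃ C, ∀ x, ‖f x‖ ≤ C :=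
    fun hf hc => hf.continuous.bounded_above_of_compact_support hc
  have h1 : ∀ β : ℝ → ℝ, ContDiff ℝ ∞ β → HasCompactSupport β → tsupport β ⊆ Ioo 0 1 →
      ∀ᵐ t ∂(volume.restrict (Ioo 0 T)), ∫ y in Ioo (0 : ℝ) 1, Z (t, y) * β y = 0 := by
    intro β hβ hβc hβs
    obtain ⟨C, hC⟩ := bd hβ hβc
    have iZ : Integrable (fun p => Z p * β p.2) (rect T) :=
      hZ.mul_bdd (c := C) (hβ.continuous.comp continuous_snd).aestronglyMeasurable
        (ae_of_all _ fun p => hC p.2)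
    have := isOpen_Ioo.ae_eq_zero_of_integral_contDiff_smul_eq_zero (μ := volume)
      (U := Ioo 0 T) (f := fun t => ∫ y in Ioo (0 : ℝ) 1, Z (t, y) * β y)
      (IntegrableOn.locallyIntegrableOn iZ.integral_prod_left) (fun α hα hαc hαs => by
        have e := h α β hα hαc hαs hβ hβc hβs
        obtain ⟨C', hC'⟩ := bd hα hαc
        have i2 : Integrable (fun p => Z p * (α p.1 * β p.2)) (rect T) :=
          (iZ.mul_bdd (c := C') (hα.continuous.comp continuous_fst).aestronglyMeasurable
            (ae_of_all _ fun p => hC' p.1)).congr (ae_of_all _ fun p => by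
              simp only [Function.comp_apply]; ring)
        rw [integral_prod _ i2] at e
        rw [← setIntegral_eq_integral_of_forall_compl_eq_zero (s := Ioo 0 T)]
        · refine Eq.trans ?_ e
          refine integral_congr_ae (ae_of_all _ fun t => ?_)
          simp only [smul_eq_mul]
          refine (integral_const_mul _ _).symm.trans ?_
          refine integral_congr_ae (ae_of_all _ fun y => ?_)
          beta_reduce
          ring
        · intro t ht
          rw [image_eq_zero_of_notMem_tsupport fun h => ht (hαs h), zero_smul])
    exact (ae_restrict_iff' measurableSet_Ioo).2 this
  -- The exceptional set of times found so far depends on β. Integrating over a measurable set of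
  -- times first gives a function of y alone, to which the one-variable lemma applies.
  have h2 : ∀ A : Set ℝ, MeasurableSet A →
      ∀ᵐ y ∂(volume.restrict (Ioo (0 : ℝ) 1)),
        ∫ t in Ioo 0 T, A.indicator (fun t => Z (t, y)) t = 0 := by
    intro A hA
    have iA : Integrable (fun p : ℝ × ℝ => A.indicator (fun t => Z (t, p.2)) p.1) (rect T) := by
      refine (hZ.indicator (hA.prod MeasurableSet.univ)).congr (ae_of_all _ fun p => ?_)
      beta_reduce
      by_cases hp : p.1 ∈ A
      · rw [indicator_of_mem hp, indicator_of_mem (show p ∈ A ×ˢ univ from ⟨hp, mem_univ _⟩)]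
      · rw [indicator_of_notMem hp, indicator_of_notMem (show p ∉ A ×ˢ univ from fun h => hp h.1)]
    have := isOpen_Ioo.ae_eq_zero_of_integral_contDiff_smul_eq_zero (μ := volume)
      (U := Ioo 0 1) (f := fun y => ∫ t in Ioo 0 T, A.indicator (fun t => Z (t, y)) t)
      (IntegrableOn.locallyIntegrableOn iA.integral_prod_right) (fun β hβ hβc hβs => by
        obtain ⟨C, hC⟩ := bd hβ hβc
        have i2 : Integrable (fun p : ℝ × ℝ => β p.2 * A.indicator (fun t => Z (t, p.2)) p.1)
            (rect T) := iA.bdd_mul (c := C)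
              (hβ.continuous.comp continuous_snd).aestronglyMeasurable (ae_of_all _ fun p => hC p.2)
        have e1 : ∫ p, β p.2 * A.indicator (fun t => Z (t, p.2)) p.1 ∂(rect T) = 0 := by
          rw [integral_prod _ i2]
          refine integral_eq_zero_of_ae ?_
          filter_upwards [h1 β hβ hβc hβs] with t ht
          by_cases htA : t ∈ A
          · simp only [indicator_of_mem htA, Pi.zero_apply]
            refine Eq.trans ?_ ht
            exact integral_congr_ae (ae_of_all _ fun y => by ring)
          · simp [indicator_of_notMem htA]
        rw [integral_prod_symm _ i2] at e1
        rw [← setIntegral_eq_integral_of_forall_compl_eq_zero (s := Ioo (0 : ℝ) 1)]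
        · refine Eq.trans ?_ e1
          refine integral_congr_ae (ae_of_all _ fun y => ?_)
          simp only [smul_eq_mul]
          exact (integral_const_mul _ _).symm
        · intro t ht
          rw [image_eq_zero_of_notMem_tsupport fun h => ht (hβs h), zero_smul])
    exact (ae_restrict_iff' measurableSet_Ioo).2 this
  have h3 : ∀ A B : Set ℝ, MeasurableSet A → MeasurableSet B →
      ∫ p in A ×ˢ B, Z p ∂(rect T) = 0 := by
    intro A B hA hB
    rw [← integral_indicator (hA.prod hB), integral_prod_symm _ (hZ.indicator (hA.prod hB))]
    refine integral_eq_zero_of_ae ?_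
    filter_upwards [h2 A hA] with y hy
    by_cases hyB : y ∈ B
    · refine Eq.trans ?_ hy
      refine integral_congr_ae (ae_of_all _ fun t => ?_)
      by_cases ht : t ∈ A
      · simp only [indicator_of_mem ht, indicator_of_mem (show (t, y) ∈ A ×ˢ B from ⟨ht, hyB⟩)]
      · simp only [indicator_of_notMem ht,
          indicator_of_notMem (show (t, y) ∉ A ×ˢ B from fun h => ht h.1)]
    · simp only [Pi.zero_apply]
      refine integral_eq_zero_of_ae (ae_of_all _ fun t => ?_)
      beta_reduce
      rw [indicator_of_notMem (show (t, y) ∉ A ×ˢ B from fun h => hyB h.2), Pi.zero_apply]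
  -- Measurable rectangles are a π-system generating the product σ-algebra.
  have h4 : ∀ S : Set (ℝ × ℝ), MeasurableSet S → ∫ p in S, Z p ∂(rect T) = 0 := by
    intro S hS
    induction S, hS using MeasurableSpace.induction_on_inter generateFrom_prod.symm
      isPiSystem_prod with
    | empty => simp
    | basic S hS =>
      obtain ⟨A, hA, B, hB, rfl⟩ := hS
      exact h3 A B hA hB
    | compl S hS ih =>
      have e := integral_add_compl hS hZ
      have e' := h3 univ univ MeasurableSet.univ MeasurableSet.univ
      rw [univ_prod_univ, Measure.restrict_univ] at e'
      linarith
    | iUnion S hd hS ih =>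
      rw [integral_iUnion hS hd hZ.integrableOn]
      simp [ih]
  exact hZ.ae_eq_zero_of_forall_setIntegral_eq_zero fun S hS _ => h4 S hS

/-- Subtracting from F the time primitive P of D leaves a function W with vanishing weak time
derivative. Such a W does not depend on time: it equals its weighted time mean, and F = mean + P is
the required representative. -/
theorem exists_time_primitive_of_measurable {T : ℝ} (hT : 0 < T) {F D : ℝ × ℝ → ℝ}
    (hFm : Measurable F) (hDm : Measurable D) (hF : MemLp F 2 (rect T)) (hD : MemLp D 2 (rect T))
    (h : ∀ α β : ℝ → ℝ, ContDiff ℝ 1 α → HasCompactSupport α → tsupport α ⊆ Ioo 0 T →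
      ContDiff ℝ 1 β → HasCompactSupport β → tsupport β ⊆ Ioo 0 1 →
      ∫ p, F p * (deriv α p.1 * β p.2) ∂(rect T) = -∫ p, D p * (α p.1 * β p.2) ∂(rect T)) :
    ∃ r : ℝ → ℝ → ℝ, Measurable (fun p : ℝ × ℝ => r p.1 p.2) ∧
      (∀ᵐ y ∂(volume.restrict (Ioo (0 : ℝ) 1)),
        HasH1Deriv 0 T (fun t => r t y) (fun t => D (t, y))) ∧
      ∀ᵐ p ∂(rect T), F p = r p.1 p.2 := by
  have iF : Integrable F (rect T) := hF.integrable (by norm_num)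
  have iD : Integrable D (rect T) := hD.integrable (by norm_num)
  -- The variable upper limit is written as a cut-off in the integrand to make P jointly measurable.
  let P : ℝ × ℝ → ℝ := fun p => ∫ s in Ioo 0 T, if s < p.1 then D (s, p.2) else 0
  have hPm : Measurable P := by
    have : StronglyMeasurable fun q : (ℝ × ℝ) × ℝ => if q.2 < q.1.1 then D (q.2, q.1.2) else 0 :=
      (Measurable.ite (measurableSet_lt (by fun_prop) (by fun_prop)) (by fun_prop)
        measurable_const).stronglyMeasurable
    exact this.integral_prod_right.measurable
  have hPeq : ∀ t ∈ Icc 0 T, ∀ y, P (t, y) = ∫ s in (0 : ℝ)..t, D (s, y) := by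
    intro t ht y
    rw [intervalIntegral.integral_of_le ht.1, integral_Ioc_eq_integral_Ioo]
    have : (fun s => if s < t then D (s, y) else 0) = (Iio t).indicator fun s => D (s, y) := by
      ext s; simp [indicator]
    change ∫ s in Ioo 0 T, (if s < t then D (s, y) else 0) = _
    rw [this, setIntegral_indicator measurableSet_Iio, Ioo_inter_Iio, min_eq_right ht.2]
  have hP1 : ∀ᵐ y ∂(volume.restrict (Ioo (0 : ℝ) 1)),
      HasH1Deriv 0 T (fun t => P (t, y)) (fun t => D (t, y)) := by
    filter_upwards [memLp_slice_right hD] with y hy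
    refine ⟨hy, fun t ht => ?_⟩
    beta_reduce
    rw [hPeq t ht, hPeq 0 ⟨le_rfl, hT.le⟩]
    simp
  have iP : Integrable P (rect T) := by
    have : Integrable (fun p : ℝ × ℝ => ∫ s in Ioo 0 T, |D (s, p.2)|) (rect T) :=
      (iD.abs.integral_prod_right).comp_snd _
    refine this.mono' hPm.aestronglyMeasurable ?_
    have h1 : ∀ᵐ p ∂(rect T), Integrable (fun s => D (s, p.2)) (volume.restrict (Ioo 0 T)) :=
      ae_rect_right iD.prod_left_ae
    filter_upwards [h1] with p hp
    refine (norm_integral_le_integral_norm _).trans (integral_mono_of_nonneg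
      (ae_of_all _ fun _ => norm_nonneg _) hp.abs (ae_of_all _ fun s => ?_))
    beta_reduce
    split_ifs <;> simp
  -- A weight of mass one supported inside (0,T). Subtracting its multiple gives an arbitrary test
  -- function in time the mean zero needed for a compactly supported primitive.
  let χ : ContDiffBump (T / 2 : ℝ) := ⟨T / 8, T / 4, by positivity, by linarith⟩
  set α₀ := χ.normed volume
  have hα₀ : ContDiff ℝ ∞ α₀ := χ.contDiff_normed
  have hα₀c : HasCompactSupport α₀ := χ.hasCompactSupport_normed
  have hα₀s : tsupport α₀ ⊆ Ioo 0 T := by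
    rw [χ.tsupport_normed_eq, Real.closedBall_eq_Icc]
    intro t ht
    have h1 : T / 2 - T / 4 ≤ t := ht.1
    have h2 : t ≤ T / 2 + T / 4 := ht.2
    exact ⟨by linarith, by linarith⟩
  have hfull : ∀ {f : ℝ → ℝ}, tsupport f ⊆ Ioo 0 T → ∫ t in (0 : ℝ)..T, f t = ∫ t, f t := by
    intro f hf
    rw [intervalIntegral.integral_of_le hT.le, integral_Ioc_eq_integral_Ioo,
      setIntegral_eq_integral_of_forall_compl_eq_zero]
    exact fun t ht => image_eq_zero_of_notMem_tsupport fun h => ht (hf h)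
  have hα₀1 : ∫ t in (0 : ℝ)..T, α₀ t = 1 := by rw [hfull hα₀s]; exact χ.integral_normed
  let W : ℝ × ℝ → ℝ := fun p => F p - P p
  have hWm : Measurable W := hFm.sub hPm
  have iW : Integrable W (rect T) := iF.sub iP
  have mulc : ∀ {G w : ℝ × ℝ → ℝ}, Integrable G (rect T) → Continuous w →
      Integrable (fun p => G p * w p) (rect T) := by
    intro G w hG hw
    obtain ⟨C, hC⟩ := (isCompact_Icc.prod isCompact_Icc :
      IsCompact (Icc 0 T ×ˢ Icc (0 : ℝ) 1)).exists_bound_of_continuousOn hw.continuousOn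
    refine hG.mul_bdd (c := C) hw.aestronglyMeasurable ?_
    filter_upwards [ae_mem_rect T] with p hp using hC p hp
  have hκ : ∀ κ β : ℝ → ℝ, Continuous κ → HasCompactSupport κ → tsupport κ ⊆ Ioo 0 T →
      ∫ t in (0 : ℝ)..T, κ t = 0 → ContDiff ℝ 1 β → HasCompactSupport β → tsupport β ⊆ Ioo 0 1 →
      ∫ p, W p * (κ p.1 * β p.2) ∂(rect T) = 0 := by
    intro κ β k1 k2 k3 k4 b1 b2 b3
    obtain ⟨θ, θ1, θ2, θ3, rfl⟩ := exists_primitive_compact hT k1 k2 k3 k4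
    have e := h θ β θ1 θ2 θ3 b1 b2 b3
    have cβ := b1.continuous
    have cθ := θ1.continuous
    have i1 := mulc (w := fun p => deriv θ p.1 * β p.2) iP (by fun_prop)
    have i2 := mulc (w := fun p => θ p.1 * β p.2) iD (by fun_prop)
    have e2 : ∫ p, P p * (deriv θ p.1 * β p.2) ∂(rect T) =
        -∫ p, D p * (θ p.1 * β p.2) ∂(rect T) := by
      rw [integral_prod_symm _ i1, integral_prod_symm _ i2, ← integral_neg]
      refine integral_congr_ae ?_
      filter_upwards [hP1] with y hy
      have := hy.integral_deriv_mul (HasH1Deriv.of_contDiff θ1 hT.le) hT.le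
      have t0 : θ 0 = 0 := image_eq_zero_of_notMem_tsupport fun h => by simpa using θ3 h
      have t1 : θ T = 0 := image_eq_zero_of_notMem_tsupport fun h => by simpa using θ3 h
      rw [t0, t1, intervalIntegral.integral_of_le hT.le, intervalIntegral.integral_of_le hT.le,
        integral_Ioc_eq_integral_Ioo, integral_Ioc_eq_integral_Ioo] at this
      simp only [mul_zero, sub_zero, zero_sub] at this
      have := congrArg (· * β y) this
      simp only [neg_mul, ← integral_mul_const] at this
      simpa only [mul_assoc] using this
    have i3 := mulc (w := fun p => deriv θ p.1 * β p.2) iF (by fun_prop)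
    have : ∫ p, W p * (deriv θ p.1 * β p.2) ∂(rect T) =
        (∫ p, F p * (deriv θ p.1 * β p.2) ∂(rect T)) -
          ∫ p, P p * (deriv θ p.1 * β p.2) ∂(rect T) := by
      rw [← integral_sub i3 i1]
      exact integral_congr_ae (ae_of_all _ fun p => by simp only [W]; ring)
    rw [this, e, e2, sub_self]
  let W₀ : ℝ → ℝ := fun y => ∫ s in Ioo 0 T, W (s, y) * α₀ s
  have cα₀ := hα₀.continuous
  have iW0 := mulc (w := fun p => α₀ p.1) iW (by fun_prop)
  have hW₀m : Measurable W₀ := by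
    have : StronglyMeasurable fun q : ℝ × ℝ => W (q.2, q.1) * α₀ q.2 :=
      ((hWm.comp (measurable_snd.prodMk measurable_fst)).mul
        (cα₀.measurable.comp measurable_snd)).stronglyMeasurable
    exact this.integral_prod_right.measurable
  have iW₀ : Integrable (fun p : ℝ × ℝ => W₀ p.2) (rect T) := iW0.integral_prod_right.comp_snd _
  have hZ : (fun p => W p - W₀ p.2) =ᵐ[rect T] 0 := by
    refine ae_eq_zero_of_integral_tensor (iW.sub iW₀) fun α β a1 a2 a3 b1 b2 b3 => ?_
    have cα := a1.continuous
    have cβ := b1.continuous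
    set c := ∫ t in (0 : ℝ)..T, α t
    have e1 := hκ (fun t => α t - c * α₀ t) β (by fun_prop) (a2.sub (hα₀c.mul_left (f := fun _ => c)))
      ((tsupport_sub _ _).trans (union_subset a3
        ((tsupport_mul_subset_right (f := fun _ => c) (g := α₀)).trans hα₀s)))
      (by
        rw [intervalIntegral.integral_sub (cα.intervalIntegrable _ _)
          ((cα₀.const_mul c).intervalIntegrable _ _), intervalIntegral.integral_const_mul, hα₀1]
        ring) (b1.of_le (by simp)) b2 b3
    have j1 := mulc (w := fun p => α p.1 * β p.2) iW (by fun_prop)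
    have j2 := mulc (w := fun p => α₀ p.1 * β p.2) iW (by fun_prop)
    have j3 := mulc (w := fun p => α p.1 * β p.2) iW₀ (by fun_prop)
    have e2 : ∫ p, W₀ p.2 * (α p.1 * β p.2) ∂(rect T) =
        c * ∫ p, W p * (α₀ p.1 * β p.2) ∂(rect T) := by
      rw [integral_prod_symm _ j3, integral_prod_symm _ j2, ← integral_const_mul]
      refine integral_congr_ae (ae_of_all _ fun y => ?_)
      have : ∫ s in Ioo 0 T, W (s, y) * (α₀ s * β y) = W₀ y * β y := by
        rw [← integral_mul_const]
        exact integral_congr_ae (ae_of_all _ fun s => by ring)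
      simp only [this]
      rw [integral_const_mul, integral_mul_const]
      simp only [c]
      rw [intervalIntegral.integral_of_le hT.le, integral_Ioc_eq_integral_Ioo]
      ring
    have e3 : ∫ p, W p * ((α p.1 - c * α₀ p.1) * β p.2) ∂(rect T) =
        (∫ p, W p * (α p.1 * β p.2) ∂(rect T)) - c * ∫ p, W p * (α₀ p.1 * β p.2) ∂(rect T) := by
      rw [← integral_const_mul, ← integral_sub j1 (j2.const_mul c)]
      exact integral_congr_ae (ae_of_all _ fun p => by ring)
    have e4 : ∫ p, (W p - W₀ p.2) * (α p.1 * β p.2) ∂(rect T) =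
        (∫ p, W p * (α p.1 * β p.2) ∂(rect T)) - ∫ p, W₀ p.2 * (α p.1 * β p.2) ∂(rect T) := by
      rw [← integral_sub j1 j3]
      exact integral_congr_ae (ae_of_all _ fun p => by ring)
    rw [e4, e2, ← e3, e1]
  refine ⟨fun t y => W₀ y + P (t, y), ?_, ?_, ?_⟩
  · exact (hW₀m.comp measurable_snd).add hPm
  · filter_upwards [hP1] with y hy
    exact ((HasH1Deriv.const (W₀ y)).add hy).congr (fun t _ => rfl) (ae_of_all _ fun t => by simp)
  · filter_upwards [hZ] with p hp
    have : W p - W₀ p.2 = 0 := hp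
    simp only [W] at this
    change F p = W₀ p.2 + P p
    linarith

theorem exists_time_primitive {T : ℝ} (hT : 0 < T) {F D : ℝ × ℝ → ℝ}
    (hF : MemLp F 2 (rect T)) (hD : MemLp D 2 (rect T))
    (h : ∀ α β : ℝ → ℝ, ContDiff ℝ 1 α → HasCompactSupport α → tsupport α ⊆ Ioo 0 T →
      ContDiff ℝ 1 β → HasCompactSupport β → tsupport β ⊆ Ioo 0 1 →
      ∫ p, F p * (deriv α p.1 * β p.2) ∂(rect T) = -∫ p, D p * (α p.1 * β p.2) ∂(rect T)) :
    ∃ r : ℝ → ℝ → ℝ, Measurable (fun p : ℝ × ℝ => r p.1 p.2) ∧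
      (∀ᵐ y ∂(volume.restrict (Ioo (0 : ℝ) 1)),
        HasH1Deriv 0 T (fun t => r t y) (fun t => D (t, y))) ∧
      ∀ᵐ p ∂(rect T), F p = r p.1 p.2 := by
  have eF := hF.1.ae_eq_mk
  have eD := hD.1.ae_eq_mk
  obtain ⟨r, h1, h2, h3⟩ := exists_time_primitive_of_measurable hT
    hF.1.stronglyMeasurable_mk.measurable hD.1.stronglyMeasurable_mk.measurable
    (hF.ae_eq eF) (hD.ae_eq eD) (fun α β a1 a2 a3 b1 b2 b3 => by
      have e1 : ∫ p, hF.1.mk F p * (deriv α p.1 * β p.2) ∂(rect T) =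
          ∫ p, F p * (deriv α p.1 * β p.2) ∂(rect T) :=
        integral_congr_ae (eF.mono fun p hp => by simp only [hp])
      have e2 : ∫ p, hD.1.mk D p * (α p.1 * β p.2) ∂(rect T) =
          ∫ p, D p * (α p.1 * β p.2) ∂(rect T) :=
        integral_congr_ae (eD.mono fun p hp => by simp only [hp])
      rw [e1, e2]
      exact h α β a1 a2 a3 b1 b2 b3)
  refine ⟨r, h1, ?_, ?_⟩
  · filter_upwards [h2, ae_slice_right eD] with y hy hy'
    exact hy.congr (fun _ _ => rfl) hy'
  · filter_upwards [eF, h3] with p hp hp'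
    rw [hp, hp']

/-- The interfaces are controlled on [0,T] only, while the frame is used on the whole line. Freezing
the velocity outside [0,T] keeps the curve C¹. -/
theorem exists_contDiff_extension {T : ℝ} (hT : 0 ≤ T) {a a' : ℝ → ℝ} (ha : HasH1Deriv 0 T a a')
    (ha' : ContinuousOn a' (Icc 0 T)) :
    ∃ b : ℝ → ℝ, ContDiff ℝ 1 b ∧ ∀ t ∈ Icc 0 T, b t = a t ∧ deriv b t = a' t := by
  let e : ℝ → ℝ := IccExtend hT ((Icc 0 T).domRestrict a')
  have he : Continuous e := (continuousOn_iff_continuous_domRestrict.1 ha').Icc_extend'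
  have hee : ∀ t ∈ Icc 0 T, e t = a' t := fun t ht => IccExtend_of_mem hT _ ht
  have hd : ∀ t, HasDerivAt (fun t => a 0 + ∫ s in (0 : ℝ)..t, e s) (e t) t := fun t =>
    (intervalIntegral.integral_hasDerivAt_right (he.intervalIntegrable _ _)
      he.stronglyMeasurable.stronglyMeasurableAtFilter he.continuousAt).const_add _
  have hder : deriv (fun t => a 0 + ∫ s in (0 : ℝ)..t, e s) = e := funext fun t => (hd t).deriv
  refine ⟨fun t => a 0 + ∫ s in (0 : ℝ)..t, e s,
    contDiff_one_iff_deriv.2 ⟨fun t => (hd t).differentiableAt, by rw [hder]; exact he⟩,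
    fun t ht => ⟨?_, by rw [hder, hee t ht]⟩⟩
  rw [ha.2 t ht]
  refine congrArg (a 0 + ·) ?_
  refine intervalIntegral.integral_congr fun s hs => ?_
  rw [uIcc_of_le ht.1] at hs
  exact hee s ⟨hs.1, hs.2.trans ht.2⟩

/-- A linear continuation of a length may become negative, so its logarithm is extended instead. -/
theorem exists_contDiff_extension_pos {T : ℝ} (hT : 0 ≤ T) {g g' : ℝ → ℝ}
    (hg : HasH1Deriv 0 T g g') (hg' : ContinuousOn g' (Icc 0 T)) (hpos : ∀ t ∈ Icc 0 T, 0 < g t) :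
    ∃ b : ℝ → ℝ, ContDiff ℝ 1 b ∧ (∀ t, 0 < b t) ∧
      ∀ t ∈ Icc 0 T, b t = g t ∧ deriv b t = g' t := by
  obtain ⟨G, hG, hGe⟩ := exists_contDiff_extension hT hg hg'
  have hl : ∀ t ∈ Icc 0 T, HasDerivAt (fun s => Real.log (G s)) (g' t / g t) t := by
    intro t ht
    have h1 := (hG.differentiable one_ne_zero t).hasDerivAt
    have h2 := h1.log (by rw [(hGe t ht).1]; exact (hpos t ht).ne')
    rwa [(hGe t ht).1, (hGe t ht).2] at h2
  have hc : ContinuousOn (fun t => g' t / g t) (Icc 0 T) :=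
    hg'.div hg.continuousOn fun t ht => (hpos t ht).ne'
  have hH : HasH1Deriv 0 T (fun s => Real.log (G s)) (fun t => g' t / g t) := by
    obtain ⟨C, hC⟩ := isCompact_Icc.exists_bound_of_continuousOn hc
    refine ⟨MemLp.of_bound ((hc.mono Ioo_subset_Icc_self).aestronglyMeasurable measurableSet_Ioo) C
      ((ae_restrict_iff' measurableSet_Ioo).2 (ae_of_all _ fun t ht =>
        hC t (Ioo_subset_Icc_self ht))), fun t ht => ?_⟩
    have hsub : uIcc 0 t ⊆ Icc 0 T := by
      rw [uIcc_of_le ht.1]; exact Icc_subset_Icc_right ht.2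
    rw [intervalIntegral.integral_eq_sub_of_hasDerivAt (fun s hs => hl s (hsub hs))
      ((hc.mono hsub).intervalIntegrable)]
    ring
  obtain ⟨l, hl1, hl2⟩ := exists_contDiff_extension hT hH hc
  refine ⟨fun t => Real.exp (l t), hl1.exp, fun t => Real.exp_pos _, fun t ht => ?_⟩
  have e1 : Real.exp (l t) = g t := by
    rw [(hl2 t ht).1, (hGe t ht).1, Real.exp_log (hpos t ht)]
  refine ⟨e1, ?_⟩
  have h1 := ((hl1.differentiable one_ne_zero t).hasDerivAt).exp
  rw [h1.deriv, e1, (hl2 t ht).2]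
  have := (hpos t ht).ne'
  field_simp

section Frame

variable {T : ℝ} {a g b q : ℝ → ℝ}

theorem strip_congr (ha : ∀ t ∈ Icc 0 T, b t = a t) (hg : ∀ t ∈ Icc 0 T, q t = g t) :
    strip T b q = strip T a g := by
  ext ⟨t, x⟩
  simp only [strip, mem_ofPred_eq]
  refine and_congr_right fun ht => ?_
  rw [ha t (Ioo_subset_Icc_self ht), hg t (Ioo_subset_Icc_self ht)]

theorem frame_congr (ha : ∀ t ∈ Icc 0 T, b t = a t) (hg : ∀ t ∈ Icc 0 T, q t = g t) :
    ∀ᵐ p ∂(rect T), frame b q p = frame a g p := by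
  filter_upwards [ae_mem_rect T] with p hp
  simp only [frame, ha p.1 hp.1, hg p.1 hp.1]

/-- Data of a `C¹` moving interval `(a(t), a(t) + g(t))`. -/
structure MovingInterval (T : ℝ) (a a' g g' : ℝ → ℝ) : Prop where
  pos : 0 < T
  left : HasH1Deriv 0 T a a'
  left_cont : ContinuousOn a' (Icc 0 T)
  length : HasH1Deriv 0 T g g'
  length_cont : ContinuousOn g' (Icc 0 T)
  length_pos : ∀ t ∈ Icc 0 T, 0 < g t

namespace MovingInterval

variable {a' g' : ℝ → ℝ}

theorem memLp_comp (M : MovingInterval T a a' g g') {H : ℝ → ℝ → ℝ}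
    (hH : MemLp (fun p : ℝ × ℝ => H p.1 p.2) 2 (volume.restrict (strip T a g))) :
    MemLp (fun p : ℝ × ℝ => H p.1 (a p.1 + g p.1 * p.2)) 2 (rect T) := by
  obtain ⟨b, hb, hb'⟩ := exists_contDiff_extension M.pos.le M.left M.left_cont
  obtain ⟨q, hq, hq0, hq'⟩ := exists_contDiff_extension_pos M.pos.le M.length M.length_cont
    M.length_pos
  rw [← strip_congr (fun t ht => (hb' t ht).1) (fun t ht => (hq' t ht).1)] at hH
  refine (memLp_frame hb.continuous hq.continuous hq0 hH).ae_eq ?_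
  filter_upwards [frame_congr (fun t ht => (hb' t ht).1) (fun t ht => (hq' t ht).1)] with p hp
  rw [hp]
  rfl

theorem ae_comp (M : MovingInterval T a a' g g') {P : ℝ × ℝ → Prop}
    (h : ∀ᵐ p ∂(volume.restrict (strip T a g)), P p) :
    ∀ᵐ p ∂(rect T), P (p.1, a p.1 + g p.1 * p.2) := by
  obtain ⟨b, hb, hb'⟩ := exists_contDiff_extension M.pos.le M.left M.left_cont
  obtain ⟨q, hq, hq0, hq'⟩ := exists_contDiff_extension_pos M.pos.le M.length M.length_cont
    M.length_pos
  rw [← strip_congr (fun t ht => (hb' t ht).1) (fun t ht => (hq' t ht).1)] at h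
  filter_upwards [frame_congr (fun t ht => (hb' t ht).1) (fun t ht => (hq' t ht).1),
    ae_frame hb.continuous hq.continuous hq0 h] with p hp hp'
  rw [hp] at hp'
  exact hp'

/-- A function with weak derivatives in a moving interval is, in the moving frame, a primitive in
time of its material derivative. -/
theorem exists_primitive (M : MovingInterval T a a' g g') {f ft fx : ℝ → ℝ → ℝ}
    (H : HasWeakTimeDeriv (strip T a g) (fun p => f p.1 p.2) (fun p => ft p.1 p.2))
    (hf : MemLp (fun p : ℝ × ℝ => f p.1 p.2) 2 (volume.restrict (strip T a g)))
    (hft : MemLp (fun p : ℝ × ℝ => ft p.1 p.2) 2 (volume.restrict (strip T a g)))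
    (hfx : MemLp (fun p : ℝ × ℝ => fx p.1 p.2) 2 (volume.restrict (strip T a g)))
    (hx : ∀ᵐ t ∂(volume.restrict (Ioo 0 T)), HasH1Deriv (a t) (a t + g t) (f t) (fx t)) :
    MemLp (fun p : ℝ × ℝ => ft p.1 (a p.1 + g p.1 * p.2) +
        (a' p.1 + g' p.1 * p.2) * fx p.1 (a p.1 + g p.1 * p.2)) 2 (rect T) ∧
    ∃ r : ℝ → ℝ → ℝ, Measurable (fun p : ℝ × ℝ => r p.1 p.2) ∧
      (∀ᵐ y ∂(volume.restrict (Ioo (0 : ℝ) 1)), HasH1Deriv 0 T (fun t => r t y)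
        (fun t => ft t (a t + g t * y) + (a' t + g' t * y) * fx t (a t + g t * y))) ∧
      ∀ᵐ p ∂(rect T), f p.1 (a p.1 + g p.1 * p.2) = r p.1 p.2 := by
  have mF := M.memLp_comp hf
  have mFt := M.memLp_comp hft
  have mFx := M.memLp_comp hfx
  have mw : ContinuousOn (fun p : ℝ × ℝ => a' p.1 + g' p.1 * p.2) (Icc 0 T ×ˢ Icc 0 1) :=
    (M.left_cont.comp continuousOn_fst fun p hp => hp.1).add
      ((M.length_cont.comp continuousOn_fst fun p hp => hp.1).mul continuousOn_snd)
  have mD := mFt.add (mFx.mul (memLp_top_rect mw) (r := 2))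
  refine ⟨mD, exists_time_primitive M.pos mF mD fun α β a1 a2 a3 b1 b2 b3 => ?_⟩
  obtain ⟨b, hb, hb'⟩ := exists_contDiff_extension M.pos.le M.left M.left_cont
  obtain ⟨q, hq, hq0, hq'⟩ := exists_contDiff_extension_pos M.pos.le M.length M.length_cont
    M.length_pos
  have es := strip_congr (fun t ht => (hb' t ht).1) (fun t ht => (hq' t ht).1)
  rw [← es] at H hf hft hfx
  have := integral_frame_deriv hb hq hq0 H hf hft hfx (by
    filter_upwards [hx, ae_restrict_mem measurableSet_Ioo] with t h1 ht
    have ht' := Ioo_subset_Icc_self ht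
    simp only [frame, (hb' t ht').1, (hq' t ht').1]
    exact h1.comp_affine (M.length_pos t ht')) a1 a2 a3 b1 b2 b3
  have ef := frame_congr (fun t ht => (hb' t ht).1) (fun t ht => (hq' t ht).1)
  refine Eq.trans (integral_congr_ae ?_) (this.trans (congrArg _ (integral_congr_ae ?_)))
  · filter_upwards [ef] with p hp
    rw [hp]
    rfl
  · filter_upwards [ef, ae_mem_rect T] with p hp hp'
    rw [hp, (hb' p.1 hp'.1).2, (hq' p.1 hp'.1).2]
    rfl

end MovingInterval

end Frame

/-! ### The flow in one fluid gap -/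

/-- The flow in one moving fluid interval `(a(t), a(t) + g(t))`, with accelerations `al`, `be` of
the end points, and with bounds of density and energy. -/
structure GapFlow (P : Params) (ρlo ρhi Ce T : ℝ) (a g : ℝ → ℝ)
    (u ut ux uxx ρ ρt ρx : ℝ → ℝ → ℝ) (al be : ℝ → ℝ) : Prop where
  pos : 0 < T
  left : HasH1Deriv 0 T a (fun t => u t (a t))
  length : HasH1Deriv 0 T g (fun t => u t (a t + g t) - u t (a t))
  length_pos : ∀ t ∈ Icc 0 T, 0 < g t
  left_acc : HasH1Deriv 0 T (fun t => u t (a t)) al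
  right_acc : HasH1Deriv 0 T (fun t => u t (a t + g t)) be
  u_cont : ContinuousOn (fun p : ℝ × ℝ => u p.1 p.2)
    {p | p.1 ∈ Icc 0 T ∧ p.2 ∈ Icc (a p.1) (a p.1 + g p.1)}
  u_h1 : ∀ t ∈ Icc 0 T, HasH1Deriv (a t) (a t + g t) (u t) (ux t)
  u_x_h1 : ∀ᵐ t ∂(volume.restrict (Ioo 0 T)), HasH1Deriv (a t) (a t + g t) (ux t) (uxx t)
  u_weak : HasWeakTimeDeriv (strip T a g) (fun p => u p.1 p.2) (fun p => ut p.1 p.2)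
  u_t_L2 : MemLp (fun p : ℝ × ℝ => ut p.1 p.2) 2 (volume.restrict (strip T a g))
  u_x_L2 : MemLp (fun p : ℝ × ℝ => ux p.1 p.2) 2 (volume.restrict (strip T a g))
  u_xx_L2 : MemLp (fun p : ℝ × ℝ => uxx p.1 p.2) 2 (volume.restrict (strip T a g))
  rho_h1 : ∀ᵐ t ∂(volume.restrict (Ioo 0 T)), HasH1Deriv (a t) (a t + g t) (ρ t) (ρx t)
  rho_weak : HasWeakTimeDeriv (strip T a g) (fun p => ρ p.1 p.2) (fun p => ρt p.1 p.2)
  rho_L2 : MemLp (fun p : ℝ × ℝ => ρ p.1 p.2) 2 (volume.restrict (strip T a g))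
  rho_t_L2 : MemLp (fun p : ℝ × ℝ => ρt p.1 p.2) 2 (volume.restrict (strip T a g))
  rho_x_L2 : MemLp (fun p : ℝ × ℝ => ρx p.1 p.2) 2 (volume.restrict (strip T a g))
  mass : ∀ᵐ p ∂(volume.restrict (strip T a g)),
    ρt p.1 p.2 + (ρx p.1 p.2 * u p.1 p.2 + ρ p.1 p.2 * ux p.1 p.2) = 0
  momentum : ∀ᵐ p ∂(volume.restrict (strip T a g)),
    (ρt p.1 p.2 * u p.1 p.2 + ρ p.1 p.2 * ut p.1 p.2) +
      (ρx p.1 p.2 * u p.1 p.2 ^ 2 + 2 * ρ p.1 p.2 * u p.1 p.2 * ux p.1 p.2) =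
    P.muF * uxx p.1 p.2 - deriv P.pF (ρ p.1 p.2) * ρx p.1 p.2
  lo_pos : 0 < ρlo
  rho_bdd : ∀ t ∈ Ioo 0 T, ∀ᵐ x ∂(volume.restrict (Ioo (a t) (a t + g t))),
    ρlo ≤ ρ t x ∧ ρ t x ≤ ρhi
  energy_bdd : ∀ t ∈ Ioo 0 T, ∫ x in (a t)..(a t + g t), ux t x ^ 2 ≤ Ce

/-- The pull-back of a function to the fixed frame. -/
def pull (a g : ℝ → ℝ) (h : ℝ → ℝ → ℝ) (t y : ℝ) : ℝ := h t (a t + g t * y)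

theorem pull_zero (a g : ℝ → ℝ) (h : ℝ → ℝ → ℝ) (t : ℝ) : pull a g h t 0 = h t (a t) := by
  simp [pull]

theorem pull_one (a g : ℝ → ℝ) (h : ℝ → ℝ → ℝ) (t : ℝ) : pull a g h t 1 = h t (a t + g t) := by
  simp [pull]

theorem integral_pull {a g : ℝ → ℝ} {t : ℝ} (h : ℝ → ℝ) :
    g t * ∫ y in (0 : ℝ)..1, h (a t + g t * y) = ∫ x in (a t)..(a t + g t), h x := by
  simp

theorem ae_pull {a r : ℝ} (hr : 0 < r) {P : ℝ → Prop}
    (h : ∀ᵐ x ∂(volume.restrict (Ioo a (a + r))), P x) :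
    ∀ᵐ y ∂(volume.restrict (Ioo (0 : ℝ) 1)), P (a + r * y) := by
  have h1 : ∀ᵐ x ∂(ENNReal.ofReal |r⁻¹| • volume.restrict (Ioo a (a + r))), P x :=
    Measure.ae_smul_measure h _
  rw [← map_affine_restrict a hr] at h1
  exact ae_of_ae_map (by fun_prop) h1

theorem ae_of_ae_pull {a r : ℝ} (hr : 0 < r) {P : ℝ → Prop}
    (h : ∀ᵐ y ∂(volume.restrict (Ioo (0 : ℝ) 1)), P (a + r * y)) :
    ∀ᵐ x ∂(volume.restrict (Ioo a (a + r))), P x := by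
  have e : MeasurableEmbedding (fun y : ℝ => a + r * y) :=
    ((Homeomorph.mulLeft₀ r hr.ne').trans (Homeomorph.addLeft a)).measurableEmbedding
  have h1 : ∀ᵐ x ∂(Measure.map (fun y => a + r * y) (volume.restrict (Ioo (0 : ℝ) 1))), P x :=
    e.ae_map_iff.2 h
  rw [map_affine_restrict a hr] at h1
  have h0 : ENNReal.ofReal |r⁻¹| ≠ 0 := by
    simp only [ne_eq, ENNReal.ofReal_eq_zero, not_le]
    positivity
  exact (Measure.ae_ennreal_smul_measure_iff h0).1 h1

/-- The converse of Fubini for null sets, which requires measurability of the exceptional set and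
hence of f. -/
theorem ae_rect_of_ae_ae {T : ℝ} {f : ℝ × ℝ → ℝ} (hf : AEStronglyMeasurable f (rect T)) {s : Set ℝ}
    (hs : MeasurableSet s) (h : ∀ᵐ t ∂(volume.restrict (Ioo 0 T)),
      ∀ᵐ y ∂(volume.restrict (Ioo (0 : ℝ) 1)), f (t, y) ∈ s) : ∀ᵐ p ∂(rect T), f p ∈ s := by
  have e := hf.ae_eq_mk
  have h1 : ∀ᵐ p ∂(rect T), hf.mk f p ∈ s := by
    refine (Measure.ae_prod_iff_ae_ae (hf.stronglyMeasurable_mk.measurable hs)).2 ?_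
    filter_upwards [h, ae_slice_left e] with t ht ht'
    filter_upwards [ht, ht'] with y hy hy'
    rw [hy'] at hy
    exact hy
  filter_upwards [e, h1] with p hp hp'
  rw [hp]; exact hp'

namespace GapFlow

variable {P : Params} {ρlo ρhi Ce T : ℝ} {a g : ℝ → ℝ}
  {u ut ux uxx ρ ρt ρx : ℝ → ℝ → ℝ} {al be : ℝ → ℝ}

theorem moving (H : GapFlow P ρlo ρhi Ce T a g u ut ux uxx ρ ρt ρx al be) :
    MovingInterval T a (fun t => u t (a t)) g (fun t => u t (a t + g t) - u t (a t)) where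
  pos := H.pos
  left := H.left
  left_cont := H.left_acc.continuousOn
  length := H.length
  length_cont := H.right_acc.continuousOn.sub H.left_acc.continuousOn
  length_pos := H.length_pos

theorem pull_continuousOn (H : GapFlow P ρlo ρhi Ce T a g u ut ux uxx ρ ρt ρx al be) :
    ContinuousOn (fun p : ℝ × ℝ => pull a g u p.1 p.2) (Icc 0 T ×ˢ Icc 0 1) := by
  have hΨ : ContinuousOn (fun p : ℝ × ℝ => (p.1, a p.1 + g p.1 * p.2)) (Icc 0 T ×ˢ Icc 0 1) :=
    continuousOn_fst.prodMk ((H.left.continuousOn.comp continuousOn_fst fun p hp => hp.1).add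
      ((H.length.continuousOn.comp continuousOn_fst fun p hp => hp.1).mul continuousOn_snd))
  refine H.u_cont.comp hΨ fun p hp => ⟨hp.1, ?_, ?_⟩
  · have := H.length_pos _ hp.1
    have := hp.2.1
    simp only [le_add_iff_nonneg_right]; positivity
  · have := H.length_pos _ hp.1
    have := hp.2.2
    simp only [add_le_add_iff_left]; nlinarith

/-- The material derivative, in the frame, of a function with derivatives `ht` and `hx`. -/
def mat (a g : ℝ → ℝ) (u ht hx : ℝ → ℝ → ℝ) (t y : ℝ) : ℝ :=
  pull a g ht t y + (u t (a t) + (u t (a t + g t) - u t (a t)) * y) * pull a g hx t y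

/-- The velocity is continuous up to the moving boundary, hence bounded on a strip of finite area.
-/
theorem u_L2 (H : GapFlow P ρlo ρhi Ce T a g u ut ux uxx ρ ρt ρx al be) :
    MemLp (fun p : ℝ × ℝ => u p.1 p.2) 2 (volume.restrict (strip T a g)) := by
  obtain ⟨b, hb, hb'⟩ := exists_contDiff_extension H.pos.le H.left H.moving.left_cont
  obtain ⟨q, hq, hq0, hq'⟩ := exists_contDiff_extension_pos H.pos.le H.length
    H.moving.length_cont H.length_pos
  have es := strip_congr (fun t ht => (hb' t ht).1) (fun t ht => (hq' t ht).1)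
  have hfin := isFiniteMeasure_strip (T := T) hb.continuous hq.continuous hq0
  have hms := (isOpen_strip (T := T) hb.continuous hq.continuous).measurableSet
  rw [es] at hfin hms
  obtain ⟨C, hC⟩ := (isCompact_Icc.prod isCompact_Icc).exists_bound_of_continuousOn
    H.pull_continuousOn
  refine MemLp.of_bound ((H.u_cont.mono fun p hp => ⟨Ioo_subset_Icc_self hp.1,
    Ioo_subset_Icc_self hp.2⟩).aestronglyMeasurable hms) C ?_
  refine (ae_restrict_iff' hms).2 (ae_of_all _ fun p hp => ?_)
  have hg := H.length_pos p.1 (Ioo_subset_Icc_self hp.1)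
  have := hC (p.1, (p.2 - a p.1) / g p.1) ⟨Ioo_subset_Icc_self hp.1,
    div_nonneg (by linarith [hp.2.1]) hg.le, (div_le_one hg).2 (by linarith [hp.2.2])⟩
  have e : a p.1 + g p.1 * ((p.2 - a p.1) / g p.1) = p.2 := by
    field_simp
    ring
  simpa only [pull, e] using this

theorem velRect (H : GapFlow P ρlo ρhi Ce T a g u ut ux uxx ρ ρt ρx al be) :
    VelRect T g (pull a g u) (pull a g ux) (pull a g uxx) (mat a g u ut ux) al be := by
  obtain ⟨hD, r, r1, r2, r3⟩ := H.moving.exists_primitive H.u_weak H.u_L2 H.u_t_L2 H.u_x_L2 (by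
    filter_upwards [ae_restrict_mem measurableSet_Ioo] with t ht
    exact H.u_h1 t (Ioo_subset_Icc_self ht))
  refine
  { v_cont := H.pull_continuousOn
    g_pos := H.length_pos
    g_h1 := by simpa only [pull_zero, pull_one] using H.length
    v_y := fun t ht => (H.u_h1 t ht).comp_affine (H.length_pos t ht)
    vx_y := ?_
    v_t := ?_
    vx_L2 := H.moving.memLp_comp H.u_x_L2
    vxx_L2 := H.moving.memLp_comp H.u_xx_L2
    vt_L2 := hD
    left := by simpa only [pull_zero] using H.left_acc
    right := by simpa only [pull_one] using H.right_acc
    vx_bdd := ?_ }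
  · filter_upwards [H.u_x_h1, ae_restrict_mem measurableSet_Ioo] with t h1 ht
    exact h1.comp_affine (H.length_pos t (Ioo_subset_Icc_self ht))
  · filter_upwards [r2, ae_slice_right r3, ae_restrict_mem measurableSet_Ioo] with y h2 h3 hy
    refine HasH1Deriv.congr h2 (fun t ht => ?_) (ae_of_all _ fun t => rfl)
    have c1 : ContinuousOn (fun t => pull a g u t y) (Icc 0 T) :=
      H.pull_continuousOn.comp (f := fun t : ℝ => (t, y)) (by fun_prop)
        fun t ht => ⟨ht, Ioo_subset_Icc_self hy⟩
    -- For almost every y the primitive and the velocity agree at almost every time. Both are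
    -- continuous in time, hence equal at every time.
    refine Measure.eqOn_Icc_of_ae_eq volume H.pos.ne ?_ c1 h2.continuousOn ht
    rwa [← restrict_Ioo_eq_restrict_Icc]
  · obtain ⟨C, hC⟩ := isCompact_Icc.exists_bound_of_continuousOn
      (H.length.continuousOn.inv₀ fun t ht => (H.length_pos t ht).ne')
    refine ⟨C * |Ce|, fun t ht => ?_⟩
    have h1 := H.energy_bdd t ht
    have hg := H.length_pos t (Ioo_subset_Icc_self ht)
    have h2 := hC t (Ioo_subset_Icc_self ht)
    rw [Pi.inv_apply, Real.norm_of_nonneg (inv_nonneg.2 hg.le)] at h2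
    rw [← integral_pull (fun x => ux t x ^ 2)] at h1
    change ∫ y in (0 : ℝ)..1, ux t (a t + g t * y) ^ 2 ≤ _
    have h3 : ∫ y in (0 : ℝ)..1, ux t (a t + g t * y) ^ 2 ≤ (g t)⁻¹ * Ce := by
      rw [← div_eq_inv_mul, le_div_iff₀ hg]; linarith
    refine h3.trans ((mul_le_mul_of_nonneg_left (le_abs_self _) (inv_nonneg.2 hg.le)).trans ?_)
    exact mul_le_mul_of_nonneg_right h2 (abs_nonneg _)

theorem rho_rect_bdd (H : GapFlow P ρlo ρhi Ce T a g u ut ux uxx ρ ρt ρx al be) :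
    ∀ᵐ p ∂(rect T), pull a g ρ p.1 p.2 ∈ Icc ρlo ρhi := by
  refine ae_rect_of_ae_ae (f := fun p : ℝ × ℝ => pull a g ρ p.1 p.2)
    (H.moving.memLp_comp H.rho_L2).1 measurableSet_Icc ?_
  filter_upwards [ae_restrict_mem measurableSet_Ioo] with t ht
  exact ae_pull (H.length_pos t (Ioo_subset_Icc_self ht)) (H.rho_bdd t ht)

/-- The density in the frame: it is, at almost every point of the frame, a primitive in time. -/
theorem exists_rho (H : GapFlow P ρlo ρhi Ce T a g u ut ux uxx ρ ρt ρx al be) :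
    MemLp (fun p : ℝ × ℝ => mat a g u ρt ρx p.1 p.2) 2 (rect T) ∧
    ∃ r : ℝ → ℝ → ℝ, Measurable (fun p : ℝ × ℝ => r p.1 p.2) ∧
      (∀ᵐ y ∂(volume.restrict (Ioo (0 : ℝ) 1)),
        HasH1Deriv 0 T (fun t => r t y) (fun t => mat a g u ρt ρx t y)) ∧
      (∀ᵐ y ∂(volume.restrict (Ioo (0 : ℝ) 1)), ∀ t ∈ Icc 0 T, r t y ∈ Icc ρlo ρhi) ∧
      ∀ᵐ p ∂(rect T), pull a g ρ p.1 p.2 = r p.1 p.2 := by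
  obtain ⟨hD, r, r1, r2, r3⟩ := H.moving.exists_primitive H.rho_weak H.rho_L2 H.rho_t_L2
    H.rho_x_L2 H.rho_h1
  refine ⟨hD, r, r1, r2, ?_, r3⟩
  have h1 : ∀ᵐ p ∂(rect T), r p.1 p.2 ∈ Icc ρlo ρhi := by
    filter_upwards [r3, H.rho_rect_bdd] with p hp hp'
    rw [← hp]; exact hp'
  filter_upwards [r2, ae_slice_right h1] with y h2 h3 t ht
  -- The bounds hold at almost every time, thus on a dense set, and pass to all times because r is
  -- continuous in time.
  have hcl : closure {s | s ∈ Ioo 0 T ∧ r s y ∈ Icc ρlo ρhi} ⊇ Icc 0 T := by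
    have hd : Dense {s | s ∈ Ioo 0 T → r s y ∈ Icc ρlo ρhi} :=
      Measure.dense_of_ae ((ae_restrict_iff' measurableSet_Ioo).1 h3)
    have := hd.open_subset_closure_inter (isOpen_Ioo (a := (0 : ℝ)) (b := T))
    rw [← closure_Ioo H.pos.ne]
    refine closure_minimal (this.trans (closure_mono ?_)) isClosed_closure
    exact fun s hs => ⟨hs.1, hs.2 hs.1⟩
  have hmem : t ∈ closure {s | s ∈ Ioo 0 T ∧ r s y ∈ Icc ρlo ρhi} := hcl ht
  have hc : ContinuousWithinAt (fun s => r s y) {s | s ∈ Ioo 0 T ∧ r s y ∈ Icc ρlo ρhi} t :=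
    (h2.continuousOn t ht).mono fun s hs => Ioo_subset_Icc_self hs.1
  have := hc.mem_closure hmem (t := Icc ρlo ρhi) fun s hs => hs.2
  rwa [isClosed_Icc.closure_eq] at this

end GapFlow

/-! ### A maximum principle for transport equations -/

/-- The function `z ↦ max(z,0)²`. -/
def posSq (z : ℝ) : ℝ := max z 0 ^ 2

theorem hasDerivAt_posSq (z : ℝ) : HasDerivAt posSq (2 * max z 0) z := by
  rcases lt_trichotomy z 0 with h | h | h
  · have : posSq =ᶠ[𝓝 z] fun _ => 0 := by
      filter_upwards [gt_mem_nhds h] with x hx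
      simp [posSq, max_eq_right hx.le]
    rw [max_eq_right h.le, mul_zero]
    exact (hasDerivAt_const z (0 : ℝ)).congr_of_eventuallyEq this
  · subst h
    rw [max_self, mul_zero, hasDerivAt_iff_isLittleO]
    have : (fun x : ℝ => x ^ 2) =o[𝓝 0] fun x => x := by
      simpa using Asymptotics.isLittleO_pow_pow (𝕜 := ℝ) (m := 1) (n := 2) (by norm_num)
    refine (Asymptotics.IsBigO.of_bound 1 (Eventually.of_forall fun x => ?_)).trans_isLittleO
      (by simpa using this)
    simp only [posSq, max_self, sub_zero, smul_eq_mul, mul_zero, ne_eq, OfNat.ofNat_ne_zero,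
      not_false_eq_true, zero_pow, norm_pow, Real.norm_eq_abs, one_mul]
    refine pow_le_pow_left₀ (abs_nonneg _) ?_ 2
    rw [abs_of_nonneg (le_max_right _ _)]
    exact max_le (le_abs_self _) (abs_nonneg _)
  · have : posSq =ᶠ[𝓝 z] fun x => x ^ 2 := by
      filter_upwards [lt_mem_nhds h] with x hx
      simp [posSq, max_eq_left hx.le]
    rw [max_eq_left h.le]
    exact (by simpa using hasDerivAt_pow 2 z : HasDerivAt (fun x : ℝ => x ^ 2) (2 * z) z
      ).congr_of_eventuallyEq this

theorem deriv_posSq (z : ℝ) : deriv posSq z = 2 * max z 0 := (hasDerivAt_posSq z).deriv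

theorem contDiff_posSq : ContDiff ℝ 1 posSq := by
  refine contDiff_one_iff_deriv.2 ⟨fun z => (hasDerivAt_posSq z).differentiableAt, ?_⟩
  simp only [funext deriv_posSq]
  fun_prop

theorem posSq_nonneg (z : ℝ) : 0 ≤ posSq z := sq_nonneg _

theorem posSq_le (z : ℝ) : posSq z ≤ z ^ 2 := by
  rw [← sq_abs z]
  exact pow_le_pow_left₀ (le_max_right _ _) (max_le (le_abs_self _) (abs_nonneg _)) 2

theorem nonpos_of_posSq_eq_zero {z : ℝ} (h : posSq z = 0) : z ≤ 0 := by
  have := pow_eq_zero_iff (two_ne_zero) |>.1 h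
  exact max_eq_right_iff.1 this

/-- A subsolution of a transport equation that is initially nonpositive remains so. -/
theorem nonpos_of_transport {T C : ℝ} (hT : 0 < T) {q qt Q Qy θ θy : ℝ → ℝ → ℝ} {w : ℝ → ℝ}
    (hm : Measurable fun p : ℝ × ℝ => q p.1 p.2)
    (hq : ∀ᵐ y ∂(volume.restrict (Ioo (0 : ℝ) 1)),
      HasH1Deriv 0 T (fun t => q t y) (fun t => qt t y))
    (hqt : MemLp (fun p : ℝ × ℝ => qt p.1 p.2) 2 (rect T))
    (hC : ∀ᵐ y ∂(volume.restrict (Ioo (0 : ℝ) 1)), ∀ t ∈ Icc 0 T, |q t y| ≤ C)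
    (hQ : ∀ᵐ t ∂(volume.restrict (Ioo 0 T)), HasH1Deriv 0 1 (Q t) (Qy t))
    (hQy : MemLp (fun p : ℝ × ℝ => Qy p.1 p.2) 2 (rect T))
    (he : ∀ᵐ p ∂(rect T), Q p.1 p.2 = q p.1 p.2)
    (hθ : ContinuousOn (fun p : ℝ × ℝ => θ p.1 p.2) (Icc 0 T ×ˢ Icc 0 1))
    (hθy : ∀ᵐ t ∂(volume.restrict (Ioo 0 T)), HasH1Deriv 0 1 (θ t) (θy t) ∧ θ t 0 = 0 ∧
      θ t 1 = 0 ∧ ∀ᵐ y ∂(volume.restrict (Ioo (0 : ℝ) 1)), θy t y ≤ 2 * w t)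
    (hle : ∀ᵐ p ∂(rect T), qt p.1 p.2 ≤ -(θ p.1 p.2 * Qy p.1 p.2))
    (hw : IntervalIntegrable w volume 0 T) (hw0 : ∀ t, 0 ≤ w t)
    (hw1 : 2 * ∫ t in (0 : ℝ)..T, w t < 1)
    (h0 : ∀ᵐ y ∂(volume.restrict (Ioo (0 : ℝ) 1)), q 0 y ≤ 0) :
    ∀ t ∈ Icc 0 T, ∀ᵐ y ∂(volume.restrict (Ioo (0 : ℝ) 1)), q t y ≤ 0 := by
  let I : ℝ → ℝ := fun t => ∫ y in Ioo (0 : ℝ) 1, posSq (q t y)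
  have hCm : ∀ᵐ y ∂(volume.restrict (Ioo (0 : ℝ) 1)), ∀ t ∈ Icc 0 T, ‖posSq (q t y)‖ ≤ C ^ 2 := by
    filter_upwards [hC] with y hy t ht
    rw [Real.norm_of_nonneg (posSq_nonneg _)]
    exact (posSq_le _).trans (sq_le_sq' (by linarith [neg_abs_le (q t y), hy t ht])
      ((le_abs_self _).trans (hy t ht)))
  have hint : ∀ t ∈ Icc 0 T, Integrable (fun y => posSq (q t y)) (volume.restrict (Ioo (0 : ℝ) 1)) :=
    fun t ht => Integrable.of_bound ((contDiff_posSq.continuous.measurable.comp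
      (hm.comp measurable_prodMk_left)).aestronglyMeasurable) (C ^ 2)
      (hCm.mono fun y hy => hy t ht)
  have hI0 : ∀ t, 0 ≤ I t := fun t => integral_nonneg fun _ => posSq_nonneg _
  have hIC : ∀ t ∈ Icc 0 T, I t ≤ C ^ 2 := by
    intro t ht
    have : I t ≤ ∫ _ in Ioo (0 : ℝ) 1, C ^ 2 :=
      integral_mono_ae (hint t ht) (integrable_const _)
        (hCm.mono fun y hy => (le_abs_self _).trans (hy t ht))
    simpa using this
  -- The supremum over time replaces Gronwall's inequality: the estimate below bounds S by (2∫w)S,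
  -- and 2∫w < 1 forces S = 0.
  set S := sSup (I '' Icc 0 T)
  have hbdd : BddAbove (I '' Icc 0 T) := ⟨C ^ 2, by rintro _ ⟨t, ht, rfl⟩; exact hIC t ht⟩
  have hIS : ∀ t ∈ Icc 0 T, I t ≤ S := fun t ht => le_csSup hbdd (mem_image_of_mem _ ht)
  have hS0 : 0 ≤ S := (hI0 0).trans (hIS 0 ⟨le_rfl, hT.le⟩)
  have key : ∀ t ∈ Icc 0 T, I t ≤ (2 * ∫ t in (0 : ℝ)..T, w t) * S := by
    intro t ht
    have htT : rect t ≤ rect T := rect_mono ht.2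
    have sub : Ioo 0 t ⊆ Ioo 0 T := Ioo_subset_Ioo_right ht.2
    have bq : ∀ᵐ p ∂(rect t), ‖2 * max (q p.1 p.2) 0‖ ≤ 2 * C := by
      filter_upwards [ae_rect_right (T := t) hC, ae_mem_rect t] with p hp hp'
      rw [Real.norm_of_nonneg (by positivity)]
      have := hp p.1 ⟨hp'.1.1, hp'.1.2.trans ht.2⟩
      have h2 : max (q p.1 p.2) 0 ≤ C :=
        max_le ((le_abs_self _).trans this) ((abs_nonneg _).trans this)
      linarith
    have mq : AEStronglyMeasurable (fun p : ℝ × ℝ => 2 * max (q p.1 p.2) 0) (rect t) :=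
      ((hm.max measurable_const).const_mul 2).aestronglyMeasurable
    have i1 : Integrable (fun p => 2 * max (q p.1 p.2) 0 * qt p.1 p.2) (rect t) :=
      ((hqt.mono_measure htT).integrable (by norm_num)).bdd_mul mq bq
    have i2 : Integrable (fun p => 2 * max (q p.1 p.2) 0 * -(θ p.1 p.2 * Qy p.1 p.2)) (rect t) := by
      have := ((hQy.mono_measure htT).mul ((memLp_top_rect hθ).mono_measure htT)
        (r := 2)).integrable (by norm_num)
      exact (this.neg).bdd_mul mq bq
    have e1 : I t = ∫ p, 2 * max (q p.1 p.2) 0 * qt p.1 p.2 ∂(rect t) := by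
      rw [integral_prod_symm _ i1]
      refine integral_congr_ae ?_
      filter_upwards [hq, h0] with y hy hy0
      have hy' := (hy.mono ⟨le_rfl, hT.le⟩ ht).comp contDiff_posSq ht.1
      have := hy'.2 t ⟨ht.1, le_rfl⟩
      rw [intervalIntegral.integral_of_le ht.1, integral_Ioc_eq_integral_Ioo] at this
      simp only [deriv_posSq] at this
      rw [this]
      simp [posSq, max_eq_right hy0]
    have e2 : ∫ p, 2 * max (q p.1 p.2) 0 * qt p.1 p.2 ∂(rect t) ≤
        ∫ p, 2 * max (q p.1 p.2) 0 * -(θ p.1 p.2 * Qy p.1 p.2) ∂(rect t) := by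
      refine integral_mono_ae i1 i2 ?_
      filter_upwards [htT.absolutelyContinuous.ae_le hle] with p hp
      exact mul_le_mul_of_nonneg_left hp (by positivity)
    have hwt : IntervalIntegrable w volume 0 t := hw.mono_set (by
      rw [uIcc_of_le ht.1, uIcc_of_le hT.le]; exact Icc_subset_Icc_right ht.2)
    -- On a time slice the integrand is -θ ∂_y(max(Q,0)²). Since θ vanishes at both ends, an
    -- integration by parts leaves θ_y max(Q,0)² without boundary terms.
    have e3 : ∫ p, 2 * max (q p.1 p.2) 0 * -(θ p.1 p.2 * Qy p.1 p.2) ∂(rect t) ≤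
        ∫ s in Ioo 0 t, 2 * w s * S := by
      rw [integral_prod _ i2]
      refine integral_mono_ae i2.integral_prod_left (by
        rw [intervalIntegrable_iff_integrableOn_Ioo_of_le ht.1] at hwt
        exact (hwt.const_mul 2).mul_const S) ?_
      filter_upwards [ae_restrict_of_ae_restrict_of_subset sub hQ,
        ae_restrict_of_ae_restrict_of_subset sub hθy, ae_slice_left
        (htT.absolutelyContinuous.ae_le he), ae_restrict_mem measurableSet_Ioo]
        with s h1 ⟨h2, h3, h4, h5⟩ h6 hs
      have hs' : s ∈ Icc 0 T := ⟨hs.1.le, hs.2.le.trans ht.2⟩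
      have H := (h1.comp contDiff_posSq zero_le_one)
      have := h2.integral_deriv_mul H zero_le_one
      rw [h3, h4, zero_mul, zero_mul, sub_zero, zero_sub] at this
      simp only [deriv_posSq, integral_unit] at this
      have a1 : ∫ y in Ioo (0 : ℝ) 1, 2 * max (q s y) 0 * -(θ s y * Qy s y) =
          ∫ y in Ioo (0 : ℝ) 1, θy s y * posSq (Q s y) := by
        rw [← neg_eq_iff_eq_neg.2 this, ← integral_neg]
        refine integral_congr_ae ?_
        filter_upwards [h6] with y hy
        rw [hy]
        ring
      have a2 : ∫ y in Ioo (0 : ℝ) 1, θy s y * posSq (Q s y) ≤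
          ∫ y in Ioo (0 : ℝ) 1, 2 * w s * posSq (q s y) := by
        refine integral_mono_ae ?_ ((hint s hs').const_mul _) ?_
        · have := memLp_mul_of_continuousOn H.continuousOn h2.1
          exact (this.integrable (by norm_num)).congr (ae_of_all _ fun y => by
            simp [mul_comm])
        · filter_upwards [h5, h6] with y hy hy'
          rw [hy']
          exact mul_le_mul_of_nonneg_right hy (posSq_nonneg _)
      rw [integral_const_mul] at a2
      rw [a1]
      exact a2.trans (mul_le_mul_of_nonneg_left (hIS s hs')
        (mul_nonneg zero_le_two (hw0 s)))
    have e4 : ∫ s in Ioo 0 t, 2 * w s * S = 2 * (∫ s in (0 : ℝ)..t, w s) * S := by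
      rw [integral_mul_const, integral_const_mul, intervalIntegral.integral_of_le ht.1,
        integral_Ioc_eq_integral_Ioo]
    have e5 : ∫ s in (0 : ℝ)..t, w s ≤ ∫ s in (0 : ℝ)..T, w s :=
      intervalIntegral.integral_mono_interval le_rfl ht.1 ht.2 (ae_of_all _ hw0) hw
    calc I t ≤ 2 * (∫ s in (0 : ℝ)..t, w s) * S := by rw [e1, ← e4]; exact e2.trans e3
      _ ≤ _ := by gcongr
  have hSle : S ≤ (2 * ∫ t in (0 : ℝ)..T, w t) * S :=
    csSup_le ⟨_, mem_image_of_mem _ ⟨le_rfl, hT.le⟩⟩ (by rintro _ ⟨t, ht, rfl⟩; exact key t ht)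
  have hS : S = 0 := by nlinarith
  intro t ht
  have hIt : I t = 0 := le_antisymm (hS ▸ hIS t ht) (hI0 t)
  have := (integral_eq_zero_iff_of_nonneg (fun _ => posSq_nonneg _) (hint t ht)).1 hIt
  filter_upwards [this] with y hy
  exact nonpos_of_posSq_eq_zero hy

/-! ### Propagation of density bounds along the flow in one gap. -/

namespace GapFlow

variable {P : Params} {ρlo ρhi Ce T : ℝ} {a g : ℝ → ℝ}
  {u ut ux uxx ρ ρt ρx : ℝ → ℝ → ℝ} {al be : ℝ → ℝ}

/-- The relative velocity of the fluid in the frame. -/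
def rel (a g : ℝ → ℝ) (u : ℝ → ℝ → ℝ) (t y : ℝ) : ℝ :=
  pull a g u t y - (u t (a t) + (u t (a t + g t) - u t (a t)) * y)

theorem rel_zero (t : ℝ) : rel a g u t 0 = 0 := by simp [rel, pull_zero]

theorem rel_one (t : ℝ) : rel a g u t 1 = 0 := by simp [rel, pull_one]

theorem rel_h1 (H : GapFlow P ρlo ρhi Ce T a g u ut ux uxx ρ ρt ρx al be) {t : ℝ}
    (ht : t ∈ Icc 0 T) : HasH1Deriv 0 1 (rel a g u t)
      (fun y => g t * pull a g ux t y - (u t (a t + g t) - u t (a t))) := by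
  have h := H.velRect.v_y t ht
  have h2 := (HasH1Deriv.const (a := 0) (b := 1) (u t (a t))).add
    (HasH1Deriv.linear (u t (a t + g t) - u t (a t)) 0)
  exact (h.sub h2).congr (fun y _ => by simp [rel]) (ae_of_all _ fun y => by simp)

theorem rel_continuousOn (H : GapFlow P ρlo ρhi Ce T a g u ut ux uxx ρ ρt ρx al be) :
    ContinuousOn (fun p : ℝ × ℝ => rel a g u p.1 p.2) (Icc 0 T ×ˢ Icc 0 1) :=
  H.pull_continuousOn.sub ((H.moving.left_cont.comp continuousOn_fst fun _ hp => hp.1).add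
      ((H.moving.length_cont.comp continuousOn_fst fun _ hp => hp.1).mul continuousOn_snd))

/-- In the frame the density is transported by the relative velocity only. That velocity vanishes at
both interfaces, which is why no boundary value of the density is needed. -/
theorem ae_mass (H : GapFlow P ρlo ρhi Ce T a g u ut ux uxx ρ ρt ρx al be) :
    ∀ᵐ p ∂(rect T), mat a g u ρt ρx p.1 p.2 =
      -(rel a g u p.1 p.2 * pull a g ρx p.1 p.2) - pull a g ρ p.1 p.2 * pull a g ux p.1 p.2 := by
  filter_upwards [H.moving.ae_comp H.mass] with p hp
  simp only [mat, rel, pull]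
  linear_combination hp

theorem abs_length_deriv_le (H : GapFlow P ρlo ρhi Ce T a g u ut ux uxx ρ ρt ρx al be) {t w : ℝ}
    (ht : t ∈ Icc 0 T) (hw : ∀ᵐ y ∂(volume.restrict (Ioo (0 : ℝ) 1)), |pull a g ux t y| ≤ w) :
    |u t (a t + g t) - u t (a t)| ≤ g t * w := by
  have hg := H.length_pos t ht
  have h := (H.velRect.v_y t ht).sub_eq (c := 0) (d := 1) (by simp) (by simp)
  rw [pull_zero, pull_one] at h
  rw [h, integral_unit]
  have h1 : ‖∫ y in Ioo (0 : ℝ) 1, g t * pull a g ux t y‖ ≤ (g t * w) *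
      (volume.restrict (Ioo (0 : ℝ) 1)).real univ :=
    norm_integral_le_of_norm_le_const (hw.mono fun y hy => by
      rw [Real.norm_eq_abs, abs_mul, abs_of_pos hg]
      exact mul_le_mul_of_nonneg_left hy hg.le)
  simpa using h1

/-- Bounds of the density propagate up to an error proportional to `∫ w`, if `|∂_x u| ≤ w`. The
sign `σ` is `1` for upper bounds, `-1` for lower bounds. -/
theorem rho_le (H : GapFlow P ρlo ρhi Ce T a g u ut ux uxx ρ ρt ρx al be) {r : ℝ → ℝ → ℝ}
    (r1 : Measurable (fun p : ℝ × ℝ => r p.1 p.2))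
    (r2 : ∀ᵐ y ∂(volume.restrict (Ioo (0 : ℝ) 1)),
        HasH1Deriv 0 T (fun t => r t y) (fun t => mat a g u ρt ρx t y))
    (r3 : ∀ᵐ y ∂(volume.restrict (Ioo (0 : ℝ) 1)), ∀ t ∈ Icc 0 T, r t y ∈ Icc ρlo ρhi)
    (r4 : ∀ᵐ p ∂(rect T), pull a g ρ p.1 p.2 = r p.1 p.2) {w : ℝ → ℝ}
    (hw : MemLp w 2 (volume.restrict (Ioo 0 T))) (hw0 : ∀ t, 0 ≤ w t)
    (hw1 : 2 * ∫ t in (0 : ℝ)..T, w t < 1)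
    (hux : ∀ᵐ t ∂(volume.restrict (Ioo 0 T)), ∀ᵐ y ∂(volume.restrict (Ioo (0 : ℝ) 1)),
      |pull a g ux t y| ≤ w t) {σ c : ℝ} (hσ : |σ| = 1)
    (h0 : ∀ᵐ y ∂(volume.restrict (Ioo (0 : ℝ) 1)), σ * r 0 y ≤ c) :
    ∀ t ∈ Icc 0 T, ∀ᵐ y ∂(volume.restrict (Ioo (0 : ℝ) 1)),
      σ * r t y ≤ c + ρhi * ∫ s in (0 : ℝ)..t, w s := by
  have hT := H.pos
  have W1 : HasH1Deriv 0 T (fun t => ∫ s in (0 : ℝ)..t, w s) w := ⟨hw, fun t _ => by simp⟩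
  obtain ⟨Cw, hCw⟩ := W1.exists_bound
  have hwm : AEStronglyMeasurable (fun p : ℝ × ℝ => w p.1) (rect T) := hw.1.comp_fst
  have hwL : MemLp (fun p : ℝ × ℝ => w p.1) 2 (rect T) := hw.comp_fst _
  have hwc : Continuous fun t => ∫ s in (0 : ℝ)..t, (Ioo 0 T).indicator w s := by
    -- Cutting w off outside (0,T) makes its primitive V continuous on the whole line, hence
    -- measurable, as the maximum principle requires.
    refine intervalIntegral.continuous_primitive (fun x y => ?_) 0
    exact ((integrable_indicator_iff measurableSet_Ioo).2
      (hw.integrable (by norm_num))).intervalIntegrable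
  let V : ℝ → ℝ := fun t => ∫ s in (0 : ℝ)..t, (Ioo 0 T).indicator w s
  have hV : ∀ t ∈ Icc 0 T, V t = ∫ s in (0 : ℝ)..t, w s := by
    intro t ht
    simp only [V]
    rw [intervalIntegral.integral_of_le ht.1, intervalIntegral.integral_of_le ht.1,
      integral_Ioc_eq_integral_Ioo, integral_Ioc_eq_integral_Ioo]
    refine setIntegral_congr_fun measurableSet_Ioo fun s hs => ?_
    exact indicator_of_mem (show s ∈ Ioo 0 T from ⟨hs.1, hs.2.trans_le ht.2⟩) _
  have hV1 : HasH1Deriv 0 T V w := W1.congr hV (ae_of_all _ fun _ => rfl)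
  have hσr : ∀ x y : ℝ, |x| ≤ y → σ * x ≤ y := fun x y h =>
    (le_abs_self _).trans (by rwa [abs_mul, hσ, one_mul])
  -- The space-independent function c + ρhi∫w is a supersolution, because the source term of the
  -- mass equation satisfies |ρ ∂ₓu| ≤ ρhi w.
  have main := nonpos_of_transport (T := T) (C := |ρhi| + |ρlo| + |c| + |ρhi| * Cw) hT
    (q := fun t y => σ * r t y - (c + ρhi * V t))
    (qt := fun t y => σ * mat a g u ρt ρx t y - ρhi * w t)
    (Q := fun t y => σ * pull a g ρ t y - (c + ρhi * V t))
    (Qy := fun t y => σ * (g t * pull a g ρx t y))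
    (θ := fun t y => (g t)⁻¹ * rel a g u t y)
    (θy := fun t y => (g t)⁻¹ * (g t * pull a g ux t y - (u t (a t + g t) - u t (a t))))
    (w := w) ?_ ?_ ?_ ?_ ?_ ?_ ?_ ?_ ?_ ?_ (W1.intervalIntegrable hT.le) hw0 hw1 ?_
  · intro t ht
    filter_upwards [main t ht] with y hy
    rw [hV t ht] at hy
    linarith
  · exact (r1.const_mul σ).sub (((hwc.measurable.comp measurable_fst).const_mul ρhi).const_add c)
  · filter_upwards [r2] with y hy
    exact ((hy.const_mul σ).sub ((HasH1Deriv.const c).add (hV1.const_mul ρhi))).congr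
      (fun t _ => rfl) (ae_of_all _ fun t => by simp)
  · exact (H.exists_rho.1.const_mul σ).sub (hwL.const_mul ρhi)
  · filter_upwards [r3] with y hy t ht
    have h1 := hy t ht
    have h2 := hCw t ht
    rw [← hV t ht] at h2
    have h3 : |r t y| ≤ |ρhi| + |ρlo| := by
      rw [abs_le]
      constructor
      · linarith [neg_abs_le ρlo, abs_nonneg ρhi, h1.1]
      · linarith [le_abs_self ρhi, abs_nonneg ρlo, h1.2]
    calc |σ * r t y - (c + ρhi * V t)| ≤ |σ * r t y| + |c + ρhi * V t| := abs_sub _ _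
      _ ≤ |r t y| + (|c| + |ρhi| * |V t|) := by
        rw [abs_mul, hσ, one_mul, ← abs_mul]
        gcongr
        exact abs_add_le _ _
      _ ≤ _ := by
        have := mul_le_mul_of_nonneg_left h2 (abs_nonneg ρhi)
        linarith
  · filter_upwards [H.rho_h1, ae_restrict_mem measurableSet_Ioo] with t h1 ht
    have h2 := h1.comp_affine (H.length_pos t (Ioo_subset_Icc_self ht))
    exact ((h2.const_mul σ).sub (HasH1Deriv.const (c + ρhi * V t))).congr
      (fun y _ => rfl) (ae_of_all _ fun y => by simp [pull])
  · exact (H.velRect.g_mul_memLp (F := pull a g ρx) (H.moving.memLp_comp H.rho_x_L2)).const_mul σ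
  · filter_upwards [r4] with p hp
    rw [hp]
  · exact ((H.length.continuousOn.inv₀ fun t ht => (H.length_pos t ht).ne').comp
      continuousOn_fst fun p hp => hp.1).mul H.rel_continuousOn
  · filter_upwards [hux, ae_restrict_mem measurableSet_Ioo] with t h1 ht
    have ht' := Ioo_subset_Icc_self ht
    have hg := H.length_pos t ht'
    refine ⟨(H.rel_h1 ht').const_mul _, by rw [rel_zero, mul_zero], by rw [rel_one, mul_zero], ?_⟩
    -- The divergence of the relative velocity has two parts, ∂ₓu and the dilation rate of the
    -- frame. The latter is a mean of ∂ₓu, hence also at most w; this explains the factor 2.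
    have h2 := H.abs_length_deriv_le ht' h1
    filter_upwards [h1] with y hy
    rw [inv_mul_le_iff₀ hg]
    have h3 := mul_le_mul_of_nonneg_left ((le_abs_self _).trans hy) hg.le
    linarith [neg_abs_le (u t (a t + g t) - u t (a t))]
  · have hux' : ∀ᵐ p ∂(rect T), |pull a g ux p.1 p.2| ≤ w p.1 := by
      have : AEStronglyMeasurable (fun p : ℝ × ℝ => |pull a g ux p.1 p.2| - w p.1) (rect T) :=
        (H.velRect.vx_L2.1.norm).sub hwm
      have := ae_rect_of_ae_ae this measurableSet_Iic (s := Iic 0) (by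
        filter_upwards [hux] with t ht
        filter_upwards [ht] with y hy
        exact sub_nonpos.2 hy)
      filter_upwards [this] with p hp
      exact sub_nonpos.1 hp
    filter_upwards [H.ae_mass, hux', H.rho_rect_bdd, ae_mem_rect T] with p h1 h2 h3 h4
    have hg := (H.length_pos p.1 h4.1).ne'
    rw [h1]
    have e : (g p.1)⁻¹ * rel a g u p.1 p.2 * (σ * (g p.1 * pull a g ρx p.1 p.2)) =
        σ * (rel a g u p.1 p.2 * pull a g ρx p.1 p.2) := by
      field_simp
    rw [e]
    have h5 : σ * (-(pull a g ρ p.1 p.2 * pull a g ux p.1 p.2)) ≤ ρhi * w p.1 := by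
      refine hσr _ _ ?_
      rw [abs_neg, abs_mul, abs_of_pos (H.lo_pos.trans_le h3.1)]
      exact mul_le_mul h3.2 h2 (abs_nonneg _) (H.lo_pos.le.trans (h3.1.trans h3.2))
    linarith
  · filter_upwards [h0] with y hy
    rw [hV 0 ⟨le_rfl, hT.le⟩]
    simpa using hy

end GapFlow

/-! ### The pressure law -/

namespace Params

theorem contDiff_pF (P : Params) : ContDiff ℝ 1 P.pF :=
  contDiff_const.mul (Real.contDiff_rpow_const_of_le (by exact_mod_cast P.one_lt_gamF.le))

theorem deriv_pF (P : Params) (s : ℝ) :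
    deriv P.pF s = P.kapF * (P.gamF * s ^ (P.gamF - 1)) :=
  ((Real.hasDerivAt_rpow_const (Or.inr P.one_lt_gamF.le)).const_mul P.kapF).deriv

theorem pF_nonneg (P : Params) {s : ℝ} (hs : 0 ≤ s) : 0 ≤ P.pF s :=
  mul_nonneg P.kapF_pos.le (Real.rpow_nonneg hs _)

theorem pF_mono (P : Params) {s t : ℝ} (hs : 0 ≤ s) (hst : s ≤ t) : P.pF s ≤ P.pF t :=
  mul_le_mul_of_nonneg_left
    (Real.rpow_le_rpow hs hst (zero_le_one.trans P.one_lt_gamF.le)) P.kapF_pos.le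

theorem deriv_pF_mul (P : Params) {s : ℝ} (hs : 0 < s) : deriv P.pF s * s = P.gamF * P.pF s := by
  rw [deriv_pF, pF, Real.rpow_sub_one hs.ne']
  field_simp

end Params

/-- The derivative of the fluid stress. -/
def stressX (P : Params) (uxx ρ ρx : ℝ → ℝ → ℝ) (t x : ℝ) : ℝ :=
  P.muF * uxx t x - deriv P.pF (ρ t x) * ρx t x

/-- The fluid stress. -/
def stress (P : Params) (ux ρ : ℝ → ℝ → ℝ) (t x : ℝ) : ℝ := P.muF * ux t x - P.pF (ρ t x)

/-! ### The energy inequality in one gap. -/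

namespace GapFlow

variable {P : Params} {ρlo ρhi Ce T : ℝ} {a g : ℝ → ℝ}
  {u ut ux uxx ρ ρt ρx : ℝ → ℝ → ℝ} {al be : ℝ → ℝ}

theorem deriv_pF_bdd (P : Params) (ρlo ρhi : ℝ) :
    ∃ C, ∀ s ∈ Icc ρlo ρhi, ‖deriv P.pF s‖ ≤ C :=
  isCompact_Icc.exists_bound_of_continuousOn (P.contDiff_pF.continuous_deriv le_rfl).continuousOn

theorem pressure_x_L2 (H : GapFlow P ρlo ρhi Ce T a g u ut ux uxx ρ ρt ρx al be) :
    MemLp (fun p : ℝ × ℝ => deriv P.pF (pull a g ρ p.1 p.2) * pull a g ρx p.1 p.2) 2 (rect T) := by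
  obtain ⟨C, hC⟩ := deriv_pF_bdd P ρlo ρhi
  have h1 : MemLp (fun p : ℝ × ℝ => deriv P.pF (pull a g ρ p.1 p.2)) ∞ (rect T) := by
    refine memLp_top_of_bound ((P.contDiff_pF.continuous_deriv le_rfl).comp_aestronglyMeasurable
      (H.moving.memLp_comp H.rho_L2).1) C ?_
    filter_upwards [H.rho_rect_bdd] with p hp using hC _ hp
  exact (H.moving.memLp_comp H.rho_x_L2).mul h1

theorem stressX_L2 (H : GapFlow P ρlo ρhi Ce T a g u ut ux uxx ρ ρt ρx al be) :
    MemLp (fun p : ℝ × ℝ => pull a g (stressX P uxx ρ ρx) p.1 p.2) 2 (rect T) :=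
  ((H.moving.memLp_comp H.u_xx_L2).const_mul P.muF).sub H.pressure_x_L2

/-- Puts the pressure in the form needed for integration by parts in time. The representative r
carries the time derivative, the pulled-back density the space derivative and the traces at the
interfaces. -/
theorem fieldRect (H : GapFlow P ρlo ρhi Ce T a g u ut ux uxx ρ ρt ρx al be) {r : ℝ → ℝ → ℝ}
    (r1 : Measurable (fun p : ℝ × ℝ => r p.1 p.2))
    (r2 : ∀ᵐ y ∂(volume.restrict (Ioo (0 : ℝ) 1)),
        HasH1Deriv 0 T (fun t => r t y) (fun t => mat a g u ρt ρx t y))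
    (r3 : ∀ᵐ y ∂(volume.restrict (Ioo (0 : ℝ) 1)), ∀ t ∈ Icc 0 T, r t y ∈ Icc ρlo ρhi)
    (r4 : ∀ᵐ p ∂(rect T), pull a g ρ p.1 p.2 = r p.1 p.2) :
    FieldRect T (P.pF ρhi) g (fun t y => P.pF (r t y)) (fun t y => P.pF (pull a g ρ t y))
      (fun t y => deriv P.pF (pull a g ρ t y) * pull a g ρx t y)
      (fun t y => deriv P.pF (r t y) * mat a g u ρt ρx t y) where
  meas := P.contDiff_pF.continuous.measurable.comp r1
  bdd := by
    filter_upwards [r3] with y hy t ht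
    have h := hy t ht
    rw [abs_of_nonneg (P.pF_nonneg (H.lo_pos.le.trans h.1))]
    exact P.pF_mono (H.lo_pos.le.trans h.1) h.2
  f_t := r2.mono fun y hy => hy.comp P.contDiff_pF H.pos.le
  ft_L2 := by
    obtain ⟨C, hC⟩ := deriv_pF_bdd P ρlo ρhi
    have h1 : MemLp (fun p : ℝ × ℝ => deriv P.pF (r p.1 p.2)) ∞ (rect T) := by
      refine memLp_top_of_bound ((P.contDiff_pF.continuous_deriv le_rfl).measurable.comp
        r1).aestronglyMeasurable C ?_
      filter_upwards [H.rho_rect_bdd, r4] with p hp hp'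
      rw [← hp']
      exact hC _ hp
    exact H.exists_rho.1.mul h1
  f_x := by
    filter_upwards [H.rho_h1, ae_restrict_mem measurableSet_Ioo] with t h1 ht
    have h2 := h1.comp_affine (H.length_pos t (Ioo_subset_Icc_self ht))
    exact (h2.comp P.contDiff_pF zero_le_one).congr (fun y _ => rfl)
      (ae_of_all _ fun y => by simp only [pull]; ring)
  ae_eq := by
    filter_upwards [ae_slice_left r4] with t ht
    filter_upwards [ht] with y hy
    rw [hy]
  fx_L2 := H.pressure_x_L2

/-- The conservative form minus u times the mass equation is ρ(∂_tu + u∂ₓu) = ∂ₓΣ_f; the frame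
already follows part of the convection. -/
theorem ae_momentum (H : GapFlow P ρlo ρhi Ce T a g u ut ux uxx ρ ρt ρx al be) :
    ∀ᵐ p ∂(rect T), mat a g u ut ux p.1 p.2 =
      pull a g (stressX P uxx ρ ρx) p.1 p.2 / pull a g ρ p.1 p.2 -
        rel a g u p.1 p.2 * pull a g ux p.1 p.2 := by
  filter_upwards [H.moving.ae_comp H.mass, H.moving.ae_comp H.momentum, H.rho_rect_bdd]
    with p h1 h2 h3
  have h0 : pull a g ρ p.1 p.2 ≠ 0 := (H.lo_pos.trans_le h3.1).ne'
  rw [eq_sub_iff_add_eq, eq_div_iff h0]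
  simp only [mat, rel, pull, stressX]
  linear_combination h2 - u p.1 (a p.1 + g p.1 * p.2) * h1

/-- Pointwise, the power of the stress in the frame. -/
theorem ae_power (H : GapFlow P ρlo ρhi Ce T a g u ut ux uxx ρ ρt ρx al be) {r : ℝ → ℝ → ℝ}
    (r4 : ∀ᵐ p ∂(rect T), pull a g ρ p.1 p.2 = r p.1 p.2) :
    ∀ᵐ p ∂(rect T),
      -(g p.1 * pull a g (stressX P uxx ρ ρx) p.1 p.2) * mat a g u ut ux p.1 p.2 -
        (g p.1 * pull a g ux p.1 p.2) * (deriv P.pF (r p.1 p.2) * mat a g u ρt ρx p.1 p.2) ≤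
      -(1 / ρhi) * (g p.1 * pull a g (stressX P uxx ρ ρx) p.1 p.2 ^ 2) +
        P.gamF * P.pF ρhi * (g p.1 * pull a g ux p.1 p.2 ^ 2) +
        P.muF * (rel a g u p.1 p.2 * ((g p.1 * pull a g uxx p.1 p.2) * pull a g ux p.1 p.2)) := by
  filter_upwards [H.ae_momentum, H.ae_mass, H.rho_rect_bdd, r4, ae_mem_rect T] with p h1 h2 h3 h4 h5
  have hg := H.length_pos p.1 h5.1
  have h0 : 0 < pull a g ρ p.1 p.2 := H.lo_pos.trans_le h3.1
  rw [← h4, h1, h2]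
  -- The convective part of the acceleration is paired with ∂ₓΣ_f and that of the pressure contains
  -- ∂ₓρ. This identity merges them into a term in u alone, so ∂ₓρ disappears.
  have e : P.muF * pull a g uxx p.1 p.2 = pull a g (stressX P uxx ρ ρx) p.1 p.2 +
      deriv P.pF (pull a g ρ p.1 p.2) * pull a g ρx p.1 p.2 := by
    simp only [pull, stressX]; ring
  have c1 : (1 / ρhi) * (g p.1 * pull a g (stressX P uxx ρ ρx) p.1 p.2 ^ 2) ≤
      (1 / pull a g ρ p.1 p.2) * (g p.1 * pull a g (stressX P uxx ρ ρx) p.1 p.2 ^ 2) :=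
    mul_le_mul_of_nonneg_right (one_div_le_one_div_of_le h0 h3.2) (by positivity)
  -- Compression changes the pressure at the rate ρp'(ρ)∂ₓu, and ρp' = γp for a power law.
  have c2 : deriv P.pF (pull a g ρ p.1 p.2) * pull a g ρ p.1 p.2 *
      (g p.1 * pull a g ux p.1 p.2 ^ 2) ≤
      P.gamF * P.pF ρhi * (g p.1 * pull a g ux p.1 p.2 ^ 2) := by
    refine mul_le_mul_of_nonneg_right ?_ (by positivity)
    rw [P.deriv_pF_mul h0]
    exact mul_le_mul_of_nonneg_left (P.pF_mono h0.le h3.2) (zero_le_one.trans P.one_lt_gamF.le)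
  have e2 : P.muF * (rel a g u p.1 p.2 * ((g p.1 * pull a g uxx p.1 p.2) * pull a g ux p.1 p.2)) =
      rel a g u p.1 p.2 * g p.1 * pull a g ux p.1 p.2 *
        (pull a g (stressX P uxx ρ ρx) p.1 p.2 +
        deriv P.pF (pull a g ρ p.1 p.2) * pull a g ρx p.1 p.2) := by
    rw [← e]; ring
  rw [e2]
  have e3 : -(g p.1 * pull a g (stressX P uxx ρ ρx) p.1 p.2) *
      (pull a g (stressX P uxx ρ ρx) p.1 p.2 / pull a g ρ p.1 p.2 -
        rel a g u p.1 p.2 * pull a g ux p.1 p.2) -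
      g p.1 * pull a g ux p.1 p.2 * (deriv P.pF (pull a g ρ p.1 p.2) *
        (-(rel a g u p.1 p.2 * pull a g ρx p.1 p.2) - pull a g ρ p.1 p.2 * pull a g ux p.1 p.2)) =
      -((1 / pull a g ρ p.1 p.2) * (g p.1 * pull a g (stressX P uxx ρ ρx) p.1 p.2 ^ 2)) +
      deriv P.pF (pull a g ρ p.1 p.2) * pull a g ρ p.1 p.2 * (g p.1 * pull a g ux p.1 p.2 ^ 2) +
      rel a g u p.1 p.2 * g p.1 * pull a g ux p.1 p.2 *
        (pull a g (stressX P uxx ρ ρx) p.1 p.2 +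
        deriv P.pF (pull a g ρ p.1 p.2) * pull a g ρx p.1 p.2) := by
    field_simp
    ring
  rw [e3]
  linarith

/-- Integration by parts of the convective term at a fixed time. -/
theorem integral_convection (H : GapFlow P ρlo ρhi Ce T a g u ut ux uxx ρ ρt ρx al be) :
    ∀ᵐ t ∂(volume.restrict (Ioo 0 T)), ∀ w, (∀ᵐ y ∂(volume.restrict (Ioo (0 : ℝ) 1)),
      |pull a g ux t y| ≤ w) →
      2 * (∫ y in (0 : ℝ)..1, rel a g u t y * ((g t * pull a g uxx t y) * pull a g ux t y)) -
        (∫ y in (0 : ℝ)..1, pull a g ux t y ^ 2) * (u t (a t + g t) - u t (a t)) ≤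
      w * (g t * ∫ y in (0 : ℝ)..1, pull a g ux t y ^ 2) := by
  filter_upwards [H.velRect.vx_y, ae_restrict_mem measurableSet_Ioo] with t h1 ht w hw
  have ht' := Ioo_subset_Icc_self ht
  have hg := H.length_pos t ht'
  have h2 := H.rel_h1 ht'
  have h3 := h1.mul h1 zero_le_one
  -- The convective term is the relative velocity times half the derivative of |∂ₓu|². After
  -- integration by parts the dilation of the frame cancels the term from the changing length, and
  -- only the cubic -g∫(∂ₓu)³ remains.
  have e := h2.integral_deriv_mul h3 zero_le_one
  rw [rel_zero, rel_one, zero_mul, zero_mul, sub_zero, zero_sub] at e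
  have isq := h1.fun_sq_intervalIntegrable zero_le_one
  obtain ⟨C, hC⟩ := h1.exists_bound
  have icub : IntervalIntegrable (fun y => g t * (pull a g ux t y * pull a g ux t y ^ 2))
      volume 0 1 := by
    refine ContinuousOn.intervalIntegrable ?_
    rw [uIcc_of_le zero_le_one]
    exact continuousOn_const.mul (h1.continuousOn.mul (h1.continuousOn.pow 2))
  have e1 : 2 * (∫ y in (0 : ℝ)..1, rel a g u t y *
      ((g t * pull a g uxx t y) * pull a g ux t y)) =
      ∫ y in (0 : ℝ)..1, rel a g u t y * (g t * pull a g uxx t y * pull a g ux t y +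
        pull a g ux t y * (g t * pull a g uxx t y)) := by
    rw [← intervalIntegral.integral_const_mul]
    exact intervalIntegral.integral_congr fun y _ => by ring
  have e2 : (∫ y in (0 : ℝ)..1, (g t * pull a g ux t y - (u t (a t + g t) - u t (a t))) *
      (pull a g ux t y * pull a g ux t y)) =
      (∫ y in (0 : ℝ)..1, g t * (pull a g ux t y * pull a g ux t y ^ 2)) -
      (u t (a t + g t) - u t (a t)) * ∫ y in (0 : ℝ)..1, pull a g ux t y ^ 2 := by
    rw [← intervalIntegral.integral_const_mul, ← intervalIntegral.integral_sub icub
      (isq.const_mul _)]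
    exact intervalIntegral.integral_congr fun y _ => by ring
  rw [e1, e, e2]
  have e3 : -(∫ y in (0 : ℝ)..1, g t * (pull a g ux t y * pull a g ux t y ^ 2)) ≤
      w * (g t * ∫ y in (0 : ℝ)..1, pull a g ux t y ^ 2) := by
    rw [← intervalIntegral.integral_neg, ← mul_assoc, ← intervalIntegral.integral_const_mul,
      integral_unit, integral_unit]
    have i1 := icub.neg
    have i2 := isq.const_mul (w * g t)
    rw [intervalIntegrable_iff_integrableOn_Ioo_of_le zero_le_one] at i1 i2
    refine integral_mono_ae i1 i2 ?_
    filter_upwards [hw] with y hy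
    have := neg_abs_le (pull a g ux t y)
    have h4 : 0 ≤ g t * pull a g ux t y ^ 2 := by positivity
    nlinarith [mul_le_mul_of_nonneg_left hy h4, mul_le_mul_of_nonneg_left this h4]
  linarith

theorem integral_rect_fst {t : ℝ} (ht : 0 ≤ t) (f : ℝ → ℝ) :
    ∫ p, f p.1 ∂(rect t) = ∫ s in (0 : ℝ)..t, f s := by
  have := integral_prod_mul (μ := volume.restrict (Ioo 0 t)) (ν := volume.restrict (Ioo (0 : ℝ) 1))
    f (fun _ => (1 : ℝ))
  simp only [mul_one] at this
  rw [this, intervalIntegral.integral_of_le ht, integral_Ioc_eq_integral_Ioo]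
  simp

/-- The energy inequality in a fluid gap. -/
theorem gap_energy (H : GapFlow P ρlo ρhi Ce T a g u ut ux uxx ρ ρt ρx al be) {r : ℝ → ℝ → ℝ}
    (r1 : Measurable (fun p : ℝ × ℝ => r p.1 p.2))
    (r2 : ∀ᵐ y ∂(volume.restrict (Ioo (0 : ℝ) 1)),
        HasH1Deriv 0 T (fun t => r t y) (fun t => mat a g u ρt ρx t y))
    (r3 : ∀ᵐ y ∂(volume.restrict (Ioo (0 : ℝ) 1)), ∀ t ∈ Icc 0 T, r t y ∈ Icc ρlo ρhi)
    (r4 : ∀ᵐ p ∂(rect T), pull a g ρ p.1 p.2 = r p.1 p.2) {w : ℝ → ℝ}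
    (hw : MemLp w 2 (volume.restrict (Ioo 0 T)))
    (hux : ∀ᵐ t ∂(volume.restrict (Ioo 0 T)), ∀ᵐ y ∂(volume.restrict (Ioo (0 : ℝ) 1)),
      |pull a g ux t y| ≤ w t) :
    ∀ᵐ t ∂(volume.restrict (Ioo 0 T)),
      P.muF / 2 * (g t * ∫ y in (0 : ℝ)..1, pull a g ux t y ^ 2) +
        1 / ρhi * (∫ s in (0 : ℝ)..t, g s * ∫ y in (0 : ℝ)..1,
          pull a g (stressX P uxx ρ ρx) s y ^ 2) ≤
      P.muF / 2 * (g 0 * ∫ y in (0 : ℝ)..1, pull a g ux 0 y ^ 2) +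
        (∫ y in (0 : ℝ)..1, P.pF (r t y) * (g t * pull a g ux t y)) -
        (∫ y in (0 : ℝ)..1, P.pF (r 0 y) * (g 0 * pull a g ux 0 y)) +
        (∫ s in (0 : ℝ)..t, (stress P ux ρ s (a s + g s) * be s - stress P ux ρ s (a s) * al s)) +
        ∫ s in (0 : ℝ)..t, (P.gamF * P.pF ρhi + P.muF / 2 * w s) *
          (g s * ∫ y in (0 : ℝ)..1, pull a g ux s y ^ 2) := by
  have V := H.velRect
  have F := H.fieldRect r1 r2 r3 r4
  have hgc := V.g_h1.continuousOn
  have trV := V.traces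
  have trF := F.F_traces hgc
  simp only [pull_zero, pull_one] at trV trF
  have mSx := H.stressX_L2
  have isq : ∀ {h : ℝ × ℝ → ℝ}, MemLp h 2 (rect T) → Integrable (fun p => g p.1 * h p ^ 2) (rect T) :=
    fun {h} hh => ((V.g_mul_memLp (F := fun t y => h (t, y)) hh).mul hh (r := 1)).integrable
      le_rfl |>.congr (ae_of_all _ fun p => by simp; ring)
  have iSx := isq mSx
  have iux := isq V.vx_L2
  filter_upwards [F.work V, ae_restrict_mem measurableSet_Ioo] with t hWt ht
  -- μ_f/2 times this inequality minus the work identity for the pressure replaces ∂ₓu by Σ_f, both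
  -- in the boundary terms and in the product with the acceleration.
  have hE := V.energy_le (Ioo_subset_Ioc_self ht)
  have htT : rect t ≤ rect T := rect_mono ht.2.le
  have sub : Ioo 0 t ⊆ Ioo 0 T := Ioo_subset_Ioo_right ht.2.le
  have subm : volume.restrict (Ioo 0 t) ≤ volume.restrict (Ioo 0 T) :=
    Measure.restrict_mono sub le_rfl
  have cv : ∀ {f k : ℝ → ℝ}, MemLp f 2 (volume.restrict (Ioo 0 T)) →
      MemLp k 2 (volume.restrict (Ioo 0 T)) → IntervalIntegrable (fun s => f s * k s) volume 0 t := by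
    intro f k hf hk
    rw [intervalIntegrable_iff_integrableOn_Ioo_of_le ht.1.le]
    exact ((hf.integrable_mul hk).mono_measure subm)
  simp only [pull_zero, pull_one] at hE hWt
  have b1 := cv trV.2 H.right_acc.1
  have b2 := cv trV.1 H.left_acc.1
  have b3 := cv trF.2 H.right_acc.1
  have b4 := cv trF.1 H.left_acc.1
  have e1 : (∫ s in (0 : ℝ)..t, (stress P ux ρ s (a s + g s) * be s -
      stress P ux ρ s (a s) * al s)) =
      P.muF / 2 * ((∫ p, 2 * ux p.1 (a p.1 + g p.1) * be p.1 ∂(rect t)) +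
        (∫ p, -2 * ux p.1 (a p.1) * al p.1 ∂(rect t))) -
      ((∫ p, P.pF (ρ p.1 (a p.1 + g p.1)) * be p.1 ∂(rect t)) +
        (∫ p, -P.pF (ρ p.1 (a p.1)) * al p.1 ∂(rect t))) := by
    rw [integral_rect_fst ht.1.le fun s => 2 * ux s (a s + g s) * be s,
      integral_rect_fst ht.1.le fun s => -2 * ux s (a s) * al s,
      integral_rect_fst ht.1.le fun s => P.pF (ρ s (a s + g s)) * be s,
      integral_rect_fst ht.1.le fun s => -P.pF (ρ s (a s)) * al s]
    simp only [stress, mul_assoc, neg_mul, intervalIntegral.integral_const_mul,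
      intervalIntegral.integral_neg]
    have : ∀ s, (P.muF * ux s (a s + g s) - P.pF (ρ s (a s + g s))) * be s -
        (P.muF * ux s (a s) - P.pF (ρ s (a s))) * al s =
        (P.muF * (ux s (a s + g s) * be s) - P.pF (ρ s (a s + g s)) * be s) -
        (P.muF * (ux s (a s) * al s) - P.pF (ρ s (a s)) * al s) := fun s => by ring
    simp only [this]
    rw [intervalIntegral.integral_sub ((b1.const_mul _).sub b3) ((b2.const_mul _).sub b4),
      intervalIntegral.integral_sub (b1.const_mul _) b3,
      intervalIntegral.integral_sub (b2.const_mul _) b4, intervalIntegral.integral_const_mul,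
      intervalIntegral.integral_const_mul]
    ring
  have mgux := V.g_mul_memLp V.vx_L2
  have mguxx := V.g_mul_memLp V.vxx_L2
  have m1 : Integrable (fun p : ℝ × ℝ =>
      -2 * (g p.1 * pull a g uxx p.1 p.2) * mat a g u ut ux p.1 p.2) (rect t) :=
    ((mguxx.const_mul (-2)).integrable_mul V.vt_L2).mono_measure htT
  have m2 : Integrable (fun p : ℝ × ℝ => -(g p.1 * (deriv P.pF (pull a g ρ p.1 p.2) *
      pull a g ρx p.1 p.2)) * mat a g u ut ux p.1 p.2) (rect t) :=
    ((V.g_mul_memLp (F := fun t y => deriv P.pF (pull a g ρ t y) * pull a g ρx t y)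
      F.fx_L2).neg.integrable_mul V.vt_L2).mono_measure htT
  have m3 : Integrable (fun p : ℝ × ℝ => (g p.1 * pull a g ux p.1 p.2) *
      (deriv P.pF (r p.1 p.2) * mat a g u ρt ρx p.1 p.2)) (rect t) :=
    (mgux.integrable_mul F.ft_L2).mono_measure htT
  have m4 : Integrable (fun p : ℝ × ℝ => rel a g u p.1 p.2 *
      ((g p.1 * pull a g uxx p.1 p.2) * pull a g ux p.1 p.2)) (rect t) := by
    have := mguxx.mul (memLp_top_rect H.rel_continuousOn) (r := 2)
    refine ((this.integrable_mul V.vx_L2).mono_measure htT).congr (ae_of_all _ fun p => ?_)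
    simp only [Pi.mul_apply]
    ring
  have e2 : P.muF / 2 * (∫ p, -2 * (g p.1 * pull a g uxx p.1 p.2) *
      mat a g u ut ux p.1 p.2 ∂(rect t)) - (∫ p, -(g p.1 * (deriv P.pF (pull a g ρ p.1 p.2) *
      pull a g ρx p.1 p.2)) * mat a g u ut ux p.1 p.2 ∂(rect t)) -
      (∫ p, (g p.1 * pull a g ux p.1 p.2) *
      (deriv P.pF (r p.1 p.2) * mat a g u ρt ρx p.1 p.2) ∂(rect t)) =
      ∫ p, (-(g p.1 * pull a g (stressX P uxx ρ ρx) p.1 p.2) * mat a g u ut ux p.1 p.2 -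
        (g p.1 * pull a g ux p.1 p.2) * (deriv P.pF (r p.1 p.2) * mat a g u ρt ρx p.1 p.2))
        ∂(rect t) := by
    rw [← integral_const_mul, ← integral_sub (m1.const_mul _) m2]
    refine (integral_sub ((m1.const_mul (P.muF / 2)).sub m2) m3).symm.trans ?_
    refine integral_congr_ae (ae_of_all _ fun p => ?_)
    simp only [pull, stressX, Pi.sub_apply]
    ring
  have e3 : ∫ p, (-(g p.1 * pull a g (stressX P uxx ρ ρx) p.1 p.2) * mat a g u ut ux p.1 p.2 -
        (g p.1 * pull a g ux p.1 p.2) * (deriv P.pF (r p.1 p.2) * mat a g u ρt ρx p.1 p.2))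
        ∂(rect t) ≤ ∫ p, (-(1 / ρhi) * (g p.1 * pull a g (stressX P uxx ρ ρx) p.1 p.2 ^ 2) +
        P.gamF * P.pF ρhi * (g p.1 * pull a g ux p.1 p.2 ^ 2) +
        P.muF * (rel a g u p.1 p.2 * ((g p.1 * pull a g uxx p.1 p.2) * pull a g ux p.1 p.2)))
        ∂(rect t) := by
    refine integral_mono_ae ?_ ((((iSx.mono_measure htT).const_mul _).add
      ((iux.mono_measure htT).const_mul _)).add (m4.const_mul _))
      (htT.absolutelyContinuous.ae_le (H.ae_power r4))
    exact (((V.g_mul_memLp mSx).neg.integrable_mul V.vt_L2).mono_measure htT).sub m3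
  have e4 : ∀ {h : ℝ → ℝ → ℝ}, Integrable (fun p : ℝ × ℝ => g p.1 * h p.1 p.2 ^ 2) (rect t) →
      IntervalIntegrable (fun s => g s * ∫ y in (0 : ℝ)..1, h s y ^ 2) volume 0 t ∧
      ∫ p, g p.1 * h p.1 p.2 ^ 2 ∂(rect t) =
        ∫ s in (0 : ℝ)..t, g s * ∫ y in (0 : ℝ)..1, h s y ^ 2 := by
    intro h hh
    have := integral_rect ht.1.le hh
    simpa only [intervalIntegral.integral_const_mul] using this
  have e5 := e4 (h := pull a g (stressX P uxx ρ ρx)) (iSx.mono_measure htT)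
  have e6 := e4 (h := pull a g ux) (iux.mono_measure htT)
  have e7 := integral_rect ht.1.le m4
  have iKE : IntervalIntegrable (fun s => (∫ y in (0 : ℝ)..1, pull a g ux s y ^ 2) *
      (u s (a s + g s) - u s (a s))) volume 0 t := by
    have h := ((H.right_acc.sub H.left_acc).continuousOn.mono
      Ioo_subset_Icc_self).aestronglyMeasurable (μ := volume) measurableSet_Ioo
    refine cv V.energy_memLp ?_
    obtain ⟨C, hC⟩ := (H.right_acc.sub H.left_acc).exists_bound
    refine MemLp.of_bound h C ?_
    filter_upwards [ae_restrict_mem measurableSet_Ioo] with s hs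
    exact hC s (Ioo_subset_Icc_self hs)
  have e8 : (∫ p, -(∫ y in (0 : ℝ)..1, pull a g ux p.1 y ^ 2) *
      (u p.1 (a p.1 + g p.1) - u p.1 (a p.1)) ∂(rect t)) =
      -∫ s in (0 : ℝ)..t, (∫ y in (0 : ℝ)..1, pull a g ux s y ^ 2) *
        (u s (a s + g s) - u s (a s)) := by
    rw [integral_rect_fst ht.1.le fun s => -(∫ y in (0 : ℝ)..1, pull a g ux s y ^ 2) *
      (u s (a s + g s) - u s (a s)), ← intervalIntegral.integral_neg]
    simp only [neg_mul]
  have iwe : IntervalIntegrable (fun s => w s * (g s * ∫ y in (0 : ℝ)..1, pull a g ux s y ^ 2))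
      volume 0 t := by
    have h1 := (cv hw V.energy_memLp).continuousOn_mul (g := g) (by
      rw [uIcc_of_le ht.1.le]; exact hgc.mono (Icc_subset_Icc_right ht.2.le))
    exact h1.congr fun s _ => by ring
  have e9 : 2 * (∫ s in (0 : ℝ)..t, ∫ y in (0 : ℝ)..1, rel a g u s y *
      ((g s * pull a g uxx s y) * pull a g ux s y)) -
      (∫ s in (0 : ℝ)..t, (∫ y in (0 : ℝ)..1, pull a g ux s y ^ 2) *
        (u s (a s + g s) - u s (a s))) ≤
      ∫ s in (0 : ℝ)..t, w s * (g s * ∫ y in (0 : ℝ)..1, pull a g ux s y ^ 2) := by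
    rw [← intervalIntegral.integral_const_mul,
      ← intervalIntegral.integral_sub (e7.1.const_mul 2) iKE]
    refine intervalIntegral.integral_mono_ae_restrict ht.1.le ((e7.1.const_mul 2).sub iKE) iwe ?_
    rw [← restrict_Ioo_eq_restrict_Icc]
    filter_upwards [ae_restrict_of_ae_restrict_of_subset sub H.integral_convection,
      ae_restrict_of_ae_restrict_of_subset sub hux] with s h1 h2
    exact h1 _ h2
  have e10 : (∫ s in (0 : ℝ)..t, (P.gamF * P.pF ρhi + P.muF / 2 * w s) *
          (g s * ∫ y in (0 : ℝ)..1, pull a g ux s y ^ 2)) =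
      P.gamF * P.pF ρhi * (∫ s in (0 : ℝ)..t, g s * ∫ y in (0 : ℝ)..1, pull a g ux s y ^ 2) +
      P.muF / 2 * ∫ s in (0 : ℝ)..t, w s * (g s * ∫ y in (0 : ℝ)..1, pull a g ux s y ^ 2) := by
    rw [← intervalIntegral.integral_const_mul, ← intervalIntegral.integral_const_mul,
      ← intervalIntegral.integral_add (e6.1.const_mul _) (iwe.const_mul _)]
    exact intervalIntegral.integral_congr fun s _ => by ring
  have e11 : ∫ p, (-(1 / ρhi) * (g p.1 * pull a g (stressX P uxx ρ ρx) p.1 p.2 ^ 2) +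
        P.gamF * P.pF ρhi * (g p.1 * pull a g ux p.1 p.2 ^ 2) +
        P.muF * (rel a g u p.1 p.2 * ((g p.1 * pull a g uxx p.1 p.2) * pull a g ux p.1 p.2)))
        ∂(rect t) = -(1 / ρhi) * (∫ s in (0 : ℝ)..t, g s * ∫ y in (0 : ℝ)..1,
          pull a g (stressX P uxx ρ ρx) s y ^ 2) +
        P.gamF * P.pF ρhi * (∫ s in (0 : ℝ)..t, g s * ∫ y in (0 : ℝ)..1, pull a g ux s y ^ 2) +
        P.muF * ∫ s in (0 : ℝ)..t, ∫ y in (0 : ℝ)..1, rel a g u s y *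
          ((g s * pull a g uxx s y) * pull a g ux s y) := by
    refine (integral_add (((iSx.mono_measure htT).const_mul _).add
      ((iux.mono_measure htT).const_mul _)) (m4.const_mul _)).trans ?_
    simp only [Pi.add_apply]
    rw [integral_add ((iSx.mono_measure htT).const_mul _) ((iux.mono_measure htT).const_mul _),
      integral_const_mul, integral_const_mul, integral_const_mul, e5.2, e6.2, e7.2]
  rw [e8] at hE
  rw [e1, e10]
  have hmu := P.muF_pos
  have hE' := mul_le_mul_of_nonneg_left hE (half_pos hmu).le
  have e9' := mul_le_mul_of_nonneg_left e9 (half_pos hmu).le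
  rw [e11] at e3
  linarith

end GapFlow

/-- The device for passing from almost every time to every time, the end points included: good times
accumulate at every t. -/
theorem frequently_of_ae {T t : ℝ} (hT : 0 < T) (ht : t ∈ Icc 0 T) {p : ℝ → Prop}
    (h : ∀ᵐ s ∂(volume.restrict (Ioo 0 T)), p s) :
    ∃ᶠ s in 𝓝[Icc 0 T] t, p s ∧ s ∈ Ioo 0 T := by
  have hd : Dense {s | s ∈ Ioo 0 T → p s} :=
    Measure.dense_of_ae ((ae_restrict_iff' measurableSet_Ioo).1 h)
  have h1 := hd.open_subset_closure_inter (isOpen_Ioo (a := (0 : ℝ)) (b := T))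
  have h2 : t ∈ closure (Ioo 0 T ∩ {s | s ∈ Ioo 0 T → p s}) := by
    rw [← closure_Ioo hT.ne] at ht
    exact closure_minimal h1 isClosed_closure ht
  have h3 := mem_closure_iff_frequently.1 h2
  rw [frequently_nhdsWithin_iff]
  exact h3.mono fun s hs => ⟨⟨hs.2 hs.1, hs.1⟩, Ioo_subset_Icc_self hs.1⟩

/-! ### One gap: absorption of the pressure work and density bounds from the initial data. -/

namespace GapFlow

variable {P : Params} {ρlo ρhi Ce T : ℝ} {a g : ℝ → ℝ}
  {u ut ux uxx ρ ρt ρx : ℝ → ℝ → ℝ} {al be : ℝ → ℝ}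

theorem energy_intervalIntegrable (H : GapFlow P ρlo ρhi Ce T a g u ut ux uxx ρ ρt ρx al be) :
    IntervalIntegrable (fun s => ∫ x in (a s)..(a s + g s), ux s x ^ 2) volume 0 T := by
  have V := H.velRect
  have := (integral_rect H.pos.le (G := fun p => g p.1 * pull a g ux p.1 p.2 ^ 2)
    (((V.g_mul_memLp V.vx_L2).integrable_mul V.vx_L2).congr
      (ae_of_all _ fun p => by simp only [Pi.mul_apply]; ring))).1
  refine this.congr fun s _ => ?_
  simp only [intervalIntegral.integral_const_mul]
  exact integral_pull fun x => ux s x ^ 2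

theorem stressX_intervalIntegrable (H : GapFlow P ρlo ρhi Ce T a g u ut ux uxx ρ ρt ρx al be) :
    IntervalIntegrable (fun s => ∫ x in (a s)..(a s + g s), stressX P uxx ρ ρx s x ^ 2)
      volume 0 T := by
  have := (integral_rect H.pos.le
    (G := fun p => g p.1 * pull a g (stressX P uxx ρ ρx) p.1 p.2 ^ 2)
    (((H.velRect.g_mul_memLp H.stressX_L2).integrable_mul H.stressX_L2).congr
      (ae_of_all _ fun p => by simp only [Pi.mul_apply]; ring))).1
  refine this.congr fun s _ => ?_
  simp only [intervalIntegral.integral_const_mul]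
  exact integral_pull fun x => stressX P uxx ρ ρx s x ^ 2

theorem stress_traces (H : GapFlow P ρlo ρhi Ce T a g u ut ux uxx ρ ρt ρx al be) :
    MemLp (fun t => stress P ux ρ t (a t)) 2 (volume.restrict (Ioo 0 T)) ∧
      MemLp (fun t => stress P ux ρ t (a t + g t)) 2 (volume.restrict (Ioo 0 T)) := by
  obtain ⟨-, r, r1, r2, r3, r4⟩ := H.exists_rho
  have trV := H.velRect.traces
  have trF := (H.fieldRect r1 r2 r3 r4).F_traces H.length.continuousOn
  simp only [pull_zero, pull_one] at trV trF
  exact ⟨(trV.1.const_mul P.muF).sub trF.1, (trV.2.const_mul P.muF).sub trF.2⟩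

theorem lsc (H : GapFlow P ρlo ρhi Ce T a g u ut ux uxx ρ ρt ρx al be) {t η : ℝ}
    (ht : t ∈ Icc 0 T) (hη : 0 < η) : ∀ᶠ s in 𝓝[Icc 0 T] t,
      ∫ x in (a t)..(a t + g t), ux t x ^ 2 ≤ (∫ x in (a s)..(a s + g s), ux s x ^ 2) + η := by
  filter_upwards [H.velRect.lsc ht hη] with s hs
  rw [← integral_pull fun x => ux t x ^ 2, ← integral_pull fun x => ux s x ^ 2]
  exact hs

/-- The work of the pressure is controlled by the energy. -/
theorem abs_pressure_work_le (H : GapFlow P ρlo ρhi Ce T a g u ut ux uxx ρ ρt ρx al be)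
    {r : ℝ → ℝ} {t : ℝ} (ht : t ∈ Icc 0 T)
    (hr : ∀ᵐ y ∂(volume.restrict (Ioo (0 : ℝ) 1)), r y ∈ Icc ρlo ρhi) :
    |∫ y in (0 : ℝ)..1, P.pF (r y) * (g t * pull a g ux t y)| ≤
      P.muF / 4 * (∫ x in (a t)..(a t + g t), ux t x ^ 2) + P.pF ρhi ^ 2 / P.muF * g t := by
  have hg := H.length_pos t ht
  have hmu := P.muF_pos
  have i1 := H.velRect.vx_sq_int ht
  rw [integral_unit]
  have h1 : ∫ y in Ioo (0 : ℝ) 1, (P.muF / 4 * (g t * pull a g ux t y ^ 2) +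
      P.pF ρhi ^ 2 / P.muF * g t) =
      P.muF / 4 * (∫ x in (a t)..(a t + g t), ux t x ^ 2) + P.pF ρhi ^ 2 / P.muF * g t := by
    rw [← integral_unit, intervalIntegral.integral_add ((i1.const_mul _).const_mul _)
      (by simp), intervalIntegral.integral_const_mul, intervalIntegral.integral_const_mul,
      ← integral_pull fun x => ux t x ^ 2]
    simp [pull]
  rw [← h1]
  have i2 := ((i1.const_mul (g t)).const_mul (P.muF / 4)).add
    (intervalIntegrable_const (c := P.pF ρhi ^ 2 / P.muF * g t) (μ := volume) (a := 0) (b := 1))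
  rw [intervalIntegrable_iff_integrableOn_Ioo_of_le zero_le_one] at i2
  rw [← Real.norm_eq_abs]
  refine norm_integral_le_of_norm_le i2 ?_
  filter_upwards [hr] with y hy
  have p0 := P.pF_nonneg (H.lo_pos.le.trans hy.1)
  have p1 := P.pF_mono (H.lo_pos.le.trans hy.1) hy.2
  rw [Real.norm_eq_abs, abs_mul, abs_mul, abs_of_nonneg p0, abs_of_pos hg]
  -- Young's inequality by completing a square. The weight μ_f/4 is half of the coefficient μ_f/2 of
  -- the energy, so half of the energy survives.
  have e : P.muF / 4 * (g t * pull a g ux t y ^ 2) + P.pF ρhi ^ 2 / P.muF * g t -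
      P.pF ρhi * (g t * |pull a g ux t y|) =
      g t / P.muF * (P.muF / 2 * |pull a g ux t y| - P.pF ρhi) ^ 2 := by
    rw [← sq_abs (pull a g ux t y)]
    field_simp
    ring
  have e2 : 0 ≤ g t / P.muF * (P.muF / 2 * |pull a g ux t y| - P.pF ρhi) ^ 2 := by positivity
  have e3 : P.pF (r y) * (g t * |pull a g ux t y|) ≤ P.pF ρhi * (g t * |pull a g ux t y|) :=
    mul_le_mul_of_nonneg_right p1 (by positivity)
  linarith

/-- The energy inequality in a fluid gap, with the work of the pressure absorbed. -/
theorem energy_le (H : GapFlow P ρlo ρhi Ce T a g u ut ux uxx ρ ρt ρx al be) {w : ℝ → ℝ}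
    (hw : MemLp w 2 (volume.restrict (Ioo 0 T)))
    (hux : ∀ᵐ t ∂(volume.restrict (Ioo 0 T)),
      ∀ᵐ x ∂(volume.restrict (Ioo (a t) (a t + g t))), |ux t x| ≤ w t) :
    ∀ᵐ t ∂(volume.restrict (Ioo 0 T)),
      P.muF / 4 * (∫ x in (a t)..(a t + g t), ux t x ^ 2) +
        1 / ρhi * (∫ s in (0 : ℝ)..t, ∫ x in (a s)..(a s + g s), stressX P uxx ρ ρx s x ^ 2) ≤
      3 * P.muF / 4 * (∫ x in (a 0)..(a 0 + g 0), ux 0 x ^ 2) +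
        P.pF ρhi ^ 2 / P.muF * (g t + g 0) +
        (∫ s in (0 : ℝ)..t, (stress P ux ρ s (a s + g s) * be s - stress P ux ρ s (a s) * al s)) +
        ∫ s in (0 : ℝ)..t, (P.gamF * P.pF ρhi + P.muF / 2 * w s) *
          ∫ x in (a s)..(a s + g s), ux s x ^ 2 := by
  obtain ⟨-, r, r1, r2, r3, r4⟩ := H.exists_rho
  have hux' : ∀ᵐ t ∂(volume.restrict (Ioo 0 T)), ∀ᵐ y ∂(volume.restrict (Ioo (0 : ℝ) 1)),
      |pull a g ux t y| ≤ w t := by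
    filter_upwards [hux, ae_restrict_mem measurableSet_Ioo] with t h1 ht
    exact ae_pull (H.length_pos t (Ioo_subset_Icc_self ht)) h1
  filter_upwards [H.gap_energy r1 r2 r3 r4 hw hux', ae_restrict_mem measurableSet_Ioo] with t h ht
  have p0 := H.abs_pressure_work_le (r := r 0) ⟨le_rfl, H.pos.le⟩
    (r3.mono fun y hy => hy 0 ⟨le_rfl, H.pos.le⟩)
  have pt := H.abs_pressure_work_le (r := r t) (Ioo_subset_Icc_self ht)
    (r3.mono fun y hy => hy t (Ioo_subset_Icc_self ht))
  have E : ∀ s, g s * (∫ y in (0 : ℝ)..1, pull a g ux s y ^ 2) =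
      ∫ x in (a s)..(a s + g s), ux s x ^ 2 := fun s => integral_pull fun x => ux s x ^ 2
  have D : ∀ s, g s * (∫ y in (0 : ℝ)..1, pull a g (stressX P uxx ρ ρx) s y ^ 2) =
      ∫ x in (a s)..(a s + g s), stressX P uxx ρ ρx s x ^ 2 :=
    fun s => integral_pull fun x => stressX P uxx ρ ρx s x ^ 2
  simp only [E, D] at h
  have := neg_abs_le (∫ y in (0 : ℝ)..1, P.pF (r 0 y) * (g 0 * pull a g ux 0 y))
  have := le_abs_self (∫ y in (0 : ℝ)..1, P.pF (r t y) * (g t * pull a g ux t y))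
  linarith

theorem eLpNorm_two_sq {μ : Measure ℝ} (f : ℝ → ℝ) :
    eLpNorm f 2 μ ^ 2 = ∫⁻ x, ‖f x‖ₑ ^ 2 ∂μ := by
  have := eLpNorm_nnreal_pow_eq_lintegral (μ := μ) (f := f) (p := 2) two_ne_zero
  simpa using this

theorem posSq_mono {x y : ℝ} (h : x ≤ y) : posSq x ≤ posSq y :=
  pow_le_pow_left₀ (le_max_right _ _) (max_le_max_right 0 h) 2

/-- The initial trace of the density in the frame inherits the bounds of the initial density. -/
theorem initial_trace (H : GapFlow P ρlo ρhi Ce T a g u ut ux uxx ρ ρt ρx al be) {r : ℝ → ℝ → ℝ}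
    (r1 : Measurable (fun p : ℝ × ℝ => r p.1 p.2))
    (r2 : ∀ᵐ y ∂(volume.restrict (Ioo (0 : ℝ) 1)),
        HasH1Deriv 0 T (fun t => r t y) (fun t => mat a g u ρt ρx t y))
    (r3 : ∀ᵐ y ∂(volume.restrict (Ioo (0 : ℝ) 1)), ∀ t ∈ Icc 0 T, r t y ∈ Icc ρlo ρhi)
    (r4 : ∀ᵐ p ∂(rect T), pull a g ρ p.1 p.2 = r p.1 p.2) {σ c : ℝ} (hσ : |σ| = 1)
    (hinit : Tendsto (fun t => eLpNorm (fun x => ρ t x - ρ 0 x) 2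
      (volume.restrict (Ioo (a t) (a t + g t) ∩ Ioo (a 0) (a 0 + g 0)))) (𝓝[Icc 0 T] 0) (𝓝 0))
    (h0 : ∀ x ∈ Ioo (a 0) (a 0 + g 0), σ * ρ 0 x ≤ c) :
    ∀ᵐ y ∂(volume.restrict (Ioo (0 : ℝ) 1)), σ * r 0 y ≤ c := by
  have hT := H.pos
  have hz : (0 : ℝ) ∈ Icc 0 T := ⟨le_rfl, hT.le⟩
  set C := (|ρhi| + |ρlo| + |c|) ^ 2
  have hC : ∀ {x : ℝ}, x ∈ Icc ρlo ρhi → posSq (σ * x - c) ≤ C := by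
    intro x hx
    refine (posSq_le _).trans ?_
    rw [← sq_abs]
    refine pow_le_pow_left₀ (abs_nonneg _) ?_ 2
    have h3 : |x| ≤ |ρhi| + |ρlo| := by
      rw [abs_le]
      constructor
      · linarith [neg_abs_le ρlo, abs_nonneg ρhi, hx.1]
      · linarith [le_abs_self ρhi, abs_nonneg ρlo, hx.2]
    calc |σ * x - c| ≤ |σ * x| + |c| := abs_sub _ _
      _ ≤ _ := by rw [abs_mul, hσ, one_mul]; linarith
  -- I measures the violation of the bound. It is continuous at time 0 by dominated convergence, as
  -- r is continuous in time, so it suffices to find times tending to 0 along which it tends to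
  -- zero.
  let I : ℝ → ℝ := fun s => ∫ y in Ioo (0 : ℝ) 1, posSq (σ * r s y - c)
  have hm : ∀ s, AEStronglyMeasurable (fun y => posSq (σ * r s y - c))
      (volume.restrict (Ioo (0 : ℝ) 1)) := fun s =>
    (contDiff_posSq.continuous.measurable.comp
      (((r1.comp measurable_prodMk_left).const_mul σ).sub_const c)).aestronglyMeasurable
  have hIc : Tendsto I (𝓝[Icc 0 T] 0) (𝓝 (I 0)) := by
    refine tendsto_integral_filter_of_dominated_convergence (fun _ => C)
      (Eventually.of_forall hm) ?_ (integrable_const _) ?_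
    · filter_upwards [self_mem_nhdsWithin] with s hs
      filter_upwards [r3] with y hy
      rw [Real.norm_of_nonneg (posSq_nonneg _)]
      exact hC (hy s hs)
    · filter_upwards [r2] with y hy
      exact (contDiff_posSq.continuous.tendsto _).comp
        (((hy.continuousOn 0 hz).tendsto.const_mul σ).sub_const c)
  have hgI : Tendsto (fun s => ENNReal.ofReal (g s * I s)) (𝓝[Icc 0 T] 0)
      (𝓝 (ENNReal.ofReal (g 0 * I 0))) :=
    (ENNReal.continuous_ofReal.tendsto _).comp ((H.length.continuousOn 0 hz).tendsto.mul hIc)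
  -- In physical space, the violation on the overlap with the initial gap is at most the squared L²
  -- distance to the initial density. The rest of the gap has length tending to 0, and there the
  -- integrand is bounded by C.
  let β : ℝ → ℝ≥0∞ := fun s => eLpNorm (fun x => ρ s x - ρ 0 x) 2
      (volume.restrict (Ioo (a s) (a s + g s) ∩ Ioo (a 0) (a 0 + g 0))) ^ (2 : ℕ) +
    ENNReal.ofReal C * (ENNReal.ofReal (a 0 - a s) +
      ENNReal.ofReal (a s + g s - (a 0 + g 0)))
  have hβ : Tendsto β (𝓝[Icc 0 T] 0) (𝓝 0) := by
    have e1 : Tendsto (fun s => ENNReal.ofReal (a 0 - a s)) (𝓝[Icc 0 T] 0) (𝓝 0) := by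
      have := (ENNReal.continuous_ofReal.tendsto _).comp
        ((H.left.continuousOn 0 hz).tendsto.const_sub (a 0))
      simpa [Function.comp_def] using this
    have e2 : Tendsto (fun s => ENNReal.ofReal (a s + g s - (a 0 + g 0))) (𝓝[Icc 0 T] 0)
        (𝓝 0) := by
      have := (ENNReal.continuous_ofReal.tendsto _).comp
        (((H.left.continuousOn 0 hz).tendsto.add (H.length.continuousOn 0 hz).tendsto).sub_const
          (a 0 + g 0))
      simpa [Function.comp_def] using this
    have := (ENNReal.Tendsto.pow (n := 2) hinit).add (ENNReal.Tendsto.const_mul (e1.add e2)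
      (Or.inr (ENNReal.ofReal_ne_top (r := C))))
    simpa using this
  have hle : ∀ᵐ s ∂(volume.restrict (Ioo 0 T)), ENNReal.ofReal (g s * I s) ≤ β s := by
    filter_upwards [ae_slice_left r4, ae_restrict_mem measurableSet_Ioo] with s hs hsT
    have hg := H.length_pos s (Ioo_subset_Icc_self hsT)
    have e1 : g s * I s = ∫ x in Ioo (a s) (a s + g s), posSq (σ * ρ s x - c) := by
      rw [← integral_Ioc_eq_integral_Ioo, ← intervalIntegral.integral_of_le (by linarith),
        ← integral_pull fun x => posSq (σ * ρ s x - c), integral_unit]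
      congr 1
      refine integral_congr_ae ?_
      filter_upwards [hs] with y hy
      rw [← hy]
      rfl
    rw [e1]
    have e2 : ENNReal.ofReal (∫ x in Ioo (a s) (a s + g s), posSq (σ * ρ s x - c)) ≤
        ∫⁻ x in Ioo (a s) (a s + g s), ENNReal.ofReal (posSq (σ * ρ s x - c)) := by
      by_cases hi : Integrable (fun x => posSq (σ * ρ s x - c))
        (volume.restrict (Ioo (a s) (a s + g s)))
      · rw [ofReal_integral_eq_lintegral_ofReal hi (ae_of_all _ fun _ => posSq_nonneg _)]
      · rw [integral_undef hi]; simp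
    refine e2.trans ?_
    rw [← lintegral_inter_add_sdiff _ _ (measurableSet_Ioo (a := a 0) (b := a 0 + g 0))]
    refine add_le_add ?_ ?_
    · rw [eLpNorm_two_sq]
      refine setLIntegral_mono_ae' (measurableSet_Ioo.inter measurableSet_Ioo)
        (ae_of_all _ fun x hx => ?_)
      rw [← Real.enorm_abs, ← ofReal_norm, ← ENNReal.ofReal_pow (norm_nonneg _)]
      refine ENNReal.ofReal_le_ofReal ?_
      rw [norm_abs_eq_norm, Real.norm_eq_abs, sq_abs]
      have h1 := h0 x hx.2
      have h2 : σ ^ 2 = 1 := by rw [← sq_abs, hσ, one_pow]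
      calc posSq (σ * ρ s x - c) ≤ posSq (σ * (ρ s x - ρ 0 x)) := posSq_mono (by linarith)
        _ ≤ (σ * (ρ s x - ρ 0 x)) ^ 2 := posSq_le _
        _ = _ := by rw [mul_pow, h2, one_mul]
    · have hb : ∀ᵐ x ∂(volume.restrict (Ioo (a s) (a s + g s) \ Ioo (a 0) (a 0 + g 0))),
          ENNReal.ofReal (posSq (σ * ρ s x - c)) ≤ ENNReal.ofReal C := by
        filter_upwards [ae_restrict_of_ae_restrict_of_subset sdiff_subset (H.rho_bdd s hsT)]
          with x hx
        exact ENNReal.ofReal_le_ofReal (hC hx)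
      refine (lintegral_mono_ae hb).trans ?_
      rw [lintegral_const, Measure.restrict_apply_univ]
      refine mul_le_mul_right ?_ _
      have hsub : Ioo (a s) (a s + g s) \ Ioo (a 0) (a 0 + g 0) ⊆
          Ioc (a s) (a 0) ∪ Ico (a 0 + g 0) (a s + g s) := by
        rintro x ⟨h1, h2⟩
        rw [mem_Ioo, not_and_or, not_lt, not_lt] at h2
        exact h2.imp (fun h => ⟨h1.1, h⟩) fun h => ⟨h, h1.2⟩
      refine (measure_mono hsub).trans ((measure_union_le _ _).trans ?_)
      rw [Real.volume_Ioc, Real.volume_Ico]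
  have hlim : ENNReal.ofReal (g 0 * I 0) ≤ 0 :=
    le_of_tendsto_of_tendsto_of_frequently hgI hβ
      ((frequently_of_ae hT hz hle).mono fun s hs => hs.1)
  have hI0 : I 0 = 0 := by
    have h1 : g 0 * I 0 ≤ 0 := by simpa using hlim
    have h2 : 0 ≤ I 0 := integral_nonneg fun _ => posSq_nonneg _
    have := H.length_pos 0 hz
    nlinarith
  have hint : Integrable (fun y => posSq (σ * r 0 y - c)) (volume.restrict (Ioo (0 : ℝ) 1)) :=
    Integrable.of_bound (hm 0) C (r3.mono fun y hy => by
      rw [Real.norm_of_nonneg (posSq_nonneg _)]; exact hC (hy 0 hz))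
  filter_upwards [(integral_eq_zero_iff_of_nonneg (fun _ => posSq_nonneg _) hint).1 hI0] with y hy
  linarith [nonpos_of_posSq_eq_zero hy]

/-- Bounds of the density propagate from the initial time. -/
theorem rho_bounds (H : GapFlow P ρlo ρhi Ce T a g u ut ux uxx ρ ρt ρx al be) {w : ℝ → ℝ}
    (hw : MemLp w 2 (volume.restrict (Ioo 0 T))) (hw0 : ∀ t, 0 ≤ w t)
    (hw1 : 2 * ∫ t in (0 : ℝ)..T, w t < 1)
    (hux : ∀ᵐ t ∂(volume.restrict (Ioo 0 T)),
      ∀ᵐ x ∂(volume.restrict (Ioo (a t) (a t + g t))), |ux t x| ≤ w t) {lo hi : ℝ}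
    (hinit : Tendsto (fun t => eLpNorm (fun x => ρ t x - ρ 0 x) 2
      (volume.restrict (Ioo (a t) (a t + g t) ∩ Ioo (a 0) (a 0 + g 0)))) (𝓝[Icc 0 T] 0) (𝓝 0))
    (h0 : ∀ x ∈ Ioo (a 0) (a 0 + g 0), lo ≤ ρ 0 x ∧ ρ 0 x ≤ hi) :
    ∀ᵐ t ∂(volume.restrict (Ioo 0 T)),
      ∀ᵐ x ∂(volume.restrict (Ioo (a t) (a t + g t))),
        lo - ρhi * (∫ s in (0 : ℝ)..T, w s) ≤ ρ t x ∧
        ρ t x ≤ hi + ρhi * (∫ s in (0 : ℝ)..T, w s) := by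
  obtain ⟨-, r, r1, r2, r3, r4⟩ := H.exists_rho
  have hux' : ∀ᵐ t ∂(volume.restrict (Ioo 0 T)), ∀ᵐ y ∂(volume.restrict (Ioo (0 : ℝ) 1)),
      |pull a g ux t y| ≤ w t := by
    filter_upwards [hux, ae_restrict_mem measurableSet_Ioo] with t h1 ht
    exact ae_pull (H.length_pos t (Ioo_subset_Icc_self ht)) h1
  have i1 := H.initial_trace r1 r2 r3 r4 (σ := 1) (by simp) hinit
    fun x hx => by rw [one_mul]; exact (h0 x hx).2
  have i2 := H.initial_trace r1 r2 r3 r4 (σ := -1) (c := -lo) (by simp) hinit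
    fun x hx => by linarith [(h0 x hx).1]
  have u1 := H.rho_le r1 r2 r3 r4 hw hw0 hw1 hux' (σ := 1) (by simp) i1
  have u2 := H.rho_le r1 r2 r3 r4 hw hw0 hw1 hux' (σ := -1) (by simp) i2
  have hwi : IntervalIntegrable w volume 0 T := by
    rw [intervalIntegrable_iff_integrableOn_Ioo_of_le H.pos.le]
    exact hw.integrable (by norm_num)
  filter_upwards [ae_slice_left r4, ae_restrict_mem measurableSet_Ioo] with t h1 ht
  have ht' := Ioo_subset_Icc_self ht
  have hg := H.length_pos t ht'
  refine ae_of_ae_pull hg ?_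
  have e5 : ∫ s in (0 : ℝ)..t, w s ≤ ∫ s in (0 : ℝ)..T, w s :=
    intervalIntegral.integral_mono_interval le_rfl ht'.1 ht'.2 (ae_of_all _ hw0) hwi
  filter_upwards [h1, u1 t ht', u2 t ht', r3] with y hy b1 b2 b3
  have hpos : 0 ≤ ρhi := H.lo_pos.le.trans ((b3 t ht').1.trans (b3 t ht').2)
  have := mul_le_mul_of_nonneg_left e5 hpos
  change _ ≤ pull a g ρ t y ∧ pull a g ρ t y ≤ _
  rw [hy]
  constructor <;> linarith

end GapFlow

/-! ### Alternating intervals -/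

/-- The points `-1 = p 0 < q 1 < p 1 < q 2 < ⋯ < p N < q (N + 1) = 1`: the intervals
`(p k, q (k + 1))` are the gaps, the intervals `(q k, p k)` the bubbles. -/
structure Chain (N : ℕ) (p q : ℕ → ℝ) : Prop where
  first : p 0 = -1
  last : q (N + 1) = 1
  gap_pos : ∀ k ≤ N, p k < q (k + 1)
  bubble_pos : ∀ k ∈ Finset.Icc 1 N, q k < p k

namespace Chain

variable {N : ℕ} {p q : ℕ → ℝ}

theorem p_mono (H : Chain N p q) {j k : ℕ} (hjk : j ≤ k) (hk : k ≤ N) : p j ≤ p k := by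
  induction k, hjk using Nat.le_induction with
  | base => exact le_rfl
  | succ k hjk ih =>
    exact (ih (by omega)).trans ((H.gap_pos k (by omega)).le.trans
      (H.bubble_pos (k + 1) (Finset.mem_Icc.2 ⟨by omega, hk⟩)).le)

/-- The index starts at 1: the value `q 0` is not one of the chain's points. -/
theorem q_mono (H : Chain N p q) {j k : ℕ} (hj : 1 ≤ j) (hjk : j ≤ k) (hk : k ≤ N + 1) :
    q j ≤ q k := by
  induction k, hjk using Nat.le_induction with
  | base => exact le_rfl
  | succ k hjk ih =>
    exact (ih (by omega)).trans ((H.bubble_pos k (Finset.mem_Icc.2 ⟨by omega, by omega⟩)).le.trans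
      (H.gap_pos k (by omega)).le)

theorem p_le_q (H : Chain N p q) {j k : ℕ} (hjk : j < k) (hk : k ≤ N + 1) : p j < q k :=
  (H.gap_pos j (by omega)).trans_le (H.q_mono (by omega) hjk hk)

theorem q_le_p (H : Chain N p q) {j k : ℕ} (hj : 1 ≤ j) (hjk : j ≤ k) (hk : k ≤ N) : q j < p k :=
  (H.bubble_pos j (Finset.mem_Icc.2 ⟨hj, by omega⟩)).trans_le (H.p_mono hjk hk)

theorem gap_subset (H : Chain N p q) {k : ℕ} (hk : k ≤ N) : Icc (p k) (q (k + 1)) ⊆ Icc (-1) 1 :=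
  Icc_subset_Icc (H.first ▸ H.p_mono (Nat.zero_le k) hk)
    (H.last ▸ H.q_mono (by omega) (by omega) le_rfl)

theorem bubble_subset (H : Chain N p q) {k : ℕ} (hk : k ∈ Finset.Icc 1 N) :
    Icc (q k) (p k) ⊆ Icc (-1) 1 := by
  obtain ⟨h1, h2⟩ := Finset.mem_Icc.1 hk
  refine Icc_subset_Icc (H.first ▸ ?_) (H.last ▸ ?_)
  · exact (H.p_le_q (by omega) (by omega)).le
  · exact (H.p_le_q (by omega) (by omega)).le

theorem notMem_bubble (H : Chain N p q) {j k : ℕ} (hj : j ∈ Finset.Icc 1 N) (hk : k ≤ N) {x : ℝ}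
    (hx : x ∈ Icc (p k) (q (k + 1))) : x ∉ Ioo (q j) (p j) := by
  obtain ⟨h1, h2⟩ := Finset.mem_Icc.1 hj
  rintro ⟨h3, h4⟩
  rcases le_or_gt j k with h | h
  · exact absurd (hx.1.trans_lt h4) (not_lt.2 (H.p_mono h hk))
  · exact absurd (h3.trans_le hx.2) (not_lt.2 (H.q_mono (by omega) h (by omega)))

theorem notMem_bubble' (H : Chain N p q) {j k : ℕ} (hj : j ∈ Finset.Icc 1 N) (hk : k ≤ N) {x : ℝ}
    (hx : x ∈ Ioo (p k) (q (k + 1))) : x ∉ Icc (q j) (p j) := by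
  obtain ⟨h1, h2⟩ := Finset.mem_Icc.1 hj
  rintro ⟨h3, h4⟩
  rcases le_or_gt j k with h | h
  · exact absurd (hx.1.trans_le h4) (not_lt.2 (H.p_mono h hk))
  · exact absurd (h3.trans_lt hx.2) (not_lt.2 (H.q_mono (by omega) h (by omega)))

theorem bubble_unique (H : Chain N p q) {j k : ℕ} (hj : j ∈ Finset.Icc 1 N)
    (hk : k ∈ Finset.Icc 1 N) {x : ℝ} (h : x ∈ Icc (q j) (p j)) (h' : x ∈ Icc (q k) (p k)) :
    j = k := by
  obtain ⟨h1, h2⟩ := Finset.mem_Icc.1 hj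
  obtain ⟨h3, h4⟩ := Finset.mem_Icc.1 hk
  rcases lt_trichotomy j k with hlt | he | hlt
  · linarith [h.2, h'.1, H.p_le_q hlt (by omega)]
  · exact he
  · linarith [h.1, h'.2, H.p_le_q hlt (by omega)]

theorem gap_unique (H : Chain N p q) {j k : ℕ} (hj : j ≤ N) (hk : k ≤ N) {x : ℝ}
    (h : x ∈ Ioo (p j) (q (j + 1))) (h' : x ∈ Icc (p k) (q (k + 1))) : j = k := by
  rcases lt_trichotomy j k with hlt | he | hlt
  · linarith [h.2, h'.1, H.q_le_p (j := j + 1) (k := k) (by omega) hlt hk]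
  · exact he
  · linarith [h.1, h'.2, H.q_le_p (j := k + 1) (k := j) (by omega) hlt hj]

/-- The fluid domain is the union of the gaps. -/
theorem sdiff_eq (H : Chain N p q) : Ioo (-1) 1 \ ⋃ k ∈ Finset.Icc 1 N, Icc (q k) (p k) =
    ⋃ k ∈ Finset.range (N + 1), Ioo (p k) (q (k + 1)) := by
  ext x
  simp only [Set.mem_sdiff, mem_iUnion, not_exists, exists_prop, Finset.mem_range]
  constructor
  · rintro ⟨hx, hb⟩
    -- Descending from the right end, x is either left of the bubble or, being in no bubble, in the
    -- gap to its right.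
    have key : ∀ k ≤ N, x < q (k + 1) → ∃ j, j < N + 1 ∧ x ∈ Ioo (p j) (q (j + 1)) := by
      intro k
      induction k with
      | zero => exact fun _ h => ⟨0, by omega, H.first ▸ hx.1, h⟩
      | succ k ih =>
        intro hk h
        have hk1 : k + 1 ∈ Finset.Icc 1 N := Finset.mem_Icc.2 ⟨by omega, hk⟩
        rcases lt_or_ge x (q (k + 1)) with h1 | h1
        · exact ih (by omega) h1
        · exact ⟨k + 1, by omega, lt_of_not_ge fun h2 => hb (k + 1) ⟨hk1, h1, h2⟩, h⟩
    exact key N le_rfl (H.last ▸ hx.2)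
  · rintro ⟨k, hk, hx⟩
    refine ⟨⟨lt_of_le_of_lt ?_ hx.1, lt_of_lt_of_le hx.2 ?_⟩, fun j hj =>
      H.notMem_bubble' hj.1 (by omega) hx hj.2⟩
    · exact H.first ▸ H.p_mono (Nat.zero_le k) (by omega)
    · exact H.last ▸ H.q_mono (by omega) (by omega) le_rfl

theorem hasH1Deriv (H : Chain N p q) {f f' : ℝ → ℝ}
    (hg : ∀ k ≤ N, HasH1Deriv (p k) (q (k + 1)) f f')
    (hb : ∀ k ∈ Finset.Icc 1 N, HasH1Deriv (q k) (p k) f f') : HasH1Deriv (-1) 1 f f' := by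
  have key : ∀ k ≤ N, HasH1Deriv (-1) (q (k + 1)) f f' := by
    intro k
    induction k with
    | zero => exact fun _ => H.first ▸ hg 0 (Nat.zero_le N)
    | succ k ih =>
      intro hk
      have hk1 : k + 1 ∈ Finset.Icc 1 N := Finset.mem_Icc.2 ⟨by omega, hk⟩
      have h0 : (-1 : ℝ) ≤ q (k + 1) := H.first ▸ (H.p_le_q (by omega) (by omega)).le
      have h1 := H.bubble_pos _ hk1
      have h2 := H.gap_pos (k + 1) hk
      have g1 := ((ih (by omega)).glue (hb _ hk1) h0 h1.le).congr (g' := f') (fun _ _ => rfl)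
        (ae_of_all _ fun x => by simp)
      exact (g1.glue (hg (k + 1) hk) (h0.trans h1.le) h2.le).congr (fun _ _ => rfl)
        (ae_of_all _ fun x => by simp)
  exact H.last ▸ key N le_rfl

theorem integral_eq_sum (H : Chain N p q) {f : ℝ → ℝ}
    (hg : ∀ k ≤ N, IntervalIntegrable f volume (p k) (q (k + 1)))
    (hb : ∀ k ∈ Finset.Icc 1 N, IntervalIntegrable f volume (q k) (p k)) :
    IntervalIntegrable f volume (-1) 1 ∧ ∫ x in (-1 : ℝ)..1, f x =
      (∑ k ∈ Finset.range (N + 1), ∫ x in (p k)..(q (k + 1)), f x) +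
        ∑ k ∈ Finset.Icc 1 N, ∫ x in (q k)..(p k), f x := by
  have key : ∀ k ≤ N, IntervalIntegrable f volume (-1) (q (k + 1)) ∧
      ∫ x in (-1 : ℝ)..(q (k + 1)), f x =
      (∑ j ∈ Finset.range (k + 1), ∫ x in (p j)..(q (j + 1)), f x) +
        ∑ j ∈ Finset.Icc 1 k, ∫ x in (q j)..(p j), f x := by
    intro k
    induction k with
    | zero =>
      intro _
      have := hg 0 (Nat.zero_le N)
      rw [H.first] at this
      simpa [H.first] using this
    | succ k ih =>
      intro hk
      have hk1 : k + 1 ∈ Finset.Icc 1 N := Finset.mem_Icc.2 ⟨by omega, hk⟩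
      obtain ⟨i1, e1⟩ := ih (by omega)
      have i2 := i1.trans (hb _ hk1)
      refine ⟨i2.trans (hg _ hk), ?_⟩
      rw [← intervalIntegral.integral_add_adjacent_intervals i2 (hg _ hk),
        ← intervalIntegral.integral_add_adjacent_intervals i1 (hb _ hk1), e1,
        Finset.sum_range_succ _ (k + 1), Finset.sum_Icc_succ_top (by omega)]
      ring
  have := key N le_rfl
  rwa [H.last] at this

theorem setIntegral_eq_sum (H : Chain N p q) {f : ℝ → ℝ}
    (hg : ∀ k ≤ N, IntervalIntegrable f volume (p k) (q (k + 1))) :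
    ∫ x in Ioo (-1) 1 \ ⋃ k ∈ Finset.Icc 1 N, Icc (q k) (p k), f x =
      ∑ k ∈ Finset.range (N + 1), ∫ x in (p k)..(q (k + 1)), f x := by
  rw [H.sdiff_eq, integral_biUnion_finset _ (fun k _ => measurableSet_Ioo)]
  · refine Finset.sum_congr rfl fun k hk => ?_
    rw [intervalIntegral.integral_of_le (H.gap_pos k (by simpa [Nat.lt_succ_iff] using hk)).le,
      integral_Ioc_eq_integral_Ioo]
  · intro j hj k hk hjk
    refine Set.disjoint_left.2 fun x h1 h2 => hjk ?_
    exact H.gap_unique (by simpa [Nat.lt_succ_iff] using hj) (by simpa [Nat.lt_succ_iff] using hk)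
      h1 (Ioo_subset_Icc_self h2)
  · intro k hk
    have hk' : k ≤ N := by simpa [Nat.lt_succ_iff] using hk
    exact (intervalIntegrable_iff_integrableOn_Ioo_of_le (H.gap_pos k hk').le).1 (hg k hk')

theorem sum_length (H : Chain N p q) :
    (∑ k ∈ Finset.range (N + 1), (q (k + 1) - p k)) + ∑ k ∈ Finset.Icc 1 N, (p k - q k) = 2 := by
  have := (H.integral_eq_sum (f := fun _ => 1) (fun _ _ => by simp) (fun _ _ => by simp)).2
  simp only [intervalIntegral.integral_const, smul_eq_mul, mul_one] at this
  linarith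

end Chain

theorem chain_of_pos {N : ℕ} {c R : ℕ → ℝ} (hR : ∀ k ∈ Finset.Icc 1 N, 0 < R k)
    (hg : ∀ k ≤ N, 0 < gap N c R k) : Chain N (xPlus c R) (xMinus N c R) where
  first := by simp [xPlus]
  last := by simp [xMinus]
  gap_pos k hk := sub_pos.1 (hg k hk)
  bubble_pos k hk := by
    have h := Finset.mem_Icc.1 hk
    have := hR k hk
    simp only [xPlus, xMinus, show k ≠ 0 by omega, show k ≠ N + 1 by omega, if_false]
    linarith

theorem fluidDomain_eq (N : ℕ) (c R : ℕ → ℝ) : fluidDomain N c R =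
    Ioo (-1) 1 \ ⋃ k ∈ Finset.Icc 1 N, Icc (xMinus N c R k) (xPlus c R k) := by
  unfold fluidDomain
  congr 1
  refine iUnion_congr fun k => iUnion_congr fun hk => ?_
  have h := Finset.mem_Icc.1 hk
  simp only [xPlus, xMinus, show k ≠ 0 by omega, show k ≠ N + 1 by omega, if_false]

/-! ### The gaps of a classical solution -/

/-- Restriction of a weak time derivative to a smaller open set. -/
theorem HasWeakTimeDeriv.mono {Q Q' : Set (ℝ × ℝ)} {f g : ℝ × ℝ → ℝ} (h : HasWeakTimeDeriv Q f g)
    (hQ : Q' ⊆ Q) : HasWeakTimeDeriv Q' f g := by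
  intro φ h1 h2 h3
  have e1 : ∀ p ∉ Q', fderiv ℝ φ p (1, 0) = 0 := fun p hp => by
    rw [fderiv_of_notMem_tsupport ℝ (notMem_subset h3 hp)]; rfl
  have e2 : ∀ p ∉ Q', φ p = 0 := fun p hp => image_eq_zero_of_notMem_tsupport (notMem_subset h3 hp)
  have := h φ h1 h2 (h3.trans hQ)
  rw [setIntegral_eq_integral_of_forall_compl_eq_zero fun p hp => by
      rw [e1 p (notMem_subset hQ hp), mul_zero],
    setIntegral_eq_integral_of_forall_compl_eq_zero fun p hp => by
      rw [e2 p (notMem_subset hQ hp), mul_zero]] at this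
  rwa [setIntegral_eq_integral_of_forall_compl_eq_zero fun p hp => by rw [e1 p hp, mul_zero],
    setIntegral_eq_integral_of_forall_compl_eq_zero fun p hp => by rw [e2 p hp, mul_zero]]

namespace Flow

theorem xp_zero (z : Flow) (t : ℝ) : z.xp 0 t = -1 := by simp [xp, xPlus]

theorem xm_last (z : Flow) (N : ℕ) (t : ℝ) : z.xm N (N + 1) t = 1 := by simp [xm, xMinus]

theorem xp_eq (z : Flow) {k : ℕ} (hk : k ≠ 0) (t : ℝ) : z.xp k t = z.c k t + z.R k t := by
  simp [xp, xPlus, hk]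

theorem xm_eq (z : Flow) {N k : ℕ} (hk : k ≠ N + 1) (t : ℝ) :
    z.xm N k t = z.c k t - z.R k t := by
  simp [xm, xMinus, hk]

theorem gap_eq (z : Flow) (N k : ℕ) (t : ℝ) : z.gap N k t = z.xm N (k + 1) t - z.xp k t := rfl

theorem xp_add_gap (z : Flow) (N k : ℕ) (t : ℝ) :
    z.xp k t + z.gap N k t = z.xm N (k + 1) t := by rw [gap_eq]; ring

/-- The acceleration of `x_k^+`. -/
def accP (z : Flow) (k : ℕ) (t : ℝ) : ℝ := if k = 0 then 0 else z.ddc k t + z.ddR k t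

/-- The acceleration of `x_k^-`. -/
def accM (z : Flow) (N k : ℕ) (t : ℝ) : ℝ := if k = N + 1 then 0 else z.ddc k t - z.ddR k t

end Flow

namespace IsClassicalSolution

variable {P : Params} {N : ℕ} {m κ : ℕ → ℝ} {T : ℝ} {z : Flow}

theorem chain (S : IsClassicalSolution P N m κ T z) {t : ℝ} (ht : t ∈ Icc 0 T) :
    Chain N (fun k => z.xp k t) (fun k => z.xm N k t) :=
  chain_of_pos (fun k hk => S.R_pos k hk t ht) fun k hk => S.gap_pos k hk t ht

theorem fluid_eq (S : IsClassicalSolution P N m κ T z) {t : ℝ} (ht : t ∈ Icc 0 T) :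
    z.fluid N t = ⋃ k ∈ Finset.range (N + 1), Ioo (z.xp k t) (z.xm N (k + 1) t) :=
  (fluidDomain_eq N _ _).trans (S.chain ht).sdiff_eq

theorem gap_subset_fluid (S : IsClassicalSolution P N m κ T z) {t : ℝ} (ht : t ∈ Icc 0 T) {k : ℕ}
    (hk : k ≤ N) : Ioo (z.xp k t) (z.xm N (k + 1) t) ⊆ z.fluid N t := by
  rw [S.fluid_eq ht]
  exact subset_biUnion_of_mem (u := fun k => Ioo (z.xp k t) (z.xm N (k + 1) t))
    (Finset.mem_coe.2 (Finset.mem_range.2 (by omega)))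

theorem setIntegral_fluid (S : IsClassicalSolution P N m κ T z) {t : ℝ} (ht : t ∈ Icc 0 T)
    {f : ℝ → ℝ} (hf : ∀ k ≤ N, IntervalIntegrable f volume (z.xp k t) (z.xm N (k + 1) t)) :
    ∫ x in z.fluid N t, f x =
      ∑ k ∈ Finset.range (N + 1), ∫ x in (z.xp k t)..(z.xm N (k + 1) t), f x := by
  rw [← (S.chain ht).setIntegral_eq_sum hf]
  congr 2
  exact fluidDomain_eq N _ _

theorem strip_subset_tube (S : IsClassicalSolution P N m κ T z) {k : ℕ} (hk : k ≤ N) :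
    strip T (z.xp k) (z.gap N k) ⊆ z.tube N T := by
  rintro p ⟨h1, h2⟩
  rw [Flow.xp_add_gap] at h2
  exact ⟨h1, S.gap_subset_fluid (Ioo_subset_Icc_self h1) hk h2⟩

/-- Interfaces move with the fluid. The wall is included as an interface at rest, for which no slip
gives zero velocity and acceleration. -/
theorem xp_h1 (S : IsClassicalSolution P N m κ T z) {k : ℕ} (hk : k ≤ N) :
    HasH1Deriv 0 T (z.xp k) (fun t => z.u t (z.xp k t)) ∧
      HasH1Deriv 0 T (fun t => z.u t (z.xp k t)) (z.accP k) := by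
  rcases Nat.eq_zero_or_pos k with rfl | h0
  · constructor
    · refine (HasH1Deriv.const (-1)).congr (fun t _ => z.xp_zero t) ?_
      filter_upwards [ae_restrict_mem measurableSet_Ioo] with t ht
      rw [z.xp_zero, S.no_slip_left t (Ioo_subset_Icc_self ht)]
    · refine (HasH1Deriv.const 0).congr (fun t ht => ?_) (ae_of_all _ fun t => by simp [Flow.accP])
      rw [z.xp_zero, S.no_slip_left t ht]
  · have hk' : k ∈ Finset.Icc 1 N := Finset.mem_Icc.2 ⟨h0, hk⟩
    constructor
    · refine ((S.c_h1 k hk').add (S.R_h1 k hk')).congr (fun t _ => z.xp_eq h0.ne' t) ?_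
      filter_upwards [ae_restrict_mem measurableSet_Ioo] with t ht
      exact S.u_plus k hk' t (Ioo_subset_Icc_self ht)
    · exact ((S.dc_h1 k hk').add (S.dR_h1 k hk')).congr (fun t ht => S.u_plus k hk' t ht)
        (ae_of_all _ fun t => by simp [Flow.accP, h0.ne'])

theorem xm_h1 (S : IsClassicalSolution P N m κ T z) {k : ℕ} (h0 : 1 ≤ k) (hk : k ≤ N + 1) :
    HasH1Deriv 0 T (z.xm N k) (fun t => z.u t (z.xm N k t)) ∧
      HasH1Deriv 0 T (fun t => z.u t (z.xm N k t)) (z.accM N k) := by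
  rcases Nat.eq_or_lt_of_le hk with rfl | h1
  · constructor
    · refine (HasH1Deriv.const 1).congr (fun t _ => z.xm_last N t) ?_
      filter_upwards [ae_restrict_mem measurableSet_Ioo] with t ht
      rw [z.xm_last, S.no_slip_right t (Ioo_subset_Icc_self ht)]
    · refine (HasH1Deriv.const 0).congr (fun t ht => ?_) (ae_of_all _ fun t => by simp [Flow.accM])
      rw [z.xm_last, S.no_slip_right t ht]
  · have hk' : k ∈ Finset.Icc 1 N := Finset.mem_Icc.2 ⟨h0, by omega⟩
    constructor
    · refine ((S.c_h1 k hk').sub (S.R_h1 k hk')).congr (fun t _ => z.xm_eq h1.ne t) ?_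
      filter_upwards [ae_restrict_mem measurableSet_Ioo] with t ht
      exact S.u_minus k hk' t (Ioo_subset_Icc_self ht)
    · exact ((S.dc_h1 k hk').sub (S.dR_h1 k hk')).congr (fun t ht => S.u_minus k hk' t ht)
        (ae_of_all _ fun t => by simp [Flow.accM, h1.ne])

theorem h1Energy_eq (S : IsClassicalSolution P N m κ T z) {t : ℝ} (ht : t ∈ Icc 0 T) :
    h1Energy P N z t =
      P.muF / 2 * (∑ k ∈ Finset.range (N + 1), ∫ x in (z.xp k t)..(z.xm N (k + 1) t),
        z.u_x t x ^ 2) + P.muG * ∑ k ∈ Finset.Icc 1 N, z.dR k t ^ 2 / z.R k t := by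
  unfold h1Energy
  have := S.setIntegral_fluid ht (f := fun x => z.u_x t x ^ 2) fun k hk =>
    (S.u_h1 k hk t ht).sq_intervalIntegrable ((S.chain ht).gap_pos k hk).le
  rw [← this, ← integral_const_mul]
  congr 2
  funext x
  ring

theorem sum_dR_nonneg (S : IsClassicalSolution P N m κ T z) {t : ℝ} (ht : t ∈ Icc 0 T) :
    0 ≤ ∑ k ∈ Finset.Icc 1 N, z.dR k t ^ 2 / z.R k t :=
  Finset.sum_nonneg fun k hk => div_nonneg (sq_nonneg _) (S.R_pos k hk t ht).le

theorem gap_energy_nonneg (S : IsClassicalSolution P N m κ T z) {t : ℝ} (ht : t ∈ Icc 0 T) {k : ℕ}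
    (hk : k ≤ N) (f : ℝ → ℝ) : 0 ≤ ∫ x in (z.xp k t)..(z.xm N (k + 1) t), f x ^ 2 :=
  intervalIntegral.integral_nonneg ((S.chain ht).gap_pos k hk).le fun _ _ => sq_nonneg _

/-- The flow of a classical solution in one gap. -/
theorem gapFlow (S : IsClassicalSolution P N m κ T z) (hT : 0 < T) {ρlo ρhi K : ℝ}
    (hlo : 0 < ρlo) (h3 : ∀ t ∈ Ioo 0 T, ∀ᵐ x ∂(volume.restrict (z.fluid N t)),
      ρlo ≤ z.rho t x ∧ z.rho t x ≤ ρhi)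
    (h4 : ∀ t ∈ Ioo 0 T, h1Energy P N z t ≤ K) {k : ℕ} (hk : k ≤ N) :
    GapFlow P ρlo ρhi (2 * K / P.muF) T (z.xp k) (z.gap N k) z.u z.u_t z.u_x z.u_xx
      z.rho z.rho_t z.rho_x (z.accP k) (z.accM N (k + 1)) := by
  have hs := Measure.restrict_mono (S.strip_subset_tube hk) (le_refl (volume : Measure (ℝ × ℝ)))
  have hp := S.xp_h1 hk
  have hm := S.xm_h1 (k := k + 1) (by omega) (by omega)
  refine
  { pos := hT
    left := hp.1
    length := ?_
    length_pos := S.gap_pos k hk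
    left_acc := hp.2
    right_acc := ?_
    u_cont := ?_
    u_h1 := ?_
    u_x_h1 := ?_
    u_weak := S.u_weak.mono (S.strip_subset_tube hk)
    u_t_L2 := S.u_t_L2.mono_measure hs
    u_x_L2 := S.u_x_L2.mono_measure hs
    u_xx_L2 := S.u_xx_L2.mono_measure hs
    rho_h1 := ?_
    rho_weak := S.rho_weak.mono (S.strip_subset_tube hk)
    rho_L2 := S.rho_L2.mono_measure hs
    rho_t_L2 := S.rho_t_L2.mono_measure hs
    rho_x_L2 := S.rho_x_L2.mono_measure hs
    mass := ae_mono hs S.mass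
    momentum := ae_mono hs S.momentum
    lo_pos := hlo
    rho_bdd := ?_
    energy_bdd := ?_ }
  all_goals simp only [Flow.xp_add_gap]
  · exact hm.1.sub hp.1
  · exact hm.2
  · exact S.u_cont k hk
  · exact S.u_h1 k hk
  · exact S.u_x_h1 k hk
  · exact S.rho_h1 k hk
  · intro t ht
    exact ae_mono (Measure.restrict_mono (S.gap_subset_fluid (Ioo_subset_Icc_self ht) hk) le_rfl)
      (h3 t ht)
  · intro t ht
    have ht' := Ioo_subset_Icc_self ht
    have hE := h4 t ht
    rw [S.h1Energy_eq ht'] at hE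
    have h1 := mul_nonneg P.muG_pos.le (S.sum_dR_nonneg ht')
    -- The energy of one gap is part of the total, which is all that the single-gap analysis needs
    -- for integrability.
    have h2 := Finset.single_le_sum (f := fun k => ∫ x in (z.xp k t)..(z.xm N (k + 1) t),
      z.u_x t x ^ 2) (fun j hj => S.gap_energy_nonneg ht' (by simpa [Nat.lt_succ_iff] using hj)
        (z.u_x t)) (Finset.mem_range.2 (Nat.lt_succ_of_le hk))
    have hmu := P.muF_pos
    rw [le_div_iff₀ hmu]
    nlinarith

end IsClassicalSolution

/-! ### Extended stresses at a fixed time -/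

theorem h1Norm_sq (a b : ℝ) (f : ℝ → ℝ) : h1Norm a b f ^ 2 =
    ⨅ (g : ℝ → ℝ) (_ : HasH1Deriv a b f g),
      ∫⁻ x in Ioo a b, ENNReal.ofReal (f x ^ 2 + g x ^ 2) := by
  rw [h1Norm, ← ENNReal.rpow_natCast, ← ENNReal.rpow_mul]
  norm_num

theorem lintegral_ofReal_Ioo {a b : ℝ} (hab : a ≤ b) {f : ℝ → ℝ}
    (hf : IntervalIntegrable f volume a b) (h0 : ∀ x, 0 ≤ f x) :
    ∫⁻ x in Ioo a b, ENNReal.ofReal (f x) = ENNReal.ofReal (∫ x in a..b, f x) := by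
  rw [intervalIntegral.integral_of_le hab, integral_Ioc_eq_integral_Ioo,
    ofReal_integral_eq_lintegral_ofReal
      ((intervalIntegrable_iff_integrableOn_Ioo_of_le hab).1 hf) (ae_of_all _ h0)]

theorem HasH1Deriv.h1Norm_sq_eq {a b : ℝ} (hab : a ≤ b) {f g : ℝ → ℝ} (h : HasH1Deriv a b f g) :
    h1Norm a b f ^ 2 = ENNReal.ofReal ((∫ x in a..b, f x ^ 2) + ∫ x in a..b, g x ^ 2) := by
  have key : ∀ g', HasH1Deriv a b f g' → ∫⁻ x in Ioo a b, ENNReal.ofReal (f x ^ 2 + g' x ^ 2) =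
      ENNReal.ofReal ((∫ x in a..b, f x ^ 2) + ∫ x in a..b, g x ^ 2) := by
    intro g' h'
    rw [← intervalIntegral.integral_add (h.fun_sq_intervalIntegrable hab)
      (h.sq_intervalIntegrable hab), ← lintegral_ofReal_Ioo hab
        ((h.fun_sq_intervalIntegrable hab).add (h.sq_intervalIntegrable hab))
        fun x => by positivity]
    refine lintegral_congr_ae ?_
    filter_upwards [h'.ae_eq h] with x hx
    rw [hx]
  rw [h1Norm_sq]
  refine le_antisymm ((iInf₂_le g h).trans (key g h).le) (le_iInf₂ fun g' h' => (key g' h').ge)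

/-- Bound of a function by its value at one point and its derivative. -/
theorem HasH1Deriv.sq_le {a b : ℝ} {f g : ℝ → ℝ} (h : HasH1Deriv a b f g) {x y : ℝ}
    (hx : x ∈ Icc a b) (hy : y ∈ Icc a b) :
    f y ^ 2 ≤ 2 * f x ^ 2 + 2 * ((b - a) * ∫ x in a..b, g x ^ 2) := by
  have h0 : 0 ≤ (b - a) * ∫ x in a..b, g x ^ 2 := mul_nonneg (by linarith [hx.1, hx.2])
    (intervalIntegral.integral_nonneg (hx.1.trans hx.2) fun _ _ => sq_nonneg _)
  have h1 := h.abs_sub_le le_rfl hx hy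
  have h2 := pow_le_pow_left₀ (abs_nonneg _) h1 2
  rw [Real.sq_sqrt h0, sq_abs] at h2
  nlinarith [sq_nonneg (2 * f x - f y)]

/-- Cauchy–Schwarz with the factor b - a kept: on intervals of length 1/N this factor makes the sums
over bubbles and gaps uniform in N. -/
theorem HasH1Deriv.sq_sub_le {a b : ℝ} (hab : a ≤ b) {f g : ℝ → ℝ} (h : HasH1Deriv a b f g) :
    (f b - f a) ^ 2 ≤ (b - a) * ∫ x in a..b, g x ^ 2 := by
  have h0 : 0 ≤ (b - a) * ∫ x in a..b, g x ^ 2 := mul_nonneg (by linarith)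
    (intervalIntegral.integral_nonneg hab fun _ _ => sq_nonneg _)
  have h1 := h.abs_sub_le le_rfl (left_mem_Icc.2 hab) (right_mem_Icc.2 hab)
  have h2 := pow_le_pow_left₀ (abs_nonneg _) h1 2
  rwa [Real.sq_sqrt h0, sq_abs] at h2

/-- A function on the gaps and functions on the bubbles. -/
def bubbleExt (N : ℕ) (p q : ℕ → ℝ) (f : ℝ → ℝ) (A : ℕ → ℝ → ℝ) (x : ℝ) : ℝ :=
  (⋃ k ∈ Finset.Icc 1 N, Ioo (q k) (p k))ᶜ.indicator f x +
    ∑ k ∈ Finset.Icc 1 N, (Ioo (q k) (p k)).indicator (A k) x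

/-- Values on the bubbles, constant in the outer gaps, and functions in the inner gaps. -/
def gapExt (N : ℕ) (p q : ℕ → ℝ) (s : ℕ → ℝ) (A : ℕ → ℝ → ℝ) (x : ℝ) : ℝ :=
  ∑ k ∈ Finset.Icc 1 N, (Icc (q k) (p k)).indicator (fun _ => s k) x +
    (Iio (q 1)).indicator (fun _ => s 1) x + (Ioi (p N)).indicator (fun _ => s N) x +
    ∑ k ∈ Finset.Ico 1 N, (Ioo (p k) (q (k + 1))).indicator (A k) x

namespace Chain

variable {N : ℕ} {p q : ℕ → ℝ}

theorem bubbleExt_gap (H : Chain N p q) (f : ℝ → ℝ) (A : ℕ → ℝ → ℝ) {k : ℕ} (hk : k ≤ N) {x : ℝ}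
    (hx : x ∈ Icc (p k) (q (k + 1))) : bubbleExt N p q f A x = f x := by
  rw [bubbleExt, indicator_of_mem, Finset.sum_eq_zero, add_zero]
  · exact fun j hj => indicator_of_notMem (H.notMem_bubble hj hk hx) _
  · simp only [mem_compl_iff, mem_iUnion, not_exists]
    exact fun j hj => H.notMem_bubble hj hk hx

theorem bubbleExt_bubble (H : Chain N p q) (f : ℝ → ℝ) (A : ℕ → ℝ → ℝ) {k : ℕ}
    (hk : k ∈ Finset.Icc 1 N) {x : ℝ} (hx : x ∈ Ioo (q k) (p k)) :
    bubbleExt N p q f A x = A k x := by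
  rw [bubbleExt, indicator_of_notMem, zero_add, Finset.sum_eq_single_of_mem k hk]
  · exact indicator_of_mem hx _
  · exact fun j hj hjk => indicator_of_notMem (fun h => hjk (H.bubble_unique hj hk
      (Ioo_subset_Icc_self h) (Ioo_subset_Icc_self hx))) _
  · simp only [mem_compl_iff, mem_iUnion, not_not, exists_prop]
    exact ⟨k, hk, hx⟩

theorem gapExt_bubble (H : Chain N p q) (s : ℕ → ℝ) (A : ℕ → ℝ → ℝ) {k : ℕ}
    (hk : k ∈ Finset.Icc 1 N) {x : ℝ} (hx : x ∈ Icc (q k) (p k)) :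
    gapExt N p q s A x = s k := by
  obtain ⟨h1, h2⟩ := Finset.mem_Icc.1 hk
  rw [gapExt, Finset.sum_eq_single_of_mem k hk, indicator_of_mem hx, indicator_of_notMem,
    indicator_of_notMem, Finset.sum_eq_zero]
  · ring
  · intro j hj
    have hj' := Finset.mem_Ico.1 hj
    exact indicator_of_notMem (fun h => H.notMem_bubble' hk hj'.2.le h hx) _
  · exact fun h => absurd (lt_of_lt_of_le (mem_Ioi.1 h) hx.2) (not_lt.2 (H.p_mono h2 le_rfl))
  · exact fun h => absurd (lt_of_le_of_lt hx.1 (mem_Iio.1 h))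
      (not_lt.2 (H.q_mono le_rfl h1 (by omega)))
  · exact fun j hj hjk => indicator_of_notMem (fun h => hjk (H.bubble_unique hj hk h hx)) _

theorem gapExt_first (H : Chain N p q) (hN : 1 ≤ N) (s : ℕ → ℝ) (A : ℕ → ℝ → ℝ) {x : ℝ}
    (hx : x ∈ Icc (-1) (q 1)) : gapExt N p q s A x = s 1 := by
  have h1 : (1 : ℕ) ∈ Finset.Icc 1 N := Finset.mem_Icc.2 ⟨le_rfl, hN⟩
  rcases hx.2.eq_or_lt with h | h
  · exact H.gapExt_bubble s A h1 ⟨h.ge, h.le.trans (H.bubble_pos 1 h1).le⟩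
  · rw [gapExt, Finset.sum_eq_zero, indicator_of_mem (show x ∈ Iio (q 1) from h),
      indicator_of_notMem, Finset.sum_eq_zero]
    · ring
    · intro j hj
      have hj' := Finset.mem_Ico.1 hj
      exact indicator_of_notMem (fun h' => lt_asymm (h.trans (H.q_le_p le_rfl hj'.1 hj'.2.le))
        h'.1) _
    · exact fun h' => lt_asymm (h.trans (H.q_le_p le_rfl hN le_rfl)) h'
    · intro j hj
      have hj' := Finset.mem_Icc.1 hj
      exact indicator_of_notMem (fun h' => absurd (h.trans_le (H.q_mono le_rfl hj'.1 (by omega)))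
        (not_lt.2 h'.1)) _

theorem gapExt_last (H : Chain N p q) (hN : 1 ≤ N) (s : ℕ → ℝ) (A : ℕ → ℝ → ℝ) {x : ℝ}
    (hx : x ∈ Icc (p N) 1) : gapExt N p q s A x = s N := by
  have h1 : N ∈ Finset.Icc 1 N := Finset.mem_Icc.2 ⟨hN, le_rfl⟩
  rcases hx.1.eq_or_lt with h | h
  · exact H.gapExt_bubble s A h1 ⟨(H.bubble_pos N h1).le.trans h.le, h.ge⟩
  · rw [gapExt, Finset.sum_eq_zero, indicator_of_notMem,
      indicator_of_mem (show x ∈ Ioi (p N) from h), Finset.sum_eq_zero]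
    · ring
    · intro j hj
      have hj' := Finset.mem_Ico.1 hj
      exact indicator_of_notMem (fun h' => lt_asymm (h'.2.trans
        (H.q_le_p (j := j + 1) (by omega) hj'.2 le_rfl)) h) _
    · exact fun h' => lt_asymm (h.trans h') (H.q_le_p le_rfl hN le_rfl)
    · intro j hj
      have hj' := Finset.mem_Icc.1 hj
      exact indicator_of_notMem (fun h' => absurd (h.trans_le h'.2)
        (not_lt.2 (H.p_mono hj'.2 le_rfl))) _

theorem gapExt_gap (H : Chain N p q) (s : ℕ → ℝ) (A : ℕ → ℝ → ℝ) {k : ℕ}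
    (hk : k ∈ Finset.Ico 1 N) {x : ℝ} (hx : x ∈ Ioo (p k) (q (k + 1))) :
    gapExt N p q s A x = A k x := by
  have hk' := Finset.mem_Ico.1 hk
  rw [gapExt, Finset.sum_eq_zero, indicator_of_notMem, indicator_of_notMem,
    Finset.sum_eq_single_of_mem k hk, indicator_of_mem hx]
  · ring
  · intro j hj hjk
    have hj' := Finset.mem_Ico.1 hj
    exact indicator_of_notMem (fun h => hjk (H.gap_unique hj'.2.le hk'.2.le h
      (Ioo_subset_Icc_self hx))) _
  · exact fun h => lt_asymm (hx.2.trans (H.q_le_p (j := k + 1) (by omega) hk'.2 le_rfl)) h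
  · exact fun h => lt_asymm ((H.q_le_p le_rfl hk'.1 hk'.2.le).trans hx.1) h
  · exact fun j hj => indicator_of_notMem (H.notMem_bubble' hj hk'.2.le hx) _

end Chain

/-- Fluid stress `f`, bubble stresses `s` and the equations of motion of the bubbles, at a fixed
time. -/
structure StressProfile (M d : ℝ) (N : ℕ) (p q m : ℕ → ℝ) (f f' : ℝ → ℝ) (cc rr s : ℕ → ℝ) :
    Prop where
  chain : Chain N p q
  one_le : 1 ≤ N
  M_pos : 0 < M
  d_pos : 0 < d
  bubble_length : ∀ k ∈ Finset.Icc 1 N, 2 * d ≤ N * (p k - q k)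
  gap_length : ∀ k ∈ Finset.Icc 1 N, d ≤ N * (q (k + 1) - p k)
  m_pos : ∀ k ∈ Finset.Icc 1 N, 0 < m k
  m_le : ∀ k ∈ Finset.Icc 1 N, N * m k ≤ M⁻¹
  h1 : ∀ k ≤ N, HasH1Deriv (p k) (q (k + 1)) f f'
  newton_c : ∀ k ∈ Finset.Icc 1 N, m k * cc k = f (p k) - f (q k)
  newton_r : ∀ k ∈ Finset.Icc 1 N, m k / 3 * rr k = f (q k) + f (p k) - 2 * s k

namespace StressProfile

variable {M d : ℝ} {N : ℕ} {p q m : ℕ → ℝ} {f f' : ℝ → ℝ} {cc rr s : ℕ → ℝ}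

/-- The extension of the fluid stress. -/
def extF (N : ℕ) (p q : ℕ → ℝ) (f : ℝ → ℝ) : ℝ → ℝ := bubbleExt N p q f fun k y =>
  f (q k) + (f (p k) - f (q k)) / (p k - q k) * (y - q k)

/-- The derivative of the extension of the fluid stress. -/
def extFx (N : ℕ) (p q : ℕ → ℝ) (f f' : ℝ → ℝ) : ℝ → ℝ := bubbleExt N p q f' fun k _ =>
  (f (p k) - f (q k)) / (p k - q k)

/-- The extension of the bubble stresses. -/
def extG (N : ℕ) (p q s : ℕ → ℝ) : ℝ → ℝ := gapExt N p q s fun k y =>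
  s k + (s (k + 1) - s k) / (q (k + 1) - p k) * (y - p k)

/-- The derivative of the extension of the bubble stresses. -/
def extGx (N : ℕ) (p q s : ℕ → ℝ) : ℝ → ℝ := gapExt N p q 0 fun k _ =>
  (s (k + 1) - s k) / (q (k + 1) - p k)

/-- The dissipation. -/
def diss (N : ℕ) (p q m : ℕ → ℝ) (f' : ℝ → ℝ) (cc rr : ℕ → ℝ) : ℝ :=
  (∑ k ∈ Finset.range (N + 1), ∫ x in (p k)..(q (k + 1)), f' x ^ 2) +
    ∑ k ∈ Finset.Icc 1 N, m k * (rr k ^ 2 + cc k ^ 2)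

theorem extF_gap (H : StressProfile M d N p q m f f' cc rr s) {k : ℕ} (hk : k ≤ N) {x : ℝ}
    (hx : x ∈ Icc (p k) (q (k + 1))) : extF N p q f x = f x := H.chain.bubbleExt_gap _ _ hk hx

theorem extF_h1 (H : StressProfile M d N p q m f f' cc rr s) :
    HasH1Deriv (-1) 1 (extF N p q f) (extFx N p q f f') := by
  refine H.chain.hasH1Deriv (fun k hk => (H.h1 k hk).congr (fun x hx => H.extF_gap hk hx) ?_)
    fun k hk => (((HasH1Deriv.const (f (q k))).add (HasH1Deriv.linear
      ((f (p k) - f (q k)) / (p k - q k)) (q k)))).congr (fun x hx => ?_) ?_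
  · filter_upwards [ae_restrict_mem measurableSet_Ioo] with x hx
    exact H.chain.bubbleExt_gap _ _ hk (Ioo_subset_Icc_self hx)
  · have h' := Finset.mem_Icc.1 hk
    have hpq := sub_pos.2 (H.chain.bubble_pos k hk)
    rcases hx.1.eq_or_lt with h | h
    -- The left end of a bubble is the right end of the preceding gap. There the extension takes the
    -- fluid value, because only open bubbles are replaced by affine pieces.
    · rw [← h, H.extF_gap (k := k - 1) (by omega)]
      · simp
      · rw [Nat.sub_add_cancel h'.1]
        exact ⟨(H.chain.p_le_q (by omega) (by omega)).le, le_rfl⟩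
    rcases hx.2.eq_or_lt with h2 | h2
    · rw [h2, H.extF_gap h'.2 ⟨le_rfl, (H.chain.gap_pos k h'.2).le⟩]
      field_simp
      ring
    exact H.chain.bubbleExt_bubble _ _ hk ⟨h, h2⟩
  · filter_upwards [ae_restrict_mem measurableSet_Ioo] with x hx
    simp only [extFx, H.chain.bubbleExt_bubble _ _ hk hx, zero_add]

theorem extG_bubble (H : StressProfile M d N p q m f f' cc rr s) {k : ℕ}
    (hk : k ∈ Finset.Icc 1 N) {x : ℝ} (hx : x ∈ Icc (q k) (p k)) : extG N p q s x = s k :=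
  H.chain.gapExt_bubble _ _ hk hx

theorem extGx_bubble (H : StressProfile M d N p q m f f' cc rr s) {k : ℕ}
    (hk : k ∈ Finset.Icc 1 N) {x : ℝ} (hx : x ∈ Icc (q k) (p k)) : extGx N p q s x = 0 :=
  H.chain.gapExt_bubble _ _ hk hx

theorem extG_h1 (H : StressProfile M d N p q m f f' cc rr s) :
    HasH1Deriv (-1) 1 (extG N p q s) (extGx N p q s) := by
  refine H.chain.hasH1Deriv (fun k hk => ?_) fun k hk => (HasH1Deriv.const (s k)).congr
    (fun x hx => H.extG_bubble hk hx) ?_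
  · rcases Nat.eq_zero_or_pos k with rfl | h0
    · rw [H.chain.first]
      refine (HasH1Deriv.const (s 1)).congr
        (fun x hx => H.chain.gapExt_first H.one_le _ _ hx) ?_
      filter_upwards [ae_restrict_mem measurableSet_Ioo] with x hx
      exact H.chain.gapExt_first H.one_le _ _ (Ioo_subset_Icc_self hx)
    rcases hk.eq_or_lt with rfl | h1
    · rw [H.chain.last]
      refine (HasH1Deriv.const (s k)).congr (fun x hx => H.chain.gapExt_last H.one_le _ _ hx) ?_
      filter_upwards [ae_restrict_mem measurableSet_Ioo] with x hx
      exact H.chain.gapExt_last H.one_le _ _ (Ioo_subset_Icc_self hx)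
    · have hk' : k ∈ Finset.Ico 1 N := Finset.mem_Ico.2 ⟨h0, h1⟩
      have hpq := sub_pos.2 (H.chain.gap_pos k hk)
      refine ((HasH1Deriv.const (s k)).add (HasH1Deriv.linear
        ((s (k + 1) - s k) / (q (k + 1) - p k)) (p k))).congr (fun x hx => ?_) ?_
      · have b1 : k ∈ Finset.Icc 1 N := Finset.mem_Icc.2 ⟨h0, hk⟩
        have b2 : k + 1 ∈ Finset.Icc 1 N := Finset.mem_Icc.2 ⟨by omega, h1⟩
        rcases hx.1.eq_or_lt with h | h
        · rw [← h, H.extG_bubble b1 ⟨(H.chain.bubble_pos k b1).le, le_rfl⟩]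
          simp
        rcases hx.2.eq_or_lt with h2 | h2
        · rw [h2, H.extG_bubble b2 ⟨le_rfl, (H.chain.bubble_pos _ b2).le⟩]
          field_simp
          ring
        exact H.chain.gapExt_gap _ _ hk' ⟨h, h2⟩
      · filter_upwards [ae_restrict_mem measurableSet_Ioo] with x hx
        simp only [extGx, H.chain.gapExt_gap _ _ hk' hx, zero_add]
  · filter_upwards [ae_restrict_mem measurableSet_Ioo] with x hx
    exact H.extGx_bubble hk (Ioo_subset_Icc_self hx)

end StressProfile

/-! ### Estimates of the extended stresses, uniform in the number of bubbles. -/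

namespace StressProfile

variable {M d : ℝ} {N : ℕ} {p q m : ℕ → ℝ} {f f' : ℝ → ℝ} {cc rr s : ℕ → ℝ}

theorem gap_int_nonneg (H : StressProfile M d N p q m f f' cc rr s) {k : ℕ} (hk : k ≤ N)
    (h : ℝ → ℝ) : 0 ≤ ∫ x in (p k)..(q (k + 1)), h x ^ 2 :=
  intervalIntegral.integral_nonneg (H.chain.gap_pos k hk).le fun _ _ => sq_nonneg _

theorem sum_gap_nonneg (H : StressProfile M d N p q m f f' cc rr s) (h : ℝ → ℝ) :
    0 ≤ ∑ k ∈ Finset.range (N + 1), ∫ x in (p k)..(q (k + 1)), h x ^ 2 :=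
  Finset.sum_nonneg fun k hk => H.gap_int_nonneg (by simpa [Nat.lt_succ_iff] using hk) h

theorem sum_acc_nonneg (H : StressProfile M d N p q m f f' cc rr s) :
    0 ≤ ∑ k ∈ Finset.Icc 1 N, m k * (rr k ^ 2 + cc k ^ 2) :=
  Finset.sum_nonneg fun k hk => mul_nonneg (H.m_pos k hk).le (by positivity)

theorem diss_nonneg (H : StressProfile M d N p q m f f' cc rr s) : 0 ≤ diss N p q m f' cc rr :=
  add_nonneg (H.sum_gap_nonneg f') H.sum_acc_nonneg

theorem N_pos (H : StressProfile M d N p q m f f' cc rr s) : (0 : ℝ) < N :=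
  Nat.cast_pos.2 H.one_le

/-- The square of a force divided by a length. -/
theorem force_sq_div_le (H : StressProfile M d N p q m f f' cc rr s) {k : ℕ}
    (hk : k ∈ Finset.Icc 1 N) {x l : ℝ} (hl : d ≤ N * l) :
    (m k * x) ^ 2 / l ≤ (M * d)⁻¹ * (m k * x ^ 2) := by
  have hN := H.N_pos
  have hd := H.d_pos
  have hM := H.M_pos
  have hm := H.m_pos k hk
  have hl0 : 0 < l := pos_of_mul_pos_right (hd.trans_le hl) hN.le
  -- Masses are at most 1/(MN) and lengths at least d/N, so N cancels in the quotient.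
  have h1 : m k / l ≤ (M * d)⁻¹ := by
    rw [div_le_iff₀ hl0, mul_inv, mul_assoc]
    have h2 := H.m_le k hk
    have h3 : 1 ≤ d⁻¹ * (N * l) := by
      rw [← div_eq_inv_mul, one_le_div hd]; exact hl
    have h4 : M⁻¹ * 1 ≤ M⁻¹ * (d⁻¹ * (N * l)) := mul_le_mul_of_nonneg_left h3 (by positivity)
    have h5 : N * m k ≤ N * (M⁻¹ * (d⁻¹ * l)) := by linarith
    exact le_of_mul_le_mul_left h5 hN
  have h2 : (m k * x) ^ 2 / l = m k / l * (m k * x ^ 2) := by field_simp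
  rw [h2]
  exact mul_le_mul_of_nonneg_right h1 (by positivity)

theorem force_sq_le (H : StressProfile M d N p q m f f' cc rr s) {k : ℕ}
    (hk : k ∈ Finset.Icc 1 N) (x : ℝ) : (m k * x) ^ 2 ≤ M⁻¹ * (m k * x ^ 2) := by
  have hm := H.m_pos k hk
  have h1 : (1 : ℝ) ≤ N := by exact_mod_cast H.one_le
  have h2 : m k ≤ M⁻¹ := (le_mul_of_one_le_left hm.le h1).trans (H.m_le k hk)
  have h3 : (m k * x) ^ 2 = m k * (m k * x ^ 2) := by ring
  rw [h3]
  exact mul_le_mul_of_nonneg_right h2 (by positivity)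

/-- The jump of the stress across a bubble is the force `m k * cc k` by Newton's law, so the slope
of the affine piece is this force divided by the length of the bubble. -/
theorem integral_extFx (H : StressProfile M d N p q m f f' cc rr s) :
    ∫ x in (-1 : ℝ)..1, extFx N p q f f' x ^ 2 =
      (∑ k ∈ Finset.range (N + 1), ∫ x in (p k)..(q (k + 1)), f' x ^ 2) +
        ∑ k ∈ Finset.Icc 1 N, (m k * cc k) ^ 2 / (p k - q k) := by
  have hF := H.extF_h1
  have hm : ∀ {a b : ℝ}, Icc a b ⊆ Icc (-1) 1 → a ≤ b →
      IntervalIntegrable (fun x => extFx N p q f f' x ^ 2) volume a b := fun h hab =>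
    (hF.mono (h (left_mem_Icc.2 hab)) (h (right_mem_Icc.2 hab))).sq_intervalIntegrable hab
  rw [(H.chain.integral_eq_sum
    (fun k hk => hm (H.chain.gap_subset hk) (H.chain.gap_pos k hk).le)
    (fun k hk => hm (H.chain.bubble_subset hk) (H.chain.bubble_pos k hk).le)).2]
  congr 1
  · refine Finset.sum_congr rfl fun k hk => ?_
    have hk' : k ≤ N := by simpa [Nat.lt_succ_iff] using hk
    refine intervalIntegral.integral_congr fun x hx => ?_
    rw [uIcc_of_le (H.chain.gap_pos k hk').le] at hx
    simp only [extFx, H.chain.bubbleExt_gap _ _ hk' hx]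
  · refine Finset.sum_congr rfl fun k hk => ?_
    have hpq := sub_pos.2 (H.chain.bubble_pos k hk)
    rw [intervalIntegral.integral_of_le (H.chain.bubble_pos k hk).le,
      integral_Ioc_eq_integral_Ioo, setIntegral_congr_fun (g := fun _ =>
        ((f (p k) - f (q k)) / (p k - q k)) ^ 2) measurableSet_Ioo fun x hx => by
          simp only [extFx, H.chain.bubbleExt_bubble _ _ hk hx]]
    rw [H.newton_c k hk]
    simp only [integral_const, smul_eq_mul, measureReal_restrict_apply_univ, Real.volume_real_Ioo,
      max_eq_left hpq.le]
    field_simp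

theorem integral_extGx (H : StressProfile M d N p q m f f' cc rr s) :
    ∫ x in (-1 : ℝ)..1, extGx N p q s x ^ 2 =
      ∑ k ∈ Finset.Ico 1 N, (s (k + 1) - s k) ^ 2 / (q (k + 1) - p k) := by
  have hG := H.extG_h1
  have hm : ∀ {a b : ℝ}, Icc a b ⊆ Icc (-1) 1 → a ≤ b →
      IntervalIntegrable (fun x => extGx N p q s x ^ 2) volume a b := fun h hab =>
    (hG.mono (h (left_mem_Icc.2 hab)) (h (right_mem_Icc.2 hab))).sq_intervalIntegrable hab
  rw [(H.chain.integral_eq_sum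
    (fun k hk => hm (H.chain.gap_subset hk) (H.chain.gap_pos k hk).le)
    (fun k hk => hm (H.chain.bubble_subset hk) (H.chain.bubble_pos k hk).le)).2]
  rw [Finset.sum_eq_zero (s := Finset.Icc 1 N) fun k hk => ?_, add_zero]
  -- In the two gaps at the walls the extension is constant.
  · have h0 : ∀ k ≤ N, k ∉ Finset.Ico 1 N →
        ∫ x in (p k)..(q (k + 1)), extGx N p q s x ^ 2 = 0 := by
      intro k hk hk'
      rw [intervalIntegral.integral_congr (g := fun _ => 0), intervalIntegral.integral_zero]
      intro x hx
      rw [uIcc_of_le (H.chain.gap_pos k hk).le] at hx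
      simp only [extGx]
      rcases Nat.eq_zero_or_pos k with rfl | h0
      · rw [H.chain.first] at hx
        rw [H.chain.gapExt_first H.one_le _ _ hx]; simp
      · have : k = N := by
          by_contra h
          exact hk' (Finset.mem_Ico.2 ⟨h0, by omega⟩)
        subst this
        rw [H.chain.last] at hx
        rw [H.chain.gapExt_last H.one_le _ _ hx]; simp
    rw [← Finset.sum_subset (s₁ := Finset.Ico 1 N)]
    · refine Finset.sum_congr rfl fun k hk => ?_
      have hk' := Finset.mem_Ico.1 hk
      have hpq := sub_pos.2 (H.chain.gap_pos k hk'.2.le)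
      rw [intervalIntegral.integral_of_le (H.chain.gap_pos k hk'.2.le).le,
        integral_Ioc_eq_integral_Ioo, setIntegral_congr_fun (g := fun _ =>
          ((s (k + 1) - s k) / (q (k + 1) - p k)) ^ 2) measurableSet_Ioo fun x hx => by
            simp only [extGx, H.chain.gapExt_gap _ _ hk hx]]
      simp only [integral_const, smul_eq_mul, measureReal_restrict_apply_univ,
        Real.volume_real_Ioo, max_eq_left hpq.le]
      field_simp
    · intro k hk
      have hk' := Finset.mem_Ico.1 hk
      exact Finset.mem_range.2 (by omega)
    · exact fun k hk hk' => h0 k (by simpa [Nat.lt_succ_iff] using hk) hk'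
  · rw [intervalIntegral.integral_congr (g := fun _ => 0), intervalIntegral.integral_zero]
    intro x hx
    rw [uIcc_of_le (H.chain.bubble_pos k hk).le] at hx
    simp only [H.extGx_bubble hk hx]
    ring

theorem gap_le_integral_extFx (H : StressProfile M d N p q m f f' cc rr s) :
    (∑ k ∈ Finset.range (N + 1), ∫ x in (p k)..(q (k + 1)), f' x ^ 2) ≤
      ∫ x in (-1 : ℝ)..1, extFx N p q f f' x ^ 2 := by
  rw [H.integral_extFx]
  exact le_add_of_nonneg_right (Finset.sum_nonneg fun k hk =>
    div_nonneg (sq_nonneg _) (sub_pos.2 (H.chain.bubble_pos k hk)).le)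

theorem integral_extFx_le (H : StressProfile M d N p q m f f' cc rr s) :
    ∫ x in (-1 : ℝ)..1, extFx N p q f f' x ^ 2 ≤ (1 + (M * d)⁻¹) * diss N p q m f' cc rr := by
  have hd := H.d_pos
  have hM := H.M_pos
  have h1 : ∑ k ∈ Finset.Icc 1 N, (m k * cc k) ^ 2 / (p k - q k) ≤
      (M * d)⁻¹ * ∑ k ∈ Finset.Icc 1 N, m k * (rr k ^ 2 + cc k ^ 2) := by
    rw [Finset.mul_sum]
    refine Finset.sum_le_sum fun k hk => ?_
    refine (H.force_sq_div_le hk (by linarith [H.bubble_length k hk])).trans ?_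
    have := H.m_pos k hk
    gcongr
    exact le_add_of_nonneg_left (sq_nonneg _)
  have h2 := H.sum_gap_nonneg f'
  have h3 := H.sum_acc_nonneg
  have h4 : 0 ≤ (M * d)⁻¹ * ∑ k ∈ Finset.range (N + 1), ∫ x in (p k)..(q (k + 1)), f' x ^ 2 := by
    positivity
  rw [H.integral_extFx, diss]
  linarith

/-- Newton's laws express Σ_k as an interface value of the fluid stress plus forces of order m_k.
The increment between neighbours is thus the increment of Σ_f across the gap, controlled by its
derivative, plus forces of the two bubbles. -/
theorem integral_extGx_le (H : StressProfile M d N p q m f f' cc rr s) :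
    ∫ x in (-1 : ℝ)..1, extGx N p q s x ^ 2 ≤ 5 * (1 + (M * d)⁻¹) * diss N p q m f' cc rr := by
  have hd := H.d_pos
  have hM := H.M_pos
  set F : ℕ → ℝ := fun k => m k * (rr k ^ 2 + cc k ^ 2) with hF
  have hF0 : ∀ k ∈ Finset.Icc 1 N, 0 ≤ F k := fun k hk =>
    mul_nonneg (H.m_pos k hk).le (by positivity)
  have h1 : ∀ k ∈ Finset.Ico 1 N, (s (k + 1) - s k) ^ 2 / (q (k + 1) - p k) ≤
      5 * (∫ x in (p k)..(q (k + 1)), f' x ^ 2) +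
        5 / 4 * ((M * d)⁻¹ * F k + (M * d)⁻¹ * F (k + 1)) := by
    intro k hk
    have hk' := Finset.mem_Ico.1 hk
    have b1 : k ∈ Finset.Icc 1 N := Finset.mem_Icc.2 ⟨hk'.1, hk'.2.le⟩
    have b2 : k + 1 ∈ Finset.Icc 1 N := Finset.mem_Icc.2 ⟨by omega, hk'.2⟩
    have hpq := sub_pos.2 (H.chain.gap_pos k hk'.2.le)
    have hl := H.gap_length k b1
    have n1 := H.newton_c k b1
    have n2 := H.newton_c _ b2
    have n3 := H.newton_r k b1
    have n4 := H.newton_r _ b2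
    have e : s (k + 1) - s k = (f (q (k + 1)) - f (p k)) + m (k + 1) * cc (k + 1) / 2 +
        m k * cc k / 2 - m (k + 1) * rr (k + 1) / 6 + m k * rr k / 6 := by linarith
    -- Cauchy–Schwarz for five terms; the weights 1/2 and 1/6 of the forces give 5/4 and 5/36, and
    -- the larger one is used for both.
    have e1 : (s (k + 1) - s k) ^ 2 ≤ 5 * (f (q (k + 1)) - f (p k)) ^ 2 +
        5 / 4 * ((m (k + 1) * cc (k + 1)) ^ 2 + (m k * cc k) ^ 2 + (m (k + 1) * rr (k + 1)) ^ 2 +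
          (m k * rr k) ^ 2) := by
      rw [e]
      generalize f (q (k + 1)) - f (p k) = A
      generalize m (k + 1) * cc (k + 1) = B
      generalize m k * cc k = C
      generalize m (k + 1) * rr (k + 1) = D
      generalize m k * rr k = E
      nlinarith [sq_nonneg (A - B / 2), sq_nonneg (A - C / 2), sq_nonneg (A + D / 6),
        sq_nonneg (A - E / 6), sq_nonneg (B / 2 - C / 2), sq_nonneg (B / 2 + D / 6),
        sq_nonneg (B / 2 - E / 6), sq_nonneg (C / 2 + D / 6), sq_nonneg (C / 2 - E / 6),
        sq_nonneg (D / 6 + E / 6), sq_nonneg D, sq_nonneg E]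
    have e2 := (H.h1 k hk'.2.le).sq_sub_le (H.chain.gap_pos k hk'.2.le).le
    have e3 : (f (q (k + 1)) - f (p k)) ^ 2 / (q (k + 1) - p k) ≤
        ∫ x in (p k)..(q (k + 1)), f' x ^ 2 := by
      rw [div_le_iff₀ hpq]; linarith
    have f1 := H.force_sq_div_le b1 (x := cc k) hl
    have f2 := H.force_sq_div_le b2 (x := cc (k + 1)) hl
    have f3 := H.force_sq_div_le b1 (x := rr k) hl
    have f4 := H.force_sq_div_le b2 (x := rr (k + 1)) hl
    have e4 := div_le_div_of_nonneg_right e1 hpq.le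
    rw [add_div, mul_div_assoc, mul_div_assoc, add_div, add_div, add_div] at e4
    simp only [hF, mul_add]
    linarith
  have h2 : ∑ k ∈ Finset.Ico 1 N, ∫ x in (p k)..(q (k + 1)), f' x ^ 2 ≤
      ∑ k ∈ Finset.range (N + 1), ∫ x in (p k)..(q (k + 1)), f' x ^ 2 := by
    refine Finset.sum_le_sum_of_subset_of_nonneg (fun k hk => ?_) fun k hk _ =>
      H.gap_int_nonneg (by simpa [Nat.lt_succ_iff] using hk) f'
    have hk' := Finset.mem_Ico.1 hk
    exact Finset.mem_range.2 (by omega)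
  have h3 : ∑ k ∈ Finset.Ico 1 N, F k ≤ ∑ k ∈ Finset.Icc 1 N, F k :=
    Finset.sum_le_sum_of_subset_of_nonneg Finset.Ico_subset_Icc_self fun k hk _ => hF0 k hk
  -- Each bubble is a right neighbour at most once.
  have h4 : ∑ k ∈ Finset.Ico 1 N, F (k + 1) ≤ ∑ k ∈ Finset.Icc 1 N, F k := by
    rw [Finset.sum_Ico_add' F 1 N 1]
    refine Finset.sum_le_sum_of_subset_of_nonneg (fun k hk => ?_) fun k hk _ => hF0 k hk
    have hk' := Finset.mem_Ico.1 hk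
    exact Finset.mem_Icc.2 ⟨by omega, by omega⟩
  rw [H.integral_extGx]
  refine (Finset.sum_le_sum h1).trans ?_
  rw [Finset.sum_add_distrib, ← Finset.mul_sum, ← Finset.mul_sum, Finset.sum_add_distrib,
    ← Finset.mul_sum, ← Finset.mul_sum, ← mul_add]
  have h5 := H.sum_gap_nonneg f'
  have h6 := H.sum_acc_nonneg
  have h7 : 0 ≤ (M * d)⁻¹ := by positivity
  rw [diss]
  change _ ≤ 5 * (1 + (M * d)⁻¹) * (_ + ∑ k ∈ Finset.Icc 1 N, F k)
  change 0 ≤ ∑ k ∈ Finset.Icc 1 N, F k at h6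
  have h8 := mul_le_mul_of_nonneg_left (add_le_add h3 h4) h7
  have h9 := mul_nonneg h7 h5
  have h10 := mul_nonneg h7 h6
  linarith

/-- A point of the fluid where the stress is controlled by its mean square. -/
theorem exists_point (H : StressProfile M d N p q m f f' cc rr s) {E : ℝ}
    (hE : ∑ k ∈ Finset.range (N + 1), ∫ x in (p k)..(q (k + 1)), f x ^ 2 ≤ E) :
    ∃ x ∈ Icc (-1 : ℝ) 1, extF N p q f x ^ 2 ≤ (E + 1) / d := by
  by_contra! hc
  have hN := H.N_pos
  have hd := H.d_pos
  have hE0 : 0 ≤ E := (H.sum_gap_nonneg f).trans hE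
  -- If no such point existed, each of the N gaps, of length at least d/N, would contribute at least
  -- (E + 1)/N, and the total would exceed E. The wall gap `k = 0`, whose length has no lower bound
  -- here, is left out.
  have h1 : ∀ k ∈ Finset.Icc 1 N, (E + 1) / N ≤ ∫ x in (p k)..(q (k + 1)), f x ^ 2 := by
    intro k hk
    have hk' := Finset.mem_Icc.1 hk
    have hpq := H.chain.gap_pos k hk'.2
    have h2 : ∫ _ in (p k)..(q (k + 1)), (E + 1) / d ≤ ∫ x in (p k)..(q (k + 1)), f x ^ 2 := by
      refine intervalIntegral.integral_mono_on hpq.le (by simp)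
        ((H.h1 k hk'.2).fun_sq_intervalIntegrable hpq.le) fun x hx => ?_
      rw [← H.extF_gap hk'.2 hx]
      exact (hc x (H.chain.gap_subset hk'.2 hx)).le
    refine le_trans ?_ h2
    rw [intervalIntegral.integral_const, smul_eq_mul, ← mul_div_assoc, div_le_div_iff₀ hN hd]
    have := mul_le_mul_of_nonneg_right (H.gap_length k hk) (by linarith : 0 ≤ E + 1)
    linarith
  have h2 := Finset.sum_le_sum h1
  rw [Finset.sum_const, Nat.card_Icc, nsmul_eq_mul, Nat.add_sub_cancel,
    mul_div_cancel₀ _ hN.ne'] at h2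
  have h3 : ∑ k ∈ Finset.Icc 1 N, ∫ x in (p k)..(q (k + 1)), f x ^ 2 ≤
      ∑ k ∈ Finset.range (N + 1), ∫ x in (p k)..(q (k + 1)), f x ^ 2 := by
    refine Finset.sum_le_sum_of_subset_of_nonneg (fun k hk => ?_) fun k hk _ =>
      H.gap_int_nonneg (by simpa [Nat.lt_succ_iff] using hk) f
    have hk' := Finset.mem_Icc.1 hk
    exact Finset.mem_range.2 (by omega)
  linarith

theorem extF_sq_le (H : StressProfile M d N p q m f f' cc rr s) {E : ℝ}
    (hE : ∑ k ∈ Finset.range (N + 1), ∫ x in (p k)..(q (k + 1)), f x ^ 2 ≤ E) {y : ℝ}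
    (hy : y ∈ Icc (-1 : ℝ) 1) : extF N p q f y ^ 2 ≤
      2 * ((E + 1) / d) + 4 * ((1 + (M * d)⁻¹) * diss N p q m f' cc rr) := by
  obtain ⟨x, hx, h⟩ := H.exists_point hE
  have := H.extF_h1.sq_le hx hy
  have := H.integral_extFx_le
  linarith

theorem s_sq_le (H : StressProfile M d N p q m f f' cc rr s) {E : ℝ}
    (hE : ∑ k ∈ Finset.range (N + 1), ∫ x in (p k)..(q (k + 1)), f x ^ 2 ≤ E) {k : ℕ}
    (hk : k ∈ Finset.Icc 1 N) : s k ^ 2 ≤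
      2 * (2 * ((E + 1) / d) + 4 * ((1 + (M * d)⁻¹) * diss N p q m f' cc rr)) +
        M⁻¹ * diss N p q m f' cc rr := by
  have hk' := Finset.mem_Icc.1 hk
  have hM := H.M_pos
  have h1 := H.extF_sq_le hE (H.chain.bubble_subset hk (left_mem_Icc.2 (H.chain.bubble_pos k hk).le))
  have h2 := H.extF_sq_le hE (H.chain.bubble_subset hk (right_mem_Icc.2 (H.chain.bubble_pos k hk).le))
  rw [H.extF_gap hk'.2 ⟨le_rfl, (H.chain.gap_pos k hk'.2).le⟩] at h2
  rw [H.extF_gap (k := k - 1) (by omega) (by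
    rw [Nat.sub_add_cancel hk'.1]
    exact ⟨(H.chain.p_le_q (by omega) (by omega)).le, le_rfl⟩)] at h1
  have h3 := H.force_sq_le hk (rr k)
  have h4 : m k * rr k ^ 2 ≤ diss N p q m f' cc rr := by
    have h5 := Finset.single_le_sum (f := fun k => m k * (rr k ^ 2 + cc k ^ 2))
      (fun k hk => mul_nonneg (H.m_pos k hk).le (by positivity)) hk
    have h6 := mul_nonneg (H.m_pos k hk).le (sq_nonneg (cc k))
    have h7 := H.sum_gap_nonneg f'
    rw [diss]
    simp only [mul_add] at h5 ⊢
    linarith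
  have h5 := mul_le_mul_of_nonneg_left h4 (inv_nonneg.2 hM.le)
  have n := H.newton_r k hk
  -- The radial equation solved for Σ_k: the mean of the interface stresses minus an inertial term.
  have e : s k = f (q k) / 2 + f (p k) / 2 - m k * rr k / 6 := by linarith
  rw [e]
  nlinarith [sq_nonneg (f (q k) / 2 - f (p k) / 2), sq_nonneg (f (q k) / 2 + m k * rr k / 6),
    sq_nonneg (f (p k) / 2 + m k * rr k / 6), sq_nonneg (m k * rr k)]

end StressProfile

/-- The constant of the stress estimates. -/
def stressConst (M d : ℝ) : ℝ := 100 * (1 + (M * d)⁻¹ + M⁻¹ + d⁻¹)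

theorem stressConst_pos {M d : ℝ} (hM : 0 < M) (hd : 0 < d) : 0 < stressConst M d := by
  unfold stressConst; positivity

namespace StressProfile

variable {M d : ℝ} {N : ℕ} {p q m : ℕ → ℝ} {f f' : ℝ → ℝ} {cc rr s : ℕ → ℝ}

theorem sup_le (H : StressProfile M d N p q m f f' cc rr s) {E : ℝ}
    (hE : ∑ k ∈ Finset.range (N + 1), ∫ x in (p k)..(q (k + 1)), f x ^ 2 ≤ E) :
    (∀ k ≤ N, ∀ x ∈ Icc (p k) (q (k + 1)),
      f x ^ 2 ≤ stressConst M d * (1 + E + diss N p q m f' cc rr)) ∧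
    ∀ k ∈ Finset.Icc 1 N, s k ^ 2 ≤ stressConst M d * (1 + E + diss N p q m f' cc rr) := by
  have hM := H.M_pos
  have hd := H.d_pos
  have hE0 : 0 ≤ E := (H.sum_gap_nonneg f).trans hE
  have hD := H.diss_nonneg
  have a1 : 0 ≤ (M * d)⁻¹ := by positivity
  have a2 : 0 ≤ M⁻¹ := by positivity
  have a3 : 0 ≤ d⁻¹ := by positivity
  have key : 2 * (2 * ((E + 1) / d) + 4 * ((1 + (M * d)⁻¹) * diss N p q m f' cc rr)) +
        M⁻¹ * diss N p q m f' cc rr ≤ stressConst M d * (1 + E + diss N p q m f' cc rr) := by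
    rw [stressConst, div_eq_mul_inv]
    nlinarith [mul_nonneg a1 hE0, mul_nonneg a2 hE0, mul_nonneg a3 hE0, mul_nonneg a1 hD,
      mul_nonneg a2 hD, mul_nonneg a3 hD]
  have a4 : 0 ≤ (E + 1) / d := by positivity
  constructor
  · intro k hk x hx
    have := H.extF_sq_le hE (H.chain.gap_subset hk hx)
    rw [H.extF_gap hk hx] at this
    have a5 : 0 ≤ (1 + (M * d)⁻¹) * diss N p q m f' cc rr := by positivity
    have a6 : 0 ≤ M⁻¹ * diss N p q m f' cc rr := by positivity
    linarith
  · exact fun k hk => (H.s_sq_le hE hk).trans key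

theorem norms_le (H : StressProfile M d N p q m f f' cc rr s) {E : ℝ}
    (hE : ∑ k ∈ Finset.range (N + 1), ∫ x in (p k)..(q (k + 1)), f x ^ 2 ≤ E) :
    h1Norm (-1) 1 (extF N p q f) ^ 2 + h1Norm (-1) 1 (extG N p q s) ^ 2 ≤
      ENNReal.ofReal (stressConst M d * (1 + E + diss N p q m f' cc rr)) := by
  have hM := H.M_pos
  have hd := H.d_pos
  have hE0 : 0 ≤ E := (H.sum_gap_nonneg f).trans hE
  have hD := H.diss_nonneg
  have a1 : 0 ≤ (M * d)⁻¹ := by positivity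
  have a2 : 0 ≤ M⁻¹ := by positivity
  have a3 : 0 ≤ d⁻¹ := by positivity
  rw [H.extF_h1.h1Norm_sq_eq (by norm_num), H.extG_h1.h1Norm_sq_eq (by norm_num),
    ← ENNReal.ofReal_add]
  rotate_left
  · exact add_nonneg (intervalIntegral.integral_nonneg (by norm_num) fun _ _ => sq_nonneg _)
      (intervalIntegral.integral_nonneg (by norm_num) fun _ _ => sq_nonneg _)
  · exact add_nonneg (intervalIntegral.integral_nonneg (by norm_num) fun _ _ => sq_nonneg _)
      (intervalIntegral.integral_nonneg (by norm_num) fun _ _ => sq_nonneg _)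
  refine ENNReal.ofReal_le_ofReal ?_
  have int_le : ∀ (h : ℝ → ℝ) (c : ℝ), IntervalIntegrable (fun x => h x ^ 2) volume (-1) 1 →
      (∀ x ∈ Icc (-1 : ℝ) 1, h x ^ 2 ≤ c) → ∫ x in (-1 : ℝ)..1, h x ^ 2 ≤ 2 * c := by
    intro h c hi hc
    have := intervalIntegral.integral_mono_on (by norm_num) hi (intervalIntegrable_const (c := c)) hc
    rw [intervalIntegral.integral_const, smul_eq_mul] at this
    linarith
  have F1 := int_le _ _ (H.extF_h1.fun_sq_intervalIntegrable (by norm_num))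
    fun y hy => H.extF_sq_le hE hy
  have F2 := H.integral_extFx_le
  have G2 := H.integral_extGx_le
  have k1 : 1 ∈ Finset.Icc 1 N := Finset.mem_Icc.2 ⟨le_rfl, H.one_le⟩
  have s1 := H.s_sq_le hE k1
  have G1 := int_le _ _ (H.extG_h1.fun_sq_intervalIntegrable (by norm_num)) fun y hy =>
    H.extG_h1.sq_le (H.chain.bubble_subset k1 (left_mem_Icc.2 (H.chain.bubble_pos 1 k1).le)) hy
  rw [H.extG_bubble k1 (left_mem_Icc.2 (H.chain.bubble_pos 1 k1).le)] at G1
  rw [div_eq_mul_inv] at s1 F1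
  rw [stressConst]
  nlinarith [mul_nonneg a1 hE0, mul_nonneg a2 hE0, mul_nonneg a3 hE0, mul_nonneg a1 hD,
      mul_nonneg a2 hD, mul_nonneg a3 hD]

end StressProfile

/-! ### Consequences of the bounds -/

/-- Young's inequality in the form that, with τ = √T, replaces Cauchy–Schwarz in time. -/
theorem sqrt_le_inv_add_mul {τ y : ℝ} (hτ : 0 < τ) (hy : 0 ≤ y) : √y ≤ 1 / τ + τ * y := by
  have e : 1 / τ + τ * √y ^ 2 - √y = (1 / τ) * ((τ * √y - 1 / 2) ^ 2 + 3 / 4) := by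
    field_simp
    ring
  rw [Real.sq_sqrt hy] at e
  have : 0 ≤ (1 / τ) * ((τ * √y - 1 / 2) ^ 2 + 3 / 4) := by positivity
  linarith

/-- The source of smallness: D is bounded only in L¹ in time, but the rates depend on its square
root, which gains a factor √T. -/
theorem integral_sqrt_le {T E K : ℝ} {D : ℝ → ℝ} (hT : 0 < T) (hT1 : T ≤ 1) (hE : 0 ≤ E)
    (hD : IntervalIntegrable D volume 0 T) (hD0 : ∀ t ∈ Icc 0 T, 0 ≤ D t)
    (hs : IntervalIntegrable (fun t => √(1 + E + D t)) volume 0 T)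
    (hK : ∫ t in (0 : ℝ)..T, D t ≤ K) : ∫ t in (0 : ℝ)..T, √(1 + E + D t) ≤ √T * (2 + E + K) := by
  have hτ : 0 < √T := Real.sqrt_pos.2 hT
  have hτ2 : √T * √T = T := Real.mul_self_sqrt hT.le
  have h1 : ∫ t in (0 : ℝ)..T, √(1 + E + D t) ≤
      ∫ t in (0 : ℝ)..T, ((1 / √T + √T * (1 + E)) + √T * D t) := by
    refine intervalIntegral.integral_mono_on hT.le hs (IntervalIntegrable.add (by simp)
      (hD.const_mul _)) fun t ht => ?_
    have h0 := hD0 t ht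
    have := sqrt_le_inv_add_mul hτ (y := 1 + E + D t) (by positivity)
    linarith
  rw [intervalIntegral.integral_add (by simp) (hD.const_mul _),
    intervalIntegral.integral_const_mul, intervalIntegral.integral_const, smul_eq_mul,
    sub_zero] at h1
  have h2 := mul_le_mul_of_nonneg_left hK hτ.le
  have h3 : T * (1 / √T) = √T := by rw [← mul_div_assoc, mul_one, Real.div_sqrt]
  have h4 : T * (√T * (1 + E)) ≤ √T * (1 + E) :=
    mul_le_of_le_one_left (by positivity) hT1
  linarith

theorem abs_mul_pos {x y : ℝ} (hy : 0 < y) : |x * y| = |x| * y := by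
  rw [abs_mul, abs_of_pos hy]

theorem intervalIntegrable_sum {ι : Type*} (s : Finset ι) {f : ι → ℝ → ℝ} {a b : ℝ}
    (h : ∀ i ∈ s, IntervalIntegrable (f i) volume a b) :
    IntervalIntegrable (fun x => ∑ i ∈ s, f i x) volume a b :=
  ⟨integrable_finsetSum _ fun i hi => (h i hi).1, integrable_finsetSum _ fun i hi => (h i hi).2⟩

/-- The same affine function, written from the left end of the bubble instead of its centre. -/
theorem sigFExt_eq {z : Flow} {P : Params} {N : ℕ} {t : ℝ}
    (hR : ∀ k ∈ Finset.Icc 1 N, 0 < z.R k t) : z.sigFExt P N t =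
      StressProfile.extF N (fun k => z.xp k t) (fun k => z.xm N k t) (z.sigF P t) := by
  funext x
  unfold Flow.sigFExt StressProfile.extF bubbleExt
  congr 1
  refine Finset.sum_congr rfl fun k hk => ?_
  have hk' := Finset.mem_Icc.1 hk
  congr 1
  funext y
  have h1 := z.xp_eq (k := k) (by omega) t
  have h2 := z.xm_eq (N := N) (k := k) (by omega) t
  have h3 : z.xp k t - z.xm N k t = 2 * z.R k t := by rw [h1, h2]; ring
  have h4 : z.xm N k t = z.c k t - z.R k t := h2
  have hr := (hR k hk).ne'
  beta_reduce
  rw [h3]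
  generalize z.sigF P t (z.xm N k t) = A
  generalize z.sigF P t (z.xp k t) = B
  rw [h4]
  field_simp
  ring

theorem sigGExt_eq (z : Flow) (P : Params) (N : ℕ) (κ : ℕ → ℝ) (t : ℝ) : z.sigGExt P N κ t =
    StressProfile.extG N (fun k => z.xp k t) (fun k => z.xm N k t) (fun k => z.sigB P κ k t) :=
  rfl

/-- The dissipation `∑_k ∫ |∂_x Σ_f|² + ∑_k m_k (|R_k''|² + |c_k''|²)`. -/
def dissipation (P : Params) (N : ℕ) (m : ℕ → ℝ) (z : Flow) (t : ℝ) : ℝ :=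
  StressProfile.diss N (fun k => z.xp k t) (fun k => z.xm N k t) m
    (stressX P z.u_xx z.rho z.rho_x t) (fun k => z.ddc k t) (fun k => z.ddR k t)

/-- The bound of the squared `L²` norm of the fluid stress. -/
def stressBound (P : Params) (ρhi K : ℝ) : ℝ := 4 * P.muF * K + 4 * P.pF ρhi ^ 2

/-- The bound of the rates of deformation for a given dissipation. -/
def rate (P : Params) (M d ρhi K D : ℝ) : ℝ :=
  (P.pF ρhi / P.muF + (M * d)⁻¹ / P.muG) +
    √(stressConst M d) * (P.muF⁻¹ + P.muG⁻¹) * √(1 + stressBound P ρhi K + D)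

/-- A classical solution with uniform bounds. -/
structure BoundedFlow (P : Params) (N : ℕ) (m κ : ℕ → ℝ) (M d ρlo ρhi K T : ℝ) (z : Flow) :
    Prop where
  sol : IsClassicalSolution P N m κ T z
  bounds : Bounds P N m κ d ρlo ρhi K (Ioo 0 T) z
  T_pos : 0 < T
  one_le : 1 ≤ N
  M_pos : 0 < M
  d_pos : 0 < d
  lo_pos : 0 < ρlo
  hi_pos : 0 < ρhi
  m_scaling : ∀ k ∈ Finset.Icc 1 N, M ≤ N * m k ∧ N * m k ≤ M⁻¹
  kappa_scaling : ∀ k ∈ Finset.Icc 1 N, M ≤ N * κ k ∧ N * κ k ≤ M⁻¹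

namespace BoundedFlow

variable {P : Params} {N : ℕ} {m κ : ℕ → ℝ} {M d ρlo ρhi K T : ℝ} {z : Flow}

theorem N_pos (H : BoundedFlow P N m κ M d ρlo ρhi K T z) : (0 : ℝ) < N :=
  Nat.cast_pos.2 H.one_le

theorem m_pos (H : BoundedFlow P N m κ M d ρlo ρhi K T z) {k : ℕ} (hk : k ∈ Finset.Icc 1 N) :
    0 < m k := pos_of_mul_pos_right (H.M_pos.trans_le (H.m_scaling k hk).1) H.N_pos.le

theorem kappa_pos (H : BoundedFlow P N m κ M d ρlo ρhi K T z) {k : ℕ} (hk : k ∈ Finset.Icc 1 N) :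
    0 < κ k := pos_of_mul_pos_right (H.M_pos.trans_le (H.kappa_scaling k hk).1) H.N_pos.le

theorem gapFlow (H : BoundedFlow P N m κ M d ρlo ρhi K T z) {k : ℕ} (hk : k ≤ N) :
    GapFlow P ρlo ρhi (2 * K / P.muF) T (z.xp k) (z.gap N k) z.u z.u_t z.u_x z.u_xx
      z.rho z.rho_t z.rho_x (z.accP k) (z.accM N (k + 1)) :=
  H.sol.gapFlow H.T_pos H.lo_pos H.bounds.q3 H.bounds.q4 hk

theorem kappa_div_le (H : BoundedFlow P N m κ M d ρlo ρhi K T z) {t : ℝ} (ht : t ∈ Ioo 0 T)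
    {k : ℕ} (hk : k ∈ Finset.Icc 1 N) : κ k / z.R k t ≤ (M * d)⁻¹ := by
  have h1 := (H.kappa_scaling k hk).2
  have h2 := (H.bounds.q1 t ht k hk).1
  have hR := H.sol.R_pos k hk t (Ioo_subset_Icc_self ht)
  have hN := H.N_pos
  rw [← mul_div_mul_left _ _ hN.ne', mul_inv, div_le_iff₀ (by positivity)]
  have h3 : 1 ≤ d⁻¹ * (N * z.R k t) := by rw [← div_eq_inv_mul, one_le_div H.d_pos]; exact h2
  have h4 := mul_le_mul_of_nonneg_left h3 (inv_nonneg.2 H.M_pos.le)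
  linarith

theorem energies_le (H : BoundedFlow P N m κ M d ρlo ρhi K T z) {t : ℝ} (ht : t ∈ Ioo 0 T) :
    (∑ k ∈ Finset.range (N + 1), ∫ x in (z.xp k t)..(z.xm N (k + 1) t), z.u_x t x ^ 2) ≤
      2 * K / P.muF ∧ ∑ k ∈ Finset.Icc 1 N, z.dR k t ^ 2 / z.R k t ≤ K / P.muG := by
  have ht' := Ioo_subset_Icc_self ht
  have h := H.bounds.q4 t ht
  rw [H.sol.h1Energy_eq ht'] at h
  have hF := P.muF_pos
  have hG := P.muG_pos
  have h1 := H.sol.sum_dR_nonneg ht'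
  have h2 : 0 ≤ ∑ k ∈ Finset.range (N + 1), ∫ x in (z.xp k t)..(z.xm N (k + 1) t),
      z.u_x t x ^ 2 := Finset.sum_nonneg fun k hk =>
    H.sol.gap_energy_nonneg ht' (by simpa [Nat.lt_succ_iff] using hk) _
  rw [le_div_iff₀ hF, le_div_iff₀ hG]
  have h3 := mul_nonneg hG.le h1
  have h4 := mul_nonneg hF.le h2
  constructor <;> linarith

theorem K_nonneg (H : BoundedFlow P N m κ M d ρlo ρhi K T z) : 0 ≤ K := by
  have ht : T / 2 ∈ Ioo 0 T := ⟨by linarith [H.T_pos], by linarith [H.T_pos]⟩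
  have h := (H.energies_le ht).2
  have := (H.sol.sum_dR_nonneg (Ioo_subset_Icc_self ht)).trans h
  have hG := P.muG_pos
  by_contra hc
  exact absurd this (not_le.2 (div_neg_of_neg_of_pos (not_le.1 hc) hG))

theorem stressBound_nonneg (H : BoundedFlow P N m κ M d ρlo ρhi K T z) :
    0 ≤ stressBound P ρhi K := by
  have := H.K_nonneg
  have := P.muF_pos
  unfold stressBound
  positivity

theorem profile (H : BoundedFlow P N m κ M d ρlo ρhi K T z) :
    ∀ᵐ t ∂(volume.restrict (Ioo 0 T)), StressProfile M d N (fun k => z.xp k t)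
      (fun k => z.xm N k t) m (z.sigF P t) (stressX P z.u_xx z.rho z.rho_x t)
      (fun k => z.ddc k t) (fun k => z.ddR k t) (fun k => z.sigB P κ k t) := by
  have e1 : ∀ᵐ t ∂(volume.restrict (Ioo 0 T)), ∀ k ≤ N,
      HasH1Deriv (z.xp k t) (z.xm N (k + 1) t) (z.u_x t) (z.u_xx t) := by
    rw [ae_all_iff]
    exact fun k => by
      by_cases hk : k ≤ N
      · filter_upwards [H.sol.u_x_h1 k hk] with t ht _ using ht
      · exact ae_of_all _ fun t h => absurd h hk
  have e2 : ∀ᵐ t ∂(volume.restrict (Ioo 0 T)), ∀ k ≤ N,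
      HasH1Deriv (z.xp k t) (z.xm N (k + 1) t) (z.rho t) (z.rho_x t) := by
    rw [ae_all_iff]
    exact fun k => by
      by_cases hk : k ≤ N
      · filter_upwards [H.sol.rho_h1 k hk] with t ht _ using ht
      · exact ae_of_all _ fun t h => absurd h hk
  have e3 : ∀ᵐ t ∂(volume.restrict (Ioo 0 T)), ∀ k ∈ Finset.Icc 1 N,
      m k * z.ddc k t = z.sigF P t (z.xp k t) - z.sigF P t (z.xm N k t) := by
    rw [ae_all_iff]
    exact fun k => by
      by_cases hk : k ∈ Finset.Icc 1 N
      · filter_upwards [H.sol.newton_c k hk] with t ht _ using ht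
      · exact ae_of_all _ fun t h => absurd h hk
  have e4 : ∀ᵐ t ∂(volume.restrict (Ioo 0 T)), ∀ k ∈ Finset.Icc 1 N, m k / 3 * z.ddR k t =
      z.sigF P t (z.xm N k t) + z.sigF P t (z.xp k t) - 2 * z.sigB P κ k t := by
    rw [ae_all_iff]
    exact fun k => by
      by_cases hk : k ∈ Finset.Icc 1 N
      · filter_upwards [H.sol.newton_R k hk] with t ht _ using ht
      · exact ae_of_all _ fun t h => absurd h hk
  filter_upwards [e1, e2, e3, e4, ae_restrict_mem measurableSet_Ioo] with t h1 h2 h3 h4 ht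
  have ht' := Ioo_subset_Icc_self ht
  refine
  { chain := H.sol.chain ht'
    one_le := H.one_le
    M_pos := H.M_pos
    d_pos := H.d_pos
    bubble_length := fun k hk => ?_
    gap_length := fun k hk => (H.bounds.q2 t ht k hk).1
    m_pos := fun k hk => H.m_pos hk
    m_le := fun k hk => (H.m_scaling k hk).2
    h1 := fun k hk => ((h1 k hk).const_mul P.muF).sub
      ((h2 k hk).comp P.contDiff_pF ((H.sol.chain ht').gap_pos k hk).le)
    newton_c := h3
    newton_r := h4 }
  have hk' := Finset.mem_Icc.1 hk
  have := (H.bounds.q1 t ht k hk).1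
  rw [z.xp_eq (by omega), z.xm_eq (by omega)]
  linarith

theorem rho_gap (H : BoundedFlow P N m κ M d ρlo ρhi K T z) {t : ℝ} (ht : t ∈ Ioo 0 T) {k : ℕ}
    (hk : k ≤ N) : ∀ᵐ x ∂(volume.restrict (Ioo (z.xp k t) (z.xm N (k + 1) t))),
      P.pF (z.rho t x) ∈ Icc 0 (P.pF ρhi) := by
  have := (H.gapFlow hk).rho_bdd t ht
  rw [Flow.xp_add_gap] at this
  filter_upwards [this] with x hx
  exact ⟨P.pF_nonneg (H.lo_pos.le.trans hx.1), P.pF_mono (H.lo_pos.le.trans hx.1) hx.2⟩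

theorem sigF_sq_le (H : BoundedFlow P N m κ M d ρlo ρhi K T z) :
    ∀ᵐ t ∂(volume.restrict (Ioo 0 T)), ∑ k ∈ Finset.range (N + 1),
      ∫ x in (z.xp k t)..(z.xm N (k + 1) t), z.sigF P t x ^ 2 ≤ stressBound P ρhi K := by
  filter_upwards [H.profile, ae_restrict_mem measurableSet_Ioo] with t h ht
  have ht' := Ioo_subset_Icc_self ht
  have hmu := P.muF_pos
  have h1 : ∀ k ∈ Finset.range (N + 1),
      ∫ x in (z.xp k t)..(z.xm N (k + 1) t), z.sigF P t x ^ 2 ≤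
      2 * P.muF ^ 2 * (∫ x in (z.xp k t)..(z.xm N (k + 1) t), z.u_x t x ^ 2) +
        2 * P.pF ρhi ^ 2 * (z.xm N (k + 1) t - z.xp k t) := by
    intro k hk
    have hk' : k ≤ N := by simpa [Nat.lt_succ_iff] using hk
    have hpq : z.xp k t < z.xm N (k + 1) t := h.chain.gap_pos k hk'
    have i1 := (H.sol.u_h1 k hk' t ht').sq_intervalIntegrable hpq.le
    have e : 2 * P.muF ^ 2 * (∫ x in (z.xp k t)..(z.xm N (k + 1) t), z.u_x t x ^ 2) +
        2 * P.pF ρhi ^ 2 * (z.xm N (k + 1) t - z.xp k t) =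
        ∫ x in (z.xp k t)..(z.xm N (k + 1) t), (2 * P.muF ^ 2 * z.u_x t x ^ 2 +
          2 * P.pF ρhi ^ 2) := by
      rw [intervalIntegral.integral_add (i1.const_mul _) (by simp),
        intervalIntegral.integral_const_mul, intervalIntegral.integral_const, smul_eq_mul]
      ring
    rw [e]
    refine intervalIntegral.integral_mono_ae_restrict hpq.le
      ((h.h1 k hk').fun_sq_intervalIntegrable hpq.le) ((i1.const_mul _).add (by simp)) ?_
    rw [← restrict_Ioo_eq_restrict_Icc]
    filter_upwards [H.rho_gap ht hk'] with x hx
    simp only [Flow.sigF]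
    have := pow_le_pow_left₀ hx.1 hx.2 2
    -- The inequality (a - b)² ≤ 2a² + 2b² for the viscous and the pressure part of the stress.
    nlinarith [sq_nonneg (P.muF * z.u_x t x + P.pF (z.rho t x))]
  refine (Finset.sum_le_sum h1).trans ?_
  rw [Finset.sum_add_distrib, ← Finset.mul_sum, ← Finset.mul_sum]
  have h2 := (H.energies_le ht).1
  have h3 := h.chain.sum_length
  have h4 : 0 ≤ ∑ k ∈ Finset.Icc 1 N, (z.xp k t - z.xm N k t) :=
    Finset.sum_nonneg fun k hk => (sub_pos.2 (h.chain.bubble_pos k hk)).le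
  have h5 : 2 * P.pF ρhi ^ 2 * ∑ k ∈ Finset.range (N + 1), (z.xm N (k + 1) t - z.xp k t) ≤
      2 * P.pF ρhi ^ 2 * 2 := mul_le_mul_of_nonneg_left (by linarith) (by positivity)
  have h6 := mul_le_mul_of_nonneg_left h2 (by positivity : 0 ≤ 2 * P.muF ^ 2)
  have h7 : 2 * P.muF ^ 2 * (2 * K / P.muF) = 4 * P.muF * K := by field_simp; ring
  rw [stressBound]
  linarith

theorem dissipation_nonneg (H : BoundedFlow P N m κ M d ρlo ρhi K T z) {t : ℝ}
    (ht : t ∈ Icc 0 T) : 0 ≤ dissipation P N m z t :=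
  add_nonneg (Finset.sum_nonneg fun k hk => H.sol.gap_energy_nonneg ht
    (by simpa [Nat.lt_succ_iff] using hk) _) (Finset.sum_nonneg fun k hk =>
      mul_nonneg (H.m_pos hk).le (by positivity))

theorem gap_dissipation_intervalIntegrable (H : BoundedFlow P N m κ M d ρlo ρhi K T z) {k : ℕ}
    (hk : k ≤ N) : IntervalIntegrable (fun t => ∫ x in (z.xp k t)..(z.xm N (k + 1) t),
      stressX P z.u_xx z.rho z.rho_x t x ^ 2) volume 0 T := by
  have := (H.gapFlow hk).stressX_intervalIntegrable
  simpa only [Flow.xp_add_gap] using this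

theorem dissipation_intervalIntegrable (H : BoundedFlow P N m κ M d ρlo ρhi K T z) :
    IntervalIntegrable (dissipation P N m z) volume 0 T := by
  have h1 : IntervalIntegrable (fun t => ∑ k ∈ Finset.range (N + 1),
      ∫ x in (z.xp k t)..(z.xm N (k + 1) t), stressX P z.u_xx z.rho z.rho_x t x ^ 2) volume 0 T :=
    intervalIntegrable_sum _ fun k hk =>
      H.gap_dissipation_intervalIntegrable (by simpa [Nat.lt_succ_iff] using hk)
  refine h1.add (intervalIntegrable_sum _ fun k hk => IntervalIntegrable.const_mul ?_ _)
  exact ((H.sol.dR_h1 k hk).sq_intervalIntegrable H.T_pos.le).add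
    ((H.sol.dc_h1 k hk).sq_intervalIntegrable H.T_pos.le)

/-- Extracts the dissipation from (Q5): its fluid part is contained in the H¹ norm of the extension
of Σ_f. -/
theorem ofReal_dissipation_le (H : BoundedFlow P N m κ M d ρlo ρhi K T z) :
    ∀ᵐ t ∂(volume.restrict (Ioo 0 T)), ENNReal.ofReal (dissipation P N m z t) ≤
      h1Norm (-1) 1 (z.sigFExt P N t) ^ 2 + h1Norm (-1) 1 (z.sigGExt P N κ t) ^ 2 +
      ENNReal.ofReal (∑ k ∈ Finset.Icc 1 N, m k * (z.ddR k t ^ 2 + z.ddc k t ^ 2)) := by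
  filter_upwards [H.profile, ae_restrict_mem measurableSet_Ioo] with t h ht
  rw [sigFExt_eq fun k hk => H.sol.R_pos k hk t (Ioo_subset_Icc_self ht), dissipation,
    StressProfile.diss, ENNReal.ofReal_add (h.sum_gap_nonneg _) h.sum_acc_nonneg]
  gcongr
  refine le_add_of_le_of_nonneg ?_ zero_le
  rw [h.extF_h1.h1Norm_sq_eq (by norm_num)]
  refine ENNReal.ofReal_le_ofReal (h.gap_le_integral_extFx.trans (le_add_of_nonneg_left ?_))
  exact intervalIntegral.integral_nonneg (by norm_num) fun _ _ => sq_nonneg _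

theorem integral_dissipation_le (H : BoundedFlow P N m κ M d ρlo ρhi K T z) :
    ∫ t in (0 : ℝ)..T, dissipation P N m z t ≤ K := by
  have hT := H.T_pos
  have h1 : ∀ t ∈ Ioo 0 T, ∫ s in (0 : ℝ)..t, dissipation P N m z s ≤ K := by
    intro t ht
    have h2 : ENNReal.ofReal (∫ s in (0 : ℝ)..t, dissipation P N m z s) ≤ ENNReal.ofReal K := by
      refine le_trans ?_ (H.bounds.q5 t ht)
      rw [intervalIntegral.integral_of_le ht.1.le, integral_Ioc_eq_integral_Ioo]
      rw [ofReal_integral_eq_lintegral_ofReal]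
      · refine lintegral_mono_ae ?_
        exact ae_mono (Measure.restrict_mono (Ioo_subset_Ioo_right ht.2.le) le_rfl)
          H.ofReal_dissipation_le
      · exact ((intervalIntegrable_iff_integrableOn_Ioo_of_le hT.le).1
          H.dissipation_intervalIntegrable).mono_set (Ioo_subset_Ioo_right ht.2.le)
      · filter_upwards [ae_restrict_mem measurableSet_Ioo] with s hs
        exact H.dissipation_nonneg ⟨hs.1.le, hs.2.le.trans ht.2.le⟩
    exact (ENNReal.ofReal_le_ofReal_iff H.K_nonneg).1 h2
  have hc : ContinuousOn (fun t => ∫ s in (0 : ℝ)..t, dissipation P N m z s) (Icc 0 T) := by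
    have := intervalIntegral.continuousOn_primitive_interval'
      H.dissipation_intervalIntegrable (left_mem_uIcc)
    rwa [uIcc_of_le hT.le] at this
  have h3 := ((hc T ⟨hT.le, le_rfl⟩).mono Ioo_subset_Icc_self)
  have : (𝓝[Ioo 0 T] T).NeBot := by
    rw [← mem_closure_iff_nhdsWithin_neBot, closure_Ioo hT.ne]
    exact ⟨hT.le, le_rfl⟩
  -- (Q5) is assumed for t < T only; the primitive is continuous up to T.
  exact le_of_tendsto h3 (eventually_mem_nhdsWithin.mono fun t ht => h1 t ht)

theorem rate_nonneg (H : BoundedFlow P N m κ M d ρlo ρhi K T z) (D : ℝ) :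
    0 ≤ rate P M d ρhi K D := by
  have := P.muF_pos
  have := P.muG_pos
  have := H.M_pos
  have := H.d_pos
  have := P.pF_nonneg H.hi_pos.le
  unfold rate
  positivity

/-- The constitutive laws solved for the rates: ∂ₓu = (Σ_f + p)/μ_f and R_k'/R_k = (Σ_k +
κ_k/R_k)/μ_g. The stresses are bounded by `StressProfile.sup_le`, the pressures by (Q3) and by
κ_k/R_k ≤ 1/(Md). -/
theorem rates_le (H : BoundedFlow P N m κ M d ρlo ρhi K T z) :
    ∀ᵐ t ∂(volume.restrict (Ioo 0 T)),
      (∀ k ≤ N, ∀ᵐ x ∂(volume.restrict (Ioo (z.xp k t) (z.xm N (k + 1) t))),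
        |z.u_x t x| ≤ rate P M d ρhi K (dissipation P N m z t)) ∧
      ∀ k ∈ Finset.Icc 1 N,
        |z.dR k t| ≤ rate P M d ρhi K (dissipation P N m z t) * z.R k t := by
  filter_upwards [H.profile, H.sigF_sq_le, ae_restrict_mem measurableSet_Ioo] with t h hE ht
  have hF := P.muF_pos
  have hG := P.muG_pos
  have hM := H.M_pos
  have hd := H.d_pos
  have hp := P.pF_nonneg H.hi_pos.le
  have hC := stressConst_pos hM hd
  obtain ⟨s1, s2⟩ := h.sup_le hE
  have e : √(stressConst M d * (1 + stressBound P ρhi K + dissipation P N m z t)) =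
    √(stressConst M d) * √(1 + stressBound P ρhi K + dissipation P N m z t) :=
    Real.sqrt_mul hC.le _
  set A := √(stressConst M d) * √(1 + stressBound P ρhi K + dissipation P N m z t) with hA
  have hA0 : 0 ≤ A := by positivity
  -- The rate is the sum of the bounds for fluid and bubbles, so that one function dominates both.
  have er : rate P M d ρhi K (dissipation P N m z t) =
      (P.pF ρhi + A) / P.muF + ((M * d)⁻¹ + A) / P.muG := by
    rw [rate, hA]; field_simp; ring
  have t1 : 0 ≤ (P.pF ρhi + A) / P.muF := by positivity
  have t2 : 0 ≤ ((M * d)⁻¹ + A) / P.muG := by positivity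
  constructor
  · intro k hk
    filter_upwards [H.rho_gap ht hk, ae_restrict_mem measurableSet_Ioo] with x hx hx'
    have h1 := Real.abs_le_sqrt (s1 k hk x (Ioo_subset_Icc_self hx'))
    change _ ≤ √(stressConst M d * (1 + stressBound P ρhi K + dissipation P N m z t)) at h1
    rw [e, Flow.sigF, abs_le] at h1
    have h2 : |z.u_x t x| ≤ (P.pF ρhi + A) / P.muF := by
      rw [le_div_iff₀ hF, ← abs_mul_pos hF, abs_le]
      constructor <;> linarith [h1.1, h1.2, hx.1, hx.2]
    linarith
  · intro k hk
    have hR := H.sol.R_pos k hk t (Ioo_subset_Icc_self ht)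
    have h1 := Real.abs_le_sqrt (s2 k hk)
    change _ ≤ √(stressConst M d * (1 + stressBound P ρhi K + dissipation P N m z t)) at h1
    rw [e, Flow.sigB, abs_le] at h1
    have h3 := H.kappa_div_le ht hk
    have h4 := div_nonneg (H.kappa_pos hk).le hR.le
    have h2 : |z.dR k t / z.R k t| ≤ ((M * d)⁻¹ + A) / P.muG := by
      rw [le_div_iff₀ hG, ← abs_mul_pos hG, abs_le]
      constructor <;> linarith [h1.1, h1.2]
    rw [abs_div, abs_of_pos hR] at h2
    rw [← div_le_iff₀ hR]
    linarith

theorem sqrt_memLp (H : BoundedFlow P N m κ M d ρlo ρhi K T z) :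
    MemLp (fun t => √(1 + stressBound P ρhi K + dissipation P N m z t)) 2
      (volume.restrict (Ioo 0 T)) := by
  have hi := (intervalIntegrable_iff_integrableOn_Ioo_of_le H.T_pos.le).1
    H.dissipation_intervalIntegrable
  refine (memLp_two_iff_integrable_sq
    (Real.continuous_sqrt.comp_aestronglyMeasurable (hi.1.const_add _))).2 ?_
  refine ((integrable_const (1 + stressBound P ρhi K)).add hi).congr ?_
  filter_upwards [ae_restrict_mem measurableSet_Ioo] with t ht
  rw [Real.sq_sqrt]
  · rfl
  have := H.dissipation_nonneg (Ioo_subset_Icc_self ht)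
  have := H.stressBound_nonneg
  positivity

theorem rate_memLp (H : BoundedFlow P N m κ M d ρlo ρhi K T z) :
    MemLp (fun t => rate P M d ρhi K (dissipation P N m z t)) 2 (volume.restrict (Ioo 0 T)) := by
  have h1 := H.sqrt_memLp.const_mul (√(stressConst M d) * (P.muF⁻¹ + P.muG⁻¹))
  have h2 : MemLp (fun _ : ℝ => P.pF ρhi / P.muF + (M * d)⁻¹ / P.muG) 2
    (volume.restrict (Ioo 0 T)) := memLp_const _
  unfold rate
  exact h2.add h1

/-- The bound of the integral of the rate for short times. -/
def _root_.BubblyFlow.rateBound (P : Params) (M d ρhi K : ℝ) : ℝ :=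
  (P.pF ρhi / P.muF + (M * d)⁻¹ / P.muG) +
    √(stressConst M d) * (P.muF⁻¹ + P.muG⁻¹) * (2 + stressBound P ρhi K + K)

theorem integral_rate_le (H : BoundedFlow P N m κ M d ρlo ρhi K T z) (hT1 : T ≤ 1) :
    ∫ t in (0 : ℝ)..T, rate P M d ρhi K (dissipation P N m z t) ≤
      √T * rateBound P M d ρhi K := by
  have hT := H.T_pos
  have hF := P.muF_pos
  have hG := P.muG_pos
  have hM := H.M_pos
  have hd := H.d_pos
  have hp := P.pF_nonneg H.hi_pos.le
  have hs := H.sqrt_memLp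
  have h1 := integral_sqrt_le hT hT1 H.stressBound_nonneg H.dissipation_intervalIntegrable
    (fun t ht => H.dissipation_nonneg ht) ((intervalIntegrable_iff_integrableOn_Ioo_of_le hT.le).2
      (hs.integrable (by norm_num))) H.integral_dissipation_le
  have h2 : T ≤ √T := Real.le_sqrt_of_sq_le (by nlinarith)
  have ha : 0 ≤ √(stressConst M d) * (P.muF⁻¹ + P.muG⁻¹) := by positivity
  have hb : 0 ≤ P.pF ρhi / P.muF + (M * d)⁻¹ / P.muG := by positivity
  simp only [rate, rateBound]
  rw [intervalIntegral.integral_add (by simp)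
    (((intervalIntegrable_iff_integrableOn_Ioo_of_le hT.le).2
      (hs.integrable (by norm_num))).const_mul _), intervalIntegral.integral_const_mul,
    intervalIntegral.integral_const, smul_eq_mul, sub_zero]
  have h3 := mul_le_mul_of_nonneg_left h1 ha
  have h4 := mul_le_mul_of_nonneg_right h2 hb
  linarith

end BoundedFlow

/-! ### The energy inequality -/

theorem HasH1Deriv.inv {a b : ℝ} {f g : ℝ → ℝ} (h : HasH1Deriv a b f g) (hab : a ≤ b)
    (hpos : ∀ x ∈ Icc a b, 0 < f x) :
    HasH1Deriv a b (fun x => (f x)⁻¹) (fun x => -(f x ^ 2)⁻¹ * g x) := by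
  have hc : ContinuousOn (fun x => (f x)⁻¹) (Icc a b) :=
    h.continuousOn.inv₀ fun x hx => (hpos x hx).ne'
  obtain ⟨C, hC⟩ := isCompact_Icc.exists_bound_of_continuousOn hc
  refine of_ac hab (absolutelyContinuousOnInterval_of_dist_le (C := C * C) (h.ac hab) ?_) ?_ ?_
  · intro x hx y hy
    rw [uIcc_of_le hab] at hx hy
    have hx0 := hpos x hx
    have hy0 := hpos y hy
    have e : (f x)⁻¹ - (f y)⁻¹ = (f x)⁻¹ * (f y)⁻¹ * (f y - f x) := by field_simp
    rw [Real.dist_eq, e, abs_mul, abs_mul, dist_comm, Real.dist_eq]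
    have c1 := hC x hx
    have c2 := hC y hy
    rw [Real.norm_eq_abs] at c1 c2
    gcongr
    exact (abs_nonneg _).trans c1
  · refine memLp_mul_of_continuousOn ?_ h.1
    exact ((h.continuousOn.pow 2).inv₀ fun x hx => (pow_pos (hpos x hx) 2).ne').neg
  · filter_upwards [h.ae_hasDerivAt] with x hx hx'
    have := (hx hx').inv (hpos x (Ioo_subset_Icc_self hx')).ne'
    have e : -g x / f x ^ 2 = -(f x ^ 2)⁻¹ * g x := by rw [div_eq_mul_inv]; ring
    rw [e] at this
    exact this

/-- The work of the bubble stress. -/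
theorem bubble_work_eq {T : ℝ} {R R' R'' : ℝ → ℝ} (h1 : HasH1Deriv 0 T R R')
    (h2 : HasH1Deriv 0 T R' R'') (hpos : ∀ t ∈ Icc 0 T, 0 < R t) (μ κ : ℝ) {t : ℝ}
    (ht : t ∈ Icc 0 T) :
    IntervalIntegrable (fun s => -(2 * (μ * (R' s / R s) - κ / R s) * R'' s)) volume 0 t ∧
    ∫ s in (0 : ℝ)..t, -(2 * (μ * (R' s / R s) - κ / R s) * R'' s) =
      (-μ * (R' t ^ 2 / R t) + 2 * κ * (R' t / R t)) -
        (-μ * (R' 0 ^ 2 / R 0) + 2 * κ * (R' 0 / R 0)) -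
        ∫ s in (0 : ℝ)..t, (μ * (R' s / R s) - 2 * (κ / R s)) * (R' s ^ 2 / R s) := by
  have hT : (0 : ℝ) ≤ T := ht.1.trans ht.2
  have q := h2.mul (h1.inv hT hpos) hT
  have F := ((h2.mul q hT).const_mul (-μ)).add (q.const_mul (2 * κ))
  have Fi := F.intervalIntegrable_sub ⟨le_rfl, hT⟩ ht
  have Fs := F.sub_eq ⟨le_rfl, hT⟩ ht
  have ci : IntervalIntegrable
      (fun s => (μ * (R' s / R s) - 2 * (κ / R s)) * (R' s ^ 2 / R s)) volume 0 t := by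
    refine ContinuousOn.intervalIntegrable ?_
    rw [uIcc_of_le ht.1]
    have c1 := h1.continuousOn.mono (Icc_subset_Icc_right ht.2)
    have c2 := h2.continuousOn.mono (Icc_subset_Icc_right ht.2)
    have c0 : ∀ s ∈ Icc 0 t, R s ≠ 0 := fun s hs => (hpos s ⟨hs.1, hs.2.trans ht.2⟩).ne'
    exact ((continuousOn_const.mul (c2.div c1 c0)).sub
      (continuousOn_const.mul (continuousOn_const.div c1 c0))).mul ((c2.pow 2).div c1 c0)
  -- The derivative of -μR'²/R + 2κR'/R, from which the terms without R'' are subtracted.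
  have e : ∀ s ∈ uIcc 0 t, -(2 * (μ * (R' s / R s) - κ / R s) * R'' s) =
      (-μ * (R'' s * (R' s * (R s)⁻¹) + R' s * (R'' s * (R s)⁻¹ +
        R' s * (-(R s ^ 2)⁻¹ * R' s))) + 2 * κ * (R'' s * (R s)⁻¹ +
        R' s * (-(R s ^ 2)⁻¹ * R' s))) -
        (μ * (R' s / R s) - 2 * (κ / R s)) * (R' s ^ 2 / R s) := by
    intro s hs
    rw [uIcc_of_le ht.1] at hs
    have := (hpos s ⟨hs.1, hs.2.trans ht.2⟩).ne'
    field_simp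
    ring
  constructor
  · exact (Fi.sub ci).congr fun s hs => (e s (uIoc_subset_uIcc hs)).symm
  · rw [intervalIntegral.integral_congr e, intervalIntegral.integral_sub Fi ci, ← Fs]
    have r1 := (hpos t ht).ne'
    have r2 := (hpos 0 ⟨le_rfl, hT⟩).ne'
    congr 1
    field_simp

/-- The term 2κR'/R is indefinite and is absorbed by Young's inequality into half of μR'²/R. The
remainder is the energy R'²/R times a coefficient that the rate controls. -/
theorem bubble_work_le {T : ℝ} {R R' R'' : ℝ → ℝ} (h1 : HasH1Deriv 0 T R R')
    (h2 : HasH1Deriv 0 T R' R'') (hpos : ∀ t ∈ Icc 0 T, 0 < R t) {μ κ c : ℝ} (hμ : 0 < μ)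
    {w : ℝ → ℝ} (hw : IntervalIntegrable w volume 0 T)
    (hR : ∀ᵐ t ∂(volume.restrict (Ioo 0 T)), |R' t| ≤ w t * R t)
    (hκ : ∀ t ∈ Ioo 0 T, κ / R t ≤ c) {t : ℝ} (ht : t ∈ Icc 0 T) :
    IntervalIntegrable (fun s => (μ * w s + 2 * c) * (R' s ^ 2 / R s)) volume 0 t ∧
    ∫ s in (0 : ℝ)..t, -(2 * (μ * (R' s / R s) - κ / R s) * R'' s) ≤
      -(μ / 2) * (R' t ^ 2 / R t) + 3 / 2 * μ * (R' 0 ^ 2 / R 0) +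
        2 / μ * (κ ^ 2 / R t + κ ^ 2 / R 0) +
        ∫ s in (0 : ℝ)..t, (μ * w s + 2 * c) * (R' s ^ 2 / R s) := by
  have hT : (0 : ℝ) ≤ T := ht.1.trans ht.2
  have c1 := h1.continuousOn.mono (Icc_subset_Icc_right ht.2)
  have c2 := h2.continuousOn.mono (Icc_subset_Icc_right ht.2)
  have c0 : ∀ s ∈ Icc 0 t, R s ≠ 0 := fun s hs => (hpos s ⟨hs.1, hs.2.trans ht.2⟩).ne'
  have hw' : IntervalIntegrable w volume 0 t := hw.mono_set (by
    rw [uIcc_of_le hT, uIcc_of_le ht.1]; exact Icc_subset_Icc_right ht.2)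
  have i1 : IntervalIntegrable (fun s => (μ * w s + 2 * c) * (R' s ^ 2 / R s)) volume 0 t := by
    refine ((hw'.const_mul μ).add (by simp)).mul_continuousOn ?_
    rw [uIcc_of_le ht.1]
    exact (c2.pow 2).div c1 c0
  have i2 : IntervalIntegrable
      (fun s => (μ * (R' s / R s) - 2 * (κ / R s)) * (R' s ^ 2 / R s)) volume 0 t := by
    refine ContinuousOn.intervalIntegrable ?_
    rw [uIcc_of_le ht.1]
    exact ((continuousOn_const.mul (c2.div c1 c0)).sub
      (continuousOn_const.mul (continuousOn_const.div c1 c0))).mul ((c2.pow 2).div c1 c0)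
  refine ⟨i1, ?_⟩
  rw [(bubble_work_eq h1 h2 hpos μ κ ht).2]
  have h3 : -∫ s in (0 : ℝ)..t, (μ * (R' s / R s) - 2 * (κ / R s)) * (R' s ^ 2 / R s) ≤
      ∫ s in (0 : ℝ)..t, (μ * w s + 2 * c) * (R' s ^ 2 / R s) := by
    rw [← intervalIntegral.integral_neg]
    refine intervalIntegral.integral_mono_ae_restrict ht.1 i2.neg i1 ?_
    rw [← restrict_Ioo_eq_restrict_Icc]
    have hR' := ae_mono (Measure.restrict_mono (Ioo_subset_Ioo_right ht.2)
      (le_refl (volume : Measure ℝ))) hR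
    filter_upwards [hR', ae_restrict_mem measurableSet_Ioo] with s hs hs'
    have hs2 : s ∈ Ioo 0 T := ⟨hs'.1, hs'.2.trans_le ht.2⟩
    have r0 := hpos s (Ioo_subset_Icc_self hs2)
    have k1 := hκ s hs2
    have k2 : |R' s / R s| ≤ w s := by rwa [abs_div, abs_of_pos r0, div_le_iff₀ r0]
    have k3 := neg_le_of_abs_le k2
    have k4 := mul_le_mul_of_nonneg_left k3 hμ.le
    have k5 : 0 ≤ R' s ^ 2 / R s := by positivity
    have := mul_le_mul_of_nonneg_right
      (by linarith : -(μ * (R' s / R s) - 2 * (κ / R s)) ≤ μ * w s + 2 * c) k5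
    linarith
  have h4 : ∀ s ∈ Icc 0 T, |2 * κ * (R' s / R s)| ≤
      μ / 2 * (R' s ^ 2 / R s) + 2 / μ * (κ ^ 2 / R s) := by
    intro s hs
    have r0 := hpos s hs
    have e1 : μ / 2 * (R' s ^ 2 / R s) + 2 / μ * (κ ^ 2 / R s) - 2 * κ * (R' s / R s) =
        (μ * R' s - 2 * κ) ^ 2 / (2 * μ * R s) := by field_simp; ring
    have e2 : μ / 2 * (R' s ^ 2 / R s) + 2 / μ * (κ ^ 2 / R s) + 2 * κ * (R' s / R s) =
        (μ * R' s + 2 * κ) ^ 2 / (2 * μ * R s) := by field_simp; ring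
    have p1 : 0 ≤ (μ * R' s - 2 * κ) ^ 2 / (2 * μ * R s) := by positivity
    have p2 : 0 ≤ (μ * R' s + 2 * κ) ^ 2 / (2 * μ * R s) := by positivity
    rw [abs_le]
    constructor <;> linarith
  have h5 := (abs_le.1 (h4 t ht)).2
  have h6 := (abs_le.1 (h4 0 ⟨le_rfl, hT⟩)).1
  linarith

/-- Regroups the end point terms from gaps to bubbles; the walls contribute nothing. -/
theorem sum_boundary (N : ℕ) (f g : ℕ → ℝ) (hg : g 0 = 0) (hf : f (N + 1) = 0) :
    ∑ k ∈ Finset.range (N + 1), (f (k + 1) - g k) = ∑ k ∈ Finset.Icc 1 N, (f k - g k) := by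
  have h1 : ∀ n, ∑ k ∈ Finset.range n, f (k + 1) = ∑ k ∈ Finset.Icc 1 n, f k := by
    intro n
    induction n with
    | zero => simp
    | succ n ih => rw [Finset.sum_range_succ, ih, Finset.sum_Icc_succ_top (by omega)]
  have h2 : ∑ k ∈ Finset.range (N + 1), g k = ∑ k ∈ Finset.Icc 1 N, g k := by
    have : ∀ n, ∑ k ∈ Finset.range (n + 1), g k = ∑ k ∈ Finset.Icc 1 n, g k := by
      intro n
      induction n with
      | zero => simp [hg]
      | succ n ih => rw [Finset.sum_range_succ, ih, Finset.sum_Icc_succ_top (by omega)]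
    exact this N
  rw [Finset.sum_sub_distrib, Finset.sum_sub_distrib, h1, h2, Finset.sum_Icc_succ_top (by omega),
    hf, add_zero]

namespace BoundedFlow

variable {P : Params} {N : ℕ} {m κ : ℕ → ℝ} {M d ρlo ρhi K T : ℝ} {z : Flow}

theorem le_R (H : BoundedFlow P N m κ M d ρlo ρhi K T z) {t : ℝ} (ht : t ∈ Icc 0 T) {k : ℕ}
    (hk : k ∈ Finset.Icc 1 N) : d ≤ N * z.R k t := by
  rw [← closure_Ioo H.T_pos.ne] at ht
  refine closure_minimal (s := Ioo 0 T) (t := {t ∈ Icc 0 T | d ≤ N * z.R k t})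
    (fun s hs => ⟨Ioo_subset_Icc_self hs, (H.bounds.q1 s hs k hk).1⟩) ?_ ht |>.2
  exact isClosed_Icc.isClosed_le continuousOn_const
    (continuousOn_const.mul (H.sol.R_h1 k hk).continuousOn)

/-- Each of the N terms is of order 1/N, since κ_k and R_k both are. -/
theorem sum_kappa_le (H : BoundedFlow P N m κ M d ρlo ρhi K T z) {t : ℝ} (ht : t ∈ Icc 0 T) :
    ∑ k ∈ Finset.Icc 1 N, κ k ^ 2 / z.R k t ≤ (M ^ 2 * d)⁻¹ := by
  have hN := H.N_pos
  have hM := H.M_pos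
  have hd := H.d_pos
  have h1 : ∀ k ∈ Finset.Icc 1 N, κ k ^ 2 / z.R k t ≤ (M ^ 2 * d)⁻¹ / N := by
    intro k hk
    have hR := H.sol.R_pos k hk t ht
    have h2 := pow_le_pow_left₀ (mul_nonneg hN.le (H.kappa_pos hk).le) (H.kappa_scaling k hk).2 2
    have h3 := H.le_R ht hk
    have e : κ k ^ 2 / z.R k t = (N * κ k) ^ 2 / (N * z.R k t) / N := by field_simp
    rw [e]
    gcongr
    calc (N * κ k) ^ 2 / (N * z.R k t) ≤ M⁻¹ ^ 2 / d := by gcongr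
      _ = (M ^ 2 * d)⁻¹ := by field_simp
  refine (Finset.sum_le_sum h1).trans ?_
  rw [Finset.sum_const, Nat.card_Icc, nsmul_eq_mul, Nat.add_sub_cancel, mul_div_cancel₀ _ hN.ne']

theorem rate_intervalIntegrable (H : BoundedFlow P N m κ M d ρlo ρhi K T z) :
    IntervalIntegrable (fun t => rate P M d ρhi K (dissipation P N m z t)) volume 0 T :=
  (intervalIntegrable_iff_integrableOn_Ioo_of_le H.T_pos.le).2
    (H.rate_memLp.integrable (by norm_num))

theorem sub_left {f : ℝ → ℝ} {t : ℝ} (ht : t ∈ Icc 0 T) (hf : IntervalIntegrable f volume 0 T) :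
    IntervalIntegrable f volume 0 t := hf.mono_set (by
  rw [uIcc_of_le (ht.1.trans ht.2), uIcc_of_le ht.1]; exact Icc_subset_Icc_right ht.2)

theorem integral_rate_mono (H : BoundedFlow P N m κ M d ρlo ρhi K T z) {t : ℝ}
    (ht : t ∈ Icc 0 T) : ∫ s in (0 : ℝ)..t, rate P M d ρhi K (dissipation P N m z s) ≤
      ∫ s in (0 : ℝ)..T, rate P M d ρhi K (dissipation P N m z s) :=
  intervalIntegral.integral_mono_interval le_rfl ht.1 ht.2 (ae_of_all _ fun _ => H.rate_nonneg _)
    H.rate_intervalIntegrable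

/-- The work of the stresses at the interfaces. -/
theorem boundary_work_le (H : BoundedFlow P N m κ M d ρlo ρhi K T z) {t : ℝ} (ht : t ∈ Icc 0 T) :
    ∑ k ∈ Finset.range (N + 1), ∫ s in (0 : ℝ)..t, (z.sigF P s (z.xm N (k + 1) s) *
      z.accM N (k + 1) s - z.sigF P s (z.xp k s) * z.accP k s) ≤
    -(P.muG / 2) * (∑ k ∈ Finset.Icc 1 N, z.dR k t ^ 2 / z.R k t) +
      3 / 2 * P.muG * (∑ k ∈ Finset.Icc 1 N, z.dR k 0 ^ 2 / z.R k 0) +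
      4 / P.muG * (M ^ 2 * d)⁻¹ -
      1 / 3 * (∫ s in (0 : ℝ)..t, ∑ k ∈ Finset.Icc 1 N, m k * (z.ddR k s ^ 2 + z.ddc k s ^ 2)) +
      K * ((∫ s in (0 : ℝ)..T, rate P M d ρhi K (dissipation P N m z s)) +
        2 * (M * d)⁻¹ / P.muG * T) := by
  have hT := H.T_pos
  have hG := P.muG_pos
  have hM := H.M_pos
  have hd := H.d_pos
  have hi : ∀ k ∈ Finset.range (N + 1), IntervalIntegrable (fun s =>
      z.sigF P s (z.xm N (k + 1) s) * z.accM N (k + 1) s - z.sigF P s (z.xp k s) * z.accP k s)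
      volume 0 t := by
    intro k hk
    have G := H.gapFlow (Nat.lt_succ_iff.1 (Finset.mem_range.1 hk))
    have tr := G.stress_traces
    simp only [Flow.xp_add_gap] at tr
    exact sub_left ht ((intervalIntegrable_iff_integrableOn_Ioo_of_le hT.le).2
      ((tr.2.integrable_mul G.right_acc.1).sub (tr.1.integrable_mul G.left_acc.1)))
  have hacc : IntervalIntegrable (fun s => ∑ k ∈ Finset.Icc 1 N,
      m k * (1 / 3 * z.ddR k s ^ 2 + z.ddc k s ^ 2)) volume 0 t :=
    intervalIntegrable_sum _ fun k hk => (sub_left ht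
      ((((H.sol.dR_h1 k hk).sq_intervalIntegrable hT.le).const_mul _).add
        ((H.sol.dc_h1 k hk).sq_intervalIntegrable hT.le))).const_mul _
  have hacc' : IntervalIntegrable (fun s => ∑ k ∈ Finset.Icc 1 N,
      m k * (z.ddR k s ^ 2 + z.ddc k s ^ 2)) volume 0 t :=
    intervalIntegrable_sum _ fun k hk => (sub_left ht
      (((H.sol.dR_h1 k hk).sq_intervalIntegrable hT.le).add
        ((H.sol.dc_h1 k hk).sq_intervalIntegrable hT.le))).const_mul _
  have hb := fun k hk => bubble_work_eq (H.sol.R_h1 k hk) (H.sol.dR_h1 k hk) (H.sol.R_pos k hk)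
    P.muG (κ k) ht
  have hbs : IntervalIntegrable (fun s => ∑ k ∈ Finset.Icc 1 N,
      -(2 * (P.muG * (z.dR k s / z.R k s) - κ k / z.R k s) * z.ddR k s)) volume 0 t :=
    intervalIntegrable_sum _ fun k hk => (hb k hk).1
  rw [← intervalIntegral.integral_finsetSum hi]
  -- With accelerations c'' ± R'' of the interfaces, a bubble receives -(jump of Σ_f)c'' - (sum of
  -- Σ_f)R''. Newton's laws make this -m c''² - (m/3)R''² - 2Σ_k R''.
  have e1 : ∫ s in (0 : ℝ)..t, ∑ k ∈ Finset.range (N + 1), (z.sigF P s (z.xm N (k + 1) s) *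
      z.accM N (k + 1) s - z.sigF P s (z.xp k s) * z.accP k s) =
      ∫ s in (0 : ℝ)..t, ((∑ k ∈ Finset.Icc 1 N,
        -(2 * (P.muG * (z.dR k s / z.R k s) - κ k / z.R k s) * z.ddR k s)) -
        ∑ k ∈ Finset.Icc 1 N, m k * (1 / 3 * z.ddR k s ^ 2 + z.ddc k s ^ 2)) := by
    refine intervalIntegral.integral_congr_ae_restrict ?_
    rw [uIoc_of_le ht.1, ← restrict_Ioo_eq_restrict_Ioc]
    have hpr := ae_mono (Measure.restrict_mono (Ioo_subset_Ioo_right ht.2)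
      (le_refl (volume : Measure ℝ))) H.profile
    filter_upwards [hpr] with s hs
    rw [sum_boundary N (fun k => z.sigF P s (z.xm N k s) * z.accM N k s)
      (fun k => z.sigF P s (z.xp k s) * z.accP k s) (by simp [Flow.accP]) (by simp [Flow.accM]),
      ← Finset.sum_sub_distrib]
    refine Finset.sum_congr rfl fun k hk => ?_
    have hk' := Finset.mem_Icc.1 hk
    have n1 := hs.newton_c k hk
    have n2 := hs.newton_r k hk
    simp only [Flow.accP, Flow.accM, show k ≠ 0 by omega, show k ≠ N + 1 by omega, if_false,
      Flow.sigB] at n1 n2 ⊢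
    linear_combination (z.ddc k s) * n1 + (z.ddR k s) * n2
  rw [e1, intervalIntegral.integral_sub hbs hacc, intervalIntegral.integral_finsetSum
    fun k hk => (hb k hk).1]
  have e2 : 1 / 3 * (∫ s in (0 : ℝ)..t, ∑ k ∈ Finset.Icc 1 N,
      m k * (z.ddR k s ^ 2 + z.ddc k s ^ 2)) ≤
      ∫ s in (0 : ℝ)..t, ∑ k ∈ Finset.Icc 1 N, m k * (1 / 3 * z.ddR k s ^ 2 + z.ddc k s ^ 2) := by
    rw [← intervalIntegral.integral_const_mul]
    refine intervalIntegral.integral_mono_on ht.1 (hacc'.const_mul _) hacc fun s _ => ?_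
    rw [Finset.mul_sum]
    refine Finset.sum_le_sum fun k hk => ?_
    have := mul_nonneg (H.m_pos hk).le (sq_nonneg (z.ddc k s))
    linarith
  have hw := H.rate_intervalIntegrable
  set w := fun s => rate P M d ρhi K (dissipation P N m z s) with hwdef
  have hB : ∀ k ∈ Finset.Icc 1 N, _ := fun k hk =>
    bubble_work_le (H.sol.R_h1 k hk) (H.sol.dR_h1 k hk) (H.sol.R_pos k hk) (κ := κ k)
      (c := (M * d)⁻¹) hG hw (by filter_upwards [H.rates_le] with s hs using hs.2 k hk)
      (fun s hs => H.kappa_div_le hs hk) ht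
  have h3 := Finset.sum_le_sum fun k hk => (hB k hk).2
  refine (sub_le_sub h3 e2).trans ?_
  rw [Finset.sum_add_distrib, Finset.sum_add_distrib, Finset.sum_add_distrib, ← Finset.mul_sum,
    ← Finset.mul_sum, ← Finset.mul_sum, Finset.sum_add_distrib,
    ← intervalIntegral.integral_finsetSum fun k hk => (hB k hk).1]
  have k1 := H.sum_kappa_le ht
  have k2 := H.sum_kappa_le (t := 0) ⟨le_rfl, hT.le⟩
  have k3 := mul_le_mul_of_nonneg_left (add_le_add k1 k2) (by positivity : 0 ≤ 2 / P.muG)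
  -- Instead of a Gronwall argument, the energy in the remainder is replaced by its bound from (Q4).
  -- The price is a factor K, compensated later by the short time.
  have h4 : ∫ s in (0 : ℝ)..t, ∑ k ∈ Finset.Icc 1 N,
      (P.muG * w s + 2 * (M * d)⁻¹) * (z.dR k s ^ 2 / z.R k s) ≤
      ∫ s in (0 : ℝ)..t, (P.muG * w s + 2 * (M * d)⁻¹) * (K / P.muG) := by
    refine intervalIntegral.integral_mono_ae_restrict ht.1
      (intervalIntegrable_sum _ fun k hk => (hB k hk).1)
      ((((sub_left ht hw).const_mul _).add (by simp)).mul_const _) ?_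
    rw [← restrict_Ioo_eq_restrict_Icc]
    filter_upwards [ae_restrict_mem measurableSet_Ioo] with s hs
    rw [← Finset.mul_sum]
    have h0 : 0 ≤ w s := H.rate_nonneg _
    exact mul_le_mul_of_nonneg_left (H.energies_le ⟨hs.1, hs.2.trans_le ht.2⟩).2 (by positivity)
  rw [intervalIntegral.integral_mul_const, intervalIntegral.integral_add
    ((sub_left ht hw).const_mul _) (by simp), intervalIntegral.integral_const_mul,
    intervalIntegral.integral_const, smul_eq_mul, sub_zero] at h4
  have h5 : ∫ s in (0 : ℝ)..t, w s ≤ ∫ s in (0 : ℝ)..T, w s := H.integral_rate_mono ht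
  have h6 : (P.muG * (∫ s in (0 : ℝ)..t, w s) + t * (2 * (M * d)⁻¹)) * (K / P.muG) ≤
      K * ((∫ s in (0 : ℝ)..T, w s) + 2 * (M * d)⁻¹ / P.muG * T) := by
    have e : K * ((∫ s in (0 : ℝ)..T, w s) + 2 * (M * d)⁻¹ / P.muG * T) =
      (P.muG * (∫ s in (0 : ℝ)..T, w s) + T * (2 * (M * d)⁻¹)) * (K / P.muG) := by
      field_simp
    rw [e]
    refine mul_le_mul_of_nonneg_right (add_le_add ?_ ?_) (div_nonneg H.K_nonneg hG.le)
    · exact mul_le_mul_of_nonneg_left h5 hG.le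
    · exact mul_le_mul_of_nonneg_right ht.2 (by positivity)
  have e7 : 2 / P.muG * ((M ^ 2 * d)⁻¹ + (M ^ 2 * d)⁻¹) = 4 / P.muG * (M ^ 2 * d)⁻¹ := by ring
  linarith

end BoundedFlow

/-- The factor of the dissipation in the energy inequality. -/
def dissConst (ρhi : ℝ) : ℝ := min (1 / ρhi) (1 / 3)

/-- The part of the energy bound that depends only on the physical constants. -/
def baseConst (P : Params) (M d ρhi : ℝ) : ℝ :=
  P.pF ρhi ^ 2 / P.muF * 4 + 4 / P.muG * (M ^ 2 * d)⁻¹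

/-- The growth rate in the energy bound. -/
def growthConst (P : Params) (M d ρhi : ℝ) : ℝ :=
  2 * (P.gamF * P.pF ρhi) / P.muF + 2 * (M * d)⁻¹ / P.muG

namespace BoundedFlow

variable {P : Params} {N : ℕ} {m κ : ℕ → ℝ} {M d ρlo ρhi K T : ℝ} {z : Flow}

theorem sum_gap_le (H : BoundedFlow P N m κ M d ρlo ρhi K T z) {t : ℝ} (ht : t ∈ Icc 0 T) :
    ∑ k ∈ Finset.range (N + 1), z.gap N k t ≤ 2 := by
  have h3 := (H.sol.chain ht).sum_length
  have h4 : 0 ≤ ∑ k ∈ Finset.Icc 1 N, (z.xp k t - z.xm N k t) :=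
    Finset.sum_nonneg fun k hk => (sub_pos.2 ((H.sol.chain ht).bubble_pos k hk)).le
  simp only [Flow.gap_eq]
  linarith

theorem gap_energy_intervalIntegrable (H : BoundedFlow P N m κ M d ρlo ρhi K T z) {k : ℕ}
    (hk : k ≤ N) : IntervalIntegrable (fun t => ∫ x in (z.xp k t)..(z.xm N (k + 1) t),
      z.u_x t x ^ 2) volume 0 T := by
  have := (H.gapFlow hk).energy_intervalIntegrable
  simpa only [Flow.xp_add_gap] using this

theorem gap_energy_le (H : BoundedFlow P N m κ M d ρlo ρhi K T z) {t : ℝ} (ht : t ∈ Ioo 0 T)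
    {k : ℕ} (hk : k ≤ N) :
    ∫ x in (z.xp k t)..(z.xm N (k + 1) t), z.u_x t x ^ 2 ≤ 2 * K / P.muF := by
  have := (H.gapFlow hk).energy_bdd t ht
  simpa only [Flow.xp_add_gap] using this

theorem rate_mul_energy_intervalIntegrable (H : BoundedFlow P N m κ M d ρlo ρhi K T z) {k : ℕ}
    (hk : k ≤ N) (a b : ℝ) : IntervalIntegrable
      (fun t => (a + b * rate P M d ρhi K (dissipation P N m z t)) *
        ∫ x in (z.xp k t)..(z.xm N (k + 1) t), z.u_x t x ^ 2) volume 0 T := by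
  have h1 : IntervalIntegrable (fun t => a + b * rate P M d ρhi K (dissipation P N m z t))
    volume 0 T := IntervalIntegrable.add (by simp) (H.rate_intervalIntegrable.const_mul b)
  have h2 := H.gap_energy_intervalIntegrable hk
  rw [intervalIntegrable_iff_integrableOn_Ioo_of_le H.T_pos.le] at h1 h2 ⊢
  refine Integrable.mul_bdd (c := 2 * K / P.muF) h1 h2.1 ?_
  filter_upwards [ae_restrict_mem measurableSet_Ioo] with t ht
  rw [Real.norm_of_nonneg (H.sol.gap_energy_nonneg (Ioo_subset_Icc_self ht) hk _)]
  exact H.gap_energy_le ht hk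

/-- The gap inequalities are summed and the boundary work inserted. Half of each part of the energy
was spent on absorbing pressure terms, whence 1/2 at time t and 3/2 at time 0. On the right K occurs
only with the integral of the rate or with T, both small for short times. -/
theorem energy_le (H : BoundedFlow P N m κ M d ρlo ρhi K T z) :
    ∀ᵐ t ∂(volume.restrict (Ioo 0 T)),
      h1Energy P N z t / 2 + dissConst ρhi * (∫ s in (0 : ℝ)..t, dissipation P N m z s) ≤
        3 / 2 * h1Energy P N z 0 + baseConst P M d ρhi +
          K * (2 * (∫ s in (0 : ℝ)..T, rate P M d ρhi K (dissipation P N m z s)) +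
            growthConst P M d ρhi * T) := by
  have hT := H.T_pos
  have hF := P.muF_pos
  have hG := P.muG_pos
  have hM := H.M_pos
  have hd := H.d_pos
  have hhi := H.hi_pos
  have hp := P.pF_nonneg H.hi_pos.le
  have hgam : 0 < P.gamF := zero_lt_one.trans P.one_lt_gamF
  set w := fun s => rate P M d ρhi K (dissipation P N m z s) with hwdef
  set A := P.gamF * P.pF ρhi with hA
  have hA0 : 0 ≤ A := by positivity
  have hk := fun (k : ℕ) (hk : k ∈ Finset.range (N + 1)) =>
    (H.gapFlow (Nat.lt_succ_iff.1 (Finset.mem_range.1 hk))).energy_le H.rate_memLp (by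
      simp only [Flow.xp_add_gap]
      filter_upwards [H.rates_le] with t ht
      exact ht.1 k (Nat.lt_succ_iff.1 (Finset.mem_range.1 hk)))
  simp only [Flow.xp_add_gap] at hk
  filter_upwards [(eventually_all_finset _).2 hk, ae_restrict_mem measurableSet_Ioo] with t h ht
  have ht' := Ioo_subset_Icc_self ht
  have hs := Finset.sum_le_sum h
  simp only [Finset.sum_add_distrib, ← Finset.mul_sum] at hs
  have hb := H.boundary_work_le ht'
  have hle : ∀ k ∈ Finset.range (N + 1), k ≤ N := fun k hk =>
    Nat.lt_succ_iff.1 (Finset.mem_range.1 hk)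
  -- the dissipation
  have d1 := fun k hk => sub_left ht' (H.gap_dissipation_intervalIntegrable (hle k hk))
  have d2 : IntervalIntegrable (fun s => ∑ k ∈ Finset.Icc 1 N,
      m k * (z.ddR k s ^ 2 + z.ddc k s ^ 2)) volume 0 t :=
    intervalIntegrable_sum _ fun k hk => (sub_left ht'
      (((H.sol.dR_h1 k hk).sq_intervalIntegrable hT.le).add
        ((H.sol.dc_h1 k hk).sq_intervalIntegrable hT.le))).const_mul _
  rw [← intervalIntegral.integral_finsetSum d1] at hs
  have d3 : ∫ s in (0 : ℝ)..t, dissipation P N m z s =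
      (∫ s in (0 : ℝ)..t, ∑ k ∈ Finset.range (N + 1), ∫ x in (z.xp k s)..(z.xm N (k + 1) s),
        stressX P z.u_xx z.rho z.rho_x s x ^ 2) +
      ∫ s in (0 : ℝ)..t, ∑ k ∈ Finset.Icc 1 N, m k * (z.ddR k s ^ 2 + z.ddc k s ^ 2) := by
    rw [← intervalIntegral.integral_add (intervalIntegrable_sum _ d1) d2]
    rfl
  have d4 : 0 ≤ ∫ s in (0 : ℝ)..t, ∑ k ∈ Finset.range (N + 1),
      ∫ x in (z.xp k s)..(z.xm N (k + 1) s), stressX P z.u_xx z.rho z.rho_x s x ^ 2 :=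
    intervalIntegral.integral_nonneg ht'.1 fun s hs => Finset.sum_nonneg fun k hk =>
      H.sol.gap_energy_nonneg ⟨hs.1, hs.2.trans ht'.2⟩ (hle k hk) _
  have d5 : 0 ≤ ∫ s in (0 : ℝ)..t, ∑ k ∈ Finset.Icc 1 N,
      m k * (z.ddR k s ^ 2 + z.ddc k s ^ 2) :=
    intervalIntegral.integral_nonneg ht'.1 fun s hs => Finset.sum_nonneg fun k hk =>
      mul_nonneg (H.m_pos hk).le (by positivity)
  have d6 : dissConst ρhi * (∫ s in (0 : ℝ)..t, dissipation P N m z s) ≤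
      1 / ρhi * (∫ s in (0 : ℝ)..t, ∑ k ∈ Finset.range (N + 1),
        ∫ x in (z.xp k s)..(z.xm N (k + 1) s), stressX P z.u_xx z.rho z.rho_x s x ^ 2) +
      1 / 3 * ∫ s in (0 : ℝ)..t, ∑ k ∈ Finset.Icc 1 N,
        m k * (z.ddR k s ^ 2 + z.ddc k s ^ 2) := by
    rw [d3, mul_add]
    exact add_le_add (mul_le_mul_of_nonneg_right (min_le_left _ _) d4)
      (mul_le_mul_of_nonneg_right (min_le_right _ _) d5)
  -- the growth
  have w1 := fun k hk => sub_left ht' (H.rate_mul_energy_intervalIntegrable (hle k hk) A (P.muF / 2))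
  have w2 : ∑ k ∈ Finset.range (N + 1), ∫ s in (0 : ℝ)..t, (A + P.muF / 2 * w s) *
      (∫ x in (z.xp k s)..(z.xm N (k + 1) s), z.u_x s x ^ 2) ≤
      K * ((∫ s in (0 : ℝ)..T, w s) + 2 * A / P.muF * T) := by
    rw [← intervalIntegral.integral_finsetSum w1]
    have w3 : ∫ s in (0 : ℝ)..t, ∑ k ∈ Finset.range (N + 1), (A + P.muF / 2 * w s) *
        (∫ x in (z.xp k s)..(z.xm N (k + 1) s), z.u_x s x ^ 2) ≤
        ∫ s in (0 : ℝ)..t, (A + P.muF / 2 * w s) * (2 * K / P.muF) := by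
      refine intervalIntegral.integral_mono_ae_restrict ht'.1 (intervalIntegrable_sum _ w1)
        ((IntervalIntegrable.add (by simp)
          ((sub_left ht' H.rate_intervalIntegrable).const_mul _)).mul_const _) ?_
      rw [← restrict_Ioo_eq_restrict_Icc]
      filter_upwards [ae_restrict_mem measurableSet_Ioo] with s hs
      have h0 : 0 ≤ w s := H.rate_nonneg _
      rw [← Finset.mul_sum]
      exact mul_le_mul_of_nonneg_left (H.energies_le ⟨hs.1, hs.2.trans_le ht'.2⟩).1 (by positivity)
    rw [intervalIntegral.integral_mul_const, intervalIntegral.integral_add (by simp)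
      ((sub_left ht' H.rate_intervalIntegrable).const_mul _), intervalIntegral.integral_const_mul (P.muF / 2),
      intervalIntegral.integral_const, smul_eq_mul, sub_zero] at w3
    refine w3.trans ?_
    have e : K * ((∫ s in (0 : ℝ)..T, w s) + 2 * A / P.muF * T) =
        (T * A + P.muF / 2 * ∫ s in (0 : ℝ)..T, w s) * (2 * K / P.muF) := by
      field_simp
      ring
    rw [e]
    refine mul_le_mul_of_nonneg_right (add_le_add ?_ ?_)
      (div_nonneg (mul_nonneg zero_le_two H.K_nonneg) hF.le)
    · exact mul_le_mul_of_nonneg_right ht'.2 hA0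
    · exact mul_le_mul_of_nonneg_left (H.integral_rate_mono ht') (by positivity)
  -- the pressure
  have p1 : P.pF ρhi ^ 2 / P.muF * ((∑ k ∈ Finset.range (N + 1), z.gap N k t) +
      ∑ k ∈ Finset.range (N + 1), z.gap N k 0) ≤ P.pF ρhi ^ 2 / P.muF * 4 :=
    mul_le_mul_of_nonneg_left
      (by linarith [H.sum_gap_le ht', H.sum_gap_le (t := 0) ⟨le_rfl, hT.le⟩]) (by positivity)
  have E1 := H.sol.h1Energy_eq ht'
  have E0 := H.sol.h1Energy_eq (t := 0) ⟨le_rfl, hT.le⟩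
  have f0 : 0 ≤ ∑ k ∈ Finset.range (N + 1), ∫ x in (z.xp k 0)..(z.xm N (k + 1) 0),
      z.u_x 0 x ^ 2 := Finset.sum_nonneg fun k hk =>
    H.sol.gap_energy_nonneg ⟨le_rfl, hT.le⟩ (hle k hk) _
  rw [E1, E0, baseConst, growthConst, ← hA]
  change _ ≤ _ + (∑ k ∈ Finset.range (N + 1), ∫ s in (0 : ℝ)..t,
    (z.sigF P s (z.xm N (k + 1) s) * z.accM N (k + 1) s - z.sigF P s (z.xp k s) * z.accP k s)) +
    ∑ k ∈ Finset.range (N + 1), ∫ s in (0 : ℝ)..t, (A + P.muF / 2 * w s) *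
      (∫ x in (z.xp k s)..(z.xm N (k + 1) s), z.u_x s x ^ 2) at hs
  linarith

end BoundedFlow

/-! ### All times -/

/-- Evaluation at the maximum replaces Gronwall: max f ≤ f(0) + η max f, so max f ≤ 2f(0) when η ≤
1/2. -/
theorem HasH1Deriv.abs_sub_le_of_rate {T η : ℝ} {f f' w : ℝ → ℝ} (hT : 0 ≤ T)
    (h : HasH1Deriv 0 T f f') (hw : IntervalIntegrable w volume 0 T) (hw0 : ∀ t, 0 ≤ w t)
    (hf : ∀ᵐ t ∂(volume.restrict (Ioo 0 T)), |f' t| ≤ w t * f t)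
    (hη : ∫ t in (0 : ℝ)..T, w t ≤ η) (hη1 : η ≤ 1 / 2) (hpos : ∀ t ∈ Icc 0 T, 0 ≤ f t) {t : ℝ}
    (ht : t ∈ Icc 0 T) : |f t - f 0| ≤ 2 * η * f 0 := by
  have h0 : (0 : ℝ) ∈ Icc 0 T := ⟨le_rfl, hT⟩
  obtain ⟨r, hr, hmax⟩ := isCompact_Icc.exists_isMaxOn ⟨0, h0⟩ h.continuousOn
  have key : ∀ t ∈ Icc 0 T, |f t - f 0| ≤ η * f r := by
    intro t ht
    have hw' : IntervalIntegrable w volume 0 t := hw.mono_set (by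
      rw [uIcc_of_le hT, uIcc_of_le ht.1]; exact Icc_subset_Icc_right ht.2)
    rw [h.sub_eq h0 ht, ← Real.norm_eq_abs]
    have h1 : ‖∫ s in (0 : ℝ)..t, f' s‖ ≤ ∫ s in (0 : ℝ)..t, w s * f r := by
      refine intervalIntegral.norm_integral_le_of_norm_le ht.1 ?_ (hw'.mul_const _)
      rw [← ae_restrict_iff' measurableSet_Ioc, ← restrict_Ioo_eq_restrict_Ioc]
      have hf' := ae_mono (Measure.restrict_mono (Ioo_subset_Ioo_right ht.2)
        (le_refl (volume : Measure ℝ))) hf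
      filter_upwards [hf', ae_restrict_mem measurableSet_Ioo] with s hs hs'
      exact hs.trans (mul_le_mul_of_nonneg_left (hmax ⟨hs'.1.le, hs'.2.le.trans ht.2⟩) (hw0 s))
    rw [intervalIntegral.integral_mul_const] at h1
    refine h1.trans (mul_le_mul_of_nonneg_right (le_trans ?_ hη) (hpos r hr))
    exact intervalIntegral.integral_mono_interval le_rfl ht.1 ht.2 (ae_of_all _ hw0) hw
  have h2 := (abs_le.1 (key r hr)).2
  have h3 := mul_le_mul_of_nonneg_right hη1 (hpos r hr)
  have h4 : 0 ≤ η := (intervalIntegral.integral_nonneg hT fun _ _ => hw0 _).trans hη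
  have h5 := mul_le_mul_of_nonneg_left (by linarith : f r ≤ 2 * f 0) h4
  linarith [key t ht]

theorem HasInitialData.fluid_zero {N : ℕ} {c0 R0 : ℕ → ℝ} {ρ0 u0 : ℝ → ℝ} {z : Flow}
    (hI : HasInitialData N c0 R0 ρ0 u0 z) : z.fluid N 0 = fluidDomain N c0 R0 := by
  unfold Flow.fluid fluidDomain
  congr 1
  refine iUnion_congr fun k => iUnion_congr fun hk => ?_
  beta_reduce
  rw [hI.c_init k hk, hI.R_init k hk]

theorem HasInitialData.gap_zero {N : ℕ} {c0 R0 : ℕ → ℝ} {ρ0 u0 : ℝ → ℝ} {z : Flow}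
    (hI : HasInitialData N c0 R0 ρ0 u0 z) {k : ℕ} (hk : k ≤ N) :
    z.gap N k 0 = gap N c0 R0 k := by
  unfold Flow.gap gap xMinus xPlus
  congr 1
  · split_ifs with h
    · rfl
    · have : k + 1 ∈ Finset.Icc 1 N := Finset.mem_Icc.2 ⟨by omega, by omega⟩
      beta_reduce
      rw [hI.c_init _ this, hI.R_init _ this]
  · split_ifs with h
    · rfl
    · have : k ∈ Finset.Icc 1 N := Finset.mem_Icc.2 ⟨by omega, hk⟩
      beta_reduce
      rw [hI.c_init _ this, hI.R_init _ this]

/-! ### The initial energy, and density bounds at every time. -/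

namespace IsClassicalSolution

variable {P : Params} {N : ℕ} {m κ : ℕ → ℝ} {T : ℝ} {z : Flow}

/-- Initially 2R_k' is the increment of u⁰ over the bubble. By Cauchy–Schwarz R_k'²/R_k is at most
half the integral of |∂ₓu⁰|² over B_k. Gaps and bubbles together tile Ω, so the bound does not see
N. -/
theorem h1Energy_zero_le (S : IsClassicalSolution P N m κ T z) (hT : 0 ≤ T) {c0 R0 : ℕ → ℝ}
    {ρ0 u0 : ℝ → ℝ} (hI : HasInitialData N c0 R0 ρ0 u0 z) (hu : MemH1 (-1) 1 u0) {A : ℝ≥0}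
    (hA : h1Norm (-1) 1 u0 ≤ A) : h1Energy P N z 0 ≤ (P.muF / 2 + P.muG) * (A : ℝ) ^ 2 := by
  obtain ⟨v, hv⟩ := hu
  have h0 : (0 : ℝ) ∈ Icc 0 T := ⟨le_rfl, hT⟩
  have hF := P.muF_pos
  have hG := P.muG_pos
  have C := S.chain h0
  have hvA : ∫ x in (-1 : ℝ)..1, v x ^ 2 ≤ (A : ℝ) ^ 2 := by
    have h1 : ENNReal.ofReal ((∫ x in (-1 : ℝ)..1, u0 x ^ 2) + ∫ x in (-1 : ℝ)..1, v x ^ 2) ≤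
        ENNReal.ofReal ((A : ℝ) ^ 2) := by
      rw [← hv.h1Norm_sq_eq (by norm_num), ENNReal.ofReal_pow A.coe_nonneg, ENNReal.ofReal_coe_nnreal]
      gcongr
    have h2 := (ENNReal.ofReal_le_ofReal_iff (by positivity)).1 h1
    have h3 : 0 ≤ ∫ x in (-1 : ℝ)..1, u0 x ^ 2 :=
      intervalIntegral.integral_nonneg (by norm_num) fun _ _ => sq_nonneg _
    linarith
  have hsub : ∀ {a b : ℝ}, Icc a b ⊆ Icc (-1) 1 → a ≤ b → HasH1Deriv a b u0 v := fun h hab =>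
    hv.mono (h (left_mem_Icc.2 hab)) (h (right_mem_Icc.2 hab))
  have hgap : ∀ k ≤ N, HasH1Deriv (z.xp k 0) (z.xm N (k + 1) 0) u0 v := fun k hk =>
    hsub (C.gap_subset hk) (C.gap_pos k hk).le
  have hbub : ∀ k ∈ Finset.Icc 1 N, HasH1Deriv (z.xm N k 0) (z.xp k 0) u0 v := fun k hk =>
    hsub (C.bubble_subset hk) (C.bubble_pos k hk).le
  have e1 : ∀ k ∈ Finset.range (N + 1), ∫ x in (z.xp k 0)..(z.xm N (k + 1) 0), z.u_x 0 x ^ 2 =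
      ∫ x in (z.xp k 0)..(z.xm N (k + 1) 0), v x ^ 2 := by
    intro k hk
    have hk' : k ≤ N := Nat.lt_succ_iff.1 (Finset.mem_range.1 hk)
    have hpq : z.xp k 0 < z.xm N (k + 1) 0 := C.gap_pos k hk'
    have c1 := S.u_h1 k hk' 0 h0
    have c2 := hgap k hk'
    -- The data fix the velocity on the open gap; continuity extends this to the end points, so the
    -- weak derivatives coincide too.
    have eq1 : EqOn (z.u 0) u0 (Icc (z.xp k 0) (z.xm N (k + 1) 0)) := by
      refine EqOn.of_subset_closure (s := Ioo (z.xp k 0) (z.xm N (k + 1) 0)) (fun x hx => ?_)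
        c1.continuousOn c2.continuousOn Ioo_subset_Icc_self (closure_Ioo hpq.ne).ge
      exact hI.u_init x (hI.fluid_zero ▸ S.gap_subset_fluid h0 hk' hx)
    have ae1 := c1.ae_eq (c2.congr eq1 (ae_of_all _ fun _ => rfl))
    refine intervalIntegral.integral_congr_ae_restrict ?_
    rw [uIoc_of_le hpq.le, ← restrict_Ioo_eq_restrict_Ioc]
    filter_upwards [ae1] with x hx
    rw [hx]
  have e2 : ∀ k ∈ Finset.Icc 1 N, z.dR k 0 ^ 2 / z.R k 0 ≤
      ∫ x in (z.xm N k 0)..(z.xp k 0), v x ^ 2 := by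
    intro k hk
    have hk' := Finset.mem_Icc.1 hk
    have hR := S.R_pos k hk 0 h0
    have hb := (hbub k hk).sq_sub_le (C.bubble_pos k hk).le
    have hn : 0 ≤ ∫ x in (z.xm N k 0)..(z.xp k 0), v x ^ 2 :=
      intervalIntegral.integral_nonneg (C.bubble_pos k hk).le fun _ _ => sq_nonneg _
    have x1 : z.xp k 0 = c0 k + R0 k := by
      rw [z.xp_eq (by omega), hI.c_init k hk, hI.R_init k hk]
    have x2 : z.xm N k 0 = c0 k - R0 k := by
      rw [z.xm_eq (by omega), hI.c_init k hk, hI.R_init k hk]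
    have x3 : z.xp k 0 - z.xm N k 0 = 2 * z.R k 0 := by
      rw [z.xp_eq (by omega), z.xm_eq (by omega)]; ring
    rw [x3] at hb
    rw [div_le_iff₀ hR, hI.dR_init k hk, ← x1, ← x2]
    have := mul_nonneg hn hR.le
    linarith
  have hs := (C.integral_eq_sum (f := fun x => v x ^ 2)
    (fun k hk => (hgap k hk).sq_intervalIntegrable (C.gap_pos k hk).le)
    (fun k hk => (hbub k hk).sq_intervalIntegrable (C.bubble_pos k hk).le)).2
  have p1 : 0 ≤ ∑ k ∈ Finset.range (N + 1), ∫ x in (z.xp k 0)..(z.xm N (k + 1) 0), v x ^ 2 :=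
    Finset.sum_nonneg fun k hk =>
      S.gap_energy_nonneg h0 (Nat.lt_succ_iff.1 (Finset.mem_range.1 hk)) _
  have p2 : 0 ≤ ∑ k ∈ Finset.Icc 1 N, ∫ x in (z.xm N k 0)..(z.xp k 0), v x ^ 2 :=
    Finset.sum_nonneg fun k hk =>
      intervalIntegral.integral_nonneg (C.bubble_pos k hk).le fun _ _ => sq_nonneg _
  rw [S.h1Energy_eq h0, Finset.sum_congr rfl e1]
  have h3 := mul_le_mul_of_nonneg_left (Finset.sum_le_sum e2) hG.le
  have h4 := mul_le_mul_of_nonneg_left (hs ▸ hvA) (by positivity : 0 ≤ P.muF / 2 + P.muG)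
  have h5 := mul_nonneg hF.le p2
  have h6 := mul_nonneg hG.le p1
  linarith

/-- Bounds of the density at almost all times hold at all times. -/
theorem rho_bounds_all (S : IsClassicalSolution P N m κ T z) (hT : 0 < T) {lo hi : ℝ}
    (h : ∀ᵐ s ∂(volume.restrict (Ioo 0 T)), ∀ᵐ x ∂(volume.restrict (z.fluid N s)),
      lo ≤ z.rho s x ∧ z.rho s x ≤ hi) {t : ℝ} (ht : t ∈ Icc 0 T) :
    ∀ᵐ x ∂(volume.restrict (z.fluid N t)), lo ≤ z.rho t x ∧ z.rho t x ≤ hi := by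
  -- The amount by which the bounds fail at time t. At a nearby good time s it is at most |ρ(s) -
  -- ρ(t)|, whose L² norm tends to 0.
  set v : ℝ → ℝ := fun x => max (max (lo - z.rho t x) (z.rho t x - hi)) 0 with hv
  have hv0 : ∀ x, v x = 0 → lo ≤ z.rho t x ∧ z.rho t x ≤ hi := by
    intro x hx
    have h1 : max (lo - z.rho t x) (z.rho t x - hi) ≤ 0 := (le_max_left _ _).trans hx.le
    have h2 := max_le_iff.1 h1
    constructor <;> linarith
  -- The densities are comparable only where both fluid domains overlap. A fixed interval strictly
  -- inside the gap stays in the fluid at nearby times, and rational end points exhaust the gap.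
  have hloc : ∀ k ≤ N, ∀ r₁ r₂ : ℝ, z.xp k t < r₁ → r₂ < z.xm N (k + 1) t →
      ∀ᵐ x ∂(volume.restrict (Ioo r₁ r₂)), lo ≤ z.rho t x ∧ z.rho t x ≤ hi := by
    intro k hk r₁ r₂ h1 h2
    have c1 := (S.xp_h1 hk).1.continuousOn t ht
    have c2 := (S.xm_h1 (k := k + 1) (by omega) (by omega)).1.continuousOn t ht
    have hQt : Ioo r₁ r₂ ⊆ z.fluid N t :=
      (Ioo_subset_Ioo h1.le h2.le).trans (S.gap_subset_fluid ht hk)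
    have hm : AEStronglyMeasurable v (volume.restrict (Ioo r₁ r₂)) := by
      have h3 := (S.rho_slice_L2 t ht).1.mono_measure (Measure.restrict_mono hQt le_rfl)
      exact ((aestronglyMeasurable_const.sub h3).sup (h3.sub aestronglyMeasurable_const)).sup
        aestronglyMeasurable_const
    have hz : eLpNorm v 2 (volume.restrict (Ioo r₁ r₂)) = 0 := by
      refine le_antisymm (le_of_forall_pos_le_add fun ε hε => ?_) zero_le
      rw [zero_add]
      have ev := (S.rho_cont t ht).eventually_le_const hε
      obtain ⟨s, ⟨hs, hs'⟩, ⟨e1, e2⟩, e3⟩ := ((frequently_of_ae hT ht h).and_eventually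
        (((c1.eventually_lt_const h1).and (c2.eventually_const_lt h2)).and ev)).exists
      have hQs : Ioo r₁ r₂ ⊆ z.fluid N s :=
        (Ioo_subset_Ioo e1.le e2.le).trans (S.gap_subset_fluid (Ioo_subset_Icc_self hs') hk)
      refine le_trans ?_ e3
      refine le_trans (eLpNorm_mono_ae ?_) (eLpNorm_mono_measure _
        (Measure.restrict_mono (subset_inter hQs hQt) le_rfl))
      filter_upwards [ae_mono (Measure.restrict_mono hQs le_rfl) hs] with x hx
      rw [Real.norm_of_nonneg (le_max_right _ _), Real.norm_eq_abs]
      refine max_le (max_le ?_ ?_) (abs_nonneg _)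
      · exact (by linarith : lo - z.rho t x ≤ z.rho s x - z.rho t x).trans (le_abs_self _)
      · exact (by linarith : z.rho t x - hi ≤ -(z.rho s x - z.rho t x)).trans (neg_le_abs _)
    filter_upwards [(eLpNorm_eq_zero_iff hm two_ne_zero).1 hz] with x hx
    exact hv0 x hx
  rw [S.fluid_eq ht]
  refine (ae_restrict_biUnion_finset_iff _ _ _).2 fun k hk => ?_
  have hk' : k ≤ N := Nat.lt_succ_iff.1 (Finset.mem_range.1 hk)
  have hall : ∀ᵐ x : ℝ, ∀ q : ℚ × ℚ, z.xp k t < q.1 → (q.2 : ℝ) < z.xm N (k + 1) t →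
      x ∈ Ioo (q.1 : ℝ) q.2 → lo ≤ z.rho t x ∧ z.rho t x ≤ hi := by
    rw [ae_all_iff]
    intro q
    by_cases h1 : z.xp k t < q.1
    · by_cases h2 : (q.2 : ℝ) < z.xm N (k + 1) t
      · filter_upwards [(ae_restrict_iff' measurableSet_Ioo).1 (hloc k hk' q.1 q.2 h1 h2)]
          with x hx _ _ using hx
      · exact ae_of_all _ fun x _ h => absurd h h2
    · exact ae_of_all _ fun x h => absurd h h1
  rw [ae_restrict_iff' measurableSet_Ioo]
  filter_upwards [hall] with x hx hx'
  obtain ⟨q1, a1, b1⟩ := exists_rat_btwn hx'.1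
  obtain ⟨q2, a2, b2⟩ := exists_rat_btwn hx'.2
  exact hx (q1, q2) a1 b2 ⟨b1, a2⟩

end IsClassicalSolution

/-! ### Improved bounds at every time. -/

namespace BoundedFlow

variable {P : Params} {N : ℕ} {m κ : ℕ → ℝ} {M d ρlo ρhi K T : ℝ} {z : Flow}

/-- The gap energies are lower semicontinuous and the bubble energies continuous, so a bound at
almost every time survives in the limit. -/
theorem h1Energy_le_of_ae (H : BoundedFlow P N m κ M d ρlo ρhi K T z) {b : ℝ}
    (h : ∀ᵐ t ∂(volume.restrict (Ioo 0 T)), h1Energy P N z t ≤ b) {t : ℝ} (ht : t ∈ Icc 0 T) :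
    h1Energy P N z t ≤ b := by
  refine le_of_forall_pos_le_add fun η hη => ?_
  have hF := P.muF_pos
  -- The N + 1 gaps lose η₁ each, with weight μ_f/2, in total η/2. The dependence on N is harmless
  -- as η is arbitrary.
  set η₁ := η / (P.muF * (N + 1)) with hη₁
  have hη₁0 : 0 < η₁ := by positivity
  have e1 : ∀ᶠ s in 𝓝[Icc 0 T] t, ∀ k ∈ Finset.range (N + 1),
      ∫ x in (z.xp k t)..(z.xm N (k + 1) t), z.u_x t x ^ 2 ≤
        (∫ x in (z.xp k s)..(z.xm N (k + 1) s), z.u_x s x ^ 2) + η₁ := by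
    refine (eventually_all_finset _).2 fun k hk => ?_
    have := (H.gapFlow (Nat.lt_succ_iff.1 (Finset.mem_range.1 hk))).lsc ht hη₁0
    simpa only [Flow.xp_add_gap] using this
  have hc : ContinuousOn (fun s => P.muG * ∑ k ∈ Finset.Icc 1 N, z.dR k s ^ 2 / z.R k s)
      (Icc 0 T) := continuousOn_const.mul (continuousOn_finsetSum _ fun k hk =>
        ((H.sol.dR_h1 k hk).continuousOn.pow 2).div (H.sol.R_h1 k hk).continuousOn
          fun s hs => (H.sol.R_pos k hk s hs).ne')
  have e2 := (hc t ht).eventually_const_lt (sub_lt_self _ (half_pos hη))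
  obtain ⟨s, ⟨hs, hs'⟩, h1, h2⟩ :=
    ((frequently_of_ae H.T_pos ht h).and_eventually (e1.and e2)).exists
  have h3 := Finset.sum_le_sum h1
  rw [Finset.sum_add_distrib, Finset.sum_const, Finset.card_range, nsmul_eq_mul] at h3
  have h4 : P.muF / 2 * (((N + 1 : ℕ) : ℝ) * η₁) = η / 2 := by
    rw [hη₁]; push_cast; field_simp
  rw [H.sol.h1Energy_eq (Ioo_subset_Icc_self hs')] at hs
  rw [H.sol.h1Energy_eq ht]
  have h5 := mul_le_mul_of_nonneg_left h3 (half_pos hF).le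
  rw [mul_add, h4] at h5
  linarith

theorem integral_dissipation_le_of_ae (H : BoundedFlow P N m κ M d ρlo ρhi K T z) {b : ℝ}
    (h : ∀ᵐ t ∂(volume.restrict (Ioo 0 T)), ∫ s in (0 : ℝ)..t, dissipation P N m z s ≤ b) :
    ∫ s in (0 : ℝ)..T, dissipation P N m z s ≤ b := by
  have hT := H.T_pos
  have hc : ContinuousOn (fun t => ∫ s in (0 : ℝ)..t, dissipation P N m z s) (Icc 0 T) := by
    have := intervalIntegral.continuousOn_primitive_interval'
      H.dissipation_intervalIntegrable (left_mem_uIcc)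
    rwa [uIcc_of_le hT.le] at this
  have hmem : T ∈ Icc 0 T := ⟨hT.le, le_rfl⟩
  exact le_of_tendsto_of_frequently (hc T hmem)
    ((frequently_of_ae hT hmem h).mono fun s hs => hs.1)

/-- The constant K hidden in `stressBound` comes with a factor T, while the dissipation is bounded
independently of K later. -/
theorem stressIntegral_le (H : BoundedFlow P N m κ M d ρlo ρhi K T z) {t : ℝ}
    (ht : t ∈ Icc 0 T) : stressIntegral P N m κ z t ≤
      ENNReal.ofReal (stressConst M d * (1 + stressBound P ρhi K) * T +
        (stressConst M d + 1) * ∫ s in (0 : ℝ)..T, dissipation P N m z s) := by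
  have hT := H.T_pos
  have hC := stressConst_pos H.M_pos H.d_pos
  have hE := H.stressBound_nonneg
  have hD := H.dissipation_intervalIntegrable
  have e : stressConst M d * (1 + stressBound P ρhi K) * T +
      (stressConst M d + 1) * (∫ s in (0 : ℝ)..T, dissipation P N m z s) =
      ∫ s in (0 : ℝ)..T, (stressConst M d * (1 + stressBound P ρhi K) +
        (stressConst M d + 1) * dissipation P N m z s) := by
    rw [intervalIntegral.integral_add (by simp) (hD.const_mul _),
      intervalIntegral.integral_const_mul (stressConst M d + 1), intervalIntegral.integral_const,
      smul_eq_mul]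
    ring
  rw [e, intervalIntegral.integral_of_le hT.le, integral_Ioc_eq_integral_Ioo,
    ofReal_integral_eq_lintegral_ofReal]
  · refine (lintegral_mono_set (Ioo_subset_Ioo_right ht.2)).trans (lintegral_mono_ae ?_)
    filter_upwards [H.profile, H.sigF_sq_le, ae_restrict_mem measurableSet_Ioo] with s h hs hs'
    have hDs := H.dissipation_nonneg (Ioo_subset_Icc_self hs')
    have h1 := h.norms_le hs
    rw [← sigFExt_eq fun k hk => H.sol.R_pos k hk s (Ioo_subset_Icc_self hs'),
      ← sigGExt_eq] at h1
    have e2 : stressConst M d * (1 + stressBound P ρhi K) +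
        (stressConst M d + 1) * dissipation P N m z s =
        stressConst M d * (1 + stressBound P ρhi K + dissipation P N m z s) +
          dissipation P N m z s := by ring
    rw [e2, ENNReal.ofReal_add (by positivity) hDs]
    refine add_le_add h1 (ENNReal.ofReal_le_ofReal ?_)
    exact le_add_of_nonneg_left (h.sum_gap_nonneg _)
  · exact (intervalIntegrable_iff_integrableOn_Ioo_of_le hT.le).1
      (IntervalIntegrable.add (by simp) (hD.const_mul _))
  · filter_upwards [ae_restrict_mem measurableSet_Ioo] with s hs
    have hDs := H.dissipation_nonneg (Ioo_subset_Icc_self hs)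
    simp only [Pi.zero_apply]
    positivity

theorem rho_bounds (H : BoundedFlow P N m κ M d ρlo ρhi K T z) {lo hi η : ℝ}
    (hη : ∫ s in (0 : ℝ)..T, rate P M d ρhi K (dissipation P N m z s) ≤ η) (hη1 : η < 1 / 2)
    (h0 : ∀ x ∈ z.fluid N 0, lo ≤ z.rho 0 x ∧ z.rho 0 x ≤ hi) {t : ℝ} (ht : t ∈ Icc 0 T) :
    ∀ᵐ x ∂(volume.restrict (z.fluid N t)),
      lo - ρhi * η ≤ z.rho t x ∧ z.rho t x ≤ hi + ρhi * η := by
  have hT := H.T_pos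
  have hz : (0 : ℝ) ∈ Icc 0 T := ⟨le_rfl, hT.le⟩
  refine H.sol.rho_bounds_all hT ?_ ht
  have key : ∀ k ∈ Finset.range (N + 1), ∀ᵐ t ∂(volume.restrict (Ioo 0 T)),
      ∀ᵐ x ∂(volume.restrict (Ioo (z.xp k t) (z.xm N (k + 1) t))),
        lo - ρhi * η ≤ z.rho t x ∧ z.rho t x ≤ hi + ρhi * η := by
    intro k hk
    have hk' : k ≤ N := Nat.lt_succ_iff.1 (Finset.mem_range.1 hk)
    have hlim : Tendsto (fun t => eLpNorm (fun x => z.rho t x - z.rho 0 x) 2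
        (volume.restrict (Ioo (z.xp k t) (z.xm N (k + 1) t) ∩
          Ioo (z.xp k 0) (z.xm N (k + 1) 0)))) (𝓝[Icc 0 T] 0) (𝓝 0) := by
      -- Continuity in L² of the whole fluid domain restricts to a single gap.
      refine tendsto_of_tendsto_of_tendsto_of_le_of_le' tendsto_const_nhds (H.sol.rho_cont 0 hz)
        (Eventually.of_forall fun _ => zero_le) ?_
      filter_upwards [self_mem_nhdsWithin] with t ht
      exact eLpNorm_mono_measure _ (Measure.restrict_mono (inter_subset_inter
        (H.sol.gap_subset_fluid ht hk') (H.sol.gap_subset_fluid hz hk')) le_rfl)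
    have := (H.gapFlow hk').rho_bounds H.rate_memLp (fun _ => H.rate_nonneg _) (by linarith)
      (by
        simp only [Flow.xp_add_gap]
        filter_upwards [H.rates_le] with t ht
        exact ht.1 k hk') (lo := lo) (hi := hi) (by simpa only [Flow.xp_add_gap] using hlim)
      (by
        simp only [Flow.xp_add_gap]
        exact fun x hx => h0 x (H.sol.gap_subset_fluid hz hk' hx))
    simp only [Flow.xp_add_gap] at this
    have h2 := mul_le_mul_of_nonneg_left hη H.hi_pos.le
    filter_upwards [this] with t ht
    filter_upwards [ht] with x hx
    constructor <;> linarith [hx.1, hx.2]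
  filter_upwards [(eventually_all_finset _).2 key, ae_restrict_mem measurableSet_Ioo] with t h1 h2
  rw [H.sol.fluid_eq (Ioo_subset_Icc_self h2)]
  exact (ae_restrict_biUnion_finset_iff _ _ _).2 h1

theorem R_close (H : BoundedFlow P N m κ M d ρlo ρhi K T z) {η : ℝ}
    (hη : ∫ s in (0 : ℝ)..T, rate P M d ρhi K (dissipation P N m z s) ≤ η) (hη1 : η ≤ 1 / 2)
    {t : ℝ} (ht : t ∈ Icc 0 T) {k : ℕ} (hk : k ∈ Finset.Icc 1 N) :
    |z.R k t - z.R k 0| ≤ 2 * η * z.R k 0 :=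
  (H.sol.R_h1 k hk).abs_sub_le_of_rate H.T_pos.le H.rate_intervalIntegrable
    (fun _ => H.rate_nonneg _) (by filter_upwards [H.rates_le] with s hs using hs.2 k hk) hη hη1
    (fun s hs => (H.sol.R_pos k hk s hs).le) ht

/-- The relative rate of change of a gap is a mean of ∂ₓu over it. Thus F_0, whose length is not
among the assumed bounds, is controlled like the others. -/
theorem gap_close (H : BoundedFlow P N m κ M d ρlo ρhi K T z) {η : ℝ}
    (hη : ∫ s in (0 : ℝ)..T, rate P M d ρhi K (dissipation P N m z s) ≤ η) (hη1 : η ≤ 1 / 2)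
    {t : ℝ} (ht : t ∈ Icc 0 T) {k : ℕ} (hk : k ≤ N) :
    |z.gap N k t - z.gap N k 0| ≤ 2 * η * z.gap N k 0 := by
  refine (H.gapFlow hk).length.abs_sub_le_of_rate H.T_pos.le H.rate_intervalIntegrable
    (fun _ => H.rate_nonneg _) ?_ hη hη1 (fun s hs => (H.sol.gap_pos k hk s hs).le) ht
  filter_upwards [H.rates_le, ae_restrict_mem measurableSet_Ioo] with s hs hs'
  have hs'' := Ioo_subset_Icc_self hs'
  have hpq := (H.sol.chain hs'').gap_pos k hk
  rw [Flow.xp_add_gap, (H.sol.u_h1 k hk s hs'').sub_eq (left_mem_Icc.2 hpq.le)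
    (right_mem_Icc.2 hpq.le), ← Real.norm_eq_abs]
  have h1 := intervalIntegral.norm_integral_le_of_norm_le hpq.le (f := z.u_x s)
    (g := fun _ => rate P M d ρhi K (dissipation P N m z s)) (μ := volume) ?_ (by simp)
  · rw [intervalIntegral.integral_const, smul_eq_mul] at h1
    rw [Flow.gap_eq, mul_comm]
    exact h1
  · rw [← ae_restrict_iff' measurableSet_Ioc, ← restrict_Ioo_eq_restrict_Ioc]
    exact hs.1 k hk

end BoundedFlow

/-- The bound of the energy and of the dissipation, independent of the number of bubbles. -/
def energyConst (P : Params) (M d ρhi A : ℝ) : ℝ :=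
  3 / 2 * ((P.muF / 2 + P.muG) * A ^ 2) + baseConst P M d ρhi + 1

/-- The threshold for the constant of the bounds. -/
def threshold (P : Params) (M d ρhi A : ℝ) : ℝ :=
  2 * energyConst P M d ρhi A + 2 * stressConst M d +
    (stressConst M d + 1) * (energyConst P M d ρhi A / dissConst ρhi)

/-! ### Signs of the constants and closing of the bootstrap. -/

theorem dissConst_pos {ρhi : ℝ} (h : 0 < ρhi) : 0 < dissConst ρhi :=
  lt_min (by positivity) (by norm_num)

theorem energyConst_pos (P : Params) {M d ρhi : ℝ} (hM : 0 < M) (hd : 0 < d) (A : ℝ) :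
    0 < energyConst P M d ρhi A := by
  have := P.muF_pos
  have := P.muG_pos
  unfold energyConst baseConst
  positivity

theorem threshold_pos (P : Params) {M d ρhi : ℝ} (hM : 0 < M) (hd : 0 < d) (hρ : 0 < ρhi) (A : ℝ) :
    0 < threshold P M d ρhi A := by
  have := energyConst_pos P (ρhi := ρhi) hM hd A
  have := stressConst_pos hM hd
  have := dissConst_pos hρ
  unfold threshold
  positivity

theorem rateBound_nonneg (P : Params) {M d ρhi K : ℝ} (hM : 0 < M) (hd : 0 < d) (hρ : 0 < ρhi)
    (hK : 0 < K) : 0 ≤ rateBound P M d ρhi K := by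
  have := P.muF_pos
  have := P.muG_pos
  have := P.pF_nonneg hρ.le
  unfold rateBound stressBound
  positivity

theorem growthConst_nonneg (P : Params) {M d ρhi : ℝ} (hM : 0 < M) (hd : 0 < d) (hρ : 0 < ρhi) :
    0 ≤ growthConst P M d ρhi := by
  have := P.muF_pos
  have := P.muG_pos
  have := P.pF_nonneg hρ.le
  have : 0 < P.gamF := zero_lt_one.trans P.one_lt_gamF
  unfold growthConst
  positivity

/-- A relative change of at most 1/4 cannot use up the factor 2 by which the data are better than
the bounds. -/
theorem scaled_bounds {n d η x₀ x : ℝ} (hn : 0 < n) (hd : 0 < d) (hη : η ≤ 1 / 8)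
    (h1 : 2 * d ≤ n * x₀) (h2 : n * x₀ ≤ (2 * d)⁻¹) (hx : |x - x₀| ≤ 2 * η * x₀) :
    d < n * x ∧ n * x < d⁻¹ := by
  have hx0 : 0 < x₀ := pos_of_mul_pos_right (by linarith) hn.le
  have h3 : 2 * η * x₀ ≤ 1 / 4 * x₀ := mul_le_mul_of_nonneg_right (by linarith) hx0.le
  obtain ⟨h4, h5⟩ := abs_le.1 hx
  have h6 := mul_le_mul_of_nonneg_left (by linarith : 3 / 4 * x₀ ≤ x) hn.le
  have h7 := mul_le_mul_of_nonneg_left (by linarith : x ≤ 5 / 4 * x₀) hn.le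
  have h8 : (2 * d)⁻¹ = d⁻¹ / 2 := by rw [mul_inv]; ring
  have h9 : 0 < d⁻¹ := inv_pos.2 hd
  constructor <;> linarith

/-- Without bubbles the scaled gap N|F_0| is 0, against its positive lower bound. -/
theorem IsAdmissibleData.one_le {M d ρlo ρhi : ℝ} {N : ℕ} {m κ c0 R0 : ℕ → ℝ} {ρ0 u0 : ℝ → ℝ}
    (h : IsAdmissibleData M d ρlo ρhi N m κ c0 R0 ρ0 u0) (hd : 0 < d) : 1 ≤ N := by
  by_contra hN
  have h0 : N = 0 := by omega
  have := (h.gap_scaling 0 (Nat.zero_le N)).1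
  rw [h0, Nat.cast_zero, zero_mul] at this
  linarith

/-- For short times the bounds improve. -/
theorem BoundedFlow.strictBounds {P : Params} {N : ℕ} {m κ c0 R0 : ℕ → ℝ} {ρ0 u0 : ℝ → ℝ}
    {M d ρlo ρhi K T : ℝ} {z : Flow} (H : BoundedFlow P N m κ M d ρlo ρhi K T z)
    (hD : IsAdmissibleData M d ρlo ρhi N m κ c0 R0 ρ0 u0) (hI : HasInitialData N c0 R0 ρ0 u0 z)
    {A : ℝ≥0} (hA : h1Norm (-1) 1 u0 ≤ A) (hK : threshold P M d ρhi A < K) (hT1 : T ≤ 1) {η : ℝ}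
    (hη : √T * rateBound P M d ρhi K ≤ η) (hη1 : η ≤ 1 / 8) (hη2 : ρhi * η ≤ ρlo / 2)
    (hη3 : K * (2 * η + growthConst P M d ρhi * T) ≤ 1) (hT2 : stressBound P ρhi K * T ≤ 1) :
    StrictBounds P N m κ d ρlo ρhi K (Icc 0 T) z := by
  have hT := H.T_pos
  have hM := H.M_pos
  have hd := H.d_pos
  have hhi := H.hi_pos
  have hlo := H.lo_pos
  have hN := H.N_pos
  have hz : (0 : ℝ) ∈ Icc 0 T := ⟨le_rfl, hT.le⟩
  have hw := (H.integral_rate_le hT1).trans hη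
  have hc := dissConst_pos hhi
  have hC := stressConst_pos hM hd
  have hEc := energyConst_pos P (ρhi := ρhi) hM hd A
  have hE : ∀ᵐ t ∂(volume.restrict (Ioo 0 T)), h1Energy P N z t / 2 +
      dissConst ρhi * (∫ s in (0 : ℝ)..t, dissipation P N m z s) ≤ energyConst P M d ρhi A := by
    filter_upwards [H.energy_le] with t ht
    have h1 := H.sol.h1Energy_zero_le hT.le hI hD.u_h1 hA
    have h2 : K * (2 * (∫ s in (0 : ℝ)..T, rate P M d ρhi K (dissipation P N m z s)) +
        growthConst P M d ρhi * T) ≤ 1 :=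
      (mul_le_mul_of_nonneg_left (by linarith) H.K_nonneg).trans hη3
    rw [energyConst]
    linarith
  have hE1 : ∀ᵐ t ∂(volume.restrict (Ioo 0 T)),
      h1Energy P N z t ≤ 2 * energyConst P M d ρhi A := by
    filter_upwards [hE, ae_restrict_mem measurableSet_Ioo] with t h1 ht
    have h2 := intervalIntegral.integral_nonneg (μ := volume) ht.1.le
      fun s hs => H.dissipation_nonneg ⟨hs.1, hs.2.trans ht.2.le⟩
    have h3 := mul_nonneg hc.le h2
    linarith
  have hE2 : ∫ s in (0 : ℝ)..T, dissipation P N m z s ≤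
      energyConst P M d ρhi A / dissConst ρhi := by
    refine H.integral_dissipation_le_of_ae ?_
    filter_upwards [hE, ae_restrict_mem measurableSet_Ioo] with t h1 ht
    have ht' := Ioo_subset_Icc_self ht
    have h2 : 0 ≤ h1Energy P N z t := by
      rw [H.sol.h1Energy_eq ht']
      refine add_nonneg (mul_nonneg (half_pos P.muF_pos).le (Finset.sum_nonneg fun k hk => ?_))
        (mul_nonneg P.muG_pos.le (H.sol.sum_dR_nonneg ht'))
      exact H.sol.gap_energy_nonneg ht' (Nat.lt_succ_iff.1 (Finset.mem_range.1 hk)) _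
    rw [le_div_iff₀ hc]
    linarith
  have hEd : 0 < energyConst P M d ρhi A / dissConst ρhi := by positivity
  rw [threshold] at hK
  -- The density stays above 2ρlo - ρhi η ≥ 3ρlo/2 and below ρhi/2 + ρhi/8 < 3ρhi/4, which leaves
  -- this margin.
  refine ⟨fun t ht k hk => ?_, fun t ht k hk => ?_, ⟨min (ρlo / 2) (ρhi / 4), ?_, fun t ht => ?_⟩,
    fun t ht => ?_, fun t ht => ?_⟩
  · refine scaled_bounds hN hd hη1 (hD.R_scaling k hk).1 (hD.R_scaling k hk).2 ?_
    rw [← hI.R_init k hk]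
    exact H.R_close hw (by linarith) ht hk
  · refine scaled_bounds hN hd hη1 (hD.gap_scaling k hk).1 (hD.gap_scaling k hk).2 ?_
    rw [← hI.gap_zero hk]
    exact H.gap_close hw (by linarith) ht hk
  · exact lt_min (by positivity) (by positivity)
  · have h0 : ∀ x ∈ z.fluid N 0, 2 * ρlo ≤ z.rho 0 x ∧ z.rho 0 x ≤ ρhi / 2 := by
      intro x hx
      rw [hI.fluid_zero] at hx
      rw [hI.rho_init x hx]
      exact hD.rho_bound x (Ioo_subset_Icc_self hx.1)
    have h1 := min_le_left (ρlo / 2) (ρhi / 4)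
    have h2 := min_le_right (ρlo / 2) (ρhi / 4)
    have h3 : ρhi * η ≤ ρhi * (1 / 8) := mul_le_mul_of_nonneg_left hη1 hhi.le
    filter_upwards [H.rho_bounds hw (by linarith) h0 ht] with x hx
    constructor <;> linarith [hx.1, hx.2]
  · have := H.h1Energy_le_of_ae hE1 ht
    have : 0 < (stressConst M d + 1) * (energyConst P M d ρhi A / dissConst ρhi) := by positivity
    linarith
  · refine (H.stressIntegral_le ht).trans_lt ?_
    have hK0 : 0 < K := lt_trans (by positivity) hK
    refine (ENNReal.ofReal_lt_ofReal_iff hK0).2 ?_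
    have h1 := mul_le_mul_of_nonneg_left hE2 (by positivity : 0 ≤ stressConst M d + 1)
    -- Here T ≤ 1 and `stressBound P ρhi K * T ≤ 1`: the K-dependent part of the stress norms is
    -- removed by the short time.
    have h2 : stressConst M d * (1 + stressBound P ρhi K) * T ≤ stressConst M d * 2 := by
      rw [mul_assoc]
      exact mul_le_mul_of_nonneg_left (by linarith) hC.le
    linarith

end BubblyFlow

end

/-! ### Choice of the threshold and of the time. -/

theorem mainTheorem5 (P : BubblyFlow.Params) (M d ρlo ρhi : ℝ) (hM : 0 < M) (hd : 0 < d)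
    (hρlo : 0 < ρlo) (hρhi : 0 < ρhi) (A B : ℝ≥0) :
    ∃ Kinf > (0 : ℝ), ∀ K > Kinf, ∃ Tinf > (0 : ℝ),
      ∀ (N : ℕ) (m κ c0 R0 : ℕ → ℝ) (ρ0 u0 : ℝ → ℝ),
        BubblyFlow.IsAdmissibleData M d ρlo ρhi N m κ c0 R0 ρ0 u0 →
        BubblyFlow.h1Norm (-1) 1 u0 ≤ A → BubblyFlow.h1Norm (-1) 1 ρ0 ≤ B →
        ∀ T : ℝ, 0 < T → T ≤ Tinf → ∀ z : BubblyFlow.Flow,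
          BubblyFlow.IsClassicalSolution P N m κ T z →
          BubblyFlow.HasInitialData N c0 R0 ρ0 u0 z →
          BubblyFlow.Bounds P N m κ d ρlo ρhi K (Ioo 0 T) z →
          BubblyFlow.StrictBounds P N m κ d ρlo ρhi K (Icc 0 T) z := by
  refine ⟨BubblyFlow.threshold P M d ρhi A, BubblyFlow.threshold_pos P hM hd hρhi A,
    fun K hK => ?_⟩
  have hK0 : 0 < K := (BubblyFlow.threshold_pos P hM hd hρhi A).trans hK
  have hr := BubblyFlow.rateBound_nonneg P hM hd hρhi hK0
  have hg := BubblyFlow.growthConst_nonneg P hM hd hρhi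
  have hs : 0 ≤ BubblyFlow.stressBound P ρhi K := by
    have := P.muF_pos
    unfold BubblyFlow.stressBound
    positivity
  set r := BubblyFlow.rateBound P M d ρhi K
  set g := BubblyFlow.growthConst P M d ρhi
  set s := BubblyFlow.stressBound P ρhi K
  -- η will bound the integral of the rate. The entries serve the lengths and the upper density
  -- bound, the lower density bound, and the growth term 2Kη ≤ 1/2.
  set η : ℝ := min (1 / 8) (min (ρlo / (2 * ρhi)) (1 / (4 * K))) with hη
  have hη0 : 0 < η := lt_min (by norm_num) (lt_min (by positivity) (by positivity))
  have hη1 : η ≤ 1 / 8 := min_le_left _ _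
  have hη2 : η ≤ ρlo / (2 * ρhi) := (min_le_right _ _).trans (min_le_left _ _)
  have hη3 : η ≤ 1 / (4 * K) := (min_le_right _ _).trans (min_le_right _ _)
  -- In order: T ≤ √T is available, √T · r ≤ η, the growth term K g T is at most 1/2, and the stress
  -- bound integrates to at most 1. The added ones avoid dividing by constants known only to be
  -- nonnegative.
  refine ⟨min 1 (min ((η / (r + 1)) ^ 2) (min (1 / (2 * K * (g + 1))) (1 / (s + 1)))),
    lt_min one_pos (lt_min (by positivity) (lt_min (by positivity) (by positivity))), ?_⟩
  intro N m κ c0 R0 ρ0 u0 hD hA _ T hT hTinf z hS hI hB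
  have t1 : T ≤ 1 := hTinf.trans (min_le_left _ _)
  have t2 : T ≤ (η / (r + 1)) ^ 2 := hTinf.trans ((min_le_right _ _).trans (min_le_left _ _))
  have t3 : T ≤ 1 / (2 * K * (g + 1)) :=
    hTinf.trans ((min_le_right _ _).trans ((min_le_right _ _).trans (min_le_left _ _)))
  have t4 : T ≤ 1 / (s + 1) :=
    hTinf.trans ((min_le_right _ _).trans ((min_le_right _ _).trans (min_le_right _ _)))
  have H : BubblyFlow.BoundedFlow P N m κ M d ρlo ρhi K T z :=
  { sol := hS
    bounds := hB
    T_pos := hT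
    one_le := hD.one_le hd
    M_pos := hM
    d_pos := hd
    lo_pos := hρlo
    hi_pos := hρhi
    m_scaling := hD.m_scaling
    kappa_scaling := hD.kappa_scaling }
  refine H.strictBounds hD hI hA hK t1 (η := η) ?_ hη1 ?_ ?_ ?_
  · have h1 : √T ≤ η / (r + 1) := Real.sqrt_le_iff.2 ⟨by positivity, t2⟩
    rw [le_div_iff₀ (by positivity)] at h1
    have h2 := Real.sqrt_nonneg T
    change √T * r ≤ η
    linarith
  · rw [le_div_iff₀ (by positivity)] at hη2
    linarith
  · rw [le_div_iff₀ (by positivity)] at hη3 t3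
    have h2 := mul_nonneg hK0.le hT.le
    change K * (2 * η + g * T) ≤ 1
    linarith
  · rw [le_div_iff₀ (by positivity)] at t4
    change s * T ≤ 1
    linarith
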